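/- **Setting.** Let $d\in\{1,2,3\}$, $G=\mathbb Z^d$ (written additively, identity $e=0$), let $S_+\subset G\setminus\{0\}$ be a finite generating set, $S_-=-S_+$ and $S=S_+\cup S_-\cup\{0\}$. A quantum walk with coin dimension $2$ on the Cayley graph of $G$ with respect to $S_+$ is a unitary operator on $\ell^2(G)\otimes\mathbb C^2$ of the form $A=\sum_{h\in S}T_h\otimes A_h$, where $T_h|g\rangle=|g+h\rangle$, with transition matrices $A_h\in M_2(\mathbb C)$, $A_h\ne0$ for $h\in S_+\cup S_-$ (while $A_e=0$ is allowed). It is isotropic on $S_+$ if there are a group $L$ of bijections $l$ of $G$ with $l(S_+)=S_+$ and $l(g+h)=l(g)+l(h)$ for $g\in G$, $h\in S_+$, acting transitively on the elements of $S_+$ of each given order, and a projective unitary representation $l\mapsto U_l$ of $L$ on $\mathbb C^2$, such that $A_{l(h)}=U_lA_hU_l^\dagger$ for all $l\in L$, $h\in S$, and $[U_l,A_h]\neq0$ whenever $h\in S_+$ and $l(h)\ne h$. Put $\sigma_X=\begin{pmatrix}0&1\\1&0\end{pmatrix}$, $\sigma_Z=\begin{pmatrix}1&0\\0&-1\end{pmatrix}$.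 "Up to a change of basis" means up to replacing all $A_h$ by $WA_hW^\dagger$ with one unitary $W$. **Theorem.** For each $d=1,2,3$ the (undirected) Cayley graph of a quantum walk on $\mathbb Z^d$ with coin dimension $2$ that is isotropic on $S_+$ is unique up to a group isomorphism identifying the vertices: it is the nearest-neighbour graph of the integer lattice for $d=1$, of the square lattice for $d=2$, and of the body-centred cubic (BCC) lattice for $d=3$. Moreover, a family $\{A_h\}_{h\in S}$ is the family of transition matrices of such an isotropic walk if and only if the following holds. (a) $d=1$: there is a generator $h_1$ of $\mathbb Z$ such that, up to a change of basis, $$A_{h_1}=V\begin{pmatrix}n&0\\0&0\end{pmatrix},\quad A_{-h_1}=V\begin{pmatrix}0&0\\0&n\end{pmatrix},\quad A_e=V\begin{pmatrix}0&im\\im&0\end{pmatrix},$$ with $n,m$ real, $n\neq0$, $n^2+m^2=1$, where either $S_+=\{h_1\}$ and $V$ is an arbitrary unitary, or $S_+=\{h_1,-h_1\}$ and $V$ is a unitary commuting with $\sigma_X$. (b) $d=2$: there are $h_1,h_2$ generating $\mathbb Z^2$ such that $A_e=0$ and, up to a change of basis, $$A_{h_1}=\tfrac12V\begin{pmatrix}1&0\\1&0\end{pmatrix},\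 A_{-h_1}=\tfrac12V\begin{pmatrix}0&-1\\0&1\end{pmatrix},\ A_{h_2}=\tfrac12V\begin{pmatrix}0&1\\0&1\end{pmatrix},\ A_{-h_2}=\tfrac12V\begin{pmatrix}1&0\\-1&0\end{pmatrix},$$ where either $S_+=\{h_1,h_2\}$ and $V$ is a unitary commuting with $\sigma_X$, or $S_+=\{h_1,-h_2\}$ and $V$ is a unitary commuting with $\sigma_Z$, or $S_+=\{h_1,h_2,-h_1,-h_2\}$ and $V=e^{i\theta}I$ is a phase. (c) $d=3$: $S_+=\{h_1,h_2,h_3,h_4\}$ where $h_1,\dots,h_4$ generate $\mathbb Z^3$ and satisfy $h_1+h_2+h_3+h_4=0$, $A_e=0$ and, up to a change of basis and a global phase, for one of the two choices of sign, $$A_{h_1}=\begin{pmatrix}\eta^\pm&0\\\eta^\pm&0\end{pmatrix},\ A_{-h_1}=\begin{pmatrix}0&-\eta^\mp\\0&\eta^\mp\end{pmatrix},\ A_{h_2}=\begin{pmatrix}0&\eta^\pm\\0&\eta^\pm\end{pmatrix},\ A_{-h_2}=\begin{pmatrix}\eta^\mp&0\\-\eta^\mp&0\end{pmatrix},$$ $$A_{h_3}=\begin{pmatrix}0&-\eta^\pm\\0&\eta^\pm\end{pmatrix},\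 A_{-h_3}=\begin{pmatrix}\eta^\mp&0\\\eta^\mp&0\end{pmatrix},\ A_{h_4}=\begin{pmatrix}\eta^\pm&0\\-\eta^\pm&0\end{pmatrix},\ A_{-h_4}=\begin{pmatrix}0&\eta^\mp\\0&\eta^\mp\end{pmatrix},\qquad \eta^\pm=\frac{1\pm i}4 .$$ The walks for the two signs (the two Weyl walks) are not equivalent: no change of basis, global phase and automorphism of $\mathbb Z^3$ preserving $S_+$ turn one into the other. Hence for $d=3$ there are, up to these equivalences, exactly two isotropic walks. -/

import Mathlib

open scoped Matrix BigOperators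

namespace IsoQW

/-! ### Cayley graphs of (additively written) abelian groups -/

section Walks

variable {G : Type*} [AddCommGroup G] [DecidableEq G]

/-- The neighbours `S₊ ∪ S₋` of the identity, where `S₋ = -S₊`. -/
def neighbours (Sp : Finset G) : Finset G := Sp ∪ Sp.image (fun h => -h)

/-- The full set of steps `S = S₊ ∪ S₋ ∪ {e}`. -/
def steps (Sp : Finset G) : Finset G := insert 0 (neighbours Sp)

/-- The (undirected, uncoloured) Cayley graph of `G` with respect to `S₊`. -/
def cayleyGraph (Sp : Finset G) : SimpleGraph G where
  Adj g g' := g ≠ g' ∧ (g' - g ∈ Sp ∨ g - g' ∈ Sp)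
  symm := ⟨fun _ _ h => ⟨h.1.symm, h.2.symm⟩⟩
  loopless := ⟨fun _ h => h.1 rfl⟩

/-- A bijection `l` of the vertices is an automorphism of the coloured Cayley graph acting as a
permutation of the colours: it maps `S₊` to itself and `l (g + h) = l g + l h` for all vertices `g`
and colours `h`. (In particular `l 0 = 0` if there is a colour, and the permutation of the colours
is the restriction of `l` to the finite set `S₊`.) -/
def IsColourAutomorphism (Sp : Finset G) (l : Equiv.Perm G) : Prop :=
  (∀ h ∈ Sp, l h ∈ Sp) ∧ ∀ g, ∀ h ∈ Sp, l (g + h) = l g + l h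

/-! ### Quantum walks -/

/-- The Hilbert space `ℓ²(G) ⊗ ℂˢ`, as square-summable functions `G → ℂˢ`. -/
abbrev WalkSpace (G : Type*) (s : ℕ) : Type _ :=
  lp (fun _ : G => EuclideanSpace ℂ (Fin s)) 2

/-- `A` is the family of transition matrices of a quantum walk on the Cayley graph of `G` with
respect to the finite generating set `S₊` (extended by `0` outside `S`): the operator
`∑_{h ∈ S} T_h ⊗ A_h`, where `T_h |n⟩ = |n + h⟩`, is unitary, and `A_h ≠ 0` for `h ∈ S₊ ∪ S₋`. -/
structure IsQuantumWalk {s : ℕ} (Sp : Finset G) (A : G → Matrix (Fin s) (Fin s) ℂ) : Prop where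
  generates : AddSubgroup.closure (Sp : Set G) = ⊤
  zero_notMem : (0 : G) ∉ Sp
  ne_zero : ∀ h ∈ neighbours Sp, A h ≠ 0
  eq_zero : ∀ h, h ∉ steps Sp → A h = 0
  unitary : ∃ W : WalkSpace G s ≃ₗᵢ[ℂ] WalkSpace G s, ∀ (ψ : WalkSpace G s) (n : G),
    W ψ n = ∑ h ∈ steps Sp, Matrix.toEuclideanLin (A h) (ψ (n - h))

/-- Isotropy with respect to `S₊`: there are a group `L` of automorphisms of the coloured Cayley
graph acting by permutations of the colours and a projective unitary representation `U` of `L` such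
that the walk is `L`-covariant, `L` is transitive on the generators of each given order, and
generators which are moved by `l` have transition matrices which do not commute with `U_l`. -/
def IsIsotropic {s : ℕ} (Sp : Finset G) (A : G → Matrix (Fin s) (Fin s) ℂ) : Prop :=
  ∃ (L : Subgroup (Equiv.Perm G)) (U : L → Matrix.unitaryGroup (Fin s) ℂ),
    (∀ l ∈ L, IsColourAutomorphism Sp l) ∧
    (∀ l l' : L, ∃ c : ℂ, ‖c‖ = 1 ∧
      (U (l * l') : Matrix (Fin s) (Fin s) ℂ) =
        c • ((U l : Matrix (Fin s) (Fin s) ℂ) * (U l' : Matrix (Fin s) (Fin s) ℂ))) ∧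
    (∀ l : L, ∀ h ∈ steps Sp, A ((l : Equiv.Perm G) h) =
      (U l : Matrix (Fin s) (Fin s) ℂ) * A h * (U l : Matrix (Fin s) (Fin s) ℂ)ᴴ) ∧
    (∀ h ∈ Sp, ∀ h' ∈ Sp, addOrderOf h = addOrderOf h' → ∃ l ∈ L, l h = h') ∧
    (∀ l : L, ∀ h ∈ Sp, (l : Equiv.Perm G) h ≠ h →
      ¬ Commute (U l : Matrix (Fin s) (Fin s) ℂ) (A h))

/-- A quantum walk on the Cayley graph with respect to `S₊` that is isotropic on `S₊`. -/
def IsIsotropicQW {s : ℕ} (Sp : Finset G) (A : G → Matrix (Fin s) (Fin s) ℂ) : Prop :=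
  IsQuantumWalk Sp A ∧ IsIsotropic Sp A

/-- Equivalence of two families of transition matrices on the same `S₊`: they agree up to a change
of basis of the coin, a global phase and a relabelling of `S₊` (induced by an automorphism
of the group). -/
def Equivalent {s : ℕ} (Sp : Finset G) (A B : G → Matrix (Fin s) (Fin s) ℂ) : Prop :=
  ∃ (φ : G ≃+ G) (W : Matrix.unitaryGroup (Fin s) ℂ) (c : ℂ), Sp.image φ = Sp ∧ ‖c‖ = 1 ∧
    ∀ g, B (φ g) = c • ((W : Matrix (Fin s) (Fin s) ℂ) * A g * (W : Matrix (Fin s) (Fin s) ℂ)ᴴ)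

end Walks

/-! ### The integer, square and body-centred cubic lattices -/

/-- Nearest-neighbour graph of `ℤᵈ`: the integer lattice (`d = 1`) and square lattice (`d = 2`). -/
def hypercubicGraph (d : ℕ) : SimpleGraph (Fin d → ℤ) where
  Adj x y := ∑ i, |x i - y i| = 1
  symm := ⟨fun x y h => by simpa only [abs_sub_comm] using h⟩
  loopless := ⟨fun x h => by simp at h⟩

/-- The body-centred cubic lattice (scaled by `2`): integer vectors whose coordinates are all even
or all odd. -/
def bcc : AddSubgroup (Fin 3 → ℤ) where
  carrier := {x | ∀ i j, x i ≡ x j [ZMOD 2]}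
  zero_mem' := fun _ _ => Int.ModEq.refl _
  add_mem' := fun hx hy i j => (hx i j).add (hy i j)
  neg_mem' := fun hx i j => (hx i j).neg

/-- Nearest-neighbour graph of the body-centred cubic lattice: the neighbours of `x` are the eight
points `x + (±1, ±1, ±1)`. -/
def bccGraph : SimpleGraph bcc where
  Adj x y := ∀ i, |x.1 i - y.1 i| = 1
  symm := ⟨fun x y h i => by rw [abs_sub_comm]; exact h i⟩
  loopless := ⟨fun x h => by simpa using h 0⟩

/-- Two graphs on abelian groups are identified by an isomorphism of the groups. -/
def SameLattice {G G' : Type*} [AddCommGroup G] [AddCommGroup G'] (Γ : SimpleGraph G)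
    (Γ' : SimpleGraph G') : Prop :=
  ∃ φ : G ≃+ G', ∀ g g', Γ'.Adj (φ g) (φ g') ↔ Γ.Adj g g'

/-! ### Explicit matrices -/

def pauliX : Matrix (Fin 2) (Fin 2) ℂ := !![0, 1; 1, 0]

def pauliZ : Matrix (Fin 2) (Fin 2) ℂ := !![1, 0; 0, -1]

/-- Matrices of the Weyl walks attached to `h₁, h₂, h₃, h₄`. -/
def weylPos (η : ℂ) : Fin 4 → Matrix (Fin 2) (Fin 2) ℂ :=
  ![!![η, 0; η, 0], !![0, η; 0, η], !![0, -η; 0, η], !![η, 0; -η, 0]]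

/-- Matrices of the Weyl walks attached to `-h₁, -h₂, -h₃, -h₄`. -/
def weylNeg (η : ℂ) : Fin 4 → Matrix (Fin 2) (Fin 2) ℂ :=
  ![!![0, -η; 0, η], !![η, 0; -η, 0], !![η, 0; η, 0], !![0, η; 0, η]]

noncomputable def etaPlus : ℂ := (1 + Complex.I) / 4

noncomputable def etaMinus : ℂ := (1 - Complex.I) / 4

/-- `h` labels the four elements of `S₊` on the body-centred cubic lattice. -/
def IsBccLabelling (Sp : Finset (Fin 3 → ℤ)) (h : Fin 4 → Fin 3 → ℤ) : Prop :=
  AddSubgroup.closure (Set.range h) = ⊤ ∧ h 0 + h 1 + h 2 + h 3 = 0 ∧ Sp = Finset.univ.image h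

/-- `A` has the transition matrices `weylPos η` on `h₁, …, h₄`, `weylNeg η'` on `-h₁, …, -h₄`, and
`0` elsewhere; so `(η, η') = (η⁺, η⁻)` and `(η⁻, η⁺)` are the two Weyl walks. -/
def IsWeylWalk (η η' : ℂ) (h : Fin 4 → Fin 3 → ℤ)
    (A : (Fin 3 → ℤ) → Matrix (Fin 2) (Fin 2) ℂ) : Prop :=
  (∀ i, A (h i) = weylPos η i ∧ A (-h i) = weylNeg η' i) ∧
    ∀ g, (∀ i, g ≠ h i ∧ g ≠ -h i) → A g = 0

end IsoQW

set_option linter.unusedSectionVars false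
set_option linter.unusedSimpArgs false

namespace IsoQW

/-! ### The symbol of a walk over the group algebra -/

/-! Unitarity of the walk means that the matrix `M = ∑ A_h h` over the group algebra satisfies `M† M
= 1`. Its determinant is then a unitary element of the group algebra. In a group with unique sums
such an element is a phase times a group element, and the symmetry of the set of steps makes that
element `0`. Hence `adj A_h` is a fixed phase times `(A_{-h})†`. Division by `V = ∑ A_h`, which
commutes with every `U_l`, leaves a walk with `A_{-h} = (adj A_h)†` and `∑ A_h = 1`
(`IsIsotropicQW.exists_isoWalk`). The classification concerns this normalised walk; commutation with
the `U_l` is what restricts `V` at the end.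

Colour automorphisms are group automorphisms and `L` is finite, so averaging gives an invariant
positive definite form. All generators have infinite order, hence form a single orbit, and the steps
lie on a sphere. If `p + q` is in no other way a sum of two steps, unitarity gives `tr (adj A_p A_q)
= 0`. On a sphere `h + h` is such a sum, so every `A_h` has determinant zero and rank one; and steps
`p`, `q` with a unique sum share the column space or the row space (`IsoWalk.share`). The closest
pair across any partition of the steps has a unique sum, and this propagation shows that `L` acts
freely on the steps (`IsoWalk.eq_one_of_smul_eq`). The second tool is pushing the walk forward along
a homomorphism `f` with `f ∘ l = f`, `l ≠ 1`: the new symbol commutes with the nonscalar `U_l`, is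
therefore diagonal, and splits into two scalar walks, each a single translation. This confines the
image of the steps to `{0, g, -g}` (`IsoWalk.exists_image_subset`).

The crux is that every `l` is an involution. In rank two, `l² ≠ 1` forces an angle of 60° between
`h` and `l h`, and the same for `l²`, which is absurd. In rank three `l²` has an axis, and summing
over its powers projects the steps to `0` and `±g` on this axis, so that a fibre over `g` lies on a
circle. Within a fibre two steps have a unique sum or are antipodal, and this rigidity excludes both
the case where some step projects to `0` (by comparison with a conjugate of `l`) and the case where
none does (by a trace computation giving `tr U_l = 0`). Nontrivial involutions are represented by
traceless matrices which anticommute pairwise, so `L` has at most four elements and its orbits can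
be listed.

What remains is algebra. In rank two the matrices are fixed by a common column, orthogonality and `∑
A_h = 1`. In rank three `A_h` is expanded in Pauli matrices with coefficients `s, w₁, w₂, w₃`.
Orthogonality relations, `det A_h = 0` and normalisation give `Re s = 1/8` and make each `w_j` equal
to `±s`, except for one `±i s`; such a matrix factors as `s (1 + Q)(1 + P)`, the Weyl form with `η =
2 s`. In rank one everything follows from `A_0 = 1 - A_h - A_{-h}` and one orthogonality relation.

Conversely, `M† M = 1` is checked in the group algebra and transferred to `ℓ²`, while Pauli matrices
cover enough automorphisms of the graph. The two Weyl walks are told apart by the traces at `h` and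
`-h`. -/

section Symbol

variable {G : Type*} [AddCommGroup G]

/-- The involution `∑ c_g g ↦ ∑ conj c_g (-g)` of the group algebra. -/
noncomputable def reflect (G : Type*) [AddCommGroup G] :
    AddMonoidAlgebra ℂ G →+* AddMonoidAlgebra ℂ G :=
  (AddMonoidAlgebra.mapDomainRingHom ℂ (negAddMonoidHom : G →+ G)).comp
    (AddMonoidAlgebra.mapRingHom G (starRingEnd ℂ))

theorem reflect_single (g : G) (c : ℂ) :
    reflect G (AddMonoidAlgebra.single g c) = AddMonoidAlgebra.single (-g) (star c) := by
  simp [reflect]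

theorem coeff_reflect (x : AddMonoidAlgebra ℂ G) (g : G) :
    (reflect G x).coeff g = star (x.coeff (-g)) := by
  classical
  induction x using AddMonoidAlgebra.induction_linear with
  | zero => simp
  | add x y hx hy => simp [hx, hy]
  | single h c =>
    rw [reflect_single, AddMonoidAlgebra.coeff_single, Finsupp.single_apply,
      AddMonoidAlgebra.coeff_single, Finsupp.single_apply]
    by_cases hg : -h = g
    · rw [if_pos hg, if_pos (by rw [← hg, neg_neg])]
    · rw [if_neg hg, if_neg (fun h' => hg (by rw [h', neg_neg])), star_zero]

/-- Evaluation of an element of the group algebra against a function on the group. -/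
noncomputable def pairing (φ : G → ℂ) : AddMonoidAlgebra ℂ G →+ ℂ :=
  (Finsupp.liftAddHom (fun g => (AddMonoidHom.mulLeft (φ g) : ℂ →+ ℂ))).comp
    AddMonoidAlgebra.coeffAddEquiv.toAddMonoidHom

theorem pairing_single (φ : G → ℂ) (g : G) (c : ℂ) :
    pairing φ (AddMonoidAlgebra.single g c) = φ g * c := by
  simp [pairing]

variable {n : ℕ}

/-- The algebraic form of `W† W = 1` for the convolution operator with kernel `A`. -/
def IsConvUnitary (T : Finset G) (A : G → Matrix (Fin n) (Fin n) ℂ) : Prop :=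
  ∀ φ : G → ℂ, ∑ h ∈ T, ∑ h' ∈ T, φ (h' - h) • ((A h)ᴴ * A h') = φ 0 • 1

/-- The matrix over the group algebra whose coefficient at `h` is `A h`. -/
noncomputable def symbol (T : Finset G) (A : G → Matrix (Fin n) (Fin n) ℂ) :
    Matrix (Fin n) (Fin n) (AddMonoidAlgebra ℂ G) :=
  Matrix.of fun i j => ∑ h ∈ T, AddMonoidAlgebra.single h (A h i j)

/-- The adjoint of a matrix over the group algebra. -/
noncomputable def symbolAdj (M : Matrix (Fin n) (Fin n) (AddMonoidAlgebra ℂ G)) :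
    Matrix (Fin n) (Fin n) (AddMonoidAlgebra ℂ G) :=
  (M.map (reflect G))ᵀ

theorem symbolAdj_mul_symbol_apply (T : Finset G) (A : G → Matrix (Fin n) (Fin n) ℂ)
    (i j : Fin n) :
    (symbolAdj (symbol T A) * symbol T A) i j =
      ∑ h ∈ T, ∑ h' ∈ T, AddMonoidAlgebra.single (h' - h) (((A h)ᴴ * A h') i j) := by
  simp only [Matrix.mul_apply, symbolAdj, symbol, Matrix.transpose_apply, Matrix.map_apply,
    Matrix.of_apply, map_sum, reflect_single, Finset.sum_mul_sum, AddMonoidAlgebra.single_mul_single,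
    Matrix.conjTranspose_apply]
  rw [Finset.sum_comm]
  refine Finset.sum_congr rfl fun h _ => ?_
  rw [Finset.sum_comm]
  refine Finset.sum_congr rfl fun h' _ => ?_
  rw [neg_add_eq_sub]
  exact (map_sum (AddMonoidAlgebra.singleAddHom (h' - h)) _ _).symm

/-- The test function `φ` stands for an arbitrary linear functional on the group algebra: indicator
functions read off the coefficients of the product, and conversely pairing with `φ` recovers the
tested identity. -/
theorem isConvUnitary_iff (T : Finset G) (A : G → Matrix (Fin n) (Fin n) ℂ) :
    IsConvUnitary T A ↔ symbolAdj (symbol T A) * symbol T A = 1 := by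
  classical
  constructor
  · intro H
    ext i j g
    have := congrFun (congrFun (H (fun x => if x = g then 1 else 0)) i) j
    rw [symbolAdj_mul_symbol_apply]
    simp only [Matrix.sum_apply, Matrix.smul_apply, smul_eq_mul] at this
    simp only [AddMonoidAlgebra.coeff_sum, Finsupp.finsetSum_apply,
      AddMonoidAlgebra.coeff_single, Finsupp.single_apply]
    simp only [ite_mul, one_mul, zero_mul] at this
    rw [this]
    by_cases hij : i = j
    · subst hij
      simp [AddMonoidAlgebra.one_def, Finsupp.single_apply]
    · simp [hij]
  · intro H φ
    ext i j
    have := congrArg (pairing φ) (congrFun (congrFun H i) j)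
    rw [symbolAdj_mul_symbol_apply] at this
    simp only [map_sum, pairing_single] at this
    simp only [Matrix.sum_apply, Matrix.smul_apply, smul_eq_mul]
    rw [this]
    by_cases hij : i = j
    · subst hij
      simp [AddMonoidAlgebra.one_def, pairing_single]
    · simp [hij]

theorem coeff_symbol (T : Finset G) (A : G → Matrix (Fin n) (Fin n) ℂ) (hA : ∀ h ∉ T, A h = 0)
    (i j : Fin n) (g : G) : (symbol T A i j).coeff g = A g i j := by
  classical
  simp only [symbol, Matrix.of_apply, AddMonoidAlgebra.coeff_sum, Finsupp.finsetSum_apply,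
      AddMonoidAlgebra.coeff_single, Finsupp.single_apply]
  rw [Finset.sum_ite_eq']
  split_ifs with h
  · rfl
  · rw [hA g h]; rfl

theorem coeff_symbolAdj (T : Finset G) (A : G → Matrix (Fin n) (Fin n) ℂ)
    (hA : ∀ h ∉ T, A h = 0) (i j : Fin n) (g : G) :
    (symbolAdj (symbol T A) i j).coeff g = (A (-g))ᴴ i j := by
  rw [symbolAdj, Matrix.transpose_apply, Matrix.map_apply, coeff_reflect, coeff_symbol T A hA,
    Matrix.conjTranspose_apply]

/-- A scalar walk on a torsion-free group is a translation up to a phase. -/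
theorem support_subsingleton_of_unitary [TwoUniqueSums G] (T : Finset G) (lam : G → ℂ)
    (H : ∀ φ : G → ℂ, ∑ h ∈ T, ∑ h' ∈ T, φ (h' - h) * (star (lam h) * lam h') = φ 0) :
    ∃ g ∈ T, lam g ≠ 0 ∧ ∀ h ∈ T, lam h ≠ 0 → h = g := by
  classical
  set P : Finset G := T.filter fun h => lam h ≠ 0 with hP
  have key : ∀ φ : G → ℂ, ∑ h ∈ P, ∑ h' ∈ P, φ (h' - h) * (star (lam h) * lam h') = φ 0 := by
    intro φ
    rw [← H φ]
    have h1 : ∀ h, ∑ h' ∈ P, φ (h' - h) * (star (lam h) * lam h') =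
        ∑ h' ∈ T, φ (h' - h) * (star (lam h) * lam h') := by
      intro h
      rw [hP, Finset.sum_filter]
      refine Finset.sum_congr rfl fun h' _ => ?_
      split_ifs with h0
      · rfl
      · rw [not_not] at h0; simp [h0]
    simp only [h1]
    rw [hP, Finset.sum_filter]
    refine Finset.sum_congr rfl fun h _ => ?_
    split_ifs with h0
    · rfl
    · rw [not_not] at h0; simp [h0]
  have hne : P.Nonempty := by
    by_contra h
    rw [Finset.not_nonempty_iff_eq_empty] at h
    have := key (fun _ => 1)
    rw [h] at this
    simp at this
  by_cases hcard : P.card = 1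
  · obtain ⟨g, hg⟩ := Finset.card_eq_one.1 hcard
    have hgP : g ∈ P := by simp [hg]
    refine ⟨g, (Finset.mem_filter.1 hgP).1, (Finset.mem_filter.1 hgP).2, fun h hT h0 => ?_⟩
    have : h ∈ P := Finset.mem_filter.2 ⟨hT, h0⟩
    simpa [hg] using this
  exfalso
  have hP2 : 1 < P.card := lt_of_le_of_ne (Finset.card_pos.2 hne) (Ne.symm hcard)
  set Q : Finset G := P.image (fun h => -h) with hQ
  have hQc : Q.card = P.card := Finset.card_image_of_injective _ neg_injective
  -- One uniquely represented sum `x + y` with `x ∈ P`, `y ∈ -P` suffices. If it is nonzero, the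
  -- corresponding coefficient of the unitarity relation is a single nonzero product. If it is zero,
  -- every `h + (-h)` represents it, so `P` has one element.
  obtain ⟨p1, hp1, p2, hp2, hne12, hu1, hu2⟩ :=
    TwoUniqueSums.uniqueAdd_of_one_lt_card (A := P) (B := Q) (by rw [hQc]; nlinarith)
  have main : ∀ p ∈ P ×ˢ Q, UniqueAdd P Q p.1 p.2 → p.1 + p.2 ≠ 0 → False := by
    rintro ⟨x, y⟩ hp hu h0
    simp only [Finset.mem_product] at hp
    obtain ⟨hx, hy⟩ := hp
    have hz : -y ∈ P := by
      obtain ⟨z, hz, rfl⟩ := Finset.mem_image.1 hy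
      simpa using hz
    have := key (fun g => if g = x + y then 1 else 0)
    rw [if_neg (Ne.symm h0), Finset.sum_eq_single (-y), Finset.sum_eq_single x] at this
    · rw [if_pos (by abel), one_mul] at this
      rcases mul_eq_zero.1 this with h | h
      · exact (Finset.mem_filter.1 hz).2 (star_eq_zero.1 h)
      · exact (Finset.mem_filter.1 hx).2 h
    · intro b hb hbx
      rw [if_neg, zero_mul]
      intro e
      exact hbx (hu hb hy (by rw [← e]; abel)).1
    · intro h; exact absurd hx h
    · intro b hb hby
      refine Finset.sum_eq_zero fun c hc => ?_
      rw [if_neg, zero_mul]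
      intro e
      apply hby
      have := (hu hc (Finset.mem_image_of_mem _ hb) (by rw [← e]; abel)).2
      exact neg_eq_iff_eq_neg.1 this
    · intro h; exact absurd hz h
  have zero : ∀ p ∈ P ×ˢ Q, UniqueAdd P Q p.1 p.2 → p.1 + p.2 = 0 → ∀ h ∈ P, h = p.1 := by
    rintro ⟨x, y⟩ hp hu h0 h hh
    exact (hu hh (Finset.mem_image_of_mem _ hh) (by rw [h0]; simp)).1
  by_cases h1 : p1.1 + p1.2 = 0
  · have hz := zero p1 hp1 hu1 h1
    apply hcard
    rw [Finset.card_eq_one]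
    exact ⟨p1.1, Finset.eq_singleton_iff_unique_mem.2 ⟨(Finset.mem_product.1 hp1).1, hz⟩⟩
  · exact main p1 hp1 hu1 h1

theorem eq_single_of_reflect_mul_self [TwoUniqueSums G] {D : AddMonoidAlgebra ℂ G}
    (hD : reflect G D * D = 1) :
    ∃ (g : G) (c : ℂ), ‖c‖ = 1 ∧ D = AddMonoidAlgebra.single g c := by
  classical
  have hsum : D = ∑ h ∈ D.coeff.support, AddMonoidAlgebra.single h (D.coeff h) :=
    (AddMonoidAlgebra.sum_coeff_single D).symm
  have H : ∀ φ : G → ℂ, ∑ h ∈ D.coeff.support, ∑ h' ∈ D.coeff.support,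
      φ (h' - h) * (star (D.coeff h) * D.coeff h') = φ 0 := by
    intro φ
    have h2 := congrArg (pairing φ) hD
    rw [hsum] at h2
    simp only [map_sum, reflect_single, Finset.sum_mul_sum, AddMonoidAlgebra.single_mul_single,
      pairing_single, AddMonoidAlgebra.one_def, mul_one, neg_add_eq_sub] at h2
    rw [← h2]
  obtain ⟨g, hg, hg0, hu⟩ := support_subsingleton_of_unitary _ _ H
  have hs : D.coeff.support = {g} :=
    Finset.eq_singleton_iff_unique_mem.2 ⟨hg, fun h hh => hu h hh (Finsupp.mem_support_iff.1 hh)⟩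
  refine ⟨g, D.coeff g, ?_, ?_⟩
  · have := H (fun _ => 1)
    rw [hs] at this
    simp only [Finset.sum_singleton, one_mul] at this
    have h3 : ((‖D.coeff g‖ ^ 2 : ℝ) : ℂ) = 1 := by
      rw [← this, Complex.star_def, ← Complex.normSq_eq_conj_mul_self, Complex.normSq_eq_norm_sq]
    have h4 : ‖D.coeff g‖ ^ 2 = 1 := by exact_mod_cast h3
    exact (pow_eq_one_iff_of_nonneg (norm_nonneg _) two_ne_zero).1 h4
  · exact hsum.trans (by rw [hs, Finset.sum_singleton])

end Symbol

/-! ### Determinant of the symbol and reduction to a special unitary symbol -/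

section Normalise

variable {G : Type*} [AddCommGroup G]

theorem conjTranspose_mul_self_of_mem {n : ℕ} {V : Matrix (Fin n) (Fin n) ℂ}
    (hV : V ∈ Matrix.unitaryGroup (Fin n) ℂ) : Vᴴ * V = 1 := (Unitary.mem_iff.1 hV).1

theorem mul_conjTranspose_self_of_mem {n : ℕ} {V : Matrix (Fin n) (Fin n) ℂ}
    (hV : V ∈ Matrix.unitaryGroup (Fin n) ℂ) : V * Vᴴ = 1 := (Unitary.mem_iff.1 hV).2

theorem adjugate_symbol_eq (T : Finset G) (A : G → Matrix (Fin 2) (Fin 2) ℂ)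
    (hA : ∀ h ∉ T, A h = 0) (i j : Fin 2) (g : G) :
    ((symbol T A).adjugate i j).coeff g = (A g).adjugate i j := by
  rw [Matrix.adjugate_fin_two, Matrix.adjugate_fin_two]
  fin_cases i <;> fin_cases j <;> simp [coeff_symbol T A hA]

/-- The adjugates of the transition matrices of a walk are, up to a shift and a phase, the adjoints
of the transition matrices at the opposite steps. -/
theorem exists_adjugate_eq_shift [TwoUniqueSums G] (T : Finset G)
    (A : G → Matrix (Fin 2) (Fin 2) ℂ) (hA : ∀ h ∉ T, A h = 0) (hc : IsConvUnitary T A) :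
    ∃ (g : G) (c : ℂ), ‖c‖ = 1 ∧ ∀ h, (A h).adjugate = c • (A (g - h))ᴴ := by
  rw [isConvUnitary_iff] at hc
  set M := symbol T A with hM
  have hdet : reflect G M.det * M.det = 1 := by
    have := congrArg Matrix.det hc
    rw [Matrix.det_mul, Matrix.det_one, symbolAdj, Matrix.det_transpose] at this
    rw [← this, RingHom.map_det]
    rfl
  obtain ⟨g, c, hc1, hD⟩ := eq_single_of_reflect_mul_self hdet
  refine ⟨g, c, hc1, fun h => ?_⟩
  have hadj : M.adjugate = M.det • symbolAdj M := by
    calc M.adjugate = symbolAdj M * M * M.adjugate := by rw [hc, one_mul]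
      _ = M.det • symbolAdj M := by
        rw [Matrix.mul_assoc, Matrix.mul_adjugate, Matrix.mul_smul, mul_one]
  ext i j
  rw [← adjugate_symbol_eq T A hA, ← hM, hadj, hD, Matrix.smul_apply, smul_eq_mul,
    AddMonoidAlgebra.coeff_single_mul_apply, hM, coeff_symbolAdj T A hA, Matrix.smul_apply,
    smul_eq_mul]
  congr 4
  abel

/-- The support of `A` is invariant under `h ↦ -h`, and by the adjugate relation also under `h ↦ g -
h`. The composite is translation by `g`, which maps a nonempty finite set in a torsion-free group to
itself only for `g = 0`. -/
theorem exists_adjugate_eq [TwoUniqueSums G] [IsAddTorsionFree G] (T : Finset G)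
    (A : G → Matrix (Fin 2) (Fin 2) ℂ) (hA : ∀ h ∉ T, A h = 0) (hc : IsConvUnitary T A)
    (hs : ∀ h, A h ≠ 0 → A (-h) ≠ 0) :
    ∃ c : ℂ, ‖c‖ = 1 ∧ ∀ h, (A h).adjugate = c • (A (-h))ᴴ := by
  obtain ⟨g, c, hc1, hadj⟩ := exists_adjugate_eq_shift T A hA hc
  have hg : g = 0 := by
    by_contra hg
    have step : ∀ h, A h ≠ 0 → A (h - g) ≠ 0 := by
      intro h hh h0
      have h1 : A (g - h) = 0 := by
        by_contra h2
        have := hs _ h2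
        rw [neg_sub] at this
        exact this h0
      have := hadj h
      rw [h1, Matrix.conjTranspose_zero, smul_zero] at this
      apply hh
      have h3 := Matrix.adjugate_adjugate' (A h)
      rw [this, Matrix.adjugate_zero] at h3
      simpa using h3.symm
    obtain ⟨h, hh⟩ : ∃ h, A h ≠ 0 := by
      by_contra hall
      push Not at hall
      have := hc (fun _ => 1)
      simp only [hall, Matrix.mul_zero, smul_zero, Finset.sum_const_zero, one_smul] at this
      exact zero_ne_one this
    have all : ∀ n : ℕ, A (h - n • g) ≠ 0 := by
      intro n
      induction n with
      | zero => simpa using hh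
      | succ k ih =>
        have := step _ ih
        rwa [sub_sub, ← succ_nsmul] at this
    have inj : Function.Injective (fun n : ℕ => h - n • g) := by
      intro a b hab
      have : a • g = b • g := sub_right_injective hab
      exact injective_nsmul_iff_not_isOfFinAddOrder.2
        (not_isOfFinAddOrder_of_isAddTorsionFree hg) this
    have : Set.Infinite (T : Set G) :=
      Set.infinite_of_injective_forall_mem inj
        (fun n => by by_contra h0; exact all n (hA _ (by simpa using h0)))
    exact this T.finite_toSet
  subst hg
  exact ⟨c, hc1, fun h => by rw [hadj h, zero_sub]⟩

theorem IsConvUnitary.sum_mem {n : ℕ} {T : Finset G} {A : G → Matrix (Fin n) (Fin n) ℂ}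
    (hc : IsConvUnitary T A) : ∑ h ∈ T, A h ∈ Matrix.unitaryGroup (Fin n) ℂ := by
  rw [Matrix.mem_unitaryGroup_iff']
  have := hc (fun _ => 1)
  simp only [one_smul] at this
  rw [← this, Matrix.star_eq_conjTranspose, Matrix.conjTranspose_sum, Finset.sum_mul_sum]

theorem IsConvUnitary.mul_left {n : ℕ} {T : Finset G} {A : G → Matrix (Fin n) (Fin n) ℂ}
    (hc : IsConvUnitary T A) {V : Matrix (Fin n) (Fin n) ℂ}
    (hV : V ∈ Matrix.unitaryGroup (Fin n) ℂ) : IsConvUnitary T (fun h => V * A h) := by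
  intro φ
  rw [← hc φ]
  refine Finset.sum_congr rfl fun h _ => Finset.sum_congr rfl fun h' _ => ?_
  rw [Matrix.conjTranspose_mul, Matrix.mul_assoc, ← Matrix.mul_assoc Vᴴ,
    conjTranspose_mul_self_of_mem hV, one_mul]

/-- Dividing a walk by its value at zero momentum makes the symbol special unitary. -/
theorem normalised_adjugate {T : Finset G} {A : G → Matrix (Fin 2) (Fin 2) ℂ}
    (hT : ∀ h ∈ T, -h ∈ T)
    (hc : IsConvUnitary T A) {c : ℂ} (hc1 : ‖c‖ = 1)
    (hadj : ∀ h, (A h).adjugate = c • (A (-h))ᴴ) (h : G) :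
    (∑ h ∈ T, A h)ᴴ * A (-h) = ((((∑ h ∈ T, A h)ᴴ * A h).adjugate))ᴴ := by
  set V := ∑ h ∈ T, A h with hVdef
  have hV := hc.sum_mem
  rw [← hVdef] at hV
  -- For `2 × 2` matrices the adjugate is additive, so the relation for the `A h` sums to one for
  -- `V` with the same phase `c`. The phase then cancels in the quotient.
  have hVadj : V.adjugate = c • Vᴴ := by
    have e1 : V.adjugate = ∑ h ∈ T, (A h).adjugate := by
      have : ∀ s : Finset G, (∑ h ∈ s, A h).adjugate = ∑ h ∈ s, (A h).adjugate := by
        classical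
        intro s
        induction s using Finset.induction_on with
        | empty => simp
        | insert a s ha ih =>
          rw [Finset.sum_insert ha, Finset.sum_insert ha, ← ih]
          rw [Matrix.adjugate_fin_two, Matrix.adjugate_fin_two, Matrix.adjugate_fin_two]
          ext i j
          fin_cases i <;> fin_cases j <;> simp [add_comm]
      exact this T
    rw [e1]
    simp only [hadj]
    rw [← Finset.smul_sum, ← Matrix.conjTranspose_sum]
    congr 2
    rw [hVdef]
    exact Finset.sum_nbij' (fun h => -h) (fun h => -h) hT hT (by simp) (by simp) (by simp)
  have hcc : c * star c = 1 := by
    rw [mul_comm, Complex.star_def, ← Complex.normSq_eq_conj_mul_self, Complex.normSq_eq_norm_sq, hc1]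
    simp
  rw [Matrix.adjugate_mul_distrib, ← Matrix.adjugate_conjTranspose, hVadj, hadj,
    Matrix.conjTranspose_mul, Matrix.conjTranspose_conjTranspose, Matrix.conjTranspose_smul,
    Matrix.conjTranspose_conjTranspose, Matrix.smul_mul, Matrix.mul_smul, smul_smul,
    hcc, one_smul]

end Normalise

/-! ### Singular `2 × 2` matrices -/

section TwoByTwo

theorem ne_zero_fin_two {a : Fin 2 → ℂ} : a ≠ 0 ↔ a 0 ≠ 0 ∨ a 1 ≠ 0 := by
  rw [Ne, funext_iff, Fin.forall_fin_two]
  simp only [Pi.zero_apply]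
  tauto

theorem exists_eq_vecMulVec {X : Matrix (Fin 2) (Fin 2) ℂ} (hd : X.det = 0) (h0 : X ≠ 0) :
    ∃ a b : Fin 2 → ℂ, a ≠ 0 ∧ b ≠ 0 ∧ X = Matrix.vecMulVec a b := by
  obtain ⟨i, j, hij⟩ : ∃ i j, X i j ≠ 0 := by
    by_contra h
    push Not at h
    exact h0 (by ext i j; exact h i j)
  rw [Matrix.det_fin_two] at hd
  -- The column through a nonzero entry, and the row through it scaled by that entry.
  refine ⟨fun k => X k j, fun m => X i m / X i j, fun h => hij (congrFun h i), fun h => ?_, ?_⟩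
  · have := congrFun h j
    simp [hij] at this
  · ext k m
    rw [Matrix.vecMulVec_apply, ← mul_div_assoc, eq_div_iff hij]
    fin_cases i <;> fin_cases j <;> fin_cases k <;> fin_cases m <;>
      simp only [Fin.zero_eta, Fin.mk_one, Fin.isValue] <;>
      first
      | ring1
      | linear_combination hd
      | linear_combination -hd

theorem vecMulVec_ne_zero_fin_two {a b : Fin 2 → ℂ} (ha : a ≠ 0) (hb : b ≠ 0) :
    Matrix.vecMulVec a b ≠ 0 := by
  rw [ne_zero_fin_two] at ha hb
  intro h
  have e := fun i j => congrFun (congrFun h i) j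
  simp only [Matrix.vecMulVec_apply, Matrix.zero_apply, mul_eq_zero] at e
  have := e 0 0; have := e 0 1; have := e 1 0; have := e 1 1
  tauto

/-- The product is the wedge of the two column vectors times a nonzero matrix. So `X.adjugate * Y =
0` expresses, for nonzero singular `X` and `Y`, that they have the same column space. Likewise `Y *
X.adjugate = 0` expresses a common row space. These are the relations called `colPar` and `rowPar`
below. -/
theorem adjugate_mul_vecMulVec {a b c d : Fin 2 → ℂ} (hb : b ≠ 0) (hd : d ≠ 0) :
    (Matrix.vecMulVec a b).adjugate * Matrix.vecMulVec c d = 0 ↔ a 0 * c 1 = a 1 * c 0 := by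
  rw [ne_zero_fin_two] at hb hd
  have e : (Matrix.vecMulVec a b).adjugate * Matrix.vecMulVec c d =
      (a 0 * c 1 - a 1 * c 0) • Matrix.vecMulVec ![-b 1, b 0] d := by
    rw [Matrix.adjugate_fin_two]
    ext i j
    fin_cases i <;>
      simp only [Matrix.mul_apply, Fin.sum_univ_two, Matrix.vecMulVec_apply, Matrix.smul_apply] <;>
      simp <;> ring
  rw [e, smul_eq_zero, sub_eq_zero]
  refine or_iff_left (vecMulVec_ne_zero_fin_two ?_ (ne_zero_fin_two.2 hd))
  rw [ne_zero_fin_two]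
  simpa [or_comm] using hb

theorem vecMulVec_mul_adjugate {a b c d : Fin 2 → ℂ} (ha : a ≠ 0) (hc : c ≠ 0) :
    Matrix.vecMulVec c d * (Matrix.vecMulVec a b).adjugate = 0 ↔ b 0 * d 1 = b 1 * d 0 := by
  rw [← Matrix.transpose_eq_zero, Matrix.transpose_mul, Matrix.adjugate_transpose,
    Matrix.transpose_vecMulVec, Matrix.transpose_vecMulVec, adjugate_mul_vecMulVec ha hc]

theorem conjTranspose_mul_vecMulVec {a b c d : Fin 2 → ℂ} (hb : b ≠ 0) (hd : d ≠ 0) :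
    (Matrix.vecMulVec a b)ᴴ * Matrix.vecMulVec c d = 0 ↔ star (a 0) * c 0 + star (a 1) * c 1 = 0 := by
  have e : (Matrix.vecMulVec a b)ᴴ * Matrix.vecMulVec c d =
      (star (a 0) * c 0 + star (a 1) * c 1) • Matrix.vecMulVec (star b) d := by
    ext i j
    simp [Matrix.mul_apply, Fin.sum_univ_two, Matrix.vecMulVec_apply]
    ring
  rw [e, smul_eq_zero]
  exact or_iff_left (vecMulVec_ne_zero_fin_two (star_ne_zero.2 hb) hd)

theorem vecMulVec_mul_conjTranspose {a b c d : Fin 2 → ℂ} (ha : a ≠ 0) (hc : c ≠ 0) :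
    Matrix.vecMulVec a b * (Matrix.vecMulVec c d)ᴴ = 0 ↔
      b 0 * star (d 0) + b 1 * star (d 1) = 0 := by
  have e : Matrix.vecMulVec a b * (Matrix.vecMulVec c d)ᴴ =
      (b 0 * star (d 0) + b 1 * star (d 1)) • Matrix.vecMulVec a (star c) := by
    ext i j
    simp [Matrix.mul_apply, Fin.sum_univ_two, Matrix.vecMulVec_apply]
    ring
  rw [e, smul_eq_zero]
  exact or_iff_left (vecMulVec_ne_zero_fin_two ha (star_ne_zero.2 hc))

variable {X Y Z U : Matrix (Fin 2) (Fin 2) ℂ}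

/-- Orthogonal singular matrices have orthogonal column spaces or orthogonal row spaces. -/
theorem perp_of_trace_eq_zero (hX : X.det = 0) (hY : Y.det = 0)
    (h : (Xᴴ * Y).trace = 0) : Xᴴ * Y = 0 ∨ X * Yᴴ = 0 := by
  rcases eq_or_ne X 0 with rfl | hX0
  · simp
  rcases eq_or_ne Y 0 with rfl | hY0
  · simp
  obtain ⟨a, b, ha, hb, rfl⟩ := exists_eq_vecMulVec hX hX0
  obtain ⟨c, d, hc, hd, rfl⟩ := exists_eq_vecMulVec hY hY0
  rw [conjTranspose_mul_vecMulVec hb hd, vecMulVec_mul_conjTranspose ha hc]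
  have : (star (a 0) * c 0 + star (a 1) * c 1) *
      star (b 0 * star (d 0) + b 1 * star (d 1)) = 0 := by
    rw [← h, Matrix.trace_fin_two]
    simp [Matrix.mul_apply, Fin.sum_univ_two, Matrix.vecMulVec_apply]
    ring
  rcases mul_eq_zero.1 this with h | h
  · exact Or.inl h
  · exact Or.inr (star_eq_zero.1 h)

/-- In size two the adjugate is an involutive antihomomorphism, so applying it exchanges the two
factors. -/
theorem colPar_symm (h : X.adjugate * Y = 0) : Y.adjugate * X = 0 := by
  have := congrArg Matrix.adjugate h
  rwa [Matrix.adjugate_mul_distrib, Matrix.adjugate_adjugate' X, Matrix.adjugate_zero,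
    Fintype.card_fin, Nat.sub_self, pow_zero, one_smul] at this

theorem rowPar_symm (h : Y * X.adjugate = 0) : X * Y.adjugate = 0 := by
  have := congrArg Matrix.adjugate h
  rwa [Matrix.adjugate_mul_distrib, Matrix.adjugate_adjugate' X, Matrix.adjugate_zero,
    Fintype.card_fin, Nat.sub_self, pow_zero, one_smul] at this

theorem wedge_trans {a b c : Fin 2 → ℂ} (hb : b ≠ 0) (h1 : a 0 * b 1 = a 1 * b 0)
    (h2 : b 0 * c 1 = b 1 * c 0) : a 0 * c 1 = a 1 * c 0 := by
  rw [ne_zero_fin_two] at hb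
  rcases hb with hb | hb <;> apply mul_left_cancel₀ hb
  · linear_combination a 0 * h2 + c 0 * h1
  · linear_combination c 1 * h1 + a 1 * h2

theorem colPar_trans (hX : X.det = 0) (hY : Y.det = 0) (hZ : Z.det = 0) (hY0 : Y ≠ 0)
    (h1 : X.adjugate * Y = 0) (h2 : Y.adjugate * Z = 0) : X.adjugate * Z = 0 := by
  rcases eq_or_ne X 0 with rfl | hX0
  · simp
  rcases eq_or_ne Z 0 with rfl | hZ0
  · simp
  obtain ⟨a, b, ha, hb, rfl⟩ := exists_eq_vecMulVec hX hX0
  obtain ⟨c, d, hc, hd, rfl⟩ := exists_eq_vecMulVec hY hY0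
  obtain ⟨e, f, he, hf, rfl⟩ := exists_eq_vecMulVec hZ hZ0
  rw [adjugate_mul_vecMulVec hb hd] at h1
  rw [adjugate_mul_vecMulVec hd hf] at h2
  rw [adjugate_mul_vecMulVec hb hf]
  exact wedge_trans hc h1 h2

theorem rowPar_trans (hX : X.det = 0) (hY : Y.det = 0) (hZ : Z.det = 0) (hY0 : Y ≠ 0)
    (h1 : Y * X.adjugate = 0) (h2 : Z * Y.adjugate = 0) : Z * X.adjugate = 0 := by
  have := colPar_trans (X := Xᵀ) (Y := Yᵀ) (Z := Zᵀ) (by rwa [Matrix.det_transpose])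
    (by rwa [Matrix.det_transpose]) (by rwa [Matrix.det_transpose])
    (by rwa [Ne, Matrix.transpose_eq_zero])
    (by rw [← Matrix.adjugate_transpose, ← Matrix.transpose_mul, h1, Matrix.transpose_zero])
    (by rw [← Matrix.adjugate_transpose, ← Matrix.transpose_mul, h2, Matrix.transpose_zero])
  rwa [← Matrix.adjugate_transpose, ← Matrix.transpose_mul, Matrix.transpose_eq_zero] at this

theorem unitary_entries (hU : U ∈ Matrix.unitaryGroup (Fin 2) ℂ) :
    (star (U 0 0) * U 0 0 + star (U 1 0) * U 1 0 = 1 ∧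
      star (U 0 0) * U 0 1 + star (U 1 0) * U 1 1 = 0) ∧
      star (U 0 1) * U 0 0 + star (U 1 1) * U 1 0 = 0 ∧
      star (U 0 1) * U 0 1 + star (U 1 1) * U 1 1 = 1 := by
  have h := conjTranspose_mul_self_of_mem hU
  have e := fun i j => congrFun (congrFun h i) j
  simp only [Matrix.mul_apply, Fin.sum_univ_two, Matrix.conjTranspose_apply] at e
  exact ⟨⟨by simpa using e 0 0, by simpa using e 0 1⟩, by simpa using e 1 0, by simpa using e 1 1⟩

theorem unitary_ne_zero (hU : U ∈ Matrix.unitaryGroup (Fin 2) ℂ) : U ≠ 0 := by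
  rintro rfl
  have := conjTranspose_mul_self_of_mem hU
  simp at this

/-- The adjugate of a unitary matrix is a multiple of its adjoint. -/
theorem unitary_adjugate (hU : U ∈ Matrix.unitaryGroup (Fin 2) ℂ) : U.adjugate = U.det • Uᴴ := by
  calc U.adjugate = Uᴴ * U * U.adjugate := by rw [conjTranspose_mul_self_of_mem hU, one_mul]
    _ = U.det • Uᴴ := by rw [Matrix.mul_assoc, Matrix.mul_adjugate, Matrix.mul_smul, mul_one]

/-- The adjugate of a unitary conjugate. -/
theorem adjugate_unitary_conj (hU : U ∈ Matrix.unitaryGroup (Fin 2) ℂ) :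
    (U * X * Uᴴ).adjugate = U * X.adjugate * Uᴴ := by
  have h2 := unitary_adjugate hU
  have h3 : (Uᴴ).adjugate = star U.det • U := by
    rw [← Matrix.adjugate_conjTranspose, h2, Matrix.conjTranspose_smul,
      Matrix.conjTranspose_conjTranspose]
  have h4 : U.det * star U.det = 1 := by
    rw [mul_comm]
    have := congrArg Matrix.det (conjTranspose_mul_self_of_mem hU)
    rwa [Matrix.det_mul, Matrix.det_conjTranspose, Matrix.det_one] at this
  rw [Matrix.adjugate_mul_distrib, Matrix.adjugate_mul_distrib, h2, h3]
  simp only [Matrix.smul_mul, Matrix.mul_smul, smul_smul, h4, one_smul, Matrix.mul_assoc]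

theorem trace_unitary_conj (hU : U ∈ Matrix.unitaryGroup (Fin 2) ℂ) :
    (U * X * Uᴴ).trace = X.trace := by
  rw [Matrix.trace_mul_comm, ← Matrix.mul_assoc, conjTranspose_mul_self_of_mem hU, one_mul]

theorem det_unitary_conj (hU : U ∈ Matrix.unitaryGroup (Fin 2) ℂ) :
    (U * X * Uᴴ).det = X.det := by
  have := congrArg Matrix.det (conjTranspose_mul_self_of_mem hU)
  rw [Matrix.det_mul, Matrix.det_one] at this
  rw [Matrix.det_mul, Matrix.det_mul]
  linear_combination X.det * this

/-- A unitary matrix mapping a vector to an orthogonal one is traceless. -/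
theorem trace_eq_zero_of_perp (hU : U ∈ Matrix.unitaryGroup (Fin 2) ℂ) (hX : X.det = 0)
    (hX0 : X ≠ 0) (h : Xᴴ * U * X = 0) : U.trace = 0 := by
  obtain ⟨a, b, ha, hb, rfl⟩ := exists_eq_vecMulVec hX hX0
  rw [Matrix.mul_assoc, Matrix.mul_vecMulVec, conjTranspose_mul_vecMulVec hb hb] at h
  simp only [Matrix.mulVec, dotProduct, Fin.sum_univ_two] at h
  have h2 := unitary_adjugate hU
  have e := fun i j => congrFun (congrFun h2 i) j
  rw [Matrix.adjugate_fin_two] at e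
  have e00 : U 1 1 = U.det * star (U 0 0) := by simpa using e 0 0
  have e01 : -U 0 1 = U.det * star (U 1 0) := by simpa using e 0 1
  have e10 : -U 1 0 = U.det * star (U 0 1) := by simpa using e 1 0
  have e11 : U 0 0 = U.det * star (U 1 1) := by simpa using e 1 1
  have h' := congrArg star h
  simp only [star_add, star_mul', star_star, star_zero] at h'
  rw [Matrix.trace_fin_two]
  -- The adjugate relation expresses the entries of `U` by conjugates of each other, and gives `tr U
  -- · ‖a‖² = ⟨a, U a⟩ + det U · conj ⟨a, U a⟩`.
  have key : (U 0 0 + U 1 1) * (star (a 0) * a 0 + star (a 1) * a 1) = 0 := by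
    linear_combination h + U.det * h' + star (a 0) * a 0 * e00 + star (a 1) * a 1 * e11 +
      a 0 * star (a 1) * e10 + a 1 * star (a 0) * e01
  refine (mul_eq_zero.1 key).resolve_right fun h0 => ha ?_
  have h1 : (Complex.normSq (a 0) + Complex.normSq (a 1) : ℝ) = 0 := by
    have : ((Complex.normSq (a 0) + Complex.normSq (a 1) : ℝ) : ℂ) = 0 := by
      push_cast
      rw [Complex.normSq_eq_conj_mul_self, Complex.normSq_eq_conj_mul_self]
      exact h0
    exact_mod_cast this
  have p0 := Complex.normSq_nonneg (a 0)
  have p1 := Complex.normSq_nonneg (a 1)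
  have q0 : Complex.normSq (a 0) = 0 := by linarith
  have q1 : Complex.normSq (a 1) = 0 := by linarith
  funext i
  fin_cases i
  · exact Complex.normSq_eq_zero.1 q0
  · exact Complex.normSq_eq_zero.1 q1

/-- The Cayley–Hamilton identity without its linear term. -/
theorem mul_self_of_trace_eq_zero (h : U.trace = 0) : U * U = -U.det • 1 := by
  rw [Matrix.trace_fin_two] at h
  ext i j
  fin_cases i <;> fin_cases j <;>
    simp [Matrix.mul_apply, Fin.sum_univ_two, Matrix.det_fin_two]
  · linear_combination U 0 0 * h
  · linear_combination U 0 1 * h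
  · linear_combination U 1 0 * h
  · linear_combination U 1 1 * h

theorem sq_eq_smul_of_perp (hU : U ∈ Matrix.unitaryGroup (Fin 2) ℂ) (hX : X.det = 0) (hX0 : X ≠ 0)
    (h : Xᴴ * U * X = 0) : ∃ c : ℂ, U * U = c • (1 : Matrix (Fin 2) (Fin 2) ℂ) :=
  ⟨-U.det, mul_self_of_trace_eq_zero (trace_eq_zero_of_perp hU hX hX0 h)⟩

end TwoByTwo

/-! ### Normalised isotropic walks -/

section Core

variable {G : Type*} [AddCommGroup G] [DecidableEq G] {L : Type*} [Group L] [DistribMulAction L G]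

/-- A walk whose symbol is special unitary and equal to the identity at zero momentum, covariant
under a group `L` acting by group automorphisms. -/
structure IsoWalk (Sp : Finset G) (A : G → Matrix (Fin 2) (Fin 2) ℂ)
    (U : L → Matrix (Fin 2) (Fin 2) ℂ) : Prop where
  gen : AddSubgroup.closure (Sp : Set G) = ⊤
  zero_notMem : (0 : G) ∉ Sp
  ne_zero : ∀ h ∈ neighbours Sp, A h ≠ 0
  eq_zero : ∀ h, h ∉ steps Sp → A h = 0
  conv : IsConvUnitary (steps Sp) A
  adj : ∀ h, A (-h) = ((A h).adjugate)ᴴ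
  sum : ∑ h ∈ steps Sp, A h = 1
  mem : ∀ (l : L), ∀ h ∈ Sp, l • h ∈ Sp
  unitary : ∀ l, U l ∈ Matrix.unitaryGroup (Fin 2) ℂ
  proj : ∀ l l', ∃ c : ℂ, U (l * l') = c • (U l * U l')
  cov : ∀ l h, A (l • h) = U l * A h * (U l)ᴴ
  trans : ∀ h ∈ Sp, ∀ h' ∈ Sp, ∃ l : L, l • h = h'
  -- This is what is kept of the noncommutation condition: if `l` moves `h` to a generator with the
  -- same matrix, covariance makes `U l` commute with `A h`.
  inj : ∀ h ∈ Sp, ∀ h' ∈ Sp, A h = A h' → h = h'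

theorem mem_neighbours {Sp : Finset G} {h : G} : h ∈ neighbours Sp ↔ h ∈ Sp ∨ -h ∈ Sp := by
  simp only [neighbours, Finset.mem_union, Finset.mem_image]
  constructor
  · rintro (h1 | ⟨x, hx, rfl⟩)
    · exact Or.inl h1
    · exact Or.inr (by simpa using hx)
  · rintro (h1 | h1)
    · exact Or.inl h1
    · exact Or.inr ⟨_, h1, neg_neg h⟩

theorem neg_mem_neighbours {Sp : Finset G} {h : G} (hh : h ∈ neighbours Sp) :
    -h ∈ neighbours Sp := by
  rw [mem_neighbours] at hh ⊢
  rw [neg_neg]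
  exact hh.symm

theorem mem_steps {Sp : Finset G} {h : G} : h ∈ steps Sp ↔ h = 0 ∨ h ∈ neighbours Sp := by
  simp [steps]

theorem neg_mem_steps {Sp : Finset G} {h : G} (hh : h ∈ steps Sp) : -h ∈ steps Sp := by
  rw [mem_steps] at hh ⊢
  rcases hh with rfl | hh
  · simp
  · exact Or.inr (neg_mem_neighbours hh)

theorem zero_notMem_neighbours {Sp : Finset G} (h0 : (0 : G) ∉ Sp) : (0 : G) ∉ neighbours Sp := by
  rw [mem_neighbours]
  simpa using h0

variable {Sp : Finset G} {A : G → Matrix (Fin 2) (Fin 2) ℂ} {U : L → Matrix (Fin 2) (Fin 2) ℂ}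

theorem trace_adjugate_fin_two (X : Matrix (Fin 2) (Fin 2) ℂ) : X.adjugate.trace = X.trace := by
  rw [Matrix.adjugate_fin_two, Matrix.trace_fin_two, Matrix.trace_fin_two]
  simp [add_comm]

namespace IsoWalk

theorem ne_zero_of_mem (W : IsoWalk Sp A U) {h : G} (hh : h ∈ neighbours Sp) : h ≠ 0 := by
  rintro rfl
  exact zero_notMem_neighbours W.zero_notMem hh

theorem smul_mem (W : IsoWalk Sp A U) (l : L) {h : G} (hh : h ∈ neighbours Sp) :
    l • h ∈ neighbours Sp := by
  rw [mem_neighbours] at hh ⊢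
  rw [← smul_neg]
  exact hh.imp (W.mem l _) (W.mem l _)

theorem smul_mem_steps (W : IsoWalk Sp A U) (l : L) {h : G} (hh : h ∈ steps Sp) :
    l • h ∈ steps Sp := by
  rw [mem_steps] at hh ⊢
  rcases hh with rfl | hh
  · simp
  · exact Or.inr (W.smul_mem l hh)

theorem exists_smul (W : IsoWalk Sp A U) {h k : G} (hh : h ∈ neighbours Sp)
    (hk : k ∈ neighbours Sp) : ∃ l : L, k = l • h ∨ k = -(l • h) := by
  rw [mem_neighbours] at hh hk
  rcases hh with hh | hh <;> rcases hk with hk | hk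
  · obtain ⟨l, hl⟩ := W.trans _ hh _ hk
    exact ⟨l, Or.inl hl.symm⟩
  · obtain ⟨l, hl⟩ := W.trans _ hh _ hk
    exact ⟨l, Or.inr (by rw [hl, neg_neg])⟩
  · obtain ⟨l, hl⟩ := W.trans _ hh _ hk
    exact ⟨l, Or.inr (by rw [← smul_neg, hl])⟩
  · obtain ⟨l, hl⟩ := W.trans _ hh _ hk
    exact ⟨l, Or.inl (by rw [smul_neg] at hl; exact (neg_injective hl).symm)⟩

/-- A property invariant under the group and under inversion holds for all steps if it holds
for one. -/
theorem forall_of_invariant (W : IsoWalk Sp A U) (P : Matrix (Fin 2) (Fin 2) ℂ → Prop)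
    (h1 : ∀ X V, V ∈ Matrix.unitaryGroup (Fin 2) ℂ → P X → P (V * X * Vᴴ))
    (h2 : ∀ X, P X → P (X.adjugate)ᴴ) {h k : G} (hh : h ∈ neighbours Sp)
    (hk : k ∈ neighbours Sp) (hP : P (A h)) : P (A k) := by
  obtain ⟨l, rfl | rfl⟩ := W.exists_smul hh hk
  · rw [W.cov]; exact h1 _ _ (W.unitary l) hP
  · rw [W.adj, W.cov]; exact h2 _ (h1 _ _ (W.unitary l) hP)

/-- Passing from `h` to `-h` conjugates the trace, so only its real part is an invariant of the
orbit. -/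
theorem trace_re_const (W : IsoWalk Sp A U) {h k : G} (hh : h ∈ neighbours Sp)
    (hk : k ∈ neighbours Sp) : (A k).trace.re = (A h).trace.re := by
  refine W.forall_of_invariant (fun X => X.trace.re = (A h).trace.re) ?_ ?_ hh hk rfl
  · intro X V hV hX
    rw [trace_unitary_conj hV, hX]
  · intro X hX
    rw [Matrix.trace_conjTranspose, trace_adjugate_fin_two, Complex.star_def, Complex.conj_re, hX]

theorem normSq_const (W : IsoWalk Sp A U) {h k : G} (hh : h ∈ neighbours Sp)
    (hk : k ∈ neighbours Sp) : ((A k)ᴴ * A k).trace = ((A h)ᴴ * A h).trace := by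
  refine W.forall_of_invariant (fun X => (Xᴴ * X).trace = ((A h)ᴴ * A h).trace) ?_ ?_ hh hk rfl
  · intro X V hV hX
    have : (V * X * Vᴴ)ᴴ * (V * X * Vᴴ) = V * (Xᴴ * X) * Vᴴ := by
      simp only [Matrix.conjTranspose_mul, Matrix.conjTranspose_conjTranspose, Matrix.mul_assoc]
      rw [← Matrix.mul_assoc Vᴴ V, conjTranspose_mul_self_of_mem hV, one_mul]
    rw [this, trace_unitary_conj hV, hX]
  · intro X hX
    rw [Matrix.conjTranspose_conjTranspose, Matrix.adjugate_conjTranspose,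
      ← Matrix.adjugate_mul_distrib, trace_adjugate_fin_two, hX]

theorem conjTranspose_neg_step (W : IsoWalk Sp A U) (h : G) : (A (-h))ᴴ = (A h).adjugate := by
  rw [W.adj, Matrix.conjTranspose_conjTranspose]

/-- The pairs `(p, q)` and `(-q, -p)` have the same difference, hence always occur together in the
unitarity relation. That they contribute equally means they cannot cancel. -/
theorem trace_neg (W : IsoWalk Sp A U) (p q : G) :
    ((A (-q))ᴴ * A (-p)).trace = ((A p)ᴴ * A q).trace := by
  rw [W.adj p, W.conjTranspose_neg_step, Matrix.adjugate_conjTranspose,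
    ← Matrix.adjugate_mul_distrib, trace_adjugate_fin_two]

/-- The trace of the unitarity relation at a nonzero group element, with the contributing pairs
listed in `P`. -/
theorem sum_pairs (W : IsoWalk Sp A U) {g : G} (hg : g ≠ 0) (P : Finset (G × G))
    (hP : ∀ p, p ∈ P ↔ p.1 ∈ steps Sp ∧ p.2 ∈ steps Sp ∧ p.2 - p.1 = g) :
    ∑ p ∈ P, ((A p.1)ᴴ * A p.2).trace = 0 := by
  have := congrArg Matrix.trace (W.conv (fun x => if x = g then 1 else 0))
  simp only [if_neg (Ne.symm hg), zero_smul, Matrix.trace_zero, Matrix.trace_sum,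
    Matrix.trace_smul, smul_eq_mul] at this
  rw [← this, ← Finset.sum_product']
  have hsub : P ⊆ steps Sp ×ˢ steps Sp := by
    intro p hp
    have := (hP p).1 hp
    exact Finset.mem_product.2 ⟨this.1, this.2.1⟩
  rw [← Finset.sum_subset hsub]
  · refine Finset.sum_congr rfl fun p hp => ?_
    rw [if_pos ((hP p).1 hp).2.2, one_mul]
  · intro p hp hpP
    rw [if_neg, zero_mul]
    intro e
    exact hpP ((hP p).2 ⟨(Finset.mem_product.1 hp).1, (Finset.mem_product.1 hp).2, e⟩)

/-- Two steps whose difference occurs only once are orthogonal. -/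
theorem trace_eq_zero_of_unique (W : IsoWalk Sp A U) {p q : G} (hp : p ∈ steps Sp)
    (hq : q ∈ steps Sp) (hpq : q ≠ p)
    (hu : ∀ k ∈ steps Sp, ∀ k' ∈ steps Sp, k' - k = q - p →
      (k = p ∧ k' = q) ∨ (k = -q ∧ k' = -p)) : ((A p)ᴴ * A q).trace = 0 := by
  have := W.sum_pairs (sub_ne_zero.2 hpq) {(p, q), (-q, -p)} (by
    rintro ⟨k, k'⟩
    simp only [Finset.mem_insert, Finset.mem_singleton, Prod.mk.injEq]
    constructor
    · rintro (⟨rfl, rfl⟩ | ⟨rfl, rfl⟩)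
      · exact ⟨hp, hq, rfl⟩
      · exact ⟨neg_mem_steps hq, neg_mem_steps hp, by abel⟩
    · rintro ⟨h1, h2, h3⟩
      exact hu k h1 k' h2 h3)
  -- For `q = -p` the two pairs coincide and the sum has one term; otherwise it has two equal ones.
  by_cases heq : (p, q) = (-q, -p)
  · rw [← heq] at this
    simpa using this
  · rw [Finset.sum_pair heq, W.trace_neg, ← two_mul] at this
    exact (mul_eq_zero.1 this).resolve_left two_ne_zero

/-- The only decompositions of `p + q` into two steps are the obvious ones. -/
def UniqueSum (Sp : Finset G) (p q : G) : Prop :=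
  ∀ k ∈ steps Sp, ∀ k' ∈ steps Sp, k + k' = p + q → (k = p ∧ k' = q) ∨ (k = q ∧ k' = p)

/-- Since `(A (-p))ᴴ` is the adjugate of `A p`, the orthogonality of `-p` and `q` turns a statement
on differences of steps into one on sums. -/
theorem trace_adjugate_eq_zero (W : IsoWalk Sp A U) {p q : G} (hp : p ∈ steps Sp)
    (hq : q ∈ steps Sp) (hpq : q ≠ -p) (hu : UniqueSum Sp p q) :
    ((A p).adjugate * A q).trace = 0 := by
  rw [← W.conjTranspose_neg_step]
  refine W.trace_eq_zero_of_unique (neg_mem_steps hp) hq hpq ?_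
  intro k hk k' hk' e
  rcases hu (-k) (neg_mem_steps hk) k' hk' (by rw [neg_add_eq_sub, e]; abel) with ⟨h1, h2⟩ | ⟨h1, h2⟩
  · exact Or.inl ⟨by rw [← h1, neg_neg], h2⟩
  · exact Or.inr ⟨by rw [← h1, neg_neg], by rw [h2, neg_neg]⟩

theorem U_ne_zero (W : IsoWalk Sp A U) (l : L) : U l ≠ 0 := unitary_ne_zero (W.unitary l)

theorem smul_eq_of_fix (W : IsoWalk Sp A U) {l : L} (h : ∀ x ∈ Sp, l • x = x) (x : G) :
    l • x = x := by
  have : x ∈ AddSubgroup.closure (Sp : Set G) := by rw [W.gen]; trivial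
  induction this using AddSubgroup.closure_induction with
  | mem x hx => exact h x hx
  | zero => simp
  | add x y _ _ hx hy => rw [smul_add, hx, hy]
  | neg x _ hx => rw [smul_neg, hx]

variable [FaithfulSMul L G]

theorem eq_one_of_fix (W : IsoWalk Sp A U) {l : L} (h : ∀ x ∈ Sp, l • x = x) : l = 1 :=
  FaithfulSMul.eq_of_smul_eq_smul (α := G) fun x => by rw [W.smul_eq_of_fix h, one_smul]

/-- A scalar `U l` leaves all transition matrices unchanged, hence by injectivity all generators. So
the projective representation is faithful. -/
theorem eq_one_of_scalar (W : IsoWalk Sp A U) {l : L} {c : ℂ} (h : U l = c • 1) : l = 1 := by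
  refine W.eq_one_of_fix fun x hx => W.inj _ (W.mem l x hx) _ hx ?_
  have h1 := mul_conjTranspose_self_of_mem (W.unitary l)
  rw [W.cov, h, Matrix.smul_mul, one_mul, Matrix.smul_mul, ← Matrix.mul_smul]
  rw [h, Matrix.smul_mul, one_mul] at h1
  rw [h1, mul_one]

theorem eq_of_U_eq_smul (W : IsoWalk Sp A U) {l l' : L} {c : ℂ} (h : U l = c • U l') : l = l' := by
  obtain ⟨c1, h1⟩ := W.proj l'⁻¹ l
  obtain ⟨c2, h2⟩ := W.proj l'⁻¹ l'
  obtain ⟨c3, h3⟩ := W.proj 1 1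
  rw [inv_mul_cancel] at h2
  have hU1 : (U (1 : L)) = c3 • (U 1 * U 1) := by rw [← h3, one_mul]
  have h4 : ∃ c4 : ℂ, U (1 : L) = c4 • 1 := by
    have h5 := congrArg (fun M => (U (1 : L))ᴴ * M) hU1
    simp only [Matrix.mul_smul, ← Matrix.mul_assoc,
      conjTranspose_mul_self_of_mem (W.unitary (1 : L)), one_mul] at h5
    have hc3 : c3 ≠ 0 := by
      rintro rfl
      rw [zero_smul] at h5
      exact one_ne_zero h5
    exact ⟨c3⁻¹, by rw [h5, smul_smul, inv_mul_cancel₀ hc3, one_smul]⟩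
  obtain ⟨c4, h4⟩ := h4
  have hc2 : c2 ≠ 0 := by
    rintro rfl
    rw [zero_smul] at h2
    exact W.U_ne_zero 1 h2
  have h6 : U (l'⁻¹ * l) = (c1 * (c * (c2⁻¹ * c4))) • 1 := by
    have h7 : U l'⁻¹ * U l' = (c2⁻¹ * c4) • 1 := by
      rw [mul_smul, ← h4, h2, smul_smul, inv_mul_cancel₀ hc2, one_smul]
    rw [h1, h, Matrix.mul_smul, h7, smul_smul, smul_smul, mul_assoc]
  have := W.eq_one_of_scalar h6
  exact (inv_mul_eq_one.1 this).symm

theorem mul_self_eq_one (W : IsoWalk Sp A U) {l : L} {c : ℂ} (h : U l * U l = c • 1) :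
    l * l = 1 := by
  obtain ⟨c1, h1⟩ := W.proj l l
  exact W.eq_one_of_scalar (c := c1 * c) (by rw [h1, h, smul_smul])

end IsoWalk

/-- An integral, positive definite form invariant under `L`. -/
structure InvForm (L : Type*) [Group L] [DistribMulAction L G] (B : LinearMap.BilinForm ℤ G) :
    Prop where
  symm : ∀ x y, B x y = B y x
  pos : ∀ x, x ≠ 0 → 0 < B x x
  inv : ∀ (l : L) x y, B (l • x) (l • y) = B x y

namespace IsoWalk

variable {B : LinearMap.BilinForm ℤ G}

theorem form_const (W : IsoWalk Sp A U) (hB : InvForm L B) {h k : G} (hh : h ∈ neighbours Sp)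
    (hk : k ∈ neighbours Sp) : B k k = B h h := by
  obtain ⟨l, rfl | rfl⟩ := W.exists_smul hh hk
  · rw [hB.inv]
  · simp [hB.inv]

/-- Four steps with `k + k' = q + q'` form a rectangle. -/
theorem rectangle (W : IsoWalk Sp A U) (hB : InvForm L B) {k k' q q' : G}
    (hk : k ∈ neighbours Sp) (hk' : k' ∈ neighbours Sp) (hq : q ∈ neighbours Sp)
    (hq' : q' ∈ neighbours Sp) (e : k + k' = q + q') :
    B (k - q) (k - q') = 0 ∧ B (k + k') (k - q) = 0 ∧ B (k + k') (k - q') = 0 := by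
  have n1 := W.form_const hB hk hk'
  have n2 := W.form_const hB hk hq
  have n3 := W.form_const hB hk hq'
  obtain rfl : k' = q + q' - k := by rw [← e]; abel
  have s1 := hB.symm k q
  have s2 := hB.symm k q'
  have s3 := hB.symm q q'
  simp only [map_sub, map_add, LinearMap.sub_apply, LinearMap.add_apply] at n1 n2 n3 ⊢
  refine ⟨by linarith, by linarith, by linarith⟩

/-- All steps have the same norm, and a sphere is strictly convex, so `h + h` has no other
decomposition. The resulting trace relation reads `2 det (A h) = 0`. -/
theorem det_eq_zero (W : IsoWalk Sp A U) (hB : InvForm L B) {h : G} (hh : h ∈ neighbours Sp) :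
    (A h).det = 0 := by
  have h0 := W.ne_zero_of_mem hh
  have hpos := hB.pos h h0
  have hne : h ≠ -h := by
    intro e
    have : B h h = B h (-h) := by rw [← e]
    rw [map_neg] at this
    linarith
  have hu : UniqueSum Sp h h := by
    intro k hk k' hk' e
    rcases mem_steps.1 hk with rfl | hk
    · rw [zero_add] at e
      exfalso
      rcases mem_steps.1 hk' with rfl | hk'
      · have : B (h + h) h = 0 := by rw [← e]; simp
        simp only [map_add, LinearMap.add_apply] at this
        linarith
      · have := W.form_const hB hh hk'
        rw [e] at this
        simp only [map_add, LinearMap.add_apply] at this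
        linarith
    · rcases mem_steps.1 hk' with rfl | hk'
      · rw [add_zero] at e
        exfalso
        have := W.form_const hB hh hk
        rw [e] at this
        simp only [map_add, LinearMap.add_apply] at this
        linarith
      · have := (W.rectangle hB hk hk' hh hh e).1
        have hkh : k = h := by
          by_contra hne
          exact (hB.pos _ (sub_ne_zero.2 hne)).ne' this
        subst hkh
        exact Or.inl ⟨rfl, add_left_cancel e⟩
  have := W.trace_adjugate_eq_zero (mem_steps.2 (Or.inr hh)) (mem_steps.2 (Or.inr hh)) hne hu
  rw [Matrix.adjugate_mul, Matrix.trace_smul] at this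
  simpa using this

/-- Steps with a uniquely decomposed sum share the column space or the row space. -/
theorem share (W : IsoWalk Sp A U) (hB : InvForm L B) {p q : G} (hp : p ∈ neighbours Sp)
    (hq : q ∈ neighbours Sp) (hu : UniqueSum Sp p q) :
    (A p).adjugate * A q = 0 ∨ A q * (A p).adjugate = 0 := by
  have hpq : q ≠ -p := by
    rintro rfl
    have h0 : (0 : G) ∈ steps Sp := mem_steps.2 (Or.inl rfl)
    rcases hu 0 h0 0 h0 (by simp) with ⟨h, -⟩ | ⟨-, h⟩ <;> exact W.ne_zero_of_mem hp h.symm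
  have h1 := W.trace_adjugate_eq_zero (mem_steps.2 (Or.inr hp)) (mem_steps.2 (Or.inr hq)) hpq hu
  rw [← W.conjTranspose_neg_step] at h1
  rcases perp_of_trace_eq_zero (W.det_eq_zero hB (neg_mem_neighbours hp)) (W.det_eq_zero hB hq) h1
    with h | h
  · left; rwa [W.conjTranspose_neg_step] at h
  · right
    rw [← W.conjTranspose_neg_step, ← Matrix.conjTranspose_eq_zero, Matrix.conjTranspose_mul,
      Matrix.conjTranspose_conjTranspose]
    exact h

/-- The closest pair separated by a partition of the steps has a uniquely decomposed sum. -/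
theorem exists_unique_sum_of_partition (W : IsoWalk Sp A U) (hB : InvForm L B) (P : G → Prop)
    (h1 : ∃ p ∈ neighbours Sp, P p) (h2 : ∃ q ∈ neighbours Sp, ¬ P q)
    (h3 : ∀ h ∈ neighbours Sp, ∃ k ∈ neighbours Sp, k ≠ h ∧ k ≠ -h) :
    ∃ p ∈ neighbours Sp, ∃ q ∈ neighbours Sp, P p ∧ ¬ P q ∧ UniqueSum Sp p q := by
  classical
  obtain ⟨p0, hp0, hP0⟩ := h1
  obtain ⟨q0, hq0, hQ0⟩ := h2
  obtain ⟨⟨p, q⟩, hpq, hmin⟩ := Finset.exists_min_image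
    ((neighbours Sp).filter P ×ˢ (neighbours Sp).filter (fun x => ¬ P x))
    (fun x => B (x.1 - x.2) (x.1 - x.2))
    ⟨(p0, q0), by simp [hp0, hP0, hq0, hQ0]⟩
  simp only [Finset.mem_product, Finset.mem_filter] at hpq
  obtain ⟨⟨hp, hPp⟩, hq, hPq⟩ := hpq
  have hmin' : ∀ x ∈ neighbours Sp, ∀ y ∈ neighbours Sp, P x → ¬ P y →
      B (p - q) (p - q) ≤ B (x - y) (x - y) := fun x hx y hy hPx hPy =>
    hmin (x, y) (by simp [hx, hy, hPx, hPy])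
  have main : ∀ k ∈ neighbours Sp, ∀ k' ∈ neighbours Sp, k + k' = p + q → k = p ∨ k = q := by
    intro k hk k' hk' e
    by_contra hne
    push Not at hne
    have hr := (W.rectangle hB hk hk' hp hq e).1
    have e1 := hB.pos _ (sub_ne_zero.2 hne.1)
    have e2 := hB.pos _ (sub_ne_zero.2 hne.2)
    -- In the rectangle `p, k, q, k'` the segment `p q` is a diagonal, so by Pythagoras `k` is
    -- closer to `p` and to `q` than these are to each other. Whichever side of the partition
    -- contains `k`, this contradicts minimality.
    have e3 : B (p - q) (p - q) = B (k - p) (k - p) + B (k - q) (k - q) := by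
      have : p - q = (k - q) - (k - p) := by abel
      have hr' := hB.symm (k - p) (k - q)
      rw [this]
      generalize k - p = u at *
      generalize k - q = v at *
      simp only [map_sub, LinearMap.sub_apply]
      linarith
    by_cases hPk : P k
    · have := hmin' k hk q hq hPk hPq
      linarith
    · have := hmin' p hp k hk hPp hPk
      have e4 : B (p - k) (p - k) = B (k - p) (k - p) := by
        simp only [map_sub, LinearMap.sub_apply]; ring
      linarith
  -- If `q = -p`, every pair `x, -x` has the same sum, which the previous step excludes for `x ≠
  -- ±p`.
  have hne : q ≠ -p := by
    rintro rfl
    obtain ⟨x, hx, hx1, hx2⟩ := h3 p hp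
    rcases main x hx (-x) (neg_mem_neighbours hx) (by simp) with h | h
    · exact hx1 h
    · exact hx2 h
  -- If `p + q` were a step, equality of norms would give `|p - q|² = 3 |p|²`, while `p + q` is at
  -- squared distance `|p|²` from both `p` and `q`.
  have hno : p + q ∉ neighbours Sp := by
    intro hs
    have n1 := W.form_const hB hp hs
    have n2 := W.form_const hB hp hq
    have hpos := hB.pos p (W.ne_zero_of_mem hp)
    have s := hB.symm p q
    by_cases hPs : P (p + q)
    · have := hmin' _ hs _ hq hPs hPq
      rw [add_sub_cancel_right] at this
      simp only [map_sub, map_add, LinearMap.sub_apply, LinearMap.add_apply] at this n1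
      linarith
    · have := hmin' _ hp _ hs hPp hPs
      rw [sub_add_cancel_left] at this
      simp only [map_sub, map_add, LinearMap.sub_apply, LinearMap.add_apply, map_neg,
        LinearMap.neg_apply] at this n1
      linarith
  refine ⟨p, hp, q, hq, hPp, hPq, ?_⟩
  intro k hk k' hk' e
  rcases mem_steps.1 hk with rfl | hk
  · rw [zero_add] at e
    subst e
    rcases mem_steps.1 hk' with h | h
    · exact absurd (eq_neg_of_add_eq_zero_right h) hne
    · exact absurd h hno
  · rcases mem_steps.1 hk' with rfl | hk'
    · rw [add_zero] at e
      subst e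
      exact absurd hk hno
    · rcases main k hk k' hk' e with rfl | rfl
      · exact Or.inl ⟨rfl, add_left_cancel e⟩
      · exact Or.inr ⟨rfl, by rw [add_comm p] at e; exact add_left_cancel e⟩

end IsoWalk

end Core

/-! ### Eigenvectors of unitary matrices and singular matrices fixed by them -/

section TwoByTwo

variable {X U : Matrix (Fin 2) (Fin 2) ℂ}

theorem star_mul_self_add_ne_zero {a : Fin 2 → ℂ} (ha : a ≠ 0) :
    star (a 0) * a 0 + star (a 1) * a 1 ≠ 0 := by
  intro h0
  have h1 : (Complex.normSq (a 0) + Complex.normSq (a 1) : ℝ) = 0 := by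
    have : ((Complex.normSq (a 0) + Complex.normSq (a 1) : ℝ) : ℂ) = 0 := by
      push_cast
      rw [Complex.normSq_eq_conj_mul_self, Complex.normSq_eq_conj_mul_self]
      exact h0
    exact_mod_cast this
  have p0 := Complex.normSq_nonneg (a 0)
  have p1 := Complex.normSq_nonneg (a 1)
  have q0 : Complex.normSq (a 0) = 0 := by linarith
  have q1 : Complex.normSq (a 1) = 0 := by linarith
  rw [ne_zero_fin_two] at ha
  rcases ha with ha | ha
  · exact ha (Complex.normSq_eq_zero.1 q0)
  · exact ha (Complex.normSq_eq_zero.1 q1)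

theorem exists_eigenvalue_of_wedge {a : Fin 2 → ℂ} (ha : a ≠ 0)
    (h : a 0 * (U *ᵥ a) 1 = a 1 * (U *ᵥ a) 0) :
    ∃ mu : ℂ, U 0 0 * a 0 + U 0 1 * a 1 = mu * a 0 ∧ U 1 0 * a 0 + U 1 1 * a 1 = mu * a 1 := by
  simp only [Matrix.mulVec, dotProduct, Fin.sum_univ_two] at h
  rw [ne_zero_fin_two] at ha
  rcases ha with ha | ha
  · refine ⟨(U 0 0 * a 0 + U 0 1 * a 1) / a 0, by field_simp, ?_⟩
    rw [div_mul_eq_mul_div, eq_div_iff ha]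
    linear_combination h
  · refine ⟨(U 1 0 * a 0 + U 1 1 * a 1) / a 1, ?_, by field_simp⟩
    rw [div_mul_eq_mul_div, eq_div_iff ha]
    linear_combination -h

/-- If both the column and the row of a singular matrix are fixed by a unitary matrix which is not
a scalar, then the matrix is normal or nilpotent. -/
theorem normal_or_nilpotent (hU : U ∈ Matrix.unitaryGroup (Fin 2) ℂ) (hX : X.det = 0) (hX0 : X ≠ 0)
    (h1 : X.adjugate * (U * X * Uᴴ) = 0) (h2 : (U * X * Uᴴ) * X.adjugate = 0)
    (hs : ∀ c : ℂ, U ≠ c • 1) : X.adjugate * Xᴴ = 0 ∨ X.trace = 0 := by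
  obtain ⟨a, b, ha, hb, rfl⟩ := exists_eq_vecMulVec hX hX0
  have hUh : (U * Matrix.vecMulVec a b * Uᴴ) =
      Matrix.vecMulVec (U *ᵥ a) (star (U *ᵥ star b)) := by
    rw [Matrix.mul_vecMulVec, Matrix.vecMulVec_mul, Matrix.star_mulVec, star_star]
  have hinj : ∀ v : Fin 2 → ℂ, v ≠ 0 → U *ᵥ v ≠ 0 := by
    intro v hv h
    apply hv
    have := congrArg (fun w => Uᴴ *ᵥ w) h
    simpa only [Matrix.mulVec_mulVec, conjTranspose_mul_self_of_mem hU, Matrix.one_mulVec,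
      Matrix.mulVec_zero] using this
  have hb' : star b ≠ 0 := star_ne_zero.2 hb
  rw [hUh, adjugate_mul_vecMulVec hb (star_ne_zero.2 (hinj _ hb'))] at h1
  rw [hUh, vecMulVec_mul_adjugate ha (hinj _ ha)] at h2
  rw [Matrix.conjTranspose_vecMulVec, adjugate_mul_vecMulVec hb (star_ne_zero.2 ha)]
  have h2' : star b 0 * (U *ᵥ star b) 1 = star b 1 * (U *ᵥ star b) 0 := by
    have := congrArg star h2
    simpa [mul_comm] using this
  obtain ⟨mu, e0, e1⟩ := exists_eigenvalue_of_wedge ha h1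
  obtain ⟨nu, f0, f1⟩ := exists_eigenvalue_of_wedge hb' h2'
  by_contra hcon
  push Not at hcon
  obtain ⟨hw, ht⟩ := hcon
  simp only [Pi.star_apply] at *
  obtain ⟨⟨u1, u2⟩, u3, u4⟩ := unitary_entries hU
  -- The vectors `a` and `star b` are eigenvectors of `U`. A nonzero trace of `X` says that they are
  -- not orthogonal, so their eigenvalues agree. As they are not parallel either, `U` is this scalar
  -- on a basis.
  have key : star mu * nu = 1 := by
    have ht' : star (a 0) * star (b 0) + star (a 1) * star (b 1) ≠ 0 := by
      intro h
      apply ht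
      rw [Matrix.trace_fin_two, Matrix.vecMulVec_apply, Matrix.vecMulVec_apply]
      have := congrArg star h
      simpa [mul_comm] using this
    have g0 := congrArg star e0
    have g1 := congrArg star e1
    simp only [star_add, star_mul'] at g0 g1
    apply mul_right_cancel₀ ht'
    rw [one_mul]
    calc star mu * nu * (star (a 0) * star (b 0) + star (a 1) * star (b 1))
        = (star mu * star (a 0)) * (nu * star (b 0)) +
            (star mu * star (a 1)) * (nu * star (b 1)) := by ring
      _ = star (a 0) * star (b 0) + star (a 1) * star (b 1) := by
        rw [← g0, ← g1, ← f0, ← f1]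
        linear_combination star (a 0) * star (b 0) * u1 + star (a 0) * star (b 1) * u2 +
          star (a 1) * star (b 0) * u3 + star (a 1) * star (b 1) * u4
  have key2 : star mu * mu = 1 := by
    have g0 := congrArg star e0
    have g1 := congrArg star e1
    simp only [star_add, star_mul'] at g0 g1
    apply mul_right_cancel₀ (star_mul_self_add_ne_zero ha)
    rw [one_mul]
    calc star mu * mu * (star (a 0) * a 0 + star (a 1) * a 1)
        = (star mu * star (a 0)) * (mu * a 0) + (star mu * star (a 1)) * (mu * a 1) := by ring
      _ = star (a 0) * a 0 + star (a 1) * a 1 := by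
        rw [← g0, ← g1, ← e0, ← e1]
        linear_combination star (a 0) * a 0 * u1 + star (a 0) * a 1 * u2 +
          star (a 1) * a 0 * u3 + star (a 1) * a 1 * u4
  have hmn : nu = mu := by
    have hmu : star mu ≠ 0 := by
      intro h; rw [h, zero_mul] at key; exact zero_ne_one key
    exact mul_left_cancel₀ hmu (key.trans key2.symm)
  subst hmn
  have hw' : a 0 * star (b 1) - a 1 * star (b 0) ≠ 0 := sub_ne_zero.2 hw
  apply hs nu
  ext i j
  have z1 : U 0 0 = nu := by
    apply mul_right_cancel₀ hw'
    linear_combination star (b 1) * e0 - a 1 * f0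
  have z2 : U 0 1 = 0 := by
    apply mul_right_cancel₀ hw'
    linear_combination a 0 * f0 - star (b 0) * e0
  have z3 : U 1 0 = 0 := by
    apply mul_right_cancel₀ hw'
    linear_combination star (b 1) * e1 - a 1 * f1
  have z4 : U 1 1 = nu := by
    apply mul_right_cancel₀ hw'
    linear_combination a 0 * f1 - star (b 0) * e1
  fin_cases i <;> fin_cases j <;> simp [z1, z2, z3, z4]

theorem adjugate_eq_neg_of_trace (h : X.trace = 0) : X.adjugate = -X := by
  rw [Matrix.trace_fin_two] at h
  rw [Matrix.adjugate_fin_two]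
  ext i j
  fin_cases i <;> fin_cases j <;> simp
  · linear_combination h
  · linear_combination h

theorem adjugate_ne_zero (h : X ≠ 0) : X.adjugate ≠ 0 := by
  intro h0
  apply h
  have := Matrix.adjugate_adjugate' X
  rw [h0, Matrix.adjugate_zero] at this
  simpa using this.symm

/-- A unitary `2 × 2` matrix has an orthonormal eigenbasis. -/
theorem exists_diagonalization (hU : U ∈ Matrix.unitaryGroup (Fin 2) ℂ) :
    ∃ (W : Matrix (Fin 2) (Fin 2) ℂ) (mu nu : ℂ), W ∈ Matrix.unitaryGroup (Fin 2) ℂ ∧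
      Wᴴ * U * W = !![mu, 0; 0, nu] := by
  obtain ⟨mu, hmu⟩ : ∃ mu : ℂ, (U - mu • 1).det = 0 := by
    obtain ⟨mu, hmu⟩ := IsAlgClosed.exists_root U.charpoly (by
      rw [Matrix.charpoly_degree_eq_dim]; simp)
    refine ⟨mu, ?_⟩
    rw [Polynomial.IsRoot, Matrix.eval_charpoly] at hmu
    rw [← neg_sub, Matrix.det_neg, Matrix.smul_one_eq_diagonal, ← Matrix.scalar_apply, hmu,
      mul_zero]
  obtain ⟨v, hv, hv0⟩ := Matrix.exists_mulVec_eq_zero_iff.2 hmu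
  have hn := star_mul_self_add_ne_zero hv
  set N : ℝ := Complex.normSq (v 0) + Complex.normSq (v 1) with hN
  have hNC : (N : ℂ) = star (v 0) * v 0 + star (v 1) * v 1 := by
    rw [hN]; push_cast
    rw [Complex.normSq_eq_conj_mul_self, Complex.normSq_eq_conj_mul_self]; rfl
  have hN0 : 0 < N := by
    have h0 : N ≠ 0 := by
      intro h; rw [h] at hNC; exact hn (by rw [← hNC]; simp)
    have := Complex.normSq_nonneg (v 0)
    have := Complex.normSq_nonneg (v 1)
    exact lt_of_le_of_ne (by rw [hN]; linarith) (Ne.symm h0)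
  set s : ℂ := (((Real.sqrt N)⁻¹ : ℝ) : ℂ) with hs
  have hss : star s * s * (star (v 0) * v 0 + star (v 1) * v 1) = 1 := by
    rw [← hNC, hs, Complex.star_def, Complex.conj_ofReal]
    norm_cast
    rw [← mul_inv, Real.mul_self_sqrt hN0.le, inv_mul_cancel₀ hN0.ne']
  have hsr : star s = s := by rw [hs, Complex.star_def, Complex.conj_ofReal]
  -- The columns are the normalised eigenvector and the unit vector orthogonal to it. In this basis
  -- `U` is upper triangular and unitary, hence diagonal.
  set W : Matrix (Fin 2) (Fin 2) ℂ := !![s * v 0, -(s * star (v 1)); s * v 1, s * star (v 0)] with hW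
  have hWu : W ∈ Matrix.unitaryGroup (Fin 2) ℂ := by
    rw [Matrix.mem_unitaryGroup_iff', Matrix.star_eq_conjTranspose]
    ext i j
    fin_cases i <;> fin_cases j <;>
      simp only [hW, Matrix.mul_apply, Fin.sum_univ_two, Matrix.conjTranspose_apply] <;> simp
    all_goals simp only [← Complex.star_def, star_star, hsr]; rw [hsr] at hss
    · linear_combination hss
    · ring
    · ring
    · linear_combination hss
  have e0 := congrFun hv0 0
  have e1 := congrFun hv0 1
  simp [Matrix.mulVec, dotProduct, Fin.sum_univ_two] at e0 e1
  set D := Wᴴ * U * W with hD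
  have hDu : D ∈ Matrix.unitaryGroup (Fin 2) ℂ := by
    rw [hD]
    exact mul_mem (mul_mem (Unitary.star_mem hWu) hU) hWu
  have d1 : D 1 0 = 0 := by
    rw [hD]
    simp only [hW, Matrix.mul_apply, Fin.sum_univ_two, Matrix.conjTranspose_apply]
    simp
    simp only [← Complex.star_def, star_star, hsr]
    linear_combination s * s * v 0 * e1 - s * s * v 1 * e0
  obtain ⟨⟨u1, u2⟩, u3, u4⟩ := unitary_entries hDu
  rw [d1] at u1 u2
  have d2 : D 0 1 = 0 := by
    have : star (D 0 0) ≠ 0 := by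
      intro h; rw [h] at u1; simp at u1
    simp only [star_zero, zero_mul, add_zero] at u2
    exact (mul_eq_zero.1 u2).resolve_left this
  refine ⟨W, D 0 0, D 1 1, hWu, ?_⟩
  rw [← hD]
  ext i j
  fin_cases i <;> fin_cases j <;> simp [d1, d2]

end TwoByTwo

/-! ### Freeness of the action on the steps -/

namespace IsoWalk

variable {G : Type*} [AddCommGroup G] [DecidableEq G] {L : Type*} [Group L] [DistribMulAction L G]
variable {Sp : Finset G} {A : G → Matrix (Fin 2) (Fin 2) ℂ} {U : L → Matrix (Fin 2) (Fin 2) ℂ}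
variable {B : LinearMap.BilinForm ℤ G}

open scoped ComplexOrder in
/-- Sharing the row space cannot imply sharing the column space for all pairs of steps. -/
theorem not_colPar_of_rowPar (W : IsoWalk Sp A U) (hB : InvForm L B)
    (h3 : ∀ h ∈ neighbours Sp, ∃ k ∈ neighbours Sp, k ≠ h ∧ k ≠ -h)
    {h : G} (hh : h ∈ neighbours Sp)
    (H : ∀ p ∈ neighbours Sp, ∀ q ∈ neighbours Sp, A q * (A p).adjugate = 0 →
      (A p).adjugate * A q = 0) : False := by
  have hd := fun x (hx : x ∈ neighbours Sp) => W.det_eq_zero hB hx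
  -- The partition is by having the column space of `A h`. It is proper because the columns of `A
  -- (-h) = (adj A_h)†` are orthogonal to those of `A h`. The closest pair across it shares a column
  -- or a row space, and under `H` a column space in any case.
  obtain ⟨p, hp, q, hq, hPp, hPq, hu⟩ := W.exists_unique_sum_of_partition hB
    (fun p => (A h).adjugate * A p = 0)
    ⟨h, hh, by rw [Matrix.adjugate_mul, hd h hh, zero_smul]⟩
    ⟨-h, neg_mem_neighbours hh, by
      rw [W.adj]
      intro h0
      have := Matrix.self_mul_conjTranspose_eq_zero.1 h0
      exact adjugate_ne_zero (W.ne_zero h hh) this⟩ h3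
  have hcp : (A p).adjugate * A q = 0 := by
    rcases W.share hB hp hq hu with h | h
    · exact h
    · exact H p hp q hq h
  exact hPq (colPar_trans (hd h hh) (hd p hp) (hd q hq) (W.ne_zero p hp) hPp hcp)

variable [FaithfulSMul L G]

/-- A group element fixing the column and the row space of one transition matrix is trivial. -/
theorem eq_one_of_colPar_rowPar (W : IsoWalk Sp A U) (hB : InvForm L B)
    (h3 : ∀ h ∈ neighbours Sp, ∃ k ∈ neighbours Sp, k ≠ h ∧ k ≠ -h)
    {h : G} (hh : h ∈ neighbours Sp) {l : L}
    (h1 : (A h).adjugate * A (l • h) = 0) (h2 : A (l • h) * (A h).adjugate = 0) : l = 1 := by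
  by_contra hl
  rw [W.cov] at h1 h2
  rcases normal_or_nilpotent (W.unitary l) (W.det_eq_zero hB hh) (W.ne_zero h hh) h1 h2
    (fun c hc => hl (W.eq_one_of_scalar hc)) with h4 | h4
  -- Normal case: each `A k` has the same column space as its adjoint, so equal row spaces amount to
  -- equal column spaces. The property passes to all steps, since it is preserved by unitary
  -- conjugation and by `X ↦ (adj X)†`.
  · have hall : ∀ k ∈ neighbours Sp, (A k).adjugate * (A k)ᴴ = 0 := by
      intro k hk
      refine W.forall_of_invariant (fun X => X.adjugate * Xᴴ = 0) ?_ ?_ hh hk h4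
      · intro X V hV hX
        rw [adjugate_unitary_conj hV, Matrix.conjTranspose_mul, Matrix.conjTranspose_mul,
          Matrix.conjTranspose_conjTranspose]
        calc V * X.adjugate * Vᴴ * (V * (Xᴴ * Vᴴ))
            = V * (X.adjugate * (Vᴴ * V) * Xᴴ) * Vᴴ := by simp only [Matrix.mul_assoc]
          _ = 0 := by rw [conjTranspose_mul_self_of_mem hV, mul_one, hX]; simp
      · intro X hX
        have := colPar_symm hX
        rw [← Matrix.adjugate_conjTranspose] at this
        have h5 := congrArg Matrix.conjTranspose this
        rw [Matrix.conjTranspose_mul, Matrix.conjTranspose_conjTranspose,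
          Matrix.conjTranspose_zero] at h5
        rw [Matrix.conjTranspose_conjTranspose, Matrix.adjugate_conjTranspose,
          Matrix.adjugate_adjugate']
        simpa using h5
    refine W.not_colPar_of_rowPar hB h3 hh fun p hp q hq hpq => ?_
    have dp := W.det_eq_zero hB hp
    have dq := W.det_eq_zero hB hq
    have dp' : ((A p)ᴴ).det = 0 := by rw [Matrix.det_conjTranspose, dp, star_zero]
    have dq' : ((A q)ᴴ).det = 0 := by rw [Matrix.det_conjTranspose, dq, star_zero]
    have e : ((A p)ᴴ).adjugate * (A q)ᴴ = 0 := by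
      rw [← Matrix.adjugate_conjTranspose, ← Matrix.conjTranspose_mul, hpq,
        Matrix.conjTranspose_zero]
    have np : (A p)ᴴ ≠ 0 := fun h => W.ne_zero p hp (Matrix.conjTranspose_eq_zero.1 h)
    have nq : (A q)ᴴ ≠ 0 := fun h => W.ne_zero q hq (Matrix.conjTranspose_eq_zero.1 h)
    exact colPar_trans dp dp' dq np (hall p hp)
      (colPar_trans dp' dq' dq nq e (colPar_symm (hall q hq)))
  -- Nilpotent case: here `adj X = -X`, so taking the adjugate of the row relation gives the column
  -- relation.
  · have hall : ∀ k ∈ neighbours Sp, (A k).trace = 0 := by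
      intro k hk
      refine W.forall_of_invariant (fun X => X.trace = 0) ?_ ?_ hh hk h4
      · intro X V hV hX
        rw [trace_unitary_conj hV, hX]
      · intro X hX
        rw [Matrix.trace_conjTranspose, trace_adjugate_fin_two, hX, star_zero]
    refine W.not_colPar_of_rowPar hB h3 hh fun p hp q hq hpq => ?_
    have ep := adjugate_eq_neg_of_trace (hall p hp)
    have eq := adjugate_eq_neg_of_trace (hall q hq)
    have := congrArg Matrix.adjugate hpq
    rw [Matrix.adjugate_mul_distrib, Matrix.adjugate_adjugate', Matrix.adjugate_zero, eq] at this
    rw [ep]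
    simpa using this

/-- If `l` fixes `h`, it fixes `A h` and so both its column and its row space. Hence `L` acts freely
on the steps. -/
theorem eq_one_of_smul_eq (W : IsoWalk Sp A U) (hB : InvForm L B)
    (h3 : ∀ h ∈ neighbours Sp, ∃ k ∈ neighbours Sp, k ≠ h ∧ k ≠ -h)
    {h : G} (hh : h ∈ neighbours Sp) {l : L} (hl : l • h = h) : l = 1 := by
  have hd := W.det_eq_zero hB hh
  refine W.eq_one_of_colPar_rowPar hB h3 hh ?_ ?_
  · rw [hl, Matrix.adjugate_mul, hd, zero_smul]
  · rw [hl, Matrix.mul_adjugate, hd, zero_smul]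

end IsoWalk

theorem adjugate_sum_fin_two {ι : Type*} (s : Finset ι) (F : ι → Matrix (Fin 2) (Fin 2) ℂ) :
    (∑ h ∈ s, F h).adjugate = ∑ h ∈ s, (F h).adjugate := by
  classical
  induction s using Finset.induction_on with
  | empty => simp
  | insert a s ha ih =>
    rw [Finset.sum_insert ha, Finset.sum_insert ha, ← ih, Matrix.adjugate_fin_two,
      Matrix.adjugate_fin_two, Matrix.adjugate_fin_two]
    ext i j
    fin_cases i <;> fin_cases j <;> simp [add_comm]

theorem offDiag_eq_zero_of_commute {Y : Matrix (Fin 2) (Fin 2) ℂ} {mu nu : ℂ} (hne : mu ≠ nu)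
    (h : !![mu, 0; 0, nu] * Y = Y * !![mu, 0; 0, nu]) : Y 0 1 = 0 ∧ Y 1 0 = 0 := by
  have e01 := congrFun (congrFun h 0) 1
  have e10 := congrFun (congrFun h 1) 0
  simp [Matrix.mul_apply, Fin.sum_univ_two] at e01 e10
  have hs : mu - nu ≠ 0 := sub_ne_zero.2 hne
  constructor
  · apply mul_left_cancel₀ hs
    linear_combination e01
  · apply mul_left_cancel₀ hs
    linear_combination -e10

/-! ### Pushing a walk forward along an endomorphism of the group -/

namespace IsoWalk

variable {G : Type*} [AddCommGroup G] [DecidableEq G] {L : Type*} [Group L] [DistribMulAction L G]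
variable {Sp : Finset G} {A : G → Matrix (Fin 2) (Fin 2) ℂ} {U : L → Matrix (Fin 2) (Fin 2) ℂ}

/-- The transition matrices of the walk pushed forward along `f`. -/
def push (Sp : Finset G) (A : G → Matrix (Fin 2) (Fin 2) ℂ) (f : G →+ G) (x : G) :
    Matrix (Fin 2) (Fin 2) ℂ := ∑ h ∈ (steps Sp).filter (fun h => f h = x), A h

theorem push_neg (W : IsoWalk Sp A U) (f : G →+ G) (x : G) :
    push Sp A f (-x) = ((push Sp A f x).adjugate)ᴴ := by
  rw [push, push, adjugate_sum_fin_two, Matrix.conjTranspose_sum]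
  refine Finset.sum_nbij' (fun h => -h) (fun h => -h) ?_ ?_ (by simp) (by simp) ?_
  · intro h hh
    rw [Finset.mem_filter] at hh ⊢
    exact ⟨neg_mem_steps hh.1, by rw [map_neg, hh.2, neg_neg]⟩
  · intro h hh
    rw [Finset.mem_filter] at hh ⊢
    exact ⟨neg_mem_steps hh.1, by rw [map_neg, hh.2]⟩
  · intro h hh
    rw [← W.adj, neg_neg]

/-- Pulling the test function back along `f` and grouping the steps by fibres; in other words, `f`
induces a homomorphism of group algebras respecting the involution. -/
theorem push_conv (W : IsoWalk Sp A U) (f : G →+ G) :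
    IsConvUnitary ((steps Sp).image f) (push Sp A f) := by
  intro φ
  have := W.conv (fun x => φ (f x))
  rw [map_zero] at this
  rw [← this]
  have hmaps : ∀ h ∈ steps Sp, f h ∈ (steps Sp).image f := fun h hh =>
    Finset.mem_image_of_mem _ hh
  rw [← Finset.sum_fiberwise_of_maps_to hmaps]
  refine Finset.sum_congr rfl fun x _ => ?_
  simp_rw [← Finset.sum_fiberwise_of_maps_to hmaps (fun h' => φ (f (h' - _)) • _)]
  rw [Finset.sum_comm]
  refine Finset.sum_congr rfl fun y _ => ?_
  rw [push, push, Matrix.conjTranspose_sum, Finset.sum_mul_sum, Finset.smul_sum]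
  refine Finset.sum_congr rfl fun h hh => ?_
  rw [Finset.smul_sum]
  refine Finset.sum_congr rfl fun h' hh' => ?_
  rw [Finset.mem_filter] at hh hh'
  rw [map_sub, hh.2, hh'.2]

theorem push_sum (W : IsoWalk Sp A U) (f : G →+ G) :
    ∑ x ∈ (steps Sp).image f, push Sp A f x = 1 := by
  rw [← W.sum]
  exact Finset.sum_fiberwise_of_maps_to (fun h hh => Finset.mem_image_of_mem _ hh) _

theorem push_eq_zero (f : G →+ G) {x : G} (hx : x ∉ (steps Sp).image f) :
    push Sp A f x = 0 := by
  rw [push]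
  refine Finset.sum_eq_zero fun h hh => ?_
  rw [Finset.mem_filter] at hh
  exact absurd (hh.2 ▸ Finset.mem_image_of_mem f hh.1) hx

/-- Conjugation by `U l` permutes the summands within each fibre, because `f ∘ l = f`. -/
theorem push_commute (W : IsoWalk Sp A U) (f : G →+ G) {l : L} (hf : ∀ h, f (l • h) = f h)
    (x : G) : U l * push Sp A f x = push Sp A f x * U l := by
  have e : U l * push Sp A f x * (U l)ᴴ = push Sp A f x := by
    rw [push, Finset.mul_sum, Finset.sum_mul]
    refine Finset.sum_nbij' (fun h => l • h) (fun h => l⁻¹ • h) ?_ ?_ (by simp) (by simp) ?_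
    · intro h hh
      rw [Finset.mem_filter] at hh ⊢
      exact ⟨W.smul_mem_steps l hh.1, by rw [hf, hh.2]⟩
    · intro h hh
      rw [Finset.mem_filter] at hh ⊢
      exact ⟨W.smul_mem_steps _ hh.1, by rw [← hf, smul_inv_smul, hh.2]⟩
    · intro h hh
      rw [W.cov]
  conv_rhs => rw [← e]
  rw [Matrix.mul_assoc _ _ (U l), conjTranspose_mul_self_of_mem (W.unitary l), mul_one]

theorem trace_push_re (W : IsoWalk Sp A U) (f : G →+ G) {h : G} (hh : h ∈ neighbours Sp) {x : G}
    (hx : x ≠ 0) : (push Sp A f x).trace.re =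
      ((steps Sp).filter (fun h => f h = x)).card * (A h).trace.re := by
  rw [push, Matrix.trace_sum, Complex.re_sum, Finset.sum_congr rfl (g := fun _ => (A h).trace.re)]
  · rw [Finset.sum_const, nsmul_eq_mul]
  · intro k hk
    rw [Finset.mem_filter, mem_steps] at hk
    rcases hk.1 with rfl | hk1
    · exact absurd (by rw [← hk.2, map_zero]) hx
    · exact W.trace_re_const hh hk1

theorem trace_push_zero_re (f : G →+ G)
    (hσ : ∀ h ∈ neighbours Sp, (A h).trace.re = 0) :
    (push Sp A f 0).trace.re = (A 0).trace.re := by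
  rw [push, Matrix.trace_sum, Complex.re_sum]
  refine Finset.sum_eq_single 0 ?_ ?_
  · intro k hk hk0
    rw [Finset.mem_filter, mem_steps] at hk
    exact hσ k (hk.1.resolve_left hk0)
  · intro h
    exact absurd (show (0 : G) ∈ (steps Sp).filter (fun h => f h = 0) from
      Finset.mem_filter.2 ⟨mem_steps.2 (Or.inl rfl), map_zero f⟩) h

theorem trace_conjTranspose_mul_self (X : Matrix (Fin 2) (Fin 2) ℂ) : (Xᴴ * X).trace =
    ((Complex.normSq (X 0 0) + Complex.normSq (X 0 1) + Complex.normSq (X 1 0) +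
      Complex.normSq (X 1 1) : ℝ) : ℂ) := by
  rw [Matrix.trace_fin_two]
  simp only [Matrix.mul_apply, Fin.sum_univ_two, Matrix.conjTranspose_apply]
  push_cast
  simp only [Complex.normSq_eq_conj_mul_self, Complex.star_def]
  ring

/-- The trace of the unitarity relation at `0`: the squared Hilbert–Schmidt norms add up to the coin
dimension. -/
theorem sum_normSq (W : IsoWalk Sp A U) :
    ∑ h ∈ steps Sp, (Complex.normSq (A h 0 0) + Complex.normSq (A h 0 1) +
      Complex.normSq (A h 1 0) + Complex.normSq (A h 1 1)) = 2 := by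
  have := congrArg Matrix.trace (W.conv (fun x => if x = 0 then 1 else 0))
  simp only [if_true, one_smul, Matrix.trace_one, Fintype.card_fin, Matrix.trace_sum,
    Matrix.trace_smul, smul_eq_mul] at this
  have e : ∀ h ∈ steps Sp, ∑ h' ∈ steps Sp, (if h' - h = 0 then (1 : ℂ) else 0) *
      ((A h)ᴴ * A h').trace = ((A h)ᴴ * A h).trace := by
    intro h hh
    rw [Finset.sum_eq_single h]
    · simp
    · intro b _ hb
      rw [if_neg (sub_ne_zero.2 hb), zero_mul]
    · intro hn; exact absurd hh hn
  rw [Finset.sum_congr rfl e] at this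
  simp only [trace_conjTranspose_mul_self] at this
  exact_mod_cast this

variable [FaithfulSMul L G]

/-- A pushforward invariant under a nontrivial group element maps the steps to at most three
points `0`, `g`, `-g`. -/
theorem exists_image_subset [TwoUniqueSums G] [IsAddTorsionFree G] (W : IsoWalk Sp A U)
    (f : G →+ G) {l : L} (hl : l ≠ 1) (hf : ∀ h, f (l • h) = f h) :
    ∃ g, ∀ h ∈ neighbours Sp, f h = 0 ∨ f h = g ∨ f h = -g := by
  obtain ⟨V, mu, nu, hV, hD⟩ := exists_diagonalization (W.unitary l)
  have hV1 := conjTranspose_mul_self_of_mem hV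
  have hV2 := mul_conjTranspose_self_of_mem hV
  have hne : mu ≠ nu := by
    rintro rfl
    apply hl
    apply W.eq_one_of_scalar (c := mu)
    have h1 : U l = V * (Vᴴ * U l * V) * Vᴴ := by
      calc U l = (V * Vᴴ) * U l * (V * Vᴴ) := by rw [hV2, one_mul, mul_one]
        _ = _ := by simp only [Matrix.mul_assoc]
    have h2 : !![mu, 0; 0, mu] = mu • (1 : Matrix (Fin 2) (Fin 2) ℂ) := by
      ext i j; fin_cases i <;> fin_cases j <;> simp
    rw [h1, hD, h2, Matrix.mul_smul, mul_one, Matrix.smul_mul, hV2]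
  set Y : G → Matrix (Fin 2) (Fin 2) ℂ := fun x => Vᴴ * push Sp A f x * V with hY
  -- `U l` has distinct eigenvalues, so what commutes with it is diagonal in its eigenbasis.
  have hoff : ∀ x, Y x 0 1 = 0 ∧ Y x 1 0 = 0 := by
    intro x
    apply offDiag_eq_zero_of_commute hne
    rw [← hD, hY]
    calc Vᴴ * U l * V * (Vᴴ * push Sp A f x * V)
        = Vᴴ * (U l * (V * Vᴴ) * push Sp A f x) * V := by simp only [Matrix.mul_assoc]
      _ = Vᴴ * (push Sp A f x * (V * Vᴴ) * U l) * V := by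
        rw [hV2, mul_one, mul_one, W.push_commute f hf]
      _ = _ := by simp only [Matrix.mul_assoc]
  have hneg : ∀ x, Y (-x) = ((Y x).adjugate)ᴴ := by
    intro x
    have hVs : Vᴴ ∈ Matrix.unitaryGroup (Fin 2) ℂ := Unitary.star_mem hV
    have := adjugate_unitary_conj (X := push Sp A f x) hVs
    rw [Matrix.conjTranspose_conjTranspose] at this
    simp only [hY]
    rw [this, W.push_neg, Matrix.conjTranspose_mul, Matrix.conjTranspose_mul,
      Matrix.conjTranspose_conjTranspose, Matrix.mul_assoc]
  have h11 : ∀ x, Y (-x) 1 1 = star (Y x 0 0) := by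
    intro x
    rw [hneg, Matrix.conjTranspose_apply, Matrix.adjugate_fin_two]
    simp
  -- The upper diagonal entry of the pushforward is a scalar walk, hence concentrated at one element
  -- `g`, with value `1` by normalisation. By `h11` the lower entry is concentrated at `-g`.
  obtain ⟨g, hgT, hg0, hgu⟩ := support_subsingleton_of_unitary ((steps Sp).image f)
    (fun x => Y x 0 0) (by
      intro φ
      have h1 := W.push_conv f φ
      have h2 := congrArg (fun M => (Vᴴ * M * V) 0 0) h1
      simp only [Finset.mul_sum, Finset.sum_mul, Matrix.sum_apply, Matrix.mul_smul,
        Matrix.smul_mul, mul_one, hV1, Matrix.smul_apply, Matrix.one_apply_eq, smul_eq_mul] at h2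
      rw [← h2]
      refine Finset.sum_congr rfl fun x _ => Finset.sum_congr rfl fun y _ => ?_
      congr 1
      have h3 : Vᴴ * ((push Sp A f x)ᴴ * push Sp A f y) * V = (Y x)ᴴ * Y y := by
        simp only [hY, Matrix.conjTranspose_mul, Matrix.conjTranspose_conjTranspose]
        calc _ = Vᴴ * ((push Sp A f x)ᴴ * 1 * push Sp A f y) * V := by rw [mul_one]
          _ = _ := by rw [← hV2]; simp only [Matrix.mul_assoc]
      rw [h3, Matrix.mul_apply, Fin.sum_univ_two, Matrix.conjTranspose_apply,
        Matrix.conjTranspose_apply, (hoff x).2]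
      simp)
  have hY0 : ∀ x, x ≠ g → Y x 0 0 = 0 := by
    intro x hx
    by_cases hxT : x ∈ (steps Sp).image f
    · by_contra h0
      exact hx (hgu x hxT h0)
    · simp only [hY]
      rw [push_eq_zero f hxT]
      simp
  have hYg : Y g 0 0 = 1 := by
    have h1 := congrArg (fun M => (Vᴴ * M * V) 0 0) (W.push_sum f)
    simp only [Finset.mul_sum, Finset.sum_mul, Matrix.sum_apply, mul_one, hV1,
      Matrix.one_apply_eq] at h1
    rw [← h1]
    exact (Finset.sum_eq_single g (fun x _ hx => hY0 x hx) (fun h => absurd hgT h)).symm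
  have htr : ∀ x, (push Sp A f x).trace = Y x 0 0 + star (Y (-x) 0 0) := by
    intro x
    have h1 := h11 (-x)
    rw [neg_neg] at h1
    rw [← h1, ← Matrix.trace_fin_two]
    simp only [hY]
    rw [Matrix.trace_mul_comm, ← Matrix.mul_assoc, hV2, one_mul]
  refine ⟨g, fun h0 hh0 => ?_⟩
  by_contra hcon
  push Not at hcon
  obtain ⟨c0, cg, cng⟩ := hcon
  -- At `f h0`, which is neither of `g` and `-g`, the pushforward vanishes. Its trace has real part
  -- a positive multiple of the common value of `Re tr A_h`, so this value is zero.
  have hσ0 : (A h0).trace.re = 0 := by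
    have h1 := W.trace_push_re f hh0 c0
    rw [htr, hY0 _ cg, hY0 (-f h0) (fun h => cng (by rw [← h, neg_neg]))] at h1
    simp only [star_zero, add_zero, Complex.zero_re] at h1
    refine (mul_eq_zero.1 h1.symm).resolve_left ?_
    rw [Nat.cast_eq_zero, Finset.card_eq_zero]
    exact Finset.ne_empty_of_mem (Finset.mem_filter.2 ⟨mem_steps.2 (Or.inr hh0), rfl⟩)
  have hσ : ∀ h ∈ neighbours Sp, (A h).trace.re = 0 := fun h hh => by
    rw [W.trace_re_const hh0 hh, hσ0]
  -- If `g = 0`, then `Re tr A_0 = 2`, and `A 0` exhausts the total norm `2`, leaving nothing for `A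
  -- h0`. If `g ≠ 0`, the pushforward has trace `1` at `g`, whereas its real part is a multiple of
  -- `Re tr A_h = 0`.
  by_cases hg : g = 0
  · subst hg
    have h1 := trace_push_zero_re f hσ
    rw [htr, neg_zero, hYg] at h1
    have h2 := W.adj 0
    rw [neg_zero] at h2
    have h00 : A 0 0 0 = star (A 0 1 1) := by
      conv_lhs => rw [h2]
      rw [Matrix.conjTranspose_apply, Matrix.adjugate_fin_two]; simp
    rw [Matrix.trace_fin_two, h00] at h1
    simp at h1
    have hs := W.sum_normSq
    have hsub : ({0, h0} : Finset G) ⊆ steps Sp := by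
      intro x hx
      rw [Finset.mem_insert, Finset.mem_singleton] at hx
      rcases hx with rfl | rfl
      · exact mem_steps.2 (Or.inl rfl)
      · exact mem_steps.2 (Or.inr hh0)
    have hle := Finset.sum_le_sum_of_subset_of_nonneg (f := fun h =>
      (Complex.normSq (A h 0 0) + Complex.normSq (A h 0 1) +
      Complex.normSq (A h 1 0) + Complex.normSq (A h 1 1))) hsub (fun h _ _ => by
        have := Complex.normSq_nonneg (A h 0 0)
        have := Complex.normSq_nonneg (A h 0 1)
        have := Complex.normSq_nonneg (A h 1 0)
        have := Complex.normSq_nonneg (A h 1 1)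
        positivity)
    rw [hs, Finset.sum_pair (W.ne_zero_of_mem hh0).symm] at hle
    have n00 : 1 ≤ Complex.normSq (A 0 0 0) := by
      rw [h00, Complex.normSq_apply]
      simp
      nlinarith [mul_self_nonneg (A 0 1 1).im]
    have n11 : 1 ≤ Complex.normSq (A 0 1 1) := by
      rw [Complex.normSq_apply]
      nlinarith [mul_self_nonneg (A 0 1 1).im]
    have m01 := Complex.normSq_nonneg (A 0 0 1)
    have m10 := Complex.normSq_nonneg (A 0 1 0)
    have k00 := Complex.normSq_nonneg (A h0 0 0)
    have k01 := Complex.normSq_nonneg (A h0 0 1)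
    have k10 := Complex.normSq_nonneg (A h0 1 0)
    have k11 := Complex.normSq_nonneg (A h0 1 1)
    apply W.ne_zero h0 hh0
    ext i j
    fin_cases i <;> fin_cases j <;> apply Complex.normSq_eq_zero.1 <;> dsimp <;> linarith
  · have h1 := W.trace_push_re f hh0 hg
    rw [hσ0, mul_zero, htr, hYg, hY0 (-g) (by
      intro h
      apply hg
      have : (2 : ℕ) • g = 0 := by rw [two_nsmul]; nth_rewrite 1 [← h]; simp
      exact (smul_eq_zero.1 this).resolve_left two_ne_zero)] at h1
    simp at h1

end IsoWalk

/-! ### Invariant forms and orthogonality -/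

section Forms

variable {G : Type*} [AddCommGroup G] [DecidableEq G] {L : Type*} [Group L] [DistribMulAction L G]

/-- The standard form in a basis, summed over the finite group `L`; the summand of the identity
already gives positivity. -/
theorem exists_invForm (G : Type*) [AddCommGroup G] [Module.Free ℤ G] [Module.Finite ℤ G]
    (L : Type*) [Group L] [DistribMulAction L G] [Finite L] :
    ∃ B : LinearMap.BilinForm ℤ G, InvForm L B := by
  classical
  have := Fintype.ofFinite L
  let b := Module.Free.chooseBasis ℤ G
  refine ⟨LinearMap.mk₂ ℤ (fun x y => ∑ l : L, ∑ i, b.repr (l • x) i * b.repr (l • y) i)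
    ?_ ?_ ?_ ?_, ?_, ?_, ?_⟩
  · intro x x' y
    simp only [smul_add, map_add, Finsupp.add_apply, add_mul, Finset.sum_add_distrib]
  · intro c x y
    simp only [smul_comm _ c x, map_smul, Finsupp.smul_apply, smul_eq_mul, mul_assoc,
      Finset.mul_sum]
  · intro x y y'
    simp only [smul_add, map_add, Finsupp.add_apply, mul_add, Finset.sum_add_distrib]
  · intro c x y
    simp only [smul_comm _ c y, map_smul, Finsupp.smul_apply, smul_eq_mul, mul_left_comm _ c,
      Finset.mul_sum]
  · intro x y
    simp only [LinearMap.mk₂_apply, mul_comm]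
  · intro x hx
    simp only [LinearMap.mk₂_apply]
    have hnn : ∀ l : L, 0 ≤ ∑ i, b.repr (l • x) i * b.repr (l • x) i := fun l =>
      Finset.sum_nonneg fun i _ => mul_self_nonneg _
    refine lt_of_lt_of_le ?_ (Finset.single_le_sum (f := fun l : L =>
      ∑ i, b.repr (l • x) i * b.repr (l • x) i) (fun l _ => hnn l) (Finset.mem_univ 1))
    rw [one_smul]
    have : b.repr x ≠ 0 := fun h => hx (b.repr.map_eq_zero_iff.1 h)
    obtain ⟨i, hi⟩ := Finsupp.ne_iff.1 this
    exact lt_of_lt_of_le (mul_self_pos.2 hi) (Finset.single_le_sum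
      (f := fun i => b.repr x i * b.repr x i) (fun i _ => mul_self_nonneg _) (Finset.mem_univ i))
  · intro l x y
    simp only [LinearMap.mk₂_apply, smul_smul]
    exact Equiv.sum_comp (Equiv.mulRight l) (fun l' : L => ∑ i, b.repr (l' • x) i * b.repr (l' • y) i)

variable {B : LinearMap.BilinForm ℤ G}

/-- The number of pairwise orthogonal nonzero vectors is bounded by the rank. -/
theorem InvForm.card_le_finrank [Module.Finite ℤ G] (hB : InvForm L B) {k : ℕ} (v : Fin k → G)
    (h0 : ∀ i, v i ≠ 0) (h : ∀ i j, i ≠ j → B (v i) (v j) = 0) : k ≤ Module.finrank ℤ G := by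
  have : LinearIndependent ℤ v := by
    rw [linearIndependent_iff']
    intro s c hc i hi
    have h1 := congrArg (fun x => B x (v i)) hc
    simp only [map_sum, LinearMap.sum_apply, map_smul, LinearMap.smul_apply, smul_eq_mul, map_zero,
      LinearMap.zero_apply] at h1
    rw [Finset.sum_eq_single i (fun j _ hj => by rw [h j i hj, mul_zero])
      (fun hn => absurd hi hn)] at h1
    exact (mul_eq_zero.1 h1).resolve_right (hB.pos _ (h0 i)).ne'
  simpa using this.fintype_card_le_finrank

theorem InvForm.eq_zero_of_rank_two [Module.Finite ℤ G] (hB : InvForm L B)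
    (hr : Module.finrank ℤ G = 2) {x y z : G} (hx : x ≠ 0) (hy : y ≠ 0) (hxy : B x y = 0)
    (hxz : B x z = 0) (hyz : B y z = 0) : z = 0 := by
  by_contra hz
  have := hB.card_le_finrank ![x, y, z] (by
    intro i; fin_cases i
    exacts [hx, hy, hz]) (by
    intro i j hij
    have h1 := hB.symm y x
    have h2 := hB.symm z x
    have h3 := hB.symm z y
    fin_cases i <;> fin_cases j <;> simp_all)
  omega

theorem InvForm.eq_zero_of_rank_three [Module.Finite ℤ G] (hB : InvForm L B)
    (hr : Module.finrank ℤ G = 3) {x y z w : G} (hx : x ≠ 0) (hy : y ≠ 0) (hz : z ≠ 0)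
    (hxy : B x y = 0) (hxz : B x z = 0) (hyz : B y z = 0) (hxw : B x w = 0) (hyw : B y w = 0)
    (hzw : B z w = 0) : w = 0 := by
  by_contra hw
  have := hB.card_le_finrank ![x, y, z, w] (by
    intro i; fin_cases i
    exacts [hx, hy, hz, hw]) (by
    intro i j hij
    have h1 := hB.symm y x
    have h2 := hB.symm z x
    have h3 := hB.symm z y
    have h4 := hB.symm w x
    have h5 := hB.symm w y
    have h6 := hB.symm w z
    fin_cases i <;> fin_cases j <;> simp_all)
  omega

theorem InvForm.ne_neg (hB : InvForm L B) {x : G} (hx : x ≠ 0) : x ≠ -x := by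
  intro h
  have h1 := hB.pos x hx
  have : B x x = B x (-x) := by rw [← h]
  rw [map_neg] at this
  linarith

/-! ### Generating sets -/

theorem finrank_le_one_of_generates [Module.Finite ℤ G] {Sp : Finset G}
    (hgen : AddSubgroup.closure (Sp : Set G) = ⊤) {x : G} (h : ∀ k ∈ Sp, k = x ∨ k = -x) :
    Module.finrank ℤ G ≤ 1 := by
  have : Submodule.span ℤ ({x} : Set G) = ⊤ := by
    rw [eq_top_iff, ← AddSubgroup.toIntSubmodule.map_top, ← hgen]
    change AddSubgroup.closure _ ≤ (Submodule.span ℤ {x}).toAddSubgroup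
    rw [AddSubgroup.closure_le]
    intro k hk
    have hx := Submodule.mem_span_singleton_self (R := ℤ) x
    rcases h k hk with rfl | rfl
    · exact hx
    · exact neg_mem hx
  have h2 := finrank_span_finset_le_card (R := ℤ) ({x} : Finset G)
  rw [Set.finrank, Finset.coe_singleton, this, finrank_top] at h2
  simpa using h2

theorem finrank_le_two_of_generates [Module.Finite ℤ G] {Sp : Finset G}
    (hgen : AddSubgroup.closure (Sp : Set G) = ⊤) {x y : G}
    (h : ∀ k ∈ Sp, (k = x ∨ k = -x) ∨ (k = y ∨ k = -y)) :
    Module.finrank ℤ G ≤ 2 := by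
  have : Submodule.span ℤ ({x, y} : Set G) = ⊤ := by
    rw [eq_top_iff, ← AddSubgroup.toIntSubmodule.map_top, ← hgen]
    change AddSubgroup.closure _ ≤ (Submodule.span ℤ {x, y}).toAddSubgroup
    rw [AddSubgroup.closure_le]
    intro k hk
    have hx : x ∈ Submodule.span ℤ ({x, y} : Set G) := Submodule.subset_span (by simp)
    have hy : y ∈ Submodule.span ℤ ({x, y} : Set G) := Submodule.subset_span (by simp)
    rcases h k hk with (rfl | rfl) | (rfl | rfl)
    · exact hx
    · exact neg_mem hx
    · exact hy
    · exact neg_mem hy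
  have h2 := finrank_span_finset_le_card (R := ℤ) ({x, y} : Finset G)
  rw [Set.finrank, Finset.coe_pair, this, finrank_top] at h2
  exact h2.trans Finset.card_le_two

end Forms

/-! ### Transposition of walks and a criterion for involutions -/

namespace IsoWalk

variable {G : Type*} [AddCommGroup G] [DecidableEq G] {L : Type*} [Group L] [DistribMulAction L G]
variable {Sp : Finset G} {A : G → Matrix (Fin 2) (Fin 2) ℂ} {U : L → Matrix (Fin 2) (Fin 2) ℂ}
variable {B : LinearMap.BilinForm ℤ G}

theorem exists_ne_of_finrank [Module.Finite ℤ G] (W : IsoWalk Sp A U)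
    (hr : 2 ≤ Module.finrank ℤ G) :
    ∀ h ∈ neighbours Sp, ∃ k ∈ neighbours Sp, k ≠ h ∧ k ≠ -h := by
  intro h _
  by_contra hcon
  push Not at hcon
  have := finrank_le_one_of_generates W.gen (x := h) (fun k hk => by
    by_cases hkh : k = h
    · exact Or.inl hkh
    · exact Or.inr (hcon k (mem_neighbours.2 (Or.inl hk)) hkh))
  omega

/-- The walk with transposed transition matrices. -/
theorem transpose (W : IsoWalk Sp A U) :
    IsoWalk Sp (fun h => (A h)ᵀ) (fun l => (U l).map star) where
  gen := W.gen
  zero_notMem := W.zero_notMem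
  ne_zero h hh h0 := W.ne_zero h hh (by simpa using congrArg Matrix.transpose h0)
  eq_zero h hh := by rw [W.eq_zero h hh, Matrix.transpose_zero]
  conv := by
    have h1 := (isConvUnitary_iff _ _).1 W.conv
    -- Matrices over the commutative group algebra have two-sided inverses. The transposed relation
    -- thus comes from `M M† = 1`. Transposition exchanges column and row spaces, which halves later
    -- case distinctions.
    have h2 := mul_eq_one_comm.1 h1
    rw [isConvUnitary_iff]
    have e1 : symbol (steps Sp) (fun h => (A h)ᵀ) = (symbol (steps Sp) A)ᵀ := by
      ext i j; simp [symbol]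
    have e2 : symbolAdj (symbol (steps Sp) A)ᵀ = (symbolAdj (symbol (steps Sp) A))ᵀ := by
      ext i j; simp [symbolAdj]
    rw [e1, e2, ← Matrix.transpose_mul, h2, Matrix.transpose_one]
  adj h := by
    rw [W.adj, ← Matrix.adjugate_transpose]
    rfl
  sum := by rw [← Matrix.transpose_sum, W.sum, Matrix.transpose_one]
  mem := W.mem
  unitary l := by
    rw [Matrix.mem_unitaryGroup_iff, Matrix.star_eq_conjTranspose]
    ext i j
    have h := congrArg star (congrFun (congrFun (mul_conjTranspose_self_of_mem (W.unitary l)) i) j)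
    rw [Matrix.mul_apply, star_sum] at h
    rw [Matrix.mul_apply]
    simp only [Matrix.conjTranspose_apply, Matrix.map_apply, star_mul', star_star] at h ⊢
    rw [h, Matrix.one_apply]
    split_ifs <;> simp
  proj l l' := by
    obtain ⟨c, hc⟩ := W.proj l l'
    refine ⟨star c, ?_⟩
    rw [hc]
    ext i j
    simp [Matrix.mul_apply]
  cov l h := by
    rw [W.cov, Matrix.transpose_mul, Matrix.transpose_mul, ← Matrix.mul_assoc]
    congr 1
    ext i j
    simp
  trans := W.trans
  inj h hh h' hh' e := W.inj h hh h' hh' (Matrix.transpose_injective e)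

variable [FaithfulSMul L G]

/-- A generator orthogonal to its image under `l` forces `l` to be an involution. -/
theorem mul_self_eq_one_of_trace (W : IsoWalk Sp A U) (hB : InvForm L B) {h : G}
    (hh : h ∈ neighbours Sp) {l : L} (ht : ((A (l • h))ᴴ * A h).trace = 0) : l * l = 1 := by
  have hd := W.det_eq_zero hB hh
  have hn := W.ne_zero h hh
  have hU := W.unitary l
  suffices ∃ c : ℂ, U l * U l = c • (1 : Matrix (Fin 2) (Fin 2) ℂ) by
    obtain ⟨c, hc⟩ := this
    exact W.mul_self_eq_one hc
  -- Either the columns or the rows of `A h` and `A (l • h)` are orthogonal. In both cases `U l`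
  -- maps some vector to an orthogonal one, so it is traceless and its square is a scalar.
  rcases perp_of_trace_eq_zero (W.det_eq_zero hB (W.smul_mem l hh)) hd ht with h1 | h1
  · refine sq_eq_smul_of_perp hU hd hn ?_
    rw [W.cov] at h1
    have h2 := congrArg (fun M => ((U l)ᴴ * M)ᴴ) h1
    simp only [Matrix.conjTranspose_mul, Matrix.conjTranspose_conjTranspose, Matrix.mul_zero,
      Matrix.conjTranspose_zero] at h2
    calc (A h)ᴴ * U l * A h = (A h)ᴴ * (U l * (A h * ((U l)ᴴ * U l))) := by
          rw [conjTranspose_mul_self_of_mem hU, mul_one, Matrix.mul_assoc]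
      _ = 0 := by rw [← h2]; simp only [Matrix.mul_assoc]
  · refine sq_eq_smul_of_perp (X := (A h)ᴴ) hU (by rw [Matrix.det_conjTranspose, hd, star_zero])
      (fun h0 => hn (Matrix.conjTranspose_eq_zero.1 h0)) ?_
    rw [W.cov] at h1
    have h2 := congrArg (fun M => ((U l)ᴴ * M)ᴴ) h1
    simp only [← Matrix.mul_assoc, conjTranspose_mul_self_of_mem hU, one_mul, Matrix.mul_zero,
      Matrix.conjTranspose_zero] at h2
    rw [← h2]
    simp only [Matrix.conjTranspose_mul, Matrix.conjTranspose_conjTranspose, Matrix.mul_assoc]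

end IsoWalk

namespace IsoWalk

variable {G : Type*} [AddCommGroup G] [DecidableEq G] {L : Type*} [Group L] [DistribMulAction L G]
variable {Sp : Finset G} {A : G → Matrix (Fin 2) (Fin 2) ℂ} {U : L → Matrix (Fin 2) (Fin 2) ℂ}
variable {B : LinearMap.BilinForm ℤ G} [FaithfulSMul L G]

/-! ### Rank two: the isotropy group consists of involutions -/

/-- If `h - l h` were not a step, it would be a difference of steps only in the obvious ways, so `A
h` and `A (l h)` would be orthogonal and `l` an involution. Being a step, it has the norm of `h`:
the angle between `h` and `l h` is 60°. -/
theorem two_mul_form_of_rank_two [Module.Finite ℤ G] (W : IsoWalk Sp A U) (hB : InvForm L B)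
    (hr : Module.finrank ℤ G = 2) {h : G} (hh : h ∈ neighbours Sp) {l : L} (hl : l * l ≠ 1) :
    2 * B h (l • h) = B h h := by
  have h3 := W.exists_ne_of_finrank hr.ge
  have hlh := W.smul_mem l hh
  have hne : l • h ≠ h := fun e => hl (by rw [W.eq_one_of_smul_eq hB h3 hh e, one_mul])
  suffices hs : h - l • h ∈ neighbours Sp by
    have n1 := W.form_const hB hh hs
    have n2 := hB.inv l h h
    have s := hB.symm h (l • h)
    simp only [map_sub, LinearMap.sub_apply] at n1
    linarith
  by_contra hs
  have hs' : l • h - h ∉ neighbours Sp := fun h' => hs (by simpa using neg_mem_neighbours h')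
  refine hl (W.mul_self_eq_one_of_trace hB hh (W.trace_eq_zero_of_unique
    (mem_steps.2 (Or.inr hlh)) (mem_steps.2 (Or.inr hh)) hne.symm ?_))
  intro k hk k' hk' e
  rcases mem_steps.1 hk with rfl | hk
  · rw [sub_zero] at e
    subst e
    rcases mem_steps.1 hk' with h0 | hk'
    · exact absurd (sub_eq_zero.1 h0).symm hne
    · exact absurd hk' hs
  rcases mem_steps.1 hk' with rfl | hk'
  · rw [zero_sub] at e
    exact absurd hk (by rw [← neg_neg k, e, neg_sub]; exact hs')
  obtain ⟨r1, r2, r3⟩ := W.rectangle hB hk' (neg_mem_neighbours hk) hh (neg_mem_neighbours hlh)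
    (by rw [← sub_eq_add_neg, ← sub_eq_add_neg, e])
  by_cases c1 : k' = h
  · subst c1
    exact Or.inl ⟨sub_right_injective e, rfl⟩
  by_cases c2 : k' = -(l • h)
  · subst c2
    refine Or.inr ⟨?_, rfl⟩
    have : k = -(l • h) - (h - l • h) := by rw [← e]; abel
    rw [this]; abel
  exfalso
  have e' : k' + -k = h - l • h := by rw [← e]; abel
  rw [e'] at r2 r3
  have s1 := hB.symm (h - l • h) (k' - h)
  have s2 := hB.symm (h - l • h) (k' - -(l • h))
  -- Another decomposition yields two nonzero orthogonal rectangle sides, both orthogonal to `h - l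
  -- h`. There is no room for this in rank two.
  have := hB.eq_zero_of_rank_two hr (sub_ne_zero.2 c1) (sub_ne_zero.2 c2) r1
    (z := h - l • h) (by rw [← s1]; exact r2) (by rw [← s2]; exact r3)
  exact hne (sub_eq_zero.1 this).symm

/-- The element `l` would act on `h` as a rotation by 60°. Then `l²` rotates `h` by 120°, but if it
is no involution the same lemma demands 60°; if it is one, `l⁶ = 1` gives `l² = 1`. -/
theorem mul_self_eq_one_of_rank_two [Module.Finite ℤ G] (W : IsoWalk Sp A U) (hB : InvForm L B)
    (hr : Module.finrank ℤ G = 2) (l : L) : l * l = 1 := by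
  by_contra hl
  have h3 := W.exists_ne_of_finrank hr.ge
  obtain ⟨h, hh⟩ : ∃ h, h ∈ neighbours Sp := by
    by_contra hcon
    push Not at hcon
    have := finrank_le_one_of_generates W.gen (x := 0) fun k hk =>
      absurd (mem_neighbours.2 (Or.inl hk)) (hcon k)
    omega
  have b1 := W.two_mul_form_of_rank_two hB hr hh hl
  have b2 : B (l • h) ((l * l) • h) = B h (l • h) := by rw [mul_smul, hB.inv]
  have n1 := hB.inv l h h
  have n2 := hB.inv (l * l) h h
  have s1 := hB.symm h (l • h)
  have s2 := hB.symm h ((l * l) • h)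
  have s3 := hB.symm (l • h) ((l * l) • h)
  have h0 := W.ne_zero_of_mem hh
  -- The relation of a rotation by 60°. Its left side is orthogonal to the orthogonal vectors `l h`
  -- and `l² h - h`.
  have hy : (l * l) • h - l • h + h = 0 := by
    refine hB.eq_zero_of_rank_two hr (x := l • h) (y := (l * l) • h - h) ?_ ?_ ?_ ?_ ?_
    · exact W.ne_zero_of_mem (W.smul_mem l hh)
    · intro e
      exact hl (W.eq_one_of_smul_eq hB h3 hh (sub_eq_zero.1 e))
    · simp only [map_sub]
      linarith
    · simp only [map_sub, map_add]
      linarith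
    · simp only [map_sub, map_add, LinearMap.sub_apply, LinearMap.add_apply]
      linarith
  have e2 : (l * l) • h = l • h - h := by
    rw [← sub_eq_zero, ← hy]; abel
  have e3 : (l * l * l) • h = -h := by
    rw [mul_assoc, mul_smul, e2, smul_sub, ← mul_smul, e2]; abel
  have h6 : l * l * l * (l * l * l) = 1 := W.eq_one_of_smul_eq hB h3 hh (by
    rw [mul_smul, e3, smul_neg, e3, neg_neg])
  by_cases h4 : l * l * (l * l) = 1
  · apply hl
    have : l * l * (l * l) * (l * l) = 1 := by rw [← h6]; simp only [mul_assoc]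
    rwa [h4, one_mul] at this
  · have b3 := W.two_mul_form_of_rank_two hB hr hh h4
    rw [e2, map_sub] at b3
    have := hB.pos h h0
    linarith

end IsoWalk

/-! ### Orbit sums -/

section OrbitSum

variable {G : Type*} [AddCommGroup G] {L : Type*} [Group L] [DistribMulAction L G]

/-- The sum `x ↦ ∑ q ^ j • x` over the powers of `q`. -/
noncomputable def orbitSum (G : Type*) [AddCommGroup G] {L : Type*} [Group L]
    [DistribMulAction L G] (q : L) : G →+ G :=
  ∑ j ∈ Finset.range (orderOf q), DistribSMul.toAddMonoidHom G (q ^ j)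

theorem orbitSum_apply (q : L) (x : G) :
    orbitSum G q x = ∑ j ∈ Finset.range (orderOf q), q ^ j • x := by
  simp [orbitSum, AddMonoidHom.finsetSum_apply]

theorem smul_orbitSum (q : L) (x : G) : q • orbitSum G q x = orbitSum G q x := by
  rw [orbitSum_apply, Finset.smul_sum]
  have h1 := Finset.sum_range_succ' (fun j => q ^ j • x) (orderOf q)
  rw [Finset.sum_range_succ, pow_orderOf_eq_one, pow_zero] at h1
  rw [add_right_cancel h1]
  exact Finset.sum_congr rfl fun j _ => by rw [smul_smul, pow_succ']

theorem pow_smul_orbitSum (q : L) (j : ℕ) (x : G) : q ^ j • orbitSum G q x = orbitSum G q x := by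
  induction j with
  | zero => simp
  | succ j ih => rw [pow_succ', mul_smul, ih, smul_orbitSum]

theorem orbitSum_conj (q z : L) (x : G) :
    orbitSum G (z * q * z⁻¹) x = z • orbitSum G q (z⁻¹ • x) := by
  have ho : orderOf (z * q * z⁻¹) = orderOf q :=
    orderOf_injective (MulAut.conj z).toMonoidHom (MulAut.conj z).injective q
  rw [orbitSum_apply, orbitSum_apply, ho, Finset.smul_sum]
  refine Finset.sum_congr rfl fun j _ => ?_
  rw [conj_pow, mul_smul, mul_smul]

theorem orbitSum_smul_of_commute {q z : L} (h : Commute q z) (x : G) :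
    orbitSum G q (z • x) = z • orbitSum G q x := by
  have := orbitSum_conj q z (z • x)
  rwa [← h.eq, mul_inv_cancel_right, inv_smul_smul] at this

theorem orbitSum_smul (q : L) (x : G) : orbitSum G q (q • x) = orbitSum G q x := by
  rw [orbitSum_smul_of_commute (Commute.refl q), smul_orbitSum]

theorem orbitSum_pow_smul (q : L) (j : ℕ) (x : G) :
    orbitSum G q (q ^ j • x) = orbitSum G q x := by
  rw [orbitSum_smul_of_commute ((Commute.refl q).pow_right j), pow_smul_orbitSum]

theorem orbitSum_of_fix {q : L} {x : G} (h : q • x = x) : orbitSum G q x = orderOf q • x := by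
  have hp : ∀ j : ℕ, q ^ j • x = x := by
    intro j
    induction j with
    | zero => simp
    | succ j ih => rw [pow_succ', mul_smul, ih, h]
  rw [orbitSum_apply, Finset.sum_congr rfl fun j _ => hp j]
  simp

theorem orbitSum_orbitSum (q : L) (x : G) :
    orbitSum G q (orbitSum G q x) = orderOf q • orbitSum G q x :=
  orbitSum_of_fix (smul_orbitSum q x)

/-- The orbit sum of `k` is fixed by `q`, so its product with `x` equals that with each `q ^ j • x`.
These add up to zero: the kernel of the orbit sum is orthogonal to its image. -/
theorem form_orbitSum [Finite L] {B : LinearMap.BilinForm ℤ G} (hB : InvForm L B) (q : L)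
    {x : G} (k : G) (hx : orbitSum G q x = 0) : B (orbitSum G q k) x = 0 := by
  have h1 : ∀ j : ℕ, B (orbitSum G q k) (q ^ j • x) = B (orbitSum G q k) x := fun j => by
    rw [← hB.inv (q ^ j) (orbitSum G q k) x, pow_smul_orbitSum]
  have h2 := congrArg (B (orbitSum G q k)) hx
  rw [orbitSum_apply q x, map_sum, Finset.sum_congr rfl fun j _ => h1 j, map_zero] at h2
  simp only [Finset.sum_const, Finset.card_range, smul_eq_mul, nsmul_eq_mul] at h2
  have := orderOf_pos q
  rcases mul_eq_zero.1 h2 with h | h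
  · exfalso
    have : orderOf q = 0 := by exact_mod_cast h
    omega
  · exact h

end OrbitSum

variable {G : Type*} [AddCommGroup G] [DecidableEq G] {L : Type*} [Group L] [DistribMulAction L G]

/-- The square of an isometry of a lattice of rank three has a fixed vector. -/
theorem InvForm.exists_fixed_of_rank_three [Module.Free ℤ G] [Module.Finite ℤ G]
    {B : LinearMap.BilinForm ℤ G} (hB : InvForm L B) (hr : Module.finrank ℤ G = 3) (l : L) :
    ∃ x : G, x ≠ 0 ∧ (l * l) • x = x := by
  let b := Module.finBasisOfFinrankEq ℤ G hr
  let T : G →ₗ[ℤ] G := (DistribSMul.toAddMonoidHom G l).toIntLinearMap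
  have hT : ∀ x, T x = l • x := fun x => rfl
  set N := LinearMap.toMatrix b b T with hN
  set M := LinearMap.BilinForm.toMatrix b B with hM
  have h1 : Nᵀ * M * N = M := by
    rw [hN, hM, ← LinearMap.BilinForm.toMatrix_comp]
    congr 1
    ext x y
    simp [LinearMap.BilinForm.comp_apply, hT, hB.inv]
  have hM0 : M.det ≠ 0 := by
    intro h0
    obtain ⟨v, hv, hv0⟩ := Matrix.exists_mulVec_eq_zero_iff.2 h0
    have hx : b.equivFun.symm v ≠ 0 := fun h => hv (b.equivFun.symm.map_eq_zero_iff.1 h)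
    have h2 := hB.pos _ hx
    have h3 : (b.repr (b.equivFun.symm v) : Fin 3 → ℤ) = v := b.equivFun.apply_symm_apply v
    rw [LinearMap.BilinForm.apply_eq_dotProduct_toMatrix_mulVec b B, h3, ← hM, hv0,
      dotProduct_zero] at h2
    exact lt_irrefl _ h2
  have hd : N.det * N.det = 1 := by
    have := congrArg Matrix.det h1
    rw [Matrix.det_mul, Matrix.det_mul, Matrix.det_transpose] at this
    apply mul_right_cancel₀ hM0
    linear_combination this
  have h2 : (N * N)ᵀ * M * (N * N) = M := by
    rw [Matrix.transpose_mul]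
    calc Nᵀ * Nᵀ * M * (N * N) = Nᵀ * (Nᵀ * M * N) * N := by simp only [Matrix.mul_assoc]
      _ = M := by rw [h1, h1]
  have h3 : (N * N - 1).det = 0 := by
    -- Since `det (N * N) = 1` and the size is odd, this identity gives `det M · det (N² - 1)` the
    -- opposite of itself.
    have e : (N * N)ᵀ * M * (N * N - 1) = -((N * N - 1)ᵀ * M) := by
      rw [Matrix.mul_sub, h2, mul_one, Matrix.transpose_sub, Matrix.sub_mul, Matrix.transpose_one,
        one_mul]
      abel
    have e2 := congrArg Matrix.det e
    rw [Matrix.det_neg, Matrix.det_mul, Matrix.det_mul, Matrix.det_mul, Matrix.det_transpose,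
      Matrix.det_transpose, Matrix.det_mul, hd, Fintype.card_fin] at e2
    have e3 : 2 * (M.det * (N * N - 1).det) = 0 := by linear_combination e2
    simpa [hM0] using e3
  obtain ⟨v, hv, hv0⟩ := Matrix.exists_mulVec_eq_zero_iff.2 h3
  refine ⟨b.equivFun.symm v, fun h => hv (b.equivFun.symm.map_eq_zero_iff.1 h), ?_⟩
  have h4 : (b.repr (b.equivFun.symm v) : Fin 3 → ℤ) = v := b.equivFun.apply_symm_apply v
  have h5 := LinearMap.toMatrix_mulVec_repr b b (T * T) (b.equivFun.symm v)
  rw [LinearMap.toMatrix_mul, ← hN, h4] at h5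
  rw [Matrix.sub_mulVec, Matrix.one_mulVec, sub_eq_zero] at hv0
  rw [hv0] at h5
  apply b.repr.injective
  apply DFunLike.coe_injective
  rw [h4, mul_smul]
  exact h5.symm

/-! ### Rank three: fibres of the projection to the axis of a square -/

namespace IsoWalk

variable {Sp : Finset G} {A : G → Matrix (Fin 2) (Fin 2) ℂ} {U : L → Matrix (Fin 2) (Fin 2) ℂ}
variable {B : LinearMap.BilinForm ℤ G} [FaithfulSMul L G]

theorem map_eq_zero (W : IsoWalk Sp A U) {f : G →+ G} (h : ∀ k ∈ neighbours Sp, f k = 0) (x : G) :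
    f x = 0 := by
  have : x ∈ AddSubgroup.closure (Sp : Set G) := by rw [W.gen]; trivial
  induction this using AddSubgroup.closure_induction with
  | mem x hx => exact h x (mem_neighbours.2 (Or.inl hx))
  | zero => simp
  | add x y _ _ hx hy => rw [map_add, hx, hy, add_zero]
  | neg x _ hx => rw [map_neg, hx, neg_zero]

/-- The image of the steps under the orbit sum of a square. -/
theorem orbitSum_image [TwoUniqueSums G] [IsAddTorsionFree G] (W : IsoWalk Sp A U) {l : L}
    (hl : l * l ≠ 1) {k : G} (hk : k ∈ neighbours Sp) (hk0 : orbitSum G (l * l) k ≠ 0)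
    {x : G} (hx : x ∈ neighbours Sp) : orbitSum G (l * l) x = 0 ∨
      orbitSum G (l * l) x = orbitSum G (l * l) k ∨
      orbitSum G (l * l) x = -orbitSum G (l * l) k := by
  obtain ⟨g, hg⟩ := W.exists_image_subset (orbitSum G (l * l)) hl (orbitSum_smul (l * l))
  rcases hg k hk with h | h | h
  · exact absurd h hk0
  · rw [h]; exact hg x hx
  · rw [h, neg_neg]
    rcases hg x hx with h | h | h
    exacts [Or.inl h, Or.inr (Or.inr h), Or.inr (Or.inl h)]

/-- Steps in a fibre of the orbit sum either have a uniquely decomposed sum or are antipodal. -/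
theorem uniqueSum_or_antipodal [TwoUniqueSums G] [IsAddTorsionFree G] [Module.Finite ℤ G]
    [Finite L] (W : IsoWalk Sp A U) (hB : InvForm L B)
    (hr : Module.finrank ℤ G = 3) {l : L} (hl : l * l ≠ 1) {k k' : G} (hk : k ∈ neighbours Sp)
    (hk' : k' ∈ neighbours Sp) (hk0 : orbitSum G (l * l) k ≠ 0)
    (hkk : orbitSum G (l * l) k' = orbitSum G (l * l) k) : UniqueSum Sp k k' ∨
      orderOf (l * l) • (k + k') = 2 • orbitSum G (l * l) k := by
  by_contra hcon
  push Not at hcon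
  obtain ⟨h1, h2⟩ := hcon
  simp only [UniqueSum] at h1
  push Not at h1
  obtain ⟨p, hp, p', hp', e, n1, n2⟩ := h1
  set f := orbitSum G (l * l) with hf
  set g := f k with hg
  have ht : ∀ {x : G}, 2 • x = 0 → x = 0 := fun {x} hx => by
    simpa using hx
  have hval : ∀ x ∈ steps Sp, f x = 0 ∨ f x = g ∨ f x = -g := by
    intro x hx
    rcases mem_steps.1 hx with rfl | hx
    · exact Or.inl (map_zero f)
    · exact W.orbitSum_image hl hk hk0 hx
  have hfe : f p + f p' = 2 • g := by rw [← map_add, e, map_add, hkk, two_nsmul]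
  -- Both values lie in `{0, g, -g}` and add up to `2 g`; without torsion this leaves only `g + g`.
  have hfp : f p = g ∧ f p' = g := by
    have hg2 : (2 : ℤ) • g ≠ 0 := by simpa using hk0
    have hg1 : (1 : ℤ) • g ≠ 0 := by simpa using hk0
    have hg3 : (3 : ℤ) • g ≠ 0 := by simpa using hk0
    have hg4 : (4 : ℤ) • g ≠ 0 := by simpa using hk0
    rcases hval p hp with h | h | h <;> rcases hval p' hp' with h' | h' | h' <;>
      rw [h, h'] at hfe
    · exact absurd (by rw [← sub_eq_zero] at hfe; rw [← neg_eq_zero, ← hfe]; module) hg2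
    · exact absurd (by rw [← sub_eq_zero] at hfe; rw [← neg_eq_zero, ← hfe]; module) hg1
    · exact absurd (by rw [← sub_eq_zero] at hfe; rw [← neg_eq_zero, ← hfe]; module) hg3
    · exact absurd (by rw [← sub_eq_zero] at hfe; rw [← neg_eq_zero, ← hfe]; module) hg1
    · exact ⟨h, h'⟩
    · exact absurd (by rw [← sub_eq_zero] at hfe; rw [← neg_eq_zero, ← hfe]; module) hg2
    · exact absurd (by rw [← sub_eq_zero] at hfe; rw [← neg_eq_zero, ← hfe]; module) hg3
    · exact absurd (by rw [← sub_eq_zero] at hfe; rw [← neg_eq_zero, ← hfe]; module) hg2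
    · exact absurd (by rw [← sub_eq_zero] at hfe; rw [← neg_eq_zero, ← hfe]; module) hg4
  have hpn : p ∈ neighbours Sp := (mem_steps.1 hp).resolve_left (by
    rintro rfl; exact hk0 (by rw [← hfp.1, map_zero]))
  have hpn' : p' ∈ neighbours Sp := (mem_steps.1 hp').resolve_left (by
    rintro rfl; exact hk0 (by rw [← hfp.2, map_zero]))
  have c1 : k - p ≠ 0 := fun h => by
    rw [sub_eq_zero] at h
    subst h
    exact n1 rfl (add_left_cancel e)
  have c2 : k - p' ≠ 0 := fun h => by
    rw [sub_eq_zero] at h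
    subst h
    refine n2 ?_ rfl
    rw [add_comm] at e
    exact add_left_cancel e
  obtain ⟨r1, r2, r3⟩ := W.rectangle hB hk hk' hpn hpn' e.symm
  have z1 : B g (k - p) = 0 := form_orbitSum hB _ _ (by rw [← hf, map_sub, hfp.1, sub_self])
  have z2 : B g (k - p') = 0 := form_orbitSum hB _ _ (by rw [← hf, map_sub, hfp.2, sub_self])
  have z3 : B g (orderOf (l * l) • (k + k') - 2 • g) = 0 := form_orbitSum hB _ _ (by
    rw [← hf, map_sub, map_nsmul, map_nsmul, map_add, hkk, hg, hf, orbitSum_orbitSum, ← hf, ← hg,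
      ← two_nsmul, smul_comm, sub_self])
  apply h2
  rw [← sub_eq_zero]
  -- The axis `g` and the two sides of the rectangle are orthogonal and nonzero. The deviation of `k
  -- + k'` from the axis is orthogonal to all three, hence zero.
  refine hB.eq_zero_of_rank_three hr hk0 c1 c2 z1 z2 r1 z3 ?_ ?_
  · rw [map_sub, map_nsmul, map_nsmul, hB.symm _ (k + k'), r2, hB.symm _ g, z1]; simp
  · rw [map_sub, map_nsmul, map_nsmul, hB.symm _ (k + k'), r3, hB.symm _ g, z2]; simp

end IsoWalk

/-! ### Unitary matrices preserving or exchanging lines -/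

section TwoByTwo

variable {X V J : Matrix (Fin 2) (Fin 2) ℂ}

/-- A unitary matrix fixing the column space of a singular matrix acts on it by a phase. -/
theorem exists_mul_eq_smul_of_colPar (hV : V ∈ Matrix.unitaryGroup (Fin 2) ℂ) (hX : X.det = 0)
    (hX0 : X ≠ 0) (h : X.adjugate * (V * X * Vᴴ) = 0) :
    ∃ mu : ℂ, star mu * mu = 1 ∧ V * X = mu • X := by
  have h1 : X.adjugate * (V * X) = 0 := by
    have := congrArg (fun M => M * V) h
    simp only [Matrix.zero_mul] at this
    rw [← this]
    simp only [Matrix.mul_assoc]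
    rw [conjTranspose_mul_self_of_mem hV, mul_one]
  obtain ⟨a, b, ha, hb, rfl⟩ := exists_eq_vecMulVec hX hX0
  rw [Matrix.mul_vecMulVec, adjugate_mul_vecMulVec hb hb] at h1
  obtain ⟨mu, e0, e1⟩ := exists_eigenvalue_of_wedge ha h1
  have hVX : V * Matrix.vecMulVec a b = mu • Matrix.vecMulVec a b := by
    ext i j
    rw [Matrix.mul_apply, Fin.sum_univ_two, Matrix.smul_apply, Matrix.vecMulVec_apply,
      Matrix.vecMulVec_apply, Matrix.vecMulVec_apply, smul_eq_mul]
    have q0 : V 0 0 * (a 0 * b j) + V 0 1 * (a 1 * b j) = mu * (a 0 * b j) := by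
      linear_combination b j * e0
    have q1 : V 1 0 * (a 0 * b j) + V 1 1 * (a 1 * b j) = mu * (a 1 * b j) := by
      linear_combination b j * e1
    fin_cases i
    · exact q0
    · exact q1
  refine ⟨mu, ?_, hVX⟩
  obtain ⟨⟨u1, u2⟩, u3, u4⟩ := unitary_entries hV
  have g0 := congrArg star e0
  have g1 := congrArg star e1
  simp only [star_add, star_mul'] at g0 g1
  apply mul_right_cancel₀ (star_mul_self_add_ne_zero ha)
  rw [one_mul]
  calc star mu * mu * (star (a 0) * a 0 + star (a 1) * a 1)
      = (star mu * star (a 0)) * (mu * a 0) + (star mu * star (a 1)) * (mu * a 1) := by ring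
    _ = star (a 0) * a 0 + star (a 1) * a 1 := by
      rw [← g0, ← g1, ← e0, ← e1]
      linear_combination star (a 0) * a 0 * u1 + star (a 0) * a 1 * u2 +
        star (a 1) * a 0 * u3 + star (a 1) * a 1 * u4

/-- By Cayley–Hamilton the squares of `J` and `V * J` are minus their determinants; for invertible
`J` comparison gives the formula. It is a polynomial identity, so invertibility is not needed. -/
theorem mul_mul_of_trace_eq_zero (h1 : J.trace = 0) (h2 : (V * J).trace = 0) :
    V * J * V = V.det • J := by
  rw [Matrix.trace_fin_two] at h1
  simp only [Matrix.trace_fin_two, Matrix.mul_apply, Fin.sum_univ_two] at h2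
  ext i j
  fin_cases i <;> fin_cases j <;>
    simp [Matrix.mul_apply, Fin.sum_univ_two, Matrix.det_fin_two]
  · linear_combination V 0 0 * h2 - (V 0 0 * V 1 1 - V 0 1 * V 1 0) * h1
  · linear_combination V 0 1 * h2
  · linear_combination V 1 0 * h2
  · linear_combination V 1 1 * h2 - (V 0 0 * V 1 1 - V 0 1 * V 1 0) * h1

/-- A unitary matrix exchanging two orthogonal lines, which are fixed by `V`, inverts `V` up to
a scalar. -/
theorem mul_mul_of_perp (hV : V ∈ Matrix.unitaryGroup (Fin 2) ℂ)
    (hJ : J ∈ Matrix.unitaryGroup (Fin 2) ℂ) (hX : X.det = 0) (hX0 : X ≠ 0)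
    (h : X.adjugate * (V * X * Vᴴ) = 0) (hp : Xᴴ * J * X = 0) : V * J * V = V.det • J := by
  obtain ⟨mu, hmu, hVX⟩ := exists_mul_eq_smul_of_colPar hV hX hX0 h
  refine mul_mul_of_trace_eq_zero (trace_eq_zero_of_perp hJ hX hX0 hp)
    (trace_eq_zero_of_perp (mul_mem hV hJ) hX hX0 ?_)
  have h1 : Vᴴ * X = star mu • X := by
    have := congrArg (fun M => star mu • (Vᴴ * M)) hVX
    simp only [← Matrix.mul_assoc, conjTranspose_mul_self_of_mem hV, one_mul, Matrix.mul_smul,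
      smul_smul, hmu, one_smul] at this
    exact this.symm
  have h2 : Xᴴ * V = mu • Xᴴ := by
    have := congrArg Matrix.conjTranspose h1
    simpa using this
  rw [← Matrix.mul_assoc, h2, Matrix.smul_mul, Matrix.smul_mul, hp, smul_zero]

end TwoByTwo

variable {G : Type*} [AddCommGroup G] [DecidableEq G] {L : Type*} [Group L] [DistribMulAction L G]

/-! ### Rank three: column and row spaces along a fibre -/

namespace IsoWalk

variable {Sp : Finset G} {A : G → Matrix (Fin 2) (Fin 2) ℂ} {U : L → Matrix (Fin 2) (Fin 2) ℂ}
variable {B : LinearMap.BilinForm ℤ G}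

theorem colPar_smul (W : IsoWalk Sp A U) {x y : G} (h : (A x).adjugate * A y = 0) (l : L) :
    (A (l • x)).adjugate * A (l • y) = 0 := by
  have hU := W.unitary l
  rw [W.cov, W.cov, adjugate_unitary_conj hU]
  calc U l * (A x).adjugate * (U l)ᴴ * (U l * A y * (U l)ᴴ)
      = U l * ((A x).adjugate * ((U l)ᴴ * U l) * A y) * (U l)ᴴ := by simp only [Matrix.mul_assoc]
    _ = 0 := by rw [conjTranspose_mul_self_of_mem hU, mul_one, h]; simp

/-- `A (-y) = (adj A_y)†`, whose column space is the orthogonal complement of that of `A y`. -/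
theorem perp_of_colPar_neg (W : IsoWalk Sp A U) {x y : G} (h : (A x).adjugate * A (-y) = 0) :
    (A y)ᴴ * A x = 0 := by
  rw [W.adj] at h
  have := congrArg (fun M => (M.adjugate)ᴴ) h
  simp only [Matrix.adjugate_zero, Matrix.conjTranspose_zero] at this
  rw [Matrix.adjugate_mul_distrib, Matrix.adjugate_adjugate', Matrix.adjugate_conjTranspose,
    Matrix.adjugate_adjugate', Matrix.conjTranspose_mul] at this
  simp at this
  have h2 := congrArg Matrix.conjTranspose this
  simpa using h2

open scoped ComplexOrder in
theorem not_colPar_neg (W : IsoWalk Sp A U) {x : G} (hx : x ∈ neighbours Sp)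
    (h : (A x).adjugate * A (-x) = 0) : False :=
  W.ne_zero x hx (Matrix.conjTranspose_mul_self_eq_zero.1 (W.perp_of_colPar_neg h))

variable [FaithfulSMul L G]

section RankThree

variable [TwoUniqueSums G] [IsAddTorsionFree G] [Module.Finite ℤ G] [Finite L]

/-- The group element fixes the image of the orbit sum, and the columns or the rows of the
transition matrices. -/
theorem smul_orbitSum_eq (W : IsoWalk Sp A U) (hB : InvForm L B) (hr : Module.finrank ℤ G = 3)
    {l : L} (hl : l * l ≠ 1) {k : G} (hk : k ∈ neighbours Sp) (hk0 : orbitSum G (l * l) k ≠ 0) :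
    l • orbitSum G (l * l) k = orbitSum G (l * l) k ∧
      ((A k).adjugate * A (l • k) = 0 ∨ A (l • k) * (A k).adjugate = 0) := by
  have h3 := W.exists_ne_of_finrank (by omega : 2 ≤ Module.finrank ℤ G)
  have hc : ∀ x, orbitSum G (l * l) (l • x) = l • orbitSum G (l * l) x := fun x =>
    orbitSum_smul_of_commute ((Commute.refl l).mul_left (Commute.refl l)) x
  have hlk := W.smul_mem l hk
  have hn : orderOf (l * l) ≠ 0 := (orderOf_pos _).ne'
  have hfix : ∀ x : G, orderOf (l * l) • x = 0 → x = 0 := fun x hx => by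
    simpa [hn] using hx
  have hne : (l * l) • k - k ≠ 0 := fun e =>
    hl (W.eq_one_of_smul_eq hB h3 hk (sub_eq_zero.1 e))
  -- The image of the axis vector under `l` is the projection of the step `l k`. If it is `g`, the
  -- steps `k` and `l k` lie in one fibre; antipodality is impossible, as `l k + k` and `l² k + l k`
  -- would agree and `l²` would fix `k`. If it is `-g`, the same applies to `k` and `-l k`, whose
  -- unique sum makes `A k` and `A (l k)` orthogonal and `l` an involution.
  rcases W.orbitSum_image hl hk hk0 hlk with h | h | h
  · rw [hc, smul_eq_zero_iff_eq] at h
    exact absurd h hk0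
  · rw [hc] at h
    refine ⟨h, ?_⟩
    rcases W.uniqueSum_or_antipodal hB hr hl hk hlk hk0 (by rw [hc, h]) with h1 | h1
    · exact W.share hB hk hlk h1
    · exfalso
      have h2 := congrArg (fun x => l • x) h1
      simp only [smul_comm l _ (_ : G), smul_add, h, ← mul_smul] at h2
      apply hne
      apply hfix
      rw [smul_sub, sub_eq_zero]
      rw [← h2, smul_add, add_comm] at h1
      exact (add_left_cancel h1).symm
  · exfalso
    have hneg : orbitSum G (l * l) (-(l • k)) = orbitSum G (l * l) k := by
      rw [map_neg, h, neg_neg]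
    rw [hc] at h
    rcases W.uniqueSum_or_antipodal hB hr hl hk (neg_mem_neighbours hlk) hk0 hneg with h1 | h1
    · have hne' : l • k ≠ k := fun e => hl (by rw [W.eq_one_of_smul_eq hB h3 hk e, one_mul])
      have h2 := W.trace_adjugate_eq_zero (mem_steps.2 (Or.inr hk))
        (mem_steps.2 (Or.inr (neg_mem_neighbours hlk))) (fun e => hne' (neg_injective e)) h1
      rw [← W.conjTranspose_neg_step, W.trace_neg] at h2
      exact hl (W.mul_self_eq_one_of_trace hB hk h2)
    · have h2 := congrArg (fun x => -(l • x)) h1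
      simp only [smul_comm l _ (_ : G), smul_add, smul_neg, h, ← mul_smul, neg_neg] at h2
      apply hne
      apply hfix
      rw [smul_sub, sub_eq_zero]
      have e1 : orderOf (l * l) • (k + -(l • k)) = orderOf (l * l) • k -
        orderOf (l * l) • (l • k) := by rw [smul_add, smul_neg, sub_eq_add_neg]
      have h4 : orderOf (l * l) • k - orderOf (l * l) • (l • k) =
          orderOf (l * l) • ((l * l) • k) - orderOf (l * l) • (l • k) := by
        rw [← e1, h1, ← h2]; abel
      exact (sub_left_injective h4).symm

/-- If `l` fixes a column space, then all steps in the fibre of the orbit sum share it. -/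
theorem colPar_fibre (W : IsoWalk Sp A U) (hB : InvForm L B) (hr : Module.finrank ℤ G = 3)
    {l : L} (hl : l * l ≠ 1) {k : G} (hk : k ∈ neighbours Sp) (hk0 : orbitSum G (l * l) k ≠ 0)
    (hcol : (A k).adjugate * A (l • k) = 0) {y : G} (hy : y ∈ neighbours Sp)
    (hyk : orbitSum G (l * l) y = orbitSum G (l * l) k) : (A k).adjugate * A y = 0 := by
  have h3 := W.exists_ne_of_finrank (by omega : 2 ≤ Module.finrank ℤ G)
  have hc : ∀ x, orbitSum G (l * l) (l • x) = l • orbitSum G (l * l) x := fun x =>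
    orbitSum_smul_of_commute ((Commute.refl l).mul_left (Commute.refl l)) x
  have hg := (W.smul_orbitSum_eq hB hr hl hk hk0).1
  have hd := fun x (hx : x ∈ neighbours Sp) => W.det_eq_zero hB hx
  have hn : orderOf (l * l) ≠ 0 := (orderOf_pos _).ne'
  have hl1 : l ≠ 1 := fun e => hl (by rw [e, one_mul])
  -- Two steps `x` and `m x` with the column of `k`, neither antipodal to `y`, suffice. If `y`
  -- shared only rows with both, then `x` and `m x` would have equal rows and columns, contrary to
  -- `m ≠ 1`.
  have key : ∀ x ∈ neighbours Sp, ∀ m : L, m ≠ 1 → orbitSum G (l * l) x = orbitSum G (l * l) k →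
      orbitSum G (l * l) (m • x) = orbitSum G (l * l) k → (A k).adjugate * A x = 0 →
      (A x).adjugate * A (m • x) = 0 →
      orderOf (l * l) • (y + x) ≠ 2 • orbitSum G (l * l) k →
      orderOf (l * l) • (y + m • x) ≠ 2 • orbitSum G (l * l) k → (A k).adjugate * A y = 0 := by
    intro x hx m hm hfx hfm hkx hxm n1 n2
    have hmx := W.smul_mem m hx
    have u1 := (W.uniqueSum_or_antipodal hB hr hl hy hx (by rw [hyk]; exact hk0)
      (by rw [hfx, hyk])).resolve_right (by rw [hyk]; exact n1)
    have u2 := (W.uniqueSum_or_antipodal hB hr hl hy hmx (by rw [hyk]; exact hk0)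
      (by rw [hfm, hyk])).resolve_right (by rw [hyk]; exact n2)
    rcases W.share hB hy hx u1 with s1 | s1
    · exact colPar_trans (hd k hk) (hd x hx) (hd y hy) (W.ne_zero x hx) hkx (colPar_symm s1)
    rcases W.share hB hy hmx u2 with s2 | s2
    · have hkm := colPar_trans (hd k hk) (hd x hx) (hd _ hmx) (W.ne_zero x hx) hkx hxm
      exact colPar_trans (hd k hk) (hd _ hmx) (hd y hy) (W.ne_zero _ hmx) hkm (colPar_symm s2)
    exfalso
    exact hm (W.eq_one_of_colPar_rowPar hB h3 hx hxm (rowPar_trans (hd x hx) (hd y hy) (hd _ hmx)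
      (W.ne_zero y hy) (rowPar_symm s1) s2))
  have hlk := W.smul_mem l hk
  have hf1 : orbitSum G (l * l) (l • k) = orbitSum G (l * l) k := by rw [hc, hg]
  have hf2 : orbitSum G (l * l) (l • l • k) = orbitSum G (l * l) k := by rw [hc, hf1, hg]
  have hkk : (A k).adjugate * A k = 0 := by rw [Matrix.adjugate_mul, hd k hk, zero_smul]
  have hcol2 := W.colPar_smul hcol l
  have hcol3 := colPar_trans (hd k hk) (hd _ hlk) (hd _ (W.smul_mem l hlk)) (W.ne_zero _ hlk)
    hcol hcol2
  have huniq : ∀ x x' : G, orderOf (l * l) • (y + x) = 2 • orbitSum G (l * l) k →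
      orderOf (l * l) • (y + x') = 2 • orbitSum G (l * l) k → x = x' := by
    intro x x' e e'
    have : orderOf (l * l) • (x - x') = 0 := by
      calc orderOf (l * l) • (x - x') = orderOf (l * l) • (y + x) - orderOf (l * l) • (y + x') := by
            module
        _ = 0 := by rw [e, e', sub_self]
    exact sub_eq_zero.1 (by simpa [hn] using this)
  have d1 : l • k ≠ k := fun e => hl1 (W.eq_one_of_smul_eq hB h3 hk e)
  have d2 : l • l • k ≠ k := fun e => hl (W.eq_one_of_smul_eq hB h3 hk (by rw [mul_smul, e]))
  have d3 : l • l • k ≠ l • k := fun e => hl1 (W.eq_one_of_smul_eq hB h3 hlk e)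
  -- At most one of the distinct steps `k`, `l k`, `l² k` is antipodal to `y`; the other two are
  -- used.
  by_cases a0 : orderOf (l * l) • (y + k) = 2 • orbitSum G (l * l) k
  · exact key _ hlk l hl1 hf1 hf2 hcol hcol2 (fun e => d1 (huniq _ _ e a0))
      (fun e => d2 (huniq _ _ e a0))
  by_cases a1 : orderOf (l * l) • (y + l • k) = 2 • orbitSum G (l * l) k
  · exact key _ hk (l * l) hl rfl (by rw [mul_smul]; exact hf2) hkk
      (by rw [mul_smul]; exact hcol3) a0 (by rw [mul_smul]; exact fun e => d3 (huniq _ _ e a1))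
  · exact key _ hk l hl1 rfl hf1 hkk hcol a0 a1

end RankThree

end IsoWalk

variable {G : Type*} [AddCommGroup G] [DecidableEq G] {L : Type*} [Group L] [DistribMulAction L G]

/-! ### Rank three: no step is annihilated by the projection -/

namespace IsoWalk

variable {Sp : Finset G} {A : G → Matrix (Fin 2) (Fin 2) ℂ} {U : L → Matrix (Fin 2) (Fin 2) ℂ}
variable {B : LinearMap.BilinForm ℤ G} [FaithfulSMul L G]
variable [TwoUniqueSums G] [IsAddTorsionFree G] [Module.Finite ℤ G] [Finite L]

/-- The `q`-orbit of `k` sums to zero, hence so do the projections of its members. These are `0` or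
`±` the projection of `k`, which itself occurs, so a negative one must occur too. -/
theorem exists_pow_smul_eq_neg (W : IsoWalk Sp A U) (hB : InvForm L B)
    {q l' : L} (hl' : l' * l' ≠ 1) {k : G} (hk : k ∈ neighbours Sp)
    (hk0 : orbitSum G q k = 0) (hk' : orbitSum G (l' * l') k ≠ 0) :
    ∃ j : ℕ, orbitSum G (l' * l') (q ^ j • k) = -orbitSum G (l' * l') k := by
  by_contra hcon
  push Not at hcon
  have h1 := congrArg (fun x => B (orbitSum G (l' * l') k) (orbitSum G (l' * l') x)) hk0
  simp only [orbitSum_apply q k, map_sum, map_zero] at h1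
  have hpos := hB.pos _ hk'
  have hnn : ∀ j ∈ Finset.range (orderOf q),
      0 ≤ B (orbitSum G (l' * l') k) (orbitSum G (l' * l') (q ^ j • k)) := by
    intro j _
    rcases W.orbitSum_image hl' hk hk' (W.smul_mem (q ^ j) hk) with h | h | h
    · rw [h, map_zero]
    · rw [h]; exact hpos.le
    · exact absurd h (hcon j)
  have h2 := (Finset.sum_eq_zero_iff_of_nonneg hnn).1 h1 0 (Finset.mem_range.2 (orderOf_pos q))
  rw [pow_zero, one_smul] at h2
  exact hpos.ne' h2

/-- If `m` inverts `l`, then it commutes with the orbit sum of `l ^ 2`. -/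
theorem orbitSum_smul_of_inverts {l m : L} (h : l * m * l = m) (k : G)
    (hg : l • orbitSum G (l * l) k = orbitSum G (l * l) k) :
    orderOf (l * l) • (m • orbitSum G (l * l) k) =
      orderOf (l * l) • orbitSum G (l * l) (m • k) := by
  -- The hypothesis says that conjugation by `m` inverts `l`, and so permutes the powers of `l²`.
  have s1 : SemiconjBy m l l⁻¹ := by
    rw [SemiconjBy, eq_inv_mul_iff_mul_eq, ← mul_assoc, h]
  have s2 : SemiconjBy m (l * l) (l * l)⁻¹ := by
    rw [mul_inv_rev]; exact s1.mul_right s1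
  have hinv : ∀ (j : ℕ) (x : G), orbitSum G (l * l) ((l * l)⁻¹ ^ j • x) = orbitSum G (l * l) x := by
    intro j x
    rw [← orbitSum_pow_smul (l * l) j ((l * l)⁻¹ ^ j • x), smul_smul, inv_pow, mul_inv_cancel,
      one_smul]
  have e1 : l • m • orbitSum G (l * l) k = m • orbitSum G (l * l) k := by
    conv_lhs => rw [← hg]
    rw [smul_smul, smul_smul, h]
  rw [← orbitSum_of_fix (q := l * l) (x := m • orbitSum G (l * l) k) (by rw [mul_smul, e1, e1])]
  conv_lhs => rw [orbitSum_apply (l * l) k, Finset.smul_sum, map_sum]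
  rw [Finset.sum_congr rfl (g := fun _ => orbitSum G (l * l) (m • k))]
  · simp
  · intro j _
    rw [smul_smul, (s2.pow_right j).eq, mul_smul, hinv]

/-- A step annihilated by the orbit sum of some `l ^ 2` leads to a contradiction. -/
theorem false_of_orbitSum_eq_zero (W : IsoWalk Sp A U) (hB : InvForm L B)
    (hr : Module.finrank ℤ G = 3) {l l' : L} (hl' : l' * l' ≠ 1) {h k : G}
    (hh : h ∈ neighbours Sp) (hk : k ∈ neighbours Sp) (h0 : orbitSum G (l * l) h ≠ 0)
    (hk0 : orbitSum G (l * l) k = 0) (hk' : orbitSum G (l' * l') k ≠ 0)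
    (hcol : (A k).adjugate * A (l' • k) = 0) : False := by
  have h3 := W.exists_ne_of_finrank (by omega : 2 ≤ Module.finrank ℤ G)
  have hl1 : l' ≠ 1 := fun e => hl' (by rw [e, one_mul])
  have hd := fun x (hx : x ∈ neighbours Sp) => W.det_eq_zero hB hx
  obtain ⟨hg', -⟩ := W.smul_orbitSum_eq hB hr hl' hk hk'
  obtain ⟨j, hj⟩ := W.exists_pow_smul_eq_neg hB hl' hk hk0 hk'
  set f := orbitSum G (l * l) with hf
  set f' := orbitSum G (l' * l') with hf'
  set i := (l * l) ^ j with hi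
  set e := l ^ j with he
  have hei : e * e = i := by rw [he, hi, (Commute.refl l).mul_pow]
  have hfi : ∀ x, f (i • x) = f x := orbitSum_pow_smul (l * l) j
  have hik := W.smul_mem i hk
  have hek := W.smul_mem e hk
  have t2 : ∀ {x : G}, x = -x → x = 0 := fun {x} hx => by
    by_contra hx0
    exact hB.ne_neg hx0 hx
  -- `i` is an involution
  have hc1 : (A k).adjugate * A (-(i • k)) = 0 :=
    W.colPar_fibre hB hr hl' hk hk' hcol (neg_mem_neighbours hik) (by
      rw [← hf', map_neg, hj, neg_neg])
  have hperp := W.perp_of_colPar_neg hc1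
  have hi2 : i * i = 1 := W.mul_self_eq_one_of_trace hB hk (by rw [hperp, Matrix.trace_zero])
  have hi1 : i ≠ 1 := by
    intro hi1
    rw [hi1, one_smul] at hj
    exact hk' (t2 hj)
  -- `i` inverts `l'`
  have hinv : l' * i * l' = i := by
    have hXJX : (A k)ᴴ * U i * A k = 0 := by
      rw [W.cov] at hperp
      have h1 := congrArg (fun M => ((U i)ᴴ * M)ᴴ) hperp
      simp only [Matrix.conjTranspose_mul, Matrix.conjTranspose_conjTranspose, Matrix.mul_zero,
        Matrix.conjTranspose_zero] at h1
      calc (A k)ᴴ * U i * A k = (A k)ᴴ * (U i * (A k * ((U i)ᴴ * U i))) := by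
            rw [conjTranspose_mul_self_of_mem (W.unitary i), mul_one, Matrix.mul_assoc]
        _ = 0 := by rw [← h1]; simp only [Matrix.mul_assoc]
    have h1 := mul_mul_of_perp (W.unitary l') (W.unitary i) (hd k hk) (W.ne_zero k hk)
      (by rw [← W.cov]; exact hcol) hXJX
    obtain ⟨c1, hc1⟩ := W.proj l' i
    obtain ⟨c2, hc2⟩ := W.proj (l' * i) l'
    exact W.eq_of_U_eq_smul (c := c2 * (c1 * (U l').det)) (by
      rw [hc2, hc1, Matrix.smul_mul, h1, smul_smul, smul_smul, mul_assoc])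
  have hig' : i • f' k = -f' k := by
    have h1 := orbitSum_smul_of_inverts hinv k hg'
    rw [← hf', hj] at h1
    have hn : orderOf (l' * l') ≠ 0 := (orderOf_pos _).ne'
    have h2 : orderOf (l' * l') • (i • f' k - -f' k) = 0 := by rw [smul_sub, h1, sub_self]
    exact sub_eq_zero.1 (by simpa only [smul_eq_zero, hn, false_or] using h2)
  -- As a power of `l²`, the element `i` fixes the axis of `l²`, but it reverses the axis of `l'²`.
  have hgg : B (f h) (f' k) = 0 := by
    have h1 := hB.inv i (f h) (f' k)
    rw [hig', hf, hi, pow_smul_orbitSum, map_neg] at h1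
    linarith
  -- `i` reverses `k`
  have hik' : i • k = -k := by
    -- The map `1 + i` sends steps to `0` or `±γ`. Its value at `h` is not annihilated by `f`, so
    -- neither is `γ`; its value at `k` is annihilated, and must be `0`.
    obtain ⟨γ, hγ⟩ := W.exists_image_subset
      (AddMonoidHom.id G + DistribSMul.toAddMonoidHom G i) hi1 (by
        intro x
        simp only [AddMonoidHom.add_apply, AddMonoidHom.id_apply, DistribSMul.toAddMonoidHom_apply]
        rw [smul_smul, hi2, one_smul, add_comm])
    simp only [AddMonoidHom.add_apply, AddMonoidHom.id_apply, DistribSMul.toAddMonoidHom_apply]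
      at hγ
    have f1 : f (h + i • h) ≠ 0 := by
      rw [map_add, hfi]
      intro e0
      exact h0 (t2 (eq_neg_of_add_eq_zero_left e0))
    have f2 : f (k + i • k) = 0 := by rw [map_add, hfi, hk0, add_zero]
    have f3 : f γ ≠ 0 := by
      intro e0
      rcases hγ h hh with h1 | h1 | h1 <;> rw [h1] at f1
      · exact f1 (map_zero f)
      · exact f1 e0
      · exact f1 (by rw [map_neg, e0, neg_zero])
    rcases hγ k hk with h1 | h1 | h1
    · exact (neg_eq_of_add_eq_zero_right h1).symm
    · rw [h1] at f2; exact absurd f2 f3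
    · rw [h1, map_neg, neg_eq_zero] at f2; exact absurd f2 f3
  -- orthogonality relations
  have o1 : B (e • k) k = 0 := by
    have h1 := hB.inv e k (e • k)
    rw [smul_smul, hei, hik', map_neg, hB.symm k] at h1
    linarith
  have o2 : B (f h) k = 0 := form_orbitSum hB _ _ hk0
  have o3 : B (f h) (e • k) = 0 := form_orbitSum hB _ _ (by
    rw [orbitSum_smul_of_commute, ← hf, hk0, smul_zero]
    exact ((Commute.refl l).mul_left (Commute.refl l)).pow_right j)
  have o4 : f' (e • k) = 0 := by
    rcases W.orbitSum_image hl' hk hk' hek with h1 | h1 | h1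
    · exact h1
    · exfalso
      have c1 := W.colPar_fibre hB hr hl' hk hk' hcol hek h1
      have c2 := W.colPar_smul c1 e
      rw [smul_smul, hei] at c2
      have c3 := colPar_trans (hd k hk) (hd _ hek) (hd _ hik) (W.ne_zero _ hek) c1 c2
      exact W.not_colPar_neg hik (colPar_trans (hd _ hik) (hd k hk)
        (hd _ (neg_mem_neighbours hik)) (W.ne_zero k hk) (colPar_symm c3) hc1)
    · exfalso
      have c1 := W.colPar_fibre hB hr hl' hk hk' hcol (neg_mem_neighbours hek)
        (by rw [map_neg, h1, neg_neg])
      have c2 := W.perp_of_colPar_neg c1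
      exact hi1 (by
        rw [← hei]
        exact W.mul_self_eq_one_of_trace hB hk (by rw [c2, Matrix.trace_zero]))
  have o5 : B (f' k) (e • k) = 0 := form_orbitSum hB _ _ o4
  -- The vectors `f h`, `e k` and `f' k` are orthogonal, and `k` is orthogonal to the first two. So
  -- `k` lies on the axis of `l'²`, which `l'` fixes pointwise, against freeness.
  have hw : B (f' k) (f' k) • k - B k (f' k) • f' k = 0 := by
    refine hB.eq_zero_of_rank_three hr h0 (W.ne_zero_of_mem hek) hk' o3 hgg
      (by rw [hB.symm]; exact o5) ?_ ?_ ?_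
    · rw [map_sub, map_smul, map_smul, o2, hgg]; simp
    · rw [map_sub, (B (e • k)).map_smul, (B (e • k)).map_smul, o1, hB.symm (e • k), o5]; simp
    · rw [map_sub, map_smul, map_smul, hB.symm k, smul_eq_mul, smul_eq_mul]; ring
  have hw2 := congrArg (fun x => l' • x) hw
  simp only [smul_sub, smul_zero, smul_comm l' _ (_ : G), hg'] at hw2
  have h5 : B (f' k) (f' k) • (l' • k - k) = 0 := by
    rw [smul_sub, sub_eq_zero.1 hw2, sub_eq_zero.1 hw, sub_self]
  rcases smul_eq_zero.1 h5 with h6 | h6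
  · exact (hB.pos _ hk').ne' h6
  · exact hl1 (W.eq_one_of_smul_eq hB h3 hk (sub_eq_zero.1 h6))

end IsoWalk

/-! ### Singular matrices with a common column space -/

section TwoByTwo

variable {X Y V : Matrix (Fin 2) (Fin 2) ℂ}

theorem exists_vecMulVec_of_colPar (hX : X.det = 0) (hX0 : X ≠ 0) (hY : Y.det = 0) (hY0 : Y ≠ 0)
    (h : X.adjugate * Y = 0) : ∃ a b d : Fin 2 → ℂ, a ≠ 0 ∧ b ≠ 0 ∧ d ≠ 0 ∧
      X = Matrix.vecMulVec a b ∧ Y = Matrix.vecMulVec a d := by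
  obtain ⟨a, b, ha, hb, rfl⟩ := exists_eq_vecMulVec hX hX0
  obtain ⟨c, d, hc, hd, rfl⟩ := exists_eq_vecMulVec hY hY0
  rw [adjugate_mul_vecMulVec hb hd] at h
  obtain ⟨t, rfl⟩ : ∃ t : ℂ, c = t • a := by
    rcases ne_zero_fin_two.1 ha with h0 | h0
    · refine ⟨c 0 / a 0, ?_⟩
      ext i
      have q0 : c 0 = c 0 / a 0 * a 0 := by field_simp
      have q1 : c 1 = c 0 / a 0 * a 1 := by
        rw [div_mul_eq_mul_div, eq_div_iff h0]; linear_combination h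
      fin_cases i
      exacts [q0, q1]
    · refine ⟨c 1 / a 1, ?_⟩
      ext i
      have q0 : c 0 = c 1 / a 1 * a 0 := by
        rw [div_mul_eq_mul_div, eq_div_iff h0]; linear_combination -h
      have q1 : c 1 = c 1 / a 1 * a 1 := by field_simp
      fin_cases i
      exacts [q0, q1]
  have ht : t ≠ 0 := fun e => hc (by rw [e, zero_smul])
  refine ⟨a, b, t • d, ha, hb, smul_ne_zero ht hd, rfl, ?_⟩
  rw [Matrix.smul_vecMulVec, Matrix.vecMulVec_smul]

theorem mul_eq_smul_of_colPar (hX : X.det = 0) (hX0 : X ≠ 0) (hY : Y.det = 0) (hY0 : Y ≠ 0)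
    (h : X.adjugate * Y = 0) {mu : ℂ} (hV : V * X = mu • X) : V * Y = mu • Y := by
  obtain ⟨a, b, d, ha, hb, hd, rfl, rfl⟩ := exists_vecMulVec_of_colPar hX hX0 hY hY0 h
  rw [Matrix.mul_vecMulVec, ← Matrix.smul_vecMulVec] at hV ⊢
  suffices V *ᵥ a = mu • a by rw [this]
  obtain ⟨j, hj⟩ := Function.ne_iff.1 hb
  ext i
  have := congrFun (congrFun hV i) j
  rw [Matrix.vecMulVec_apply, Matrix.vecMulVec_apply] at this
  exact mul_right_cancel₀ hj this

/-- Orthogonal singular matrices of the same norm with the same column space, in a common basis. -/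
theorem exists_common_column (hX : X.det = 0) (hX0 : X ≠ 0) (hY : Y.det = 0) (hY0 : Y ≠ 0)
    (h : X.adjugate * Y = 0) (ht : (Xᴴ * Y).trace = 0)
    (hn : (Yᴴ * Y).trace = (Xᴴ * X).trace) :
    ∃ (T : Matrix (Fin 2) (Fin 2) ℂ) (α β : ℂ), T ∈ Matrix.unitaryGroup (Fin 2) ℂ ∧
      X = T * !![α, 0; β, 0] * Tᴴ ∧ Y = T * !![0, α; 0, β] * Tᴴ := by
  obtain ⟨a, b, d, ha, hb, hd, rfl, rfl⟩ := exists_vecMulVec_of_colPar hX hX0 hY hY0 h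
  have hs := star_mul_self_add_ne_zero ha
  have hsb := star_mul_self_add_ne_zero hb
  simp only [Matrix.trace_fin_two, Matrix.mul_apply, Fin.sum_univ_two, Matrix.conjTranspose_apply,
    Matrix.vecMulVec_apply, star_mul'] at ht hn
  set s := star (a 0) * a 0 + star (a 1) * a 1 with hsdef
  set r : ℝ := Complex.normSq (b 0) + Complex.normSq (b 1) with hr
  have hrC : (r : ℂ) = star (b 0) * b 0 + star (b 1) * b 1 := by
    rw [hr]; push_cast
    rw [Complex.normSq_eq_conj_mul_self, Complex.normSq_eq_conj_mul_self]; rfl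
  rw [← hrC] at hsb
  have hr0 : 0 < r := lt_of_le_of_ne
    (by rw [hr]; exact add_nonneg (Complex.normSq_nonneg _) (Complex.normSq_nonneg _))
    (fun e => hsb (by rw [← e, Complex.ofReal_zero]))
  have e1 : star (b 0) * d 0 + star (b 1) * d 1 = 0 := by
    apply mul_left_cancel₀ hs
    rw [hsdef]
    linear_combination ht
  have e2 : star (d 0) * d 0 + star (d 1) * d 1 = r := by
    apply mul_left_cancel₀ hs
    rw [hsdef, hrC]
    linear_combination hn
  have e3 : star (d 0) * b 0 + star (d 1) * b 1 = 0 := by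
    have := congrArg star e1
    simp only [star_add, star_mul', star_star, star_zero] at this
    linear_combination this
  set t : ℂ := ((Real.sqrt r : ℝ) : ℂ) with ht'
  have htt : t * t = r := by rw [ht', ← Complex.ofReal_mul, Real.mul_self_sqrt hr0.le]
  have ht0 : t ≠ 0 := by
    intro e; rw [e, zero_mul] at htt; exact hsb htt.symm
  have hts : star t = t := by rw [ht', Complex.star_def, Complex.conj_ofReal]
  -- The traces factor through `‖a‖²`, so the row vectors `b` and `d` are orthogonal of equal norm
  -- `t`. Their normalised conjugates are the new basis.
  set T : Matrix (Fin 2) (Fin 2) ℂ := t⁻¹ • !![star (b 0), star (d 0); star (b 1), star (d 1)]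
    with hT
  have hTh : Tᴴ = t⁻¹ • !![b 0, b 1; d 0, d 1] := by
    rw [hT, Matrix.conjTranspose_smul, star_inv₀, hts]
    congr 1
    ext i j
    fin_cases i <;> fin_cases j <;> simp
  have hTT : Tᴴ * T = 1 := by
    rw [hTh, hT, Matrix.smul_mul, Matrix.mul_smul, smul_smul, ← mul_inv, htt]
    rw [inv_smul_eq_iff₀ hsb]
    ext i j
    fin_cases i <;> fin_cases j <;>
      simp only [Matrix.mul_apply, Fin.sum_univ_two, Matrix.smul_apply, smul_eq_mul,
        Matrix.of_apply, Matrix.cons_val', Matrix.cons_val_zero, Matrix.cons_val_one,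
        Matrix.cons_val_fin_one, Fin.zero_eta, Fin.mk_one, Matrix.one_apply_eq,
        Matrix.one_apply_ne, ne_eq, zero_ne_one, one_ne_zero, not_false_eq_true, mul_one, mul_zero]
    · linear_combination -hrC
    · linear_combination e3
    · linear_combination e1
    · linear_combination e2
  have hTu : T ∈ Matrix.unitaryGroup (Fin 2) ℂ := Matrix.mem_unitaryGroup_iff'.2 hTT
  have hTT' := mul_conjTranspose_self_of_mem hTu
  have key : ∀ (y : Fin 2 → ℂ), Matrix.vecMulVec a y =
      T * Matrix.vecMulVec (Tᴴ *ᵥ a) (y ᵥ* T) * Tᴴ := by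
    intro y
    rw [Matrix.mul_vecMulVec, Matrix.vecMulVec_mul, Matrix.mulVec_mulVec, Matrix.vecMul_vecMul,
      hTT', Matrix.one_mulVec, Matrix.vecMul_one]
  have hbT : b ᵥ* T = ![t, 0] := by
    ext i
    rw [hT, Matrix.vecMul_smul, Pi.smul_apply, smul_eq_mul, inv_mul_eq_iff_eq_mul₀ ht0]
    fin_cases i <;> simp [Matrix.vecMul, dotProduct, Fin.sum_univ_two]
    · simp at hrC; rw [htt, hrC]; ring
    · simp at e3; linear_combination e3
  have hdT : d ᵥ* T = ![0, t] := by
    ext i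
    rw [hT, Matrix.vecMul_smul, Pi.smul_apply, smul_eq_mul, inv_mul_eq_iff_eq_mul₀ ht0]
    fin_cases i <;> simp [Matrix.vecMul, dotProduct, Fin.sum_univ_two]
    · simp at e1; linear_combination e1
    · simp at e2; rw [htt, ← e2]; ring
  refine ⟨T, (Tᴴ *ᵥ a) 0 * t, (Tᴴ *ᵥ a) 1 * t, hTu, ?_, ?_⟩
  · rw [key b, hbT]
    congr 2
    ext i j
    fin_cases i <;> fin_cases j <;> simp [Matrix.vecMulVec_apply]
  · rw [key d, hdT]
    congr 2
    ext i j
    fin_cases i <;> fin_cases j <;> simp [Matrix.vecMulVec_apply]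

/-- Two orthogonal singular matrices of the same norm with the same column space. -/
theorem conjTranspose_mul_self_add (hX : X.det = 0) (hX0 : X ≠ 0) (hY : Y.det = 0) (hY0 : Y ≠ 0)
    (h : X.adjugate * Y = 0) (ht : (Xᴴ * Y).trace = 0)
    (hn : (Yᴴ * Y).trace = (Xᴴ * X).trace) : Xᴴ * X + Yᴴ * Y = (Xᴴ * X).trace • 1 := by
  obtain ⟨T, α, β, hT, rfl, rfl⟩ := exists_common_column hX hX0 hY hY0 h ht hn
  have hTT := conjTranspose_mul_self_of_mem hT
  have key : ∀ M : Matrix (Fin 2) (Fin 2) ℂ, (T * M * Tᴴ)ᴴ * (T * M * Tᴴ) = T * (Mᴴ * M) * Tᴴ := by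
    intro M
    rw [Matrix.conjTranspose_mul, Matrix.conjTranspose_mul, Matrix.conjTranspose_conjTranspose]
    calc T * (Mᴴ * Tᴴ) * (T * M * Tᴴ) = T * (Mᴴ * (Tᴴ * T) * M) * Tᴴ := by
          simp only [Matrix.mul_assoc]
      _ = _ := by rw [hTT, mul_one]
  rw [key, key, trace_unitary_conj hT, ← Matrix.add_mul, ← Matrix.mul_add,
    show !![α, 0; β, 0]ᴴ * !![α, 0; β, 0] + !![0, α; 0, β]ᴴ * !![0, α; 0, β] =
      (!![α, 0; β, 0]ᴴ * !![α, 0; β, 0]).trace • 1 by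
        ext i j
        fin_cases i <;> fin_cases j <;>
          simp [Matrix.mul_apply, Fin.sum_univ_two, Matrix.trace_fin_two],
    Matrix.mul_smul, mul_one, Matrix.smul_mul, mul_conjTranspose_self_of_mem hT]

/-- The eigenvalues of `V` are `mu` and `mu * w` with `|w| = 1`, and `star mu * V.trace = 1 + w`.
This has real part zero only for `w = -1`. -/
theorem trace_eq_zero_of_re (hV : V ∈ Matrix.unitaryGroup (Fin 2) ℂ) (hX0 : X ≠ 0) {mu : ℂ}
    (hmu : star mu * mu = 1) (h : V * X = mu • X) (hre : (star mu * V.trace).re = 0) :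
    V.trace = 0 := by
  have hd : (V - mu • 1).det = 0 := by
    by_contra hd
    apply hX0
    have h1 : (V - mu • 1) * X = 0 := by rw [Matrix.sub_mul, h, Matrix.smul_mul, one_mul, sub_self]
    have h2 := congrArg (fun M => (V - mu • 1)⁻¹ * M) h1
    simpa [← Matrix.mul_assoc, Matrix.nonsing_inv_mul _ (isUnit_iff_ne_zero.2 hd)] using h2
  have hdet : star V.det * V.det = 1 := by
    have := congrArg Matrix.det (conjTranspose_mul_self_of_mem hV)
    rwa [Matrix.det_mul, Matrix.det_conjTranspose, Matrix.det_one] at this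
  rw [Matrix.det_fin_two] at hd
  simp at hd
  set w := star mu * V.trace - 1 with hw
  have hdw : V.det = mu * mu * w := by
    rw [hw, Matrix.det_fin_two, Matrix.trace_fin_two]
    linear_combination hd - mu * (V 0 0 + V 1 1) * hmu
  have hww : star w * w = 1 := by
    rw [hdw] at hdet
    simp only [star_mul'] at hdet
    calc star w * w = (star mu * mu) * (star mu * mu) * (star w * w) := by rw [hmu]; ring
      _ = 1 := by rw [← hdet]; ring
  have hwre : w.re = -1 := by rw [hw, Complex.sub_re, hre, Complex.one_re, zero_sub]
  have hwim : w.im = 0 := by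
    have := congrArg Complex.re hww
    rw [Complex.star_def, Complex.mul_re, Complex.conj_re, Complex.conj_im, Complex.one_re,
      hwre] at this
    nlinarith
  have hw1 : w = -1 := Complex.ext (by rw [hwre]; simp) (by rw [hwim]; simp)
  have : star mu * V.trace = 0 := by rw [hw] at hw1; linear_combination hw1
  refine (mul_eq_zero.1 this).resolve_left fun e => ?_
  rw [e, zero_mul] at hmu
  exact zero_ne_one hmu

end TwoByTwo

variable {G : Type*} [AddCommGroup G] [DecidableEq G] {L : Type*} [Group L] [DistribMulAction L G]

/-! ### Rank three: projections vanishing on no step, and the involution theorem -/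

namespace IsoWalk

variable {Sp : Finset G} {A : G → Matrix (Fin 2) (Fin 2) ℂ} {U : L → Matrix (Fin 2) (Fin 2) ℂ}
variable {B : LinearMap.BilinForm ℤ G} [FaithfulSMul L G]
variable [TwoUniqueSums G] [IsAddTorsionFree G] [Module.Finite ℤ G] [Finite L]

/-- Differences within a fibre of an orbit sum which does not vanish on any step. -/
theorem sub_eq_sub_cases (W : IsoWalk Sp A U) (hB : InvForm L B) (hr : Module.finrank ℤ G = 3)
    {l : L} (hl : l * l ≠ 1) (hall : ∀ x ∈ neighbours Sp, orbitSum G (l * l) x ≠ 0)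
    {x y c c' : G} (hx : x ∈ neighbours Sp) (hy : y ∈ neighbours Sp)
    (hxy : orbitSum G (l * l) y = orbitSum G (l * l) x)
    (hne : x ≠ y) (hc : c ∈ steps Sp) (hc' : c' ∈ steps Sp) (e : c' - c = y - x) :
    ((c = x ∧ c' = y) ∨ (c = -y ∧ c' = -x)) ∨
      (c ∈ neighbours Sp ∧ c' ∈ neighbours Sp ∧ orbitSum G (l * l) c = orbitSum G (l * l) x ∧
        orderOf (l * l) • (c' + x) = 2 • orbitSum G (l * l) x ∧
        orderOf (l * l) • (c + y) = 2 • orbitSum G (l * l) x) ∨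
      (-c ∈ neighbours Sp ∧ -c' ∈ neighbours Sp ∧
        orbitSum G (l * l) (-c) = orbitSum G (l * l) x ∧
        orderOf (l * l) • (-c + x) = 2 • orbitSum G (l * l) x ∧
        orderOf (l * l) • (-c' + y) = 2 • orbitSum G (l * l) x) := by
  set f := orbitSum G (l * l) with hf
  have hcc : f c' = f c := by
    rw [← sub_eq_zero, ← map_sub, e, map_sub, hxy, sub_self]
  have hyx : y ≠ x := hne.symm
  have main : ∀ d d' : G, d ∈ neighbours Sp → d' ∈ neighbours Sp → f d = f x → f d' = f x →
      d' - d = y - x → (d = x ∧ d' = y) ∨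
        (orderOf (l * l) • (d' + x) = 2 • f x ∧ orderOf (l * l) • (d + y) = 2 • f x) := by
    intro d d' hd hd' hfd hfd' e
    have e1 : d + y = d' + x := by
      have : d' = y - x + d := by rw [← e]; abel
      rw [this]; abel
    rcases W.uniqueSum_or_antipodal hB hr hl hd' hx (hall _ hd') (by rw [← hf, hfd']) with h | h
    · left
      rcases h d (mem_steps.2 (Or.inr hd)) y (mem_steps.2 (Or.inr hy)) e1 with ⟨h1, h2⟩ | ⟨h1, h2⟩
      · exact absurd h2 hyx
      · exact ⟨h1, h2.symm⟩
    · right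
      rw [← hf, hfd'] at h
      exact ⟨h, by rw [e1, h]⟩
  have hcn : c ∈ neighbours Sp := by
    rcases mem_steps.1 hc with rfl | hcn
    · exfalso
      rw [map_zero] at hcc
      rcases mem_steps.1 hc' with rfl | hcn'
      · rw [sub_self] at e; exact hyx (sub_eq_zero.1 e.symm)
      · exact hall _ hcn' hcc
    · exact hcn
  have hcn' : c' ∈ neighbours Sp := by
    rcases mem_steps.1 hc' with rfl | hcn'
    · rw [map_zero] at hcc
      exact absurd hcc.symm (hall _ hcn)
    · exact hcn'
  rcases W.orbitSum_image hl hx (hall x hx) hcn with h | h | h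
  · exact absurd h (hall _ hcn)
  · rcases main c c' hcn hcn' h (hcc.trans h) e with h1 | h1
    · exact Or.inl (Or.inl h1)
    · exact Or.inr (Or.inl ⟨hcn, hcn', h, h1⟩)
  · rcases main (-c') (-c) (neg_mem_neighbours hcn') (neg_mem_neighbours hcn)
      (by rw [map_neg, hcc, h, neg_neg]) (by rw [map_neg, h, neg_neg])
      (by rw [← e]; abel) with ⟨h1, h2⟩ | h1
    · exact Or.inl (Or.inr ⟨by rw [← h2, neg_neg], by rw [← h1, neg_neg]⟩)
    · exact Or.inr (Or.inr ⟨neg_mem_neighbours hcn, neg_mem_neighbours hcn',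
        by rw [map_neg, h, neg_neg], h1⟩)

open scoped ComplexOrder in
/-- An orbit sum of some `l ^ 2` which does not vanish on any step leads to a contradiction. -/
theorem false_of_orbitSum_ne_zero (W : IsoWalk Sp A U) (hB : InvForm L B)
    (hr : Module.finrank ℤ G = 3) {l : L} (hl : l * l ≠ 1)
    (hall : ∀ x ∈ neighbours Sp, orbitSum G (l * l) x ≠ 0) {h : G} (hh : h ∈ neighbours Sp)
    (hcol : (A h).adjugate * A (l • h) = 0) : False := by
  have h3 := W.exists_ne_of_finrank (by omega : 2 ≤ Module.finrank ℤ G)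
  have hl1 : l ≠ 1 := fun e => hl (by rw [e, one_mul])
  have hlh := W.smul_mem l hh
  have hne : l • h ≠ h := fun e => hl1 (W.eq_one_of_smul_eq hB h3 hh e)
  have hg := (W.smul_orbitSum_eq hB hr hl hh (hall h hh)).1
  have hc : ∀ x, orbitSum G (l * l) (l • x) = l • orbitSum G (l * l) x := fun x =>
    orbitSum_smul_of_commute ((Commute.refl l).mul_left (Commute.refl l)) x
  have hn : orderOf (l * l) ≠ 0 := (orderOf_pos _).ne'
  set f := orbitSum G (l * l) with hf
  have hfl : f (l • h) = f h := by rw [hc, hg]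
  have huniq : ∀ {x x' z : G}, orderOf (l * l) • (x + z) = 2 • f h →
      orderOf (l * l) • (x' + z) = 2 • f h → x = x' := by
    intro x x' z e e'
    have : orderOf (l * l) • (x - x') = 0 := by
      calc orderOf (l * l) • (x - x') = orderOf (l * l) • (x + z) - orderOf (l * l) • (x' + z) := by
            module
        _ = 0 := by rw [e, e', sub_self]
    exact sub_eq_zero.1 (by simpa only [smul_eq_zero, hn, false_or] using this)
  -- The difference `h - l h` has additional decompositions only if the fibre contains an antipode
  -- of `l h`. Without one, `A h` and `A (l h)` are orthogonal and `l` is an involution.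
  by_cases hp' : ∃ p' ∈ neighbours Sp, orderOf (l * l) • (p' + l • h) = 2 • f h
  · obtain ⟨p', hp', e'⟩ := hp'
    obtain ⟨p, rfl⟩ : ∃ p, p' = l • p := ⟨l⁻¹ • p', by rw [smul_inv_smul]⟩
    have hp : p ∈ neighbours Sp := by
      have := W.smul_mem l⁻¹ hp'
      rwa [inv_smul_smul] at this
    have e : orderOf (l * l) • (p + h) = 2 • f h := by
      have h1 := congrArg (fun x => l⁻¹ • x) e'
      simp only [smul_comm l⁻¹ _ (_ : G), smul_add, inv_smul_smul] at h1
      rw [smul_add, h1, inv_smul_eq_iff.2 hg.symm]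
    have hfp : f p = f h := by
      have h1 := congrArg f e
      rw [map_nsmul, map_nsmul, map_add, hf, orbitSum_orbitSum, ← hf, smul_comm 2,
        two_nsmul, ← sub_eq_zero, ← smul_sub] at h1
      have h2 := (by simpa only [smul_eq_zero, hn, false_or] using h1 : f p + f h - (f h + f h) = 0)
      rw [add_sub_add_right_eq_sub] at h2
      exact sub_eq_zero.1 h2
    have hph : p ≠ h := by
      rintro rfl
      have h1 : ∀ z : G, orderOf (l * l) • (z + z) = 2 • f p → z = p := by
        intro z hz
        have h2 : (orderOf (l * l) * 2) • (z - p) = 0 := by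
          calc (orderOf (l * l) * 2) • (z - p) =
                orderOf (l * l) • (z + z) - orderOf (l * l) • (p + p) := by module
            _ = 0 := by rw [hz, e, sub_self]
        exact sub_eq_zero.1 (by
          simpa only [smul_eq_zero, mul_eq_zero, hn, false_or, OfNat.ofNat_ne_zero] using h2)
      exact hne (h1 _ e')
    have hflp : f (l • p) = f h := by rw [hc, hfp, hg]
    have hsgn : ∀ {x y : G}, f x = f h → f y = f h → x ≠ -y := by
      rintro x y hx hy rfl
      rw [map_neg, hy] at hx
      exact hB.ne_neg (hall h hh) hx.symm
    have hdiff : l • p - p = h - l • h := by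
      have h1 : orderOf (l * l) • ((p + h) - (l • p + l • h)) = 0 := by
        rw [smul_sub, e, e', sub_self]
      have h2 := sub_eq_zero.1 (by simpa only [smul_eq_zero, hn, false_or] using h1 :
        (p + h) - (l • p + l • h) = 0)
      rw [sub_eq_sub_iff_add_eq_add, ← h2, add_comm]
    -- the antipodal steps are orthogonal
    have hperp : ((A p)ᴴ * A h).trace = 0 := by
      refine W.trace_eq_zero_of_unique (mem_steps.2 (Or.inr hp)) (mem_steps.2 (Or.inr hh))
        hph.symm ?_
      intro c hc c' hc' ec
      rcases W.sub_eq_sub_cases hB hr hl hall hp hh hfp.symm hph hc hc' ec with h1 | h1 | h1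
      · exact h1
      · rw [← hf, hfp] at h1
        obtain ⟨-, -, -, h4, h5⟩ := h1
        exact Or.inl ⟨huniq h5 e, huniq h4 (by rw [add_comm]; exact e)⟩
      · rw [← hf, hfp] at h1
        obtain ⟨-, -, -, h4, h5⟩ := h1
        have a1 : -c = h := huniq h4 (by rw [add_comm]; exact e)
        have a2 : -c' = p := huniq h5 e
        exact Or.inr ⟨by rw [← a1, neg_neg], by rw [← a2, neg_neg]⟩
    have hll : ∀ {x : G}, x ∈ neighbours Sp → l • l • x ≠ x := fun {x} hx ex =>
      hl (W.eq_one_of_smul_eq hB h3 hx (by rw [mul_smul, ex]))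
    -- With `p` antipodal to `h`, the steps `h`, `l h`, `p`, `l p` form a parallelogram, so `h - l h
    -- = l p - p`. Together with the negated pairs this gives exactly four decompositions.
    have hsum := W.sum_pairs (g := h - l • h) (sub_ne_zero.2 hne.symm)
      {(l • h, h), (-h, -(l • h)), (p, l • p), (-(l • p), -p)} (by
        rintro ⟨c, c'⟩
        simp only [Finset.mem_insert, Finset.mem_singleton, Prod.mk.injEq]
        have m1 := mem_steps.2 (Or.inr hh)
        have m2 := mem_steps.2 (Or.inr hlh)
        have m3 := mem_steps.2 (Or.inr hp)
        have m4 := mem_steps.2 (Or.inr hp')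
        constructor
        · rintro (⟨rfl, rfl⟩ | ⟨rfl, rfl⟩ | ⟨rfl, rfl⟩ | ⟨rfl, rfl⟩)
          · exact ⟨m2, m1, rfl⟩
          · exact ⟨neg_mem_steps m1, neg_mem_steps m2, by abel⟩
          · exact ⟨m3, m4, hdiff⟩
          · exact ⟨neg_mem_steps m4, neg_mem_steps m3, by rw [← hdiff]; abel⟩
        · rintro ⟨c1, c2, c3⟩
          rcases W.sub_eq_sub_cases hB hr hl hall hlh hh hfl.symm hne c1 c2 c3 with
            (h1 | h1) | h1 | h1
          · exact Or.inl h1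
          · exact Or.inr (Or.inl h1)
          · rw [← hf, hfl] at h1
            obtain ⟨-, -, -, h4, h5⟩ := h1
            exact Or.inr (Or.inr (Or.inl ⟨huniq h5 e, huniq h4 e'⟩))
          · rw [← hf, hfl] at h1
            obtain ⟨-, -, -, h4, h5⟩ := h1
            have a1 : -c = l • p := huniq h4 e'
            have a2 : -c' = p := huniq h5 e
            exact Or.inr (Or.inr (Or.inr ⟨by rw [← a1, neg_neg], by rw [← a2, neg_neg]⟩)))
    rw [Finset.sum_insert, Finset.sum_insert, Finset.sum_pair] at hsum
    rotate_left
    · exact fun h1 => hsgn hfp hflp (Prod.mk.inj h1).1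
    · simp only [Finset.mem_insert, Finset.mem_singleton, Prod.mk.injEq, not_or, not_and]
      refine ⟨fun h1 => absurd h1.symm (hsgn hfp rfl), fun h1 h2 => ?_⟩
      apply hll hh
      rw [neg_injective h2, ← neg_injective h1]
    · simp only [Finset.mem_insert, Finset.mem_singleton, Prod.mk.injEq, not_or, not_and]
      refine ⟨fun h1 => absurd h1 (hsgn hfl rfl), fun h1 h2 => ?_,
        fun h1 => absurd h1 (hsgn hfl hflp)⟩
      exact hll hh (by rw [h1, ← h2])
    simp only [W.trace_neg] at hsum
    -- the real part of the trace of `U l` vanishes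
    have hU := W.unitary l
    have dh := W.det_eq_zero hB hh
    have dp := W.det_eq_zero hB hp
    have nh := W.ne_zero h hh
    have np := W.ne_zero p hp
    obtain ⟨mu, hmu, hUh⟩ := exists_mul_eq_smul_of_colPar hU dh nh (by rw [← W.cov]; exact hcol)
    have hcp := W.colPar_fibre hB hr hl hh (hall h hh) hcol hp hfp
    have hUp := mul_eq_smul_of_colPar dh nh dp np hcp hUh
    have e1 : ((A (l • h))ᴴ * A h).trace = star mu * (U l * ((A h)ᴴ * A h)).trace := by
      rw [W.cov, hUh, Matrix.conjTranspose_mul, Matrix.conjTranspose_conjTranspose,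
        Matrix.conjTranspose_smul, Matrix.mul_smul, Matrix.smul_mul, Matrix.trace_smul, smul_eq_mul,
        Matrix.mul_assoc]
    have e2 : ((A p)ᴴ * A (l • p)).trace = star (star mu * (U l * ((A p)ᴴ * A p)).trace) := by
      rw [star_mul', star_star, ← Matrix.trace_conjTranspose, Matrix.conjTranspose_mul,
        Matrix.conjTranspose_mul, Matrix.conjTranspose_conjTranspose, W.cov, hUp, Matrix.smul_mul,
        Matrix.mul_smul, Matrix.trace_smul, smul_eq_mul, Matrix.mul_assoc]
    -- `A h` and `A p` share the column on which `U l` acts by `mu`, and have orthogonal rows of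
    -- equal norm. So the sum below is a scalar, and the trace relation reduces to `Re (star mu * tr
    -- U_l) = 0`.
    have hN := conjTranspose_mul_self_add dh nh dp np hcp
      (by
        rw [show (A h)ᴴ * A p = ((A p)ᴴ * A h)ᴴ by simp, Matrix.trace_conjTranspose, hperp,
          star_zero]) (W.normSq_const hh hp)
    have hre : (star mu * (U l * ((A h)ᴴ * A h + (A p)ᴴ * A p)).trace).re = 0 := by
      rw [Matrix.mul_add, Matrix.trace_add, mul_add, Complex.add_re]
      have h1 := congrArg Complex.re hsum
      rw [e1, e2] at h1
      simp only [Complex.add_re, Complex.star_def, Complex.conj_re, Complex.zero_re] at h1 ⊢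
      linarith
    rw [hN, Matrix.mul_smul, mul_one, Matrix.trace_smul, smul_eq_mul] at hre
    have htr := trace_eq_zero_of_re hU nh hmu hUh (by
      rw [trace_conjTranspose_mul_self, mul_left_comm, Complex.re_ofReal_mul] at hre
      refine (mul_eq_zero.1 hre).resolve_left fun h1 => nh ?_
      apply Matrix.trace_conjTranspose_mul_self_eq_zero_iff.1
      rw [trace_conjTranspose_mul_self, h1, Complex.ofReal_zero])
    exact hl (W.mul_self_eq_one (mul_self_of_trace_eq_zero htr))
  · push Not at hp'
    refine hl (W.mul_self_eq_one_of_trace hB hh (W.trace_eq_zero_of_unique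
      (mem_steps.2 (Or.inr hlh)) (mem_steps.2 (Or.inr hh)) hne.symm ?_))
    intro c hc c' hc' e
    rcases W.sub_eq_sub_cases hB hr hl hall hlh hh hfl.symm hne hc hc' e with h1 | h1 | h1
    · exact h1
    · rw [← hf, hfl] at h1
      exact absurd h1.2.2.2.1 (hp' _ h1.2.1)
    · rw [← hf, hfl] at h1
      exact absurd h1.2.2.2.1 (hp' _ h1.1)

theorem mul_self_eq_one_of_rank_three [Module.Free ℤ G] (W : IsoWalk Sp A U) (hB : InvForm L B)
    (hr : Module.finrank ℤ G = 3) (l : L) : l * l = 1 := by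
  by_contra hl
  obtain ⟨x, hx0, hx⟩ := hB.exists_fixed_of_rank_three hr l
  obtain ⟨h, hh, h0⟩ : ∃ h ∈ neighbours Sp, orbitSum G (l * l) h ≠ 0 := by
    by_contra hcon
    push Not at hcon
    have h1 := W.map_eq_zero hcon x
    rw [orbitSum_of_fix hx] at h1
    have hn : orderOf (l * l) ≠ 0 := (orderOf_pos _).ne'
    exact hx0 (by simpa only [smul_eq_zero, hn, false_or] using h1)
  by_cases hall : ∀ k ∈ neighbours Sp, orbitSum G (l * l) k ≠ 0
  · rcases (W.smul_orbitSum_eq hB hr hl hh h0).2 with hc | hc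
    · exact W.false_of_orbitSum_ne_zero hB hr hl hall hh hc
    · refine W.transpose.false_of_orbitSum_ne_zero hB hr hl hall hh ?_
      rw [← Matrix.adjugate_transpose, ← Matrix.transpose_mul, hc, Matrix.transpose_zero]
  · push Not at hall
    obtain ⟨k, hk, hk0⟩ := hall
    -- Conjugating `l` by an element taking `h` to `±k` gives a second projection, which does not
    -- vanish on `k`.
    obtain ⟨m, hm⟩ := W.exists_smul hh hk
    have e : m * l * m⁻¹ * (m * l * m⁻¹) = m * (l * l) * m⁻¹ := by group
    have hl' : m * l * m⁻¹ * (m * l * m⁻¹) ≠ 1 := by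
      rw [e]
      exact fun h1 => hl (conj_eq_one_iff.1 h1)
    have hk' : orbitSum G (m * l * m⁻¹ * (m * l * m⁻¹)) k ≠ 0 := by
      rw [e, orbitSum_conj]
      intro h1
      rw [smul_eq_zero_iff_eq] at h1
      rcases hm with rfl | rfl
      · rw [inv_smul_smul] at h1; exact h0 h1
      · rw [smul_neg, inv_smul_smul, map_neg, neg_eq_zero] at h1; exact h0 h1
    rcases (W.smul_orbitSum_eq hB hr hl' hk hk').2 with hc | hc
    · exact W.false_of_orbitSum_eq_zero hB hr hl' hh hk h0 hk0 hk' hc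
    · refine W.transpose.false_of_orbitSum_eq_zero hB hr hl' hh hk h0 hk0 hk' ?_
      rw [← Matrix.adjugate_transpose, ← Matrix.transpose_mul, hc, Matrix.transpose_zero]

end IsoWalk

/-! ### Isotropy groups consisting of involutions -/

section TwoByTwo

variable {X Y : Matrix (Fin 2) (Fin 2) ℂ}

/-- Polarisation of the Cayley–Hamilton identity for traceless matrices. -/
theorem mul_add_mul_of_trace_eq_zero (hX : X.trace = 0) (hY : Y.trace = 0) :
    X * Y + Y * X = (X * Y).trace • 1 := by
  rw [Matrix.trace_fin_two] at hX hY
  ext i j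
  fin_cases i <;> fin_cases j <;>
    simp [Matrix.mul_apply, Fin.sum_univ_two, Matrix.trace_fin_two]
  · linear_combination Y 0 0 * hX - X 1 1 * hY
  · linear_combination Y 0 1 * hX + X 0 1 * hY
  · linear_combination Y 1 0 * hX + X 1 0 * hY
  · linear_combination Y 1 1 * hX - X 0 0 * hY

theorem trace_eq_zero_of_mul_self {c : ℂ} (h : X * X = c • 1) (hX : ∀ d : ℂ, X ≠ d • 1) :
    X.trace = 0 := by
  by_contra ht
  -- The value solves `X² - tr X · X + det X = 0` for `X` when `X² = c`.
  apply hX (X.trace⁻¹ * (c + X.det))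
  rw [mul_smul, eq_inv_smul_iff₀ ht]
  have e := fun i j => congrFun (congrFun h i) j
  simp only [Matrix.mul_apply, Fin.sum_univ_two, Matrix.smul_apply, smul_eq_mul] at e
  have e00 := e 0 0
  have e01 := e 0 1
  have e10 := e 1 0
  have e11 := e 1 1
  simp at e00 e01 e10 e11
  ext i j
  fin_cases i <;> fin_cases j <;>
    simp [Matrix.det_fin_two, Matrix.trace_fin_two]
  · linear_combination e00
  · rw [← mul_eq_zero]; linear_combination e01
  · rw [← mul_eq_zero]; linear_combination e10
  · linear_combination e11

end TwoByTwo

variable {G : Type*} [AddCommGroup G] [DecidableEq G] {L : Type*} [Group L] [DistribMulAction L G]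

namespace IsoWalk

variable {Sp : Finset G} {A : G → Matrix (Fin 2) (Fin 2) ℂ} {U : L → Matrix (Fin 2) (Fin 2) ℂ}
variable {B : LinearMap.BilinForm ℤ G} [FaithfulSMul L G]

theorem exists_U_one (W : IsoWalk Sp A U) : ∃ c : ℂ, U (1 : L) = c • 1 := by
  obtain ⟨c, hc⟩ := W.proj 1 1
  rw [one_mul] at hc
  have h5 := congrArg (fun M => (U (1 : L))ᴴ * M) hc
  simp only [Matrix.mul_smul, ← Matrix.mul_assoc,
    conjTranspose_mul_self_of_mem (W.unitary (1 : L)), one_mul] at h5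
  have hc0 : c ≠ 0 := by
    rintro rfl
    rw [zero_smul] at h5
    exact one_ne_zero h5
  exact ⟨c⁻¹, by rw [h5, smul_smul, inv_mul_cancel₀ hc0, one_smul]⟩

theorem trace_U_eq_zero (W : IsoWalk Sp A U) {l : L} (h1 : l ≠ 1) (h2 : l * l = 1) :
    (U l).trace = 0 := by
  obtain ⟨c, hc⟩ := W.proj l l
  obtain ⟨d, hd⟩ := W.exists_U_one
  rw [h2, hd] at hc
  have hc0 : c ≠ 0 := by
    rintro rfl
    rw [zero_smul, ← hd] at hc
    exact W.U_ne_zero 1 hc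
  refine trace_eq_zero_of_mul_self (c := c⁻¹ * d) ?_ fun e he => h1 (W.eq_one_of_scalar he)
  rw [mul_smul, hc, smul_smul, inv_mul_cancel₀ hc0, one_smul]

/-- Distinct nontrivial involutions are represented by anticommuting matrices. -/
theorem anticommute (W : IsoWalk Sp A U) (hinv : ∀ l : L, l * l = 1) {l m : L} (hl : l ≠ 1)
    (hm : m ≠ 1) (hlm : l ≠ m) : U l * U m = -(U m * U l) := by
  have h1 : l * m ≠ 1 := fun e => hlm (by
    rw [mul_eq_one_iff_eq_inv.1 e, inv_eq_iff_mul_eq_one.2 (hinv m)])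
  have ht := W.trace_U_eq_zero h1 (hinv _)
  obtain ⟨c, hc⟩ := W.proj l m
  have hc0 : c ≠ 0 := by
    rintro rfl
    rw [zero_smul] at hc
    exact W.U_ne_zero _ hc
  rw [hc, Matrix.trace_smul, smul_eq_mul] at ht
  have := mul_add_mul_of_trace_eq_zero (W.trace_U_eq_zero hl (hinv l)) (W.trace_U_eq_zero hm (hinv m))
  rw [(mul_eq_zero.1 ht).resolve_left hc0, zero_smul] at this
  exact eq_neg_of_add_eq_zero_left this

/-- An isotropy group of involutions has at most four elements. -/
theorem group_cases (W : IsoWalk Sp A U) (hinv : ∀ l : L, l * l = 1) :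
    (∀ l : L, l = 1) ∨ (∃ m : L, m ≠ 1 ∧ ∀ l : L, l = 1 ∨ l = m) ∨
      ∃ m n : L, m ≠ 1 ∧ n ≠ 1 ∧ m ≠ n ∧ ∀ l : L, l = 1 ∨ l = m ∨ l = n ∨ l = m * n := by
  by_cases h1 : ∀ l : L, l = 1
  · exact Or.inl h1
  push Not at h1
  obtain ⟨m, hm⟩ := h1
  by_cases h2 : ∀ l : L, l = 1 ∨ l = m
  · exact Or.inr (Or.inl ⟨m, hm, h2⟩)
  push Not at h2
  obtain ⟨n, hn, hnm⟩ := h2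
  refine Or.inr (Or.inr ⟨m, n, hm, hn, hnm.symm, ?_⟩)
  intro l
  by_contra hcon
  push Not at hcon
  obtain ⟨c1, c2, c3, c4⟩ := hcon
  have h1 : m * n ≠ 1 := fun e => hnm (by
    rw [mul_eq_one_iff_eq_inv.1 e, inv_eq_iff_mul_eq_one.2 (hinv n)])
  have a1 := W.anticommute hinv c1 hm c2
  have a2 := W.anticommute hinv c1 hn c3
  have a3 := W.anticommute hinv c1 h1 c4
  obtain ⟨c, hc⟩ := W.proj m n
  have hc0 : c ≠ 0 := by
    rintro rfl
    rw [zero_smul] at hc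
    exact W.U_ne_zero _ hc
  -- Anticommuting with both factors, `U l` commutes with their product. The latter is a multiple of
  -- `U (m * n)`, with which it should also anticommute.
  have a4 : U l * (U m * U n) = U m * U n * U l := by
    rw [← Matrix.mul_assoc, a1, Matrix.neg_mul, Matrix.mul_assoc, a2, Matrix.mul_neg, neg_neg,
      Matrix.mul_assoc]
  rw [hc, Matrix.mul_smul, Matrix.smul_mul, a4, ← smul_neg] at a3
  have a5 : U m * U n * U l = 0 := by
    have := smul_right_injective _ hc0 a3
    have h2 : (2 : ℂ) • (U m * U n * U l) = 0 := by
      rw [two_smul]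
      nth_rewrite 1 [this]
      exact neg_add_cancel _
    exact (smul_eq_zero.1 h2).resolve_left two_ne_zero
  exact unitary_ne_zero (mul_mem (mul_mem (W.unitary m) (W.unitary n)) (W.unitary l)) a5

theorem mem_iff_of_mem (W : IsoWalk Sp A U) {h : G} (hh : h ∈ Sp) {x : G} :
    x ∈ Sp ↔ ∃ l : L, x = l • h := by
  constructor
  · intro hx
    obtain ⟨l, hl⟩ := W.trans h hh x hx
    exact ⟨l, hl.symm⟩
  · rintro ⟨l, rfl⟩
    exact W.mem l h hh

theorem nonempty [Nontrivial G] (W : IsoWalk Sp A U) : ∃ h, h ∈ Sp := by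
  by_contra hcon
  push Not at hcon
  have hS : Sp = ∅ := Finset.eq_empty_of_forall_notMem hcon
  have := W.gen
  rw [hS] at this
  simp at this

section Involutions

variable [TwoUniqueSums G] [IsAddTorsionFree G] [Module.Finite ℤ G]

/-- Under `1 + m` the steps `h` and `n h` have images equal up to sign, and likewise `h` and `m h`
under `1 + n`. A minus sign in either case is the claim. Two plus signs give `m h = n h`, contrary
to freeness. -/
theorem four_sum_eq_zero (W : IsoWalk Sp A U) (hB : InvForm L B)
    (hr : 2 ≤ Module.finrank ℤ G) (hinv : ∀ l : L, l * l = 1) {h : G} (hh : h ∈ neighbours Sp)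
    {m n : L} (hm : m ≠ 1) (hn : n ≠ 1) (hmn : m ≠ n) (h1 : h + m • h ≠ 0) (h2 : h + n • h ≠ 0) :
    h + m • h + n • h + (m * n) • h = 0 := by
  have h3 := W.exists_ne_of_finrank hr
  have hcomm : ∀ l l' : L, l * l' = l' * l := fun l l' => by
    calc l * l' = (l * l')⁻¹ := (inv_eq_of_mul_eq_one_left (hinv _)).symm
      _ = l'⁻¹ * l⁻¹ := mul_inv_rev _ _
      _ = l' * l := by
        rw [inv_eq_of_mul_eq_one_left (hinv l), inv_eq_of_mul_eq_one_left (hinv l')]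
  have key : ∀ l l' : L, l ≠ 1 → h + l • h ≠ 0 → h + l • h = l' • h + (l * l') • h ∨
      h + l • h = -(l' • h + (l * l') • h) := by
    intro l l' hl hne
    obtain ⟨g, hg⟩ := W.exists_image_subset
      (AddMonoidHom.id G + DistribSMul.toAddMonoidHom G l) hl (by
        intro x
        simp only [AddMonoidHom.add_apply, AddMonoidHom.id_apply, DistribSMul.toAddMonoidHom_apply]
        rw [smul_smul, hinv l, one_smul, add_comm])
    simp only [AddMonoidHom.add_apply, AddMonoidHom.id_apply, DistribSMul.toAddMonoidHom_apply]
      at hg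
    have a1 := hg h hh
    have a2 := hg (l' • h) (W.smul_mem l' hh)
    have hne' : l' • h + l • l' • h ≠ 0 := by
      rw [smul_smul, hcomm l l', mul_smul, ← smul_add]
      intro e
      exact hne ((smul_eq_zero_iff_eq l').1 e)
    rw [mul_smul]
    rcases a1 with a1 | a1 | a1
    · exact absurd a1 hne
    · rcases a2 with a2 | a2 | a2
      · exact absurd a2 hne'
      · exact Or.inl (a1.trans a2.symm)
      · exact Or.inr (by rw [a1, a2, neg_neg])
    · rcases a2 with a2 | a2 | a2
      · exact absurd a2 hne'
      · exact Or.inr (by rw [a1, a2])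
      · exact Or.inl (a1.trans a2.symm)
  rcases key m n hm h1 with k1 | k1
  · rcases key n m hn h2 with k2 | k2
    · exfalso
      rw [hcomm n m] at k2
      generalize e1 : m • h = x at *
      generalize e2 : n • h = y at *
      have h4 : (2 : ℤ) • (x - y) = 0 := by
        have : (2 : ℤ) • (x - y) = (h + x - (y + (m * n) • h)) - (h + y - (x + (m * n) • h)) := by
          abel
        rw [this, k1, k2]; abel
      have h5 : x = y := sub_eq_zero.1 (by simpa using h4)
      rw [← e1, ← e2] at h5
      have h6 : (n⁻¹ * m) • h = h := by rw [mul_smul, h5, inv_smul_smul]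
      exact hmn (inv_mul_eq_one.1 (W.eq_one_of_smul_eq hB h3 hh h6)).symm
    · rw [hcomm n m] at k2
      rw [← sub_eq_zero, sub_neg_eq_add] at k2
      rw [← k2]; abel
  · rw [← sub_eq_zero, sub_neg_eq_add] at k1
    rw [← k1]; abel

/-- The generators of an isotropic walk in rank two. -/
theorem generators_of_rank_two (W : IsoWalk Sp A U) (hB : InvForm L B)
    (hr : Module.finrank ℤ G = 2) (hinv : ∀ l : L, l * l = 1) :
    ∃ (h : G) (m : L), m ≠ 1 ∧ (Sp = {h, m • h} ∨
      (Sp = {h, m • h, -h, -(m • h)} ∧ ∃ i : L, i • h = -h)) := by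
  have : Nontrivial G := by
    apply Module.nontrivial_of_finrank_pos (R := ℤ); omega
  obtain ⟨h, hh⟩ := W.nonempty
  have hhn : h ∈ neighbours Sp := mem_neighbours.2 (Or.inl hh)
  rcases W.group_cases hinv with hL | ⟨m, hm, hL⟩ | ⟨m, n, hm, hn, hmn, hL⟩
  · exfalso
    have := finrank_le_one_of_generates W.gen (x := h) fun k hk => by
      obtain ⟨l, rfl⟩ := (W.mem_iff_of_mem hh).1 hk
      rw [hL l, one_smul]; exact Or.inl rfl
    omega
  · refine ⟨h, m, hm, Or.inl ?_⟩
    ext x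
    rw [W.mem_iff_of_mem hh, Finset.mem_insert, Finset.mem_singleton]
    constructor
    · rintro ⟨l, rfl⟩
      rcases hL l with rfl | rfl
      · exact Or.inl (one_smul _ _)
      · exact Or.inr rfl
    · rintro (rfl | rfl)
      · exact ⟨1, (one_smul _ _).symm⟩
      · exact ⟨m, rfl⟩
  · have main : ∀ i p : L, i • h = -h → p ≠ 1 →
        (∀ l : L, l = 1 ∨ l = i ∨ l = p ∨ l = p * i) → 
        ∃ (h : G) (m : L), m ≠ 1 ∧ (Sp = {h, m • h} ∨
          (Sp = {h, m • h, -h, -(m • h)} ∧ ∃ i : L, i • h = -h)) := by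
      intro i p hi hp hL'
      refine ⟨h, p, hp, Or.inr ⟨?_, i, hi⟩⟩
      have hpi : (p * i) • h = -(p • h) := by rw [mul_smul, hi, smul_neg]
      ext x
      rw [W.mem_iff_of_mem hh]
      simp only [Finset.mem_insert, Finset.mem_singleton]
      constructor
      · rintro ⟨l, rfl⟩
        rcases hL' l with rfl | rfl | rfl | rfl
        · exact Or.inl (one_smul _ _)
        · exact Or.inr (Or.inr (Or.inl hi))
        · exact Or.inr (Or.inl rfl)
        · exact Or.inr (Or.inr (Or.inr hpi))
      · rintro (rfl | rfl | rfl | rfl)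
        · exact ⟨1, (one_smul _ _).symm⟩
        · exact ⟨p, rfl⟩
        · exact ⟨i, hi.symm⟩
        · exact ⟨p * i, hpi.symm⟩
    by_cases c1 : h + m • h = 0
    · refine main m n (neg_eq_of_add_eq_zero_right c1).symm hn fun l => ?_
      rcases hL l with h1 | h1 | h1 | h1
      · exact Or.inl h1
      · exact Or.inr (Or.inl h1)
      · exact Or.inr (Or.inr (Or.inl h1))
      · refine Or.inr (Or.inr (Or.inr ?_))
        rw [h1, ← inv_eq_of_mul_eq_one_left (hinv (m * n)), mul_inv_rev,
          inv_eq_of_mul_eq_one_left (hinv m), inv_eq_of_mul_eq_one_left (hinv n)]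
    by_cases c2 : h + n • h = 0
    · refine main n m (neg_eq_of_add_eq_zero_right c2).symm hm fun l => ?_
      rcases hL l with h1 | h1 | h1 | h1
      exacts [Or.inl h1, Or.inr (Or.inr (Or.inl h1)), Or.inr (Or.inl h1),
        Or.inr (Or.inr (Or.inr h1))]
    by_cases c3 : h + (m * n) • h = 0
    · refine main (m * n) m (neg_eq_of_add_eq_zero_right c3).symm hm fun l => ?_
      rcases hL l with h1 | h1 | h1 | h1
      · exact Or.inl h1
      · exact Or.inr (Or.inr (Or.inl h1))
      · refine Or.inr (Or.inr (Or.inr ?_))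
        rw [h1, ← mul_assoc, hinv m, one_mul]
      · exact Or.inr (Or.inl h1)
    exfalso
    have h0 := W.four_sum_eq_zero hB hr.ge hinv hhn hm hn hmn c1 c2
    have e1 : m • (m * n) • h = n • h := by rw [smul_smul, ← mul_assoc, hinv, one_mul]
    have e2 : m • n • h = (m * n) • h := (mul_smul _ _ _).symm
    have e3 : m • m • h = h := by rw [smul_smul, hinv, one_smul]
    have e5 : n • n • h = h := by rw [smul_smul, hinv, one_smul]
    have hnm : n * m = m * n := by
      rw [← inv_eq_of_mul_eq_one_left (hinv (m * n)), mul_inv_rev,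
        inv_eq_of_mul_eq_one_left (hinv m), inv_eq_of_mul_eq_one_left (hinv n)]
    have e4 : n • (m * n) • h = m • h := by
      rw [smul_smul, ← hnm, ← mul_assoc, hinv, one_mul]
    have e6 : n • m • h = (m * n) • h := by rw [smul_smul, hnm]
    have i1 := hB.inv m (h + m • h) (h + n • h)
    have i2 := hB.inv m (h + m • h) (h + (m * n) • h)
    have i3 := hB.inv n (h + n • h) (h + (m * n) • h)
    simp only [smul_add, e1, e2, e3, e4, e5, e6] at i1 i2 i3
    have f1 : m • h + (m * n) • h = -(h + n • h) := by
      rw [eq_neg_iff_add_eq_zero, ← h0]; abel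
    have f2 : m • h + n • h = -(h + (m * n) • h) := by
      rw [eq_neg_iff_add_eq_zero, ← h0]; abel
    have f3 : n • h + m • h = -(h + (m * n) • h) := by rw [add_comm, f2]
    rw [f1, add_comm (m • h) h, map_neg] at i1
    rw [f2, add_comm (m • h) h, map_neg] at i2
    rw [f3, add_comm (n • h) h, map_neg] at i3
    exact c3 (hB.eq_zero_of_rank_two hr c1 c2 (by linarith) (by linarith) (by linarith))

/-- The generators of an isotropic walk in rank three. -/
theorem generators_of_rank_three (W : IsoWalk Sp A U) (hB : InvForm L B)
    (hr : Module.finrank ℤ G = 3) (hinv : ∀ l : L, l * l = 1) :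
    ∃ (h : G) (m n : L), m ≠ 1 ∧ n ≠ 1 ∧ m ≠ n ∧ Sp = {h, m • h, n • h, (m * n) • h} ∧
      h + m • h + n • h + (m * n) • h = 0 := by
  have : Nontrivial G := by
    apply Module.nontrivial_of_finrank_pos (R := ℤ); omega
  obtain ⟨h, hh⟩ := W.nonempty
  have hhn : h ∈ neighbours Sp := mem_neighbours.2 (Or.inl hh)
  rcases W.group_cases hinv with hL | ⟨m, hm, hL⟩ | ⟨m, n, hm, hn, hmn, hL⟩
  · exfalso
    have := finrank_le_one_of_generates W.gen (x := h) fun k hk => by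
      obtain ⟨l, rfl⟩ := (W.mem_iff_of_mem hh).1 hk
      rw [hL l, one_smul]; exact Or.inl rfl
    omega
  · exfalso
    have := finrank_le_two_of_generates W.gen (x := h) (y := m • h) fun k hk => by
      obtain ⟨l, rfl⟩ := (W.mem_iff_of_mem hh).1 hk
      rcases hL l with rfl | rfl
      · exact Or.inl (Or.inl (one_smul _ _))
      · exact Or.inr (Or.inl rfl)
    omega
  · refine ⟨h, m, n, hm, hn, hmn, ?_, ?_⟩
    · ext x
      rw [W.mem_iff_of_mem hh]
      simp only [Finset.mem_insert, Finset.mem_singleton]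
      constructor
      · rintro ⟨l, rfl⟩
        rcases hL l with rfl | rfl | rfl | rfl
        · exact Or.inl (one_smul _ _)
        · exact Or.inr (Or.inl rfl)
        · exact Or.inr (Or.inr (Or.inl rfl))
        · exact Or.inr (Or.inr (Or.inr rfl))
      · rintro (rfl | rfl | rfl | rfl)
        · exact ⟨1, (one_smul _ _).symm⟩
        · exact ⟨m, rfl⟩
        · exact ⟨n, rfl⟩
        · exact ⟨m * n, rfl⟩
    · refine W.four_sum_eq_zero hB (by omega) hinv hhn hm hn hmn ?_ ?_
      -- An element reversing `h` would leave only two directions among the generators, too few for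
      -- rank three.
      · intro e
        have hmh : m • h = -h := (neg_eq_of_add_eq_zero_right e).symm
        have hnm : m * n = n * m := by
          rw [← inv_eq_of_mul_eq_one_left (hinv (n * m)), mul_inv_rev,
            inv_eq_of_mul_eq_one_left (hinv m), inv_eq_of_mul_eq_one_left (hinv n)]
        have := finrank_le_two_of_generates W.gen (x := h) (y := n • h) fun k hk => by
          obtain ⟨l, rfl⟩ := (W.mem_iff_of_mem hh).1 hk
          rcases hL l with rfl | rfl | rfl | rfl
          · exact Or.inl (Or.inl (one_smul _ _))
          · exact Or.inl (Or.inr hmh)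
          · exact Or.inr (Or.inl rfl)
          · exact Or.inr (Or.inr (by rw [hnm, mul_smul, hmh, smul_neg]))
        omega
      · intro e
        have hnh : n • h = -h := (neg_eq_of_add_eq_zero_right e).symm
        have := finrank_le_two_of_generates W.gen (x := h) (y := m • h) fun k hk => by
          obtain ⟨l, rfl⟩ := (W.mem_iff_of_mem hh).1 hk
          rcases hL l with rfl | rfl | rfl | rfl
          · exact Or.inl (Or.inl (one_smul _ _))
          · exact Or.inr (Or.inl rfl)
          · exact Or.inl (Or.inr hnh)
          · exact Or.inr (Or.inr (by rw [mul_smul, hnh, smul_neg]))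
        omega

end Involutions

end IsoWalk

/-! ### Conjugation identities -/

section TwoByTwo

variable {X Y T M : Matrix (Fin 2) (Fin 2) ℂ}

theorem conj_conjTranspose_conj (hT : T ∈ Matrix.unitaryGroup (Fin 2) ℂ) :
    T * (Tᴴ * X * T) * Tᴴ = X := by
  have h := mul_conjTranspose_self_of_mem hT
  calc T * (Tᴴ * X * T) * Tᴴ = (T * Tᴴ) * X * (T * Tᴴ) := by simp only [Matrix.mul_assoc]
    _ = X := by rw [h, one_mul, mul_one]

theorem conj_mul_conj (hT : T ∈ Matrix.unitaryGroup (Fin 2) ℂ) :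
    (T * X * Tᴴ) * (T * Y * Tᴴ) = T * (X * Y) * Tᴴ := by
  have h := conjTranspose_mul_self_of_mem hT
  calc (T * X * Tᴴ) * (T * Y * Tᴴ) = T * (X * (Tᴴ * T) * Y) * Tᴴ := by simp only [Matrix.mul_assoc]
    _ = _ := by rw [h, mul_one]

theorem conjTranspose_conj : (T * X * Tᴴ)ᴴ = T * Xᴴ * Tᴴ := by
  simp [Matrix.mul_assoc]

theorem conj_injective (hT : T ∈ Matrix.unitaryGroup (Fin 2) ℂ) (h : T * X * Tᴴ = T * Y * Tᴴ) :
    X = Y := by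
  have h1 := conjTranspose_mul_self_of_mem hT
  have h2 := congrArg (fun M => Tᴴ * M * T) h
  simp only [Matrix.mul_assoc, h1, mul_one] at h2
  simpa only [← Matrix.mul_assoc, h1, one_mul] using h2

end TwoByTwo

/-! ### Coordinates given by generators -/

section Coordinates

variable {G : Type*} [AddCommGroup G]

theorem exists_coordinates [Module.Finite ℤ G] {d : ℕ} (h : Fin d → G)
    (hgen : AddSubgroup.closure (Set.range h) = ⊤) (hr : Module.finrank ℤ G = d) :
    ∃ φ : G ≃+ (Fin d → ℤ), ∀ i, φ (h i) = Pi.single i 1 := by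
  have hs : ⊤ ≤ Submodule.span ℤ (Set.range h) := by
    rw [← AddSubgroup.toIntSubmodule.map_top, ← hgen]
    change AddSubgroup.closure _ ≤ (Submodule.span ℤ (Set.range h)).toAddSubgroup
    rw [AddSubgroup.closure_le]
    exact Submodule.subset_span
  have hl : LinearIndependent ℤ h :=
    linearIndependent_of_top_le_span_of_card_eq_finrank hs (by rw [Fintype.card_fin, hr])
  let b := Module.Basis.mk hl hs
  refine ⟨b.equivFun.toAddEquiv, fun i => ?_⟩
  have : h i = b i := (Module.Basis.mk_apply hl hs i).symm
  rw [this]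
  ext j
  simp [Module.Basis.equivFun_apply, Finsupp.single_apply, Pi.single_apply, eq_comm]

end Coordinates

/-! ### Normal form in rank two -/

namespace IsoWalk

variable {G : Type*} [AddCommGroup G] [DecidableEq G] {L : Type*} [Group L] [DistribMulAction L G]
variable {Sp : Finset G} {A : G → Matrix (Fin 2) (Fin 2) ℂ} {U : L → Matrix (Fin 2) (Fin 2) ℂ}
variable {B : LinearMap.BilinForm ℤ G}

theorem neg_conj (W : IsoWalk Sp A U) {T M : Matrix (Fin 2) (Fin 2) ℂ}
    (hT : T ∈ Matrix.unitaryGroup (Fin 2) ℂ) {h : G} (h1 : A h = T * M * Tᴴ) :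
    A (-h) = T * (M.adjugate)ᴴ * Tᴴ := by
  rw [W.adj, h1, adjugate_unitary_conj hT, conjTranspose_conj]

theorem closure_eq_top {Sp : Finset G} {S : Set G}
    (hgen : AddSubgroup.closure (Sp : Set G) = ⊤) (h : ∀ x ∈ Sp, x ∈ S ∨ -x ∈ S) :
    AddSubgroup.closure S = ⊤ := by
  rw [eq_top_iff, ← hgen, AddSubgroup.closure_le]
  intro x hx
  rcases h x hx with h1 | h1
  · exact AddSubgroup.subset_closure h1
  · rw [← neg_neg x]
    exact neg_mem (AddSubgroup.subset_closure h1)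

/-- The transition matrices of an isotropic walk in rank two whose steps `h`, `k` share the
column space. -/
theorem form_of_rank_two [Module.Finite ℤ G] (W : IsoWalk Sp A U) (hB : InvForm L B)
    {h k : G} (hh : h ∈ neighbours Sp) (hk : k ∈ neighbours Sp)
    (hS : ∀ x ∈ neighbours Sp, x = h ∨ x = -h ∨ x = k ∨ x = -k)
    (φ : G ≃+ (Fin 2 → ℤ)) (h0 : φ h = Pi.single 0 1) (h1 : φ k = Pi.single 1 1)
    (hc : (A h).adjugate * A k = 0) :
    ∃ T : Matrix (Fin 2) (Fin 2) ℂ, T ∈ Matrix.unitaryGroup (Fin 2) ℂ ∧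
      A h = T * ((1 / 2 : ℂ) • !![1, 0; 1, 0]) * Tᴴ ∧
      A (-h) = T * ((1 / 2 : ℂ) • !![0, -1; 0, 1]) * Tᴴ ∧
      A k = T * ((1 / 2 : ℂ) • !![0, 1; 0, 1]) * Tᴴ ∧
      A (-k) = T * ((1 / 2 : ℂ) • !![1, 0; -1, 0]) * Tᴴ ∧ A 0 = 0 := by
  have a0 : φ h 0 = 1 := by rw [h0]; simp
  have a1 : φ h 1 = 0 := by rw [h0]; simp
  have a2 : φ k 0 = 0 := by rw [h1]; simp
  have a3 : φ k 1 = 1 := by rw [h1]; simp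
  have hst : ∀ x ∈ steps Sp, x = 0 ∨ x = h ∨ x = -h ∨ x = k ∨ x = -k := by
    intro x hx
    rcases mem_steps.1 hx with h | h
    · exact Or.inl h
    · exact Or.inr (hS x h)
  have co : ∀ {x y : G}, x = y → φ x 0 = φ y 0 ∧ φ x 1 = φ y 1 := fun e => by rw [e]; simp
  have hx0 : ∀ x ∈ neighbours Sp, ((A 0)ᴴ * A x).trace = 0 := by
    intro x hx
    refine W.trace_eq_zero_of_unique (mem_steps.2 (Or.inl rfl)) (mem_steps.2 (Or.inr hx))
      (W.ne_zero_of_mem hx) ?_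
    intro c hcm c' hcm' e
    have e' := co e
    rcases hS x hx with rfl | rfl | rfl | rfl <;> rcases hst c hcm with rfl | rfl | rfl | rfl | rfl <;>
      rcases hst c' hcm' with rfl | rfl | rfl | rfl | rfl <;>
      simp [a0, a1, a2, a3] at e' <;> simp
  have hperp : ((A h)ᴴ * A k).trace = 0 := by
    refine W.trace_eq_zero_of_unique (mem_steps.2 (Or.inr hh)) (mem_steps.2 (Or.inr hk))
      (by rintro rfl; simp [a0] at a2) ?_
    intro c hcm c' hcm' e
    have e' := co e
    rcases hst c hcm with rfl | rfl | rfl | rfl | rfl <;>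
      rcases hst c' hcm' with rfl | rfl | rfl | rfl | rfl <;>
      simp [a0, a1, a2, a3] at e' <;> simp
  obtain ⟨T, α, β, hT, eh, ek⟩ := exists_common_column (W.det_eq_zero hB hh) (W.ne_zero h hh)
    (W.det_eq_zero hB hk) (W.ne_zero k hk) hc hperp (W.normSq_const hh hk)
  have enh := W.neg_conj hT eh
  have enk := W.neg_conj hT ek
  obtain ⟨N, hN⟩ : ∃ N, A 0 = T * N * Tᴴ := ⟨Tᴴ * A 0 * T, (conj_conjTranspose_conj hT).symm⟩
  have hM : ∀ x ∈ neighbours Sp, ∀ M, A x = T * M * Tᴴ → (Nᴴ * M).trace = 0 := by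
    intro x hx M hM
    have := hx0 x hx
    rwa [hN, hM, conjTranspose_conj, conj_mul_conj hT, trace_unitary_conj hT] at this
  have m1 := hM _ hh _ eh
  have m2 := hM _ (neg_mem_neighbours hh) _ enh
  have m3 := hM _ hk _ ek
  have m4 := hM _ (neg_mem_neighbours hk) _ enk
  have hαβ : star α * α + star β * β ≠ 0 := by
    have := star_mul_self_add_ne_zero (a := ![α, β]) (by
      intro e
      have e0 : α = 0 := by simpa using congrFun e 0
      have e1 : β = 0 := by simpa using congrFun e 1
      apply W.ne_zero h hh
      have : (!![0, 0; 0, 0] : Matrix (Fin 2) (Fin 2) ℂ) = 0 := by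
        ext i j; fin_cases i <;> fin_cases j <;> rfl
      rw [eh, e0, e1, this]
      simp)
    simpa using this
  -- `A 0` is orthogonal to the four matrices at `±h`, `±k`, which span all `2 × 2` matrices. The
  -- combinations below isolate each entry, multiplied by `|α|² + |β|²`.
  have hN0 : N = 0 := by
    simp [Matrix.trace_fin_two, Matrix.mul_apply, Fin.sum_univ_two, Matrix.adjugate_fin_two] at m1 m2 m3 m4
    simp only [← Complex.star_def] at m1 m2 m3 m4
    have z : ∀ i j, star (N i j) = 0 := by
      have z00 : star (N 0 0) = 0 := by
        apply (mul_eq_zero.1 _).resolve_right hαβ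
        linear_combination star α * m1 + β * m4
      have z01 : star (N 0 1) = 0 := by
        apply (mul_eq_zero.1 _).resolve_right hαβ
        linear_combination star α * m3 - β * m2
      have z10 : star (N 1 0) = 0 := by
        apply (mul_eq_zero.1 _).resolve_right hαβ
        linear_combination star β * m1 - α * m4
      have z11 : star (N 1 1) = 0 := by
        apply (mul_eq_zero.1 _).resolve_right hαβ
        linear_combination star β * m3 + α * m2
      intro i j
      fin_cases i <;> fin_cases j
      exacts [z00, z01, z10, z11]
    ext i j
    exact star_eq_zero.1 (z i j)
  have hA0 : A 0 = 0 := by rw [hN, hN0]; simp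
  have hsum := W.sum
  have hsteps : steps Sp = {0, h, -h, k, -k} := by
    ext x
    simp only [Finset.mem_insert, Finset.mem_singleton]
    refine ⟨hst x, ?_⟩
    rintro (rfl | rfl | rfl | rfl | rfl)
    · exact mem_steps.2 (Or.inl rfl)
    · exact mem_steps.2 (Or.inr hh)
    · exact mem_steps.2 (Or.inr (neg_mem_neighbours hh))
    · exact mem_steps.2 (Or.inr hk)
    · exact mem_steps.2 (Or.inr (neg_mem_neighbours hk))
  have nd : ∀ {x y : G}, (φ x 0 ≠ φ y 0 ∨ φ x 1 ≠ φ y 1) → x ≠ y := by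
    rintro x _ hxy rfl
    simp at hxy
  rw [hsteps, Finset.sum_insert, Finset.sum_insert, Finset.sum_insert, Finset.sum_pair, hA0,
    zero_add, eh, ek, enh, enk] at hsum
  rotate_left
  · exact nd (by simp [a0, a1, a2, a3])
  · simp only [Finset.mem_insert, Finset.mem_singleton, not_or]
    exact ⟨nd (by simp [a0, a1, a2, a3]), nd (by simp [a0, a1, a2, a3])⟩
  · simp only [Finset.mem_insert, Finset.mem_singleton, not_or]
    exact ⟨nd (by simp [a0, a1, a2, a3]), nd (by simp [a0, a1, a2, a3]),
      nd (by simp [a0, a1, a2, a3])⟩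
  · simp only [Finset.mem_insert, Finset.mem_singleton, not_or]
    exact ⟨nd (by simp [a0, a1, a2, a3]), nd (by simp [a0, a1, a2, a3]),
      nd (by simp [a0, a1, a2, a3]), nd (by simp [a0, a1, a2, a3])⟩
  -- The normalisation `∑ A = 1`, read in the basis `T`, determines `α = β = 1/2`.
  have hsum2 : !![α, 0; β, 0] + ((!![α, 0; β, 0] : Matrix (Fin 2) (Fin 2) ℂ).adjugateᴴ +
      (!![0, α; 0, β] + (!![0, α; 0, β] : Matrix (Fin 2) (Fin 2) ℂ).adjugateᴴ)) = 1 := by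
    apply conj_injective hT
    rw [mul_one, mul_conjTranspose_self_of_mem hT, ← hsum]
    simp only [Matrix.mul_add, Matrix.add_mul]
  have s := fun i j => congrFun (congrFun hsum2 i) j
  have s00 := s 0 0
  have s01 := s 0 1
  have s10 := s 1 0
  have s11 := s 1 1
  simp [Matrix.adjugate_fin_two] at s00 s01 s10 s11
  have hα : α = 1 / 2 := by linear_combination (s00 + s01) / 2
  have hβ : β = 1 / 2 := by linear_combination (s10 + s11) / 2
  refine ⟨T, hT, ?_, ?_, ?_, ?_, hA0⟩
  · rw [eh, hα, hβ]
    congr 2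
    ext i j; fin_cases i <;> fin_cases j <;> simp
  · rw [enh, hα, hβ]
    congr 2
    ext i j; fin_cases i <;> fin_cases j <;> simp [Matrix.adjugate_fin_two, map_ofNat]
  · rw [ek, hα, hβ]
    congr 2
    ext i j; fin_cases i <;> fin_cases j <;> simp
  · rw [enk, hα, hβ]
    congr 2
    ext i j; fin_cases i <;> fin_cases j <;> simp [Matrix.adjugate_fin_two, map_ofNat]

end IsoWalk

/-! ### Pauli matrices as intertwiners -/

section TwoByTwo

variable {P V : Matrix (Fin 2) (Fin 2) ℂ}

/-- A group element permuting the rank-two steps is represented by an intertwiner of the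
corresponding matrices, and these equations fix it up to a scalar. Exchanging `h₁` and `h₂` gives
`pauliX`; the next two lemmas treat the exchange of `h₁` with `-h₂` and the reversal of `h₁`. -/
theorem eq_smul_pauliX (h1 : P * !![1, 0; 1, 0] = !![0, 1; 0, 1] * P)
    (h2 : P * !![0, 1; 0, 1] = !![1, 0; 1, 0] * P) : P = P 0 1 • pauliX := by
  have a := fun i j => congrFun (congrFun h1 i) j
  have b := fun i j => congrFun (congrFun h2 i) j
  have a01 := a 0 1
  have b00 := b 0 0
  have b11 := b 1 1
  simp [Matrix.mul_apply, Fin.sum_univ_two] at a01 b00 b11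
  ext i j
  fin_cases i <;> fin_cases j <;> simp [pauliX]
  · exact b00.symm
  · linear_combination b11 + a01
  · exact a01.symm

theorem eq_smul_pauliZ (h1 : P * !![1, 0; 1, 0] = !![1, 0; -1, 0] * P)
    (h2 : P * !![1, 0; -1, 0] = !![1, 0; 1, 0] * P) : P = P 0 0 • pauliZ := by
  have a := fun i j => congrFun (congrFun h1 i) j
  have b := fun i j => congrFun (congrFun h2 i) j
  have a01 := a 0 1
  have a10 := a 1 0
  have b10 := b 1 0
  simp [Matrix.mul_apply, Fin.sum_univ_two] at a01 a10 b10
  ext i j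
  fin_cases i <;> fin_cases j <;> simp [pauliZ]
  · exact a01.symm
  · linear_combination (a10 + b10) / 2
  · linear_combination (a10 - b10) / 2

theorem eq_smul_pauliX_mul_pauliZ (h1 : P * !![1, 0; 1, 0] = !![0, -1; 0, 1] * P)
    (h2 : P * !![0, -1; 0, 1] = !![1, 0; 1, 0] * P) : P = P 1 0 • (pauliX * pauliZ) := by
  have a := fun i j => congrFun (congrFun h1 i) j
  have b := fun i j => congrFun (congrFun h2 i) j
  have a01 := a 0 1
  have a00 := a 0 0
  have b00 := b 0 0
  simp [Matrix.mul_apply, Fin.sum_univ_two] at a01 a00 b00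
  ext i j
  fin_cases i <;> fin_cases j <;> simp [pauliX, pauliZ]
  · exact b00.symm
  · linear_combination a00 + b00
  · exact a01

theorem eq_smul_one_of_commute (hX : Commute V pauliX) (hZ : Commute V pauliZ) :
    V = V 0 0 • 1 := by
  have a := fun i j => congrFun (congrFun hX.eq i) j
  have b := fun i j => congrFun (congrFun hZ.eq i) j
  have a01 := a 0 1
  have b01 := b 0 1
  have b10 := b 1 0
  simp [Matrix.mul_apply, Fin.sum_univ_two, pauliX, pauliZ] at a01 b01 b10
  ext i j
  fin_cases i <;> fin_cases j <;> simp
  · linear_combination -b01 / 2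
  · linear_combination b10 / 2
  · exact a01.symm

theorem Commute.of_eq_smul {c : ℂ} {Q : Matrix (Fin 2) (Fin 2) ℂ} (hVP : Commute V P) (hP0 : P ≠ 0)
    (hP : P = c • Q) : Commute V Q := by
  have hc : c ≠ 0 := by
    rintro rfl
    exact hP0 (by rw [hP, zero_smul])
  have : Q = c⁻¹ • P := by rw [hP, smul_smul, inv_mul_cancel₀ hc, one_smul]
  rw [this]
  exact hVP.smul_right _

theorem pauliX_mul_self : pauliX * pauliX = 1 := by
  ext i j; fin_cases i <;> fin_cases j <;> simp [pauliX]

theorem pauliZ_mul_self : pauliZ * pauliZ = 1 := by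
  ext i j; fin_cases i <;> fin_cases j <;> simp [pauliZ]

theorem commute_pauliZ_of_mul (hX : Commute V pauliX) (hXZ : Commute V (pauliX * pauliZ)) :
    Commute V pauliZ := by
  have := hX.mul_right hXZ
  rwa [← Matrix.mul_assoc, pauliX_mul_self, one_mul] at this

theorem commute_pauliX_of_mul (hZ : Commute V pauliZ) (hXZ : Commute V (pauliX * pauliZ)) :
    Commute V pauliX := by
  have := hXZ.mul_right hZ
  rwa [Matrix.mul_assoc, pauliZ_mul_self, mul_one] at this

end TwoByTwo

/-! ### Classification in rank two -/

namespace IsoWalk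

variable {G : Type*} [AddCommGroup G] [DecidableEq G] {L : Type*} [Group L] [DistribMulAction L G]
variable {Sp : Finset G} {A : G → Matrix (Fin 2) (Fin 2) ℂ} {U : L → Matrix (Fin 2) (Fin 2) ℂ}
variable {B : LinearMap.BilinForm ℤ G}

theorem conj_U_mul (W : IsoWalk Sp A U) {T M N : Matrix (Fin 2) (Fin 2) ℂ}
    (hT : T ∈ Matrix.unitaryGroup (Fin 2) ℂ) {l : L} {x y : G} (hxy : l • x = y) {c : ℂ}
    (hc : c ≠ 0) (hx : A x = T * (c • M) * Tᴴ) (hy : A y = T * (c • N) * Tᴴ) :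
    (Tᴴ * U l * T) * M = N * (Tᴴ * U l * T) := by
  have h1 := W.cov l x
  rw [hxy, hx, hy] at h1
  have h2 := congrArg (fun Z => c⁻¹ • (Tᴴ * (Z * U l) * T)) h1
  have hTT := conjTranspose_mul_self_of_mem hT
  have hUU := conjTranspose_mul_self_of_mem (W.unitary l)
  simp only [Matrix.mul_smul, Matrix.smul_mul, smul_smul, inv_mul_cancel₀ hc, one_smul] at h2
  have e1 : Tᴴ * (T * N * Tᴴ * U l) * T = N * (Tᴴ * U l * T) := by
    calc _ = (Tᴴ * T) * N * (Tᴴ * U l * T) := by simp only [Matrix.mul_assoc]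
      _ = _ := by rw [hTT, one_mul]
  have e2 : Tᴴ * (U l * (T * M * Tᴴ) * (U l)ᴴ * U l) * T = Tᴴ * U l * T * M := by
    calc _ = Tᴴ * U l * T * M * (Tᴴ * ((U l)ᴴ * U l) * T) := by simp only [Matrix.mul_assoc]
      _ = _ := by rw [hUU, mul_one, hTT, mul_one]
  rw [e1, e2] at h2
  exact h2.symm

theorem conj_U_ne_zero (W : IsoWalk Sp A U) {T : Matrix (Fin 2) (Fin 2) ℂ}
    (hT : T ∈ Matrix.unitaryGroup (Fin 2) ℂ) (l : L) : Tᴴ * U l * T ≠ 0 :=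
  unitary_ne_zero (mul_mem (mul_mem (Unitary.star_mem hT) (W.unitary l)) hT)

theorem commute_conj {T V Y : Matrix (Fin 2) (Fin 2) ℂ} (hT : T ∈ Matrix.unitaryGroup (Fin 2) ℂ)
    (h : Commute V Y) : Commute (Tᴴ * V * T) (Tᴴ * Y * T) := by
  have hTu : Tᴴ ∈ Matrix.unitaryGroup (Fin 2) ℂ := Unitary.star_mem hT
  have h1 := conj_mul_conj (X := V) (Y := Y) hTu
  have h2 := conj_mul_conj (X := Y) (Y := V) hTu
  rw [Matrix.conjTranspose_conjTranspose] at h1 h2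
  rw [Commute, SemiconjBy, h1, h2, h.eq]

variable [FaithfulSMul L G]

/-- Two linearly independent steps exhausting the steps share a column, up to a sign. -/
theorem colPar_of_rank_two (W : IsoWalk Sp A U) (hB : InvForm L B)
    {h k : G} (hh : h ∈ neighbours Sp) (hk : k ∈ neighbours Sp)
    (hS : ∀ x ∈ neighbours Sp, x = h ∨ x = -h ∨ x = k ∨ x = -k)
    (φ : G ≃+ (Fin 2 → ℤ)) (h0 : φ h = Pi.single 0 1) (h1 : φ k = Pi.single 1 1) :
    (A h).adjugate * A k = 0 ∨ (A h).adjugate * A (-k) = 0 := by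
  have a0 : φ h 0 = 1 := by rw [h0]; simp
  have a1 : φ h 1 = 0 := by rw [h0]; simp
  have a2 : φ k 0 = 0 := by rw [h1]; simp
  have a3 : φ k 1 = 1 := by rw [h1]; simp
  have hst : ∀ x ∈ steps Sp, x = 0 ∨ x = h ∨ x = -h ∨ x = k ∨ x = -k := by
    intro x hx
    rcases mem_steps.1 hx with h | h
    · exact Or.inl h
    · exact Or.inr (hS x h)
  have co : ∀ {x y : G}, x = y → φ x 0 = φ y 0 ∧ φ x 1 = φ y 1 := fun e => by rw [e]; simp
  have u1 : UniqueSum Sp h k := by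
    intro c hcm c' hcm' e
    have e' := co e
    rcases hst c hcm with rfl | rfl | rfl | rfl | rfl <;>
      rcases hst c' hcm' with rfl | rfl | rfl | rfl | rfl <;>
      simp [a0, a1, a2, a3] at e' <;> simp
  have u2 : UniqueSum Sp h (-k) := by
    intro c hcm c' hcm' e
    have e' := co e
    rcases hst c hcm with rfl | rfl | rfl | rfl | rfl <;>
      rcases hst c' hcm' with rfl | rfl | rfl | rfl | rfl <;>
      simp [a0, a1, a2, a3] at e' <;> simp
  have hkn := neg_mem_neighbours hk
  rcases W.share hB hh hk u1 with s1 | s1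
  · exact Or.inl s1
  rcases W.share hB hh hkn u2 with s2 | s2
  · exact Or.inr s2
  exfalso
  -- Sharing rows with both `k` and `-k` is impossible, since `A (-k)` has rows orthogonal to those
  -- of `A k`.
  have r := rowPar_trans (W.det_eq_zero hB hk) (W.det_eq_zero hB hh) (W.det_eq_zero hB hkn)
    (W.ne_zero h hh) (rowPar_symm s1) s2
  refine W.transpose.not_colPar_neg hk ?_
  rw [← Matrix.adjugate_transpose, ← Matrix.transpose_mul, r, Matrix.transpose_zero]

/-- Classification of normalised isotropic walks in rank two. -/
theorem classification_of_rank_two [TwoUniqueSums G] [IsAddTorsionFree G] [Module.Finite ℤ G]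
    (W : IsoWalk Sp A U) (hB : InvForm L B) (hr : Module.finrank ℤ G = 2) :
    ∃ (h₁ h₂ : G) (T : Matrix (Fin 2) (Fin 2) ℂ), T ∈ Matrix.unitaryGroup (Fin 2) ℂ ∧
      AddSubgroup.closure {h₁, h₂} = ⊤ ∧
      (A h₁ = T * ((1 / 2 : ℂ) • !![1, 0; 1, 0]) * Tᴴ ∧
      A (-h₁) = T * ((1 / 2 : ℂ) • !![0, -1; 0, 1]) * Tᴴ ∧
      A h₂ = T * ((1 / 2 : ℂ) • !![0, 1; 0, 1]) * Tᴴ ∧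
      A (-h₂) = T * ((1 / 2 : ℂ) • !![1, 0; -1, 0]) * Tᴴ ∧ A 0 = 0) ∧
      (∀ x ∈ neighbours Sp, x = h₁ ∨ x = -h₁ ∨ x = h₂ ∨ x = -h₂) ∧
      ((Sp = {h₁, h₂} ∧ ∀ V, (∀ l, Commute V (U l)) → Commute (Tᴴ * V * T) pauliX) ∨
        (Sp = {h₁, -h₂} ∧ ∀ V, (∀ l, Commute V (U l)) → Commute (Tᴴ * V * T) pauliZ) ∨
        (Sp = {h₁, h₂, -h₁, -h₂} ∧ ∀ V, (∀ l, Commute V (U l)) →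
          ∃ c : ℂ, Tᴴ * V * T = c • 1)) := by
  have hinv := W.mul_self_eq_one_of_rank_two hB hr
  obtain ⟨h, m, hm, hcase⟩ := W.generators_of_rank_two hB hr hinv
  obtain ⟨k, hk⟩ : ∃ k, m • h = k := ⟨_, rfl⟩
  rw [hk] at hcase
  have hmk : m • k = h := by rw [← hk, smul_smul, hinv, one_smul]
  have hSp : ∀ x ∈ Sp, x = h ∨ x = -h ∨ x = k ∨ x = -k := by
    rcases hcase with hS | ⟨hS, -⟩ <;> rw [hS] <;> intro x hx <;> simp at hx <;> tauto
  have hS : ∀ x ∈ neighbours Sp, x = h ∨ x = -h ∨ x = k ∨ x = -k := by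
    intro x hx
    rcases mem_neighbours.1 hx with h1 | h1
    · exact hSp x h1
    · rcases hSp _ h1 with h2 | h2 | h2 | h2
      · right; left; rw [← h2, neg_neg]
      · left; exact neg_injective h2
      · right; right; right; rw [← h2, neg_neg]
      · right; right; left; exact neg_injective h2
  have hhS : h ∈ Sp := by rcases hcase with hS | ⟨hS, -⟩ <;> rw [hS] <;> simp
  have hhn : h ∈ neighbours Sp := mem_neighbours.2 (Or.inl hhS)
  have hkn : k ∈ neighbours Sp := by rw [← hk]; exact W.smul_mem m hhn
  -- the common form, for either sign of `k`
  have main : ∀ k' : G, k' ∈ neighbours Sp → (∀ x ∈ neighbours Sp, x = h ∨ x = -h ∨ x = k' ∨ x = -k') →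
      AddSubgroup.closure {h, k'} = ⊤ ∧ ∃ φ : G ≃+ (Fin 2 → ℤ), φ h = Pi.single 0 1 ∧
        φ k' = Pi.single 1 1 := by
    intro k' hk' hS'
    have hcl : AddSubgroup.closure {h, k'} = ⊤ := by
      refine closure_eq_top W.gen fun x hx => ?_
      rcases hS' x (mem_neighbours.2 (Or.inl hx)) with rfl | rfl | rfl | rfl <;> simp
    obtain ⟨φ, hφ⟩ := exists_coordinates ![h, k'] (by
      rw [Matrix.range_cons, Matrix.range_cons, Matrix.range_empty, Set.union_empty,
        Set.singleton_union]
      exact hcl) hr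
    exact ⟨hcl, φ, hφ 0, hφ 1⟩
  have half : (1 / 2 : ℂ) ≠ 0 := by norm_num
  obtain ⟨hcl, φ, f0, f1⟩ := main k hkn hS
  -- The normal form needs a common column, so the second basis step is `k` or `-k`. In the first
  -- case `m` exchanges `h₁` with `h₂` and acts as `pauliX`. In the second it exchanges `h₁` with
  -- `-h₂` and acts as `pauliZ`. A reversal of `h` supplies the other Pauli matrix.
  rcases W.colPar_of_rank_two hB hhn hkn hS φ f0 f1 with hcol | hcol
  · obtain ⟨T, hT, e1, e2, e3, e4, e0⟩ := W.form_of_rank_two hB hhn hkn hS φ f0 f1 hcol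
    refine ⟨h, k, T, hT, hcl, ⟨e1, e2, e3, e4, e0⟩, hS, ?_⟩
    have hX : ∀ V, (∀ l, Commute V (U l)) → Commute (Tᴴ * V * T) pauliX := fun V hV =>
      Commute.of_eq_smul (commute_conj hT (hV m)) (W.conj_U_ne_zero hT m)
        (eq_smul_pauliX (W.conj_U_mul hT hk half e1 e3) (W.conj_U_mul hT hmk half e3 e1))
    rcases hcase with hS | ⟨hS, i, hi⟩
    · exact Or.inl ⟨hS, hX⟩
    · refine Or.inr (Or.inr ⟨hS, fun V hV => ⟨_, eq_smul_one_of_commute (hX V hV) ?_⟩⟩)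
      refine commute_pauliZ_of_mul (hX V hV) (Commute.of_eq_smul (commute_conj hT (hV i))
        (W.conj_U_ne_zero hT i) (eq_smul_pauliX_mul_pauliZ (W.conj_U_mul hT hi half e1 e2)
          (W.conj_U_mul hT (by rw [smul_neg, hi, neg_neg]) half e2 e1)))
  · have hS' : ∀ x ∈ neighbours Sp, x = h ∨ x = -h ∨ x = -k ∨ x = - -k := fun x hx => by
      rcases hS x hx with h1 | h1 | h1 | h1
      · exact Or.inl h1
      · exact Or.inr (Or.inl h1)
      · exact Or.inr (Or.inr (Or.inr (by rw [neg_neg, h1])))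
      · exact Or.inr (Or.inr (Or.inl h1))
    obtain ⟨hcl, φ, f0, f1⟩ := main (-k) (neg_mem_neighbours hkn) hS'
    obtain ⟨T, hT, e1, e2, e3, e4, e0⟩ := W.form_of_rank_two hB hhn (neg_mem_neighbours hkn) hS'
      φ f0 f1 hcol
    refine ⟨h, -k, T, hT, hcl, ⟨e1, e2, e3, e4, e0⟩, hS', ?_⟩
    rw [neg_neg] at e4
    have hZ : ∀ V, (∀ l, Commute V (U l)) → Commute (Tᴴ * V * T) pauliZ := fun V hV =>
      Commute.of_eq_smul (commute_conj hT (hV m)) (W.conj_U_ne_zero hT m)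
        (eq_smul_pauliZ (W.conj_U_mul hT hk half e1 e4) (W.conj_U_mul hT hmk half e4 e1))
    rcases hcase with hS | ⟨hS, i, hi⟩
    · exact Or.inr (Or.inl ⟨by rw [neg_neg, hS], hZ⟩)
    · refine Or.inr (Or.inr ⟨?_, fun V hV => ⟨_, eq_smul_one_of_commute ?_ (hZ V hV)⟩⟩)
      · rw [hS, neg_neg]
        ext x; simp; tauto
      refine commute_pauliX_of_mul (hZ V hV) (Commute.of_eq_smul (commute_conj hT (hV i))
        (W.conj_U_ne_zero hT i) (eq_smul_pauliX_mul_pauliZ (W.conj_U_mul hT hi half e1 e2)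
          (W.conj_U_mul hT (by rw [smul_neg, hi, neg_neg]) half e2 e1)))

end IsoWalk

/-! ### Anticommuting unitary matrices in the Pauli basis -/

section TwoByTwo

variable {P Q X Y T : Matrix (Fin 2) (Fin 2) ℂ}

theorem pauliX_mem : pauliX ∈ Matrix.unitaryGroup (Fin 2) ℂ := by
  rw [Matrix.mem_unitaryGroup_iff]
  ext i j; fin_cases i <;> fin_cases j <;> simp [pauliX, Matrix.star_eq_conjTranspose, Matrix.mul_apply, Fin.sum_univ_two]

theorem pauliZ_mem : pauliZ ∈ Matrix.unitaryGroup (Fin 2) ℂ := by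
  rw [Matrix.mem_unitaryGroup_iff]
  ext i j; fin_cases i <;> fin_cases j <;> simp [pauliZ, Matrix.star_eq_conjTranspose, Matrix.mul_apply, Fin.sum_univ_two]

theorem pauliX_conjTranspose : pauliXᴴ = pauliX := by
  ext i j; fin_cases i <;> fin_cases j <;> simp [pauliX]

theorem pauliZ_conjTranspose : pauliZᴴ = pauliZ := by
  ext i j; fin_cases i <;> fin_cases j <;> simp [pauliZ]

theorem pauliZ_mul_pauliX : pauliZ * pauliX = -(pauliX * pauliZ) := by
  ext i j; fin_cases i <;> fin_cases j <;> simp [pauliX, pauliZ]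

theorem diagonal_mem_unitaryGroup {e : ℂ} (he : ‖e‖ = 1) :
    !![1, 0; 0, e] ∈ Matrix.unitaryGroup (Fin 2) ℂ := by
  have h : e * (starRingEnd ℂ) e = 1 := by
    rw [Complex.mul_conj, Complex.normSq_eq_norm_sq, he]; simp
  rw [Matrix.mem_unitaryGroup_iff]
  ext i j
  fin_cases i <;> fin_cases j <;> 
    simp [Matrix.star_eq_conjTranspose, Matrix.mul_apply, Fin.sum_univ_two, h]

theorem trace_conjTranspose_conj_mul_conj (hT : T ∈ Matrix.unitaryGroup (Fin 2) ℂ) :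
    ((T * X * Tᴴ)ᴴ * (T * Y * Tᴴ)).trace = (Xᴴ * Y).trace := by
  rw [conjTranspose_conj, conj_mul_conj hT, trace_unitary_conj hT]

theorem conj_mul_conj_conjTranspose : (X * T) * Y * (X * T)ᴴ = X * (T * Y * Tᴴ) * Xᴴ := by
  simp only [Matrix.conjTranspose_mul, Matrix.mul_assoc]

/-- Anticommuting unitary matrices are, up to phases and a change of basis, Pauli matrices. -/
theorem exists_pauli_basis (hP : P ∈ Matrix.unitaryGroup (Fin 2) ℂ)
    (hQ : Q ∈ Matrix.unitaryGroup (Fin 2) ℂ) (htr : P.trace = 0) (hPQ : P * Q = -(Q * P)) :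
    ∃ (T : Matrix (Fin 2) (Fin 2) ℂ) (κ κ' : ℂ), T ∈ Matrix.unitaryGroup (Fin 2) ℂ ∧
      P = κ • (T * pauliZ * Tᴴ) ∧ Q = κ' • (T * pauliX * Tᴴ) := by
  obtain ⟨W, mu, nu, hW, hD⟩ := exists_diagonalization hP
  have hPW : P = W * !![mu, 0; 0, nu] * Wᴴ := by rw [← hD, conj_conjTranspose_conj hW]
  have hnu : nu = -mu := by
    rw [hPW, trace_unitary_conj hW, Matrix.trace_fin_two] at htr
    simp at htr
    exact (neg_eq_of_add_eq_zero_right htr).symm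
  subst hnu
  have hmu : mu ≠ 0 := by
    rintro rfl
    apply unitary_ne_zero hP
    have : (!![0, 0; 0, -0] : Matrix (Fin 2) (Fin 2) ℂ) = 0 := by
      ext i j; fin_cases i <;> fin_cases j <;> simp
    rw [hPW, this]; simp
  obtain ⟨N, hN⟩ : ∃ N, Q = W * N * Wᴴ := ⟨Wᴴ * Q * W, (conj_conjTranspose_conj hW).symm⟩
  have hNu : N ∈ Matrix.unitaryGroup (Fin 2) ℂ := by
    have : N = Wᴴ * Q * W := by
      rw [hN]
      simp only [Matrix.mul_assoc, conjTranspose_mul_self_of_mem hW, mul_one]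
      rw [← Matrix.mul_assoc, conjTranspose_mul_self_of_mem hW, one_mul]
    rw [this]
    exact mul_mem (mul_mem (Unitary.star_mem hW) hQ) hW
  have hanti : !![mu, 0; 0, -mu] * N = -(N * !![mu, 0; 0, -mu]) := by
    apply conj_injective hW
    rw [Matrix.mul_neg, Matrix.neg_mul, ← conj_mul_conj hW, ← conj_mul_conj hW, ← hPW, ← hN, hPQ]
  have e := fun i j => congrFun (congrFun hanti i) j
  have e00 := e 0 0
  have e11 := e 1 1
  simp [Matrix.mul_apply, Fin.sum_univ_two] at e00 e11
  have n00 : N 0 0 = 0 := by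
    apply (mul_eq_zero.1 _).resolve_left hmu
    linear_combination e00 / 2
  have n11 : N 1 1 = 0 := by
    apply (mul_eq_zero.1 _).resolve_left hmu
    linear_combination -e11 / 2
  obtain ⟨⟨u1, -⟩, -, u2⟩ := unitary_entries hNu
  rw [n00, mul_zero, zero_add] at u1
  rw [n11, mul_zero, add_zero] at u2
  have hb : ‖N 0 1‖ = 1 := by
    have := congrArg norm u2
    rw [norm_mul, norm_star, norm_one] at this
    nlinarith [norm_nonneg (N 0 1)]
  have hc : ‖N 1 0‖ = 1 := by
    have := congrArg norm u1
    rw [norm_mul, norm_star, norm_one] at this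
    nlinarith [norm_nonneg (N 1 0)]
  have hb0 : N 0 1 ≠ 0 := by rw [← norm_pos_iff, hb]; exact one_pos
  -- `Q` is antidiagonal with entries of modulus one. Conjugation by `diag(1, e)` equalises them
  -- when `e²` is their ratio, and does not affect the diagonal `P`.
  obtain ⟨e, he⟩ := IsAlgClosed.exists_pow_nat_eq (N 1 0 / N 0 1) (n := 2) two_pos
  have he1 : ‖e‖ = 1 := by
    have := congrArg norm he
    rw [norm_pow, norm_div, hb, hc, div_one] at this
    nlinarith [norm_nonneg e]
  have hee : e * (starRingEnd ℂ) e = 1 := by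
    rw [Complex.mul_conj, Complex.normSq_eq_norm_sq, he1]; simp
  rw [eq_div_iff hb0] at he
  have hDt : (!![1, 0; 0, e])ᴴ = !![1, 0; 0, (starRingEnd ℂ) e] := by
    ext i j; fin_cases i <;> fin_cases j <;> simp
  refine ⟨W * !![1, 0; 0, e], mu, N 0 1 * e, mul_mem hW (diagonal_mem_unitaryGroup he1), ?_, ?_⟩
  · rw [conj_mul_conj_conjTranspose, hDt, ← Matrix.smul_mul, ← Matrix.mul_smul, hPW]
    congr 2
    ext i j
    fin_cases i <;> fin_cases j <;> 
      simp [pauliZ, hee]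
  · rw [conj_mul_conj_conjTranspose, hDt, ← Matrix.smul_mul, ← Matrix.mul_smul, hN]
    congr 2
    ext i j
    fin_cases i <;> fin_cases j <;> 
      simp [pauliX, n00, n11]
    · rw [mul_assoc, hee, mul_one]
    · linear_combination -he

theorem conj_conj_of_mul_eq {Y Z : Matrix (Fin 2) (Fin 2) ℂ} {C : Matrix (Fin 2) (Fin 2) ℂ}
    (h : C * Y * Cᴴ = Z) : (T * C) * Y * (T * C)ᴴ = T * Z * Tᴴ := by
  rw [conj_mul_conj_conjTranspose, h]

theorem eq_or_eq_neg_of_smul_involutive {κ : ℂ} (hP : P * P = 1) (hQ : Q * Q = 1)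
    (h : P = κ • Q) : P = Q ∨ P = -Q := by
  have h1 : κ * κ = 1 := by
    rw [h, Matrix.smul_mul, Matrix.mul_smul, hQ, smul_smul] at hP
    simpa using congrFun (congrFun hP 0) 0
  rcases mul_self_eq_one_iff.1 h1 with rfl | rfl
  · left; rw [h, one_smul]
  · right; rw [h, neg_smul, one_smul]

/-- Anticommuting unitary involutions are Pauli matrices up to a change of basis. -/
theorem exists_pauli_basis_of_involutive (hP : P ∈ Matrix.unitaryGroup (Fin 2) ℂ)
    (hQ : Q ∈ Matrix.unitaryGroup (Fin 2) ℂ) (htr : P.trace = 0) (hPQ : P * Q = -(Q * P))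
    (hP1 : P * P = 1) (hQ1 : Q * Q = 1) :
    ∃ T : Matrix (Fin 2) (Fin 2) ℂ, T ∈ Matrix.unitaryGroup (Fin 2) ℂ ∧
      P = T * pauliZ * Tᴴ ∧ Q = T * pauliX * Tᴴ := by
  obtain ⟨T, κ, κ', hT, h1, h2⟩ := exists_pauli_basis hP hQ htr hPQ
  have sq : ∀ {Y}, Y * Y = 1 → (T * Y * Tᴴ) * (T * Y * Tᴴ) = 1 := fun h => by
    rw [conj_mul_conj hT, h, mul_one, mul_conjTranspose_self_of_mem hT]
  have neg : ∀ Y, -(T * Y * Tᴴ) = T * -Y * Tᴴ := fun Y => by simp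
  have xz : pauliX * pauliZ * pauliXᴴ = -pauliZ := by
    ext i j; fin_cases i <;> fin_cases j <;>
      simp [pauliX, pauliZ, Matrix.mul_apply, Fin.sum_univ_two]
  have xx : pauliX * pauliX * pauliXᴴ = pauliX := by
    ext i j; fin_cases i <;> fin_cases j <;>
      simp [pauliX, Matrix.mul_apply, Fin.sum_univ_two]
  have zz : pauliZ * pauliZ * pauliZᴴ = pauliZ := by
    ext i j; fin_cases i <;> fin_cases j <;>
      simp [pauliZ, Matrix.mul_apply, Fin.sum_univ_two]
  have zx : pauliZ * pauliX * pauliZᴴ = -pauliX := by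
    ext i j; fin_cases i <;> fin_cases j <;>
      simp [pauliX, pauliZ, Matrix.mul_apply, Fin.sum_univ_two]
  -- A sign of `P` is absorbed by conjugation with `pauliX`, which fixes the other matrix; a sign of
  -- `Q` by `pauliZ`.
  have step1 : ∃ T' : Matrix (Fin 2) (Fin 2) ℂ, T' ∈ Matrix.unitaryGroup (Fin 2) ℂ ∧
      P = T' * pauliZ * T'ᴴ ∧ T * pauliX * Tᴴ = T' * pauliX * T'ᴴ := by
    rcases eq_or_eq_neg_of_smul_involutive hP1 (sq pauliZ_mul_self) h1 with h | h
    · exact ⟨T, hT, h, rfl⟩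
    · exact ⟨T * pauliX, mul_mem hT pauliX_mem, by rw [h, neg, conj_conj_of_mul_eq xz],
        (conj_conj_of_mul_eq xx).symm⟩
  obtain ⟨T', hT', h3, h4⟩ := step1
  rcases eq_or_eq_neg_of_smul_involutive hQ1 (sq pauliX_mul_self) h2 with h | h
  · exact ⟨T', hT', h3, h.trans h4⟩
  · refine ⟨T' * pauliZ, mul_mem hT' pauliZ_mem, by rw [h3, conj_conj_of_mul_eq zz], ?_⟩
    rw [h, h4, conj_conj_of_mul_eq zx, Matrix.mul_neg, Matrix.neg_mul]

end TwoByTwo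

/-! ### The scalar equations of rank three and the resulting factorisation -/

section Scalars

/-- A number whose square has real part zero lies on a diagonal of the plane; with the modulus of
`s` prescribed, only the quarter turns of `s` remain. -/
theorem eq_of_re_sq {s w : ℂ} (hs : s.re = 1 / 8) (hs2 : (s ^ 2).re = 0) (hw2 : (w ^ 2).re = 0)
    (hn : Complex.normSq w = Complex.normSq s) :
    w = s ∨ w = -s ∨ w = Complex.I * s ∨ w = -(Complex.I * s) := by
  have e1 : s.im ^ 2 = 1 / 64 := by
    rw [sq, Complex.mul_re, hs] at hs2; linarith
  have e2 : w.re ^ 2 = w.im ^ 2 := by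
    rw [sq, Complex.mul_re] at hw2; linarith
  rw [Complex.normSq_apply, Complex.normSq_apply, hs] at hn
  have e3 : w.re ^ 2 = (1 / 8) ^ 2 := by linarith
  have e4 : w.im ^ 2 = (1 / 8) ^ 2 := by linarith
  have e5 : s.im ^ 2 = (1 / 8) ^ 2 := by linarith
  rcases sq_eq_sq_iff_eq_or_eq_neg.1 e3 with h3 | h3 <;>
    rcases sq_eq_sq_iff_eq_or_eq_neg.1 e4 with h4 | h4 <;>
    rcases sq_eq_sq_iff_eq_or_eq_neg.1 e5 with h5 | h5 <;>
    simp only [Complex.ext_iff, Complex.neg_re, Complex.neg_im, Complex.mul_re, Complex.mul_im,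
      Complex.I_re, Complex.I_im, hs, h3, h4, h5] <;> norm_num

/-- The real parts of the four quadratic relations give `3 Re s² = Re s²`, so `Re s² = 0` and each
`w_j²` is `±s²`. Their sum is `s²`, so exactly one sign is negative. -/
theorem exists_signs {s w₁ w₂ w₃ : ℂ} (hs : s.re = 1 / 8) (hn₁ : Complex.normSq w₁ = Complex.normSq s)
    (hn₂ : Complex.normSq w₂ = Complex.normSq s) (hn₃ : Complex.normSq w₃ = Complex.normSq s)
    (hsum : w₁ ^ 2 + w₂ ^ 2 + w₃ ^ 2 = s ^ 2) (h₁ : (s ^ 2 - w₁ ^ 2).re = 0)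
    (h₂ : (s ^ 2 - w₂ ^ 2).re = 0) (h₃ : (s ^ 2 - w₃ ^ 2).re = 0) :
    (s = (1 + Complex.I) / 8 ∨ s = (1 - Complex.I) / 8) ∧
    (((w₁ = s ∨ w₁ = -s) ∧ (w₂ = s ∨ w₂ = -s) ∧ (w₃ = Complex.I * s ∨ w₃ = -(Complex.I * s))) ∨
    ((w₁ = s ∨ w₁ = -s) ∧ (w₃ = s ∨ w₃ = -s) ∧ (w₂ = Complex.I * s ∨ w₂ = -(Complex.I * s))) ∨
    ((w₂ = s ∨ w₂ = -s) ∧ (w₃ = s ∨ w₃ = -s) ∧ (w₁ = Complex.I * s ∨ w₁ = -(Complex.I * s)))) := by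
  have h0 := congrArg Complex.re hsum
  simp only [Complex.sub_re, Complex.add_re] at h₁ h₂ h₃ h0
  have hs2 : (s ^ 2).re = 0 := by linarith
  have hne : s ^ 2 ≠ 0 := by
    intro h
    rw [sq_eq_zero_iff] at h
    rw [h] at hs
    norm_num at hs
  have sq1 : ∀ {w : ℂ}, w = s ∨ w = -s → w ^ 2 = s ^ 2 := by
    rintro w (rfl | rfl) <;> ring
  have sq2 : ∀ {w : ℂ}, w = Complex.I * s ∨ w = -(Complex.I * s) → w ^ 2 = -s ^ 2 := by
    rintro w (rfl | rfl) <;> linear_combination s ^ 2 * Complex.I_sq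
  have split : ∀ {w : ℂ}, (w ^ 2).re = 0 → Complex.normSq w = Complex.normSq s →
      (w = s ∨ w = -s) ∨ (w = Complex.I * s ∨ w = -(Complex.I * s)) := fun h h' => by
    rw [or_assoc]; exact eq_of_re_sq hs hs2 h h'
  refine ⟨?_, ?_⟩
  · have e1 : s.im ^ 2 = (1 / 8) ^ 2 := by
      rw [sq, Complex.mul_re, hs] at hs2; linarith
    rcases sq_eq_sq_iff_eq_or_eq_neg.1 e1 with h5 | h5
    · left; apply Complex.ext <;> simp [hs, h5]
    · right; apply Complex.ext <;> simp [hs, h5]; norm_num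
  · rcases split (by linarith) hn₁ with c1 | c1 <;> rcases split (by linarith) hn₂ with c2 | c2 <;>
      rcases split (by linarith) hn₃ with c3 | c3
    · exfalso; rw [sq1 c1, sq1 c2, sq1 c3] at hsum; exact hne (by linear_combination hsum / 2)
    · exact Or.inl ⟨c1, c2, c3⟩
    · exact Or.inr (Or.inl ⟨c1, c3, c2⟩)
    · exfalso; rw [sq1 c1, sq2 c2, sq2 c3] at hsum; exact hne (by linear_combination -hsum / 2)
    · exact Or.inr (Or.inr ⟨c2, c3, c1⟩)
    · exfalso; rw [sq2 c1, sq1 c2, sq2 c3] at hsum; exact hne (by linear_combination -hsum / 2)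
    · exfalso; rw [sq2 c1, sq2 c2, sq1 c3] at hsum; exact hne (by linear_combination -hsum / 2)
    · exfalso; rw [sq2 c1, sq2 c2, sq2 c3] at hsum; exact hne (by linear_combination -hsum / 4)

end Scalars

section Factor

variable {P Q : Matrix (Fin 2) (Fin 2) ℂ}

/-- `1 ± P ± Q ± PQ` factors for anticommuting `P` and `Q`. -/
theorem exists_factor {s w₁ w₂ w₃ : ℂ} (hPQ : P * Q = -(Q * P)) (h₁ : w₁ = s ∨ w₁ = -s)
    (h₂ : w₂ = s ∨ w₂ = -s) (h₃ : w₃ = s ∨ w₃ = -s) :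
    ∃ (P' Q' : Matrix (Fin 2) (Fin 2) ℂ),
      s • 1 + w₁ • P + w₂ • Q + w₃ • (P * Q) = s • ((1 + Q') * (1 + P')) ∧
      (((P' = P ∨ P' = -P) ∧ (Q' = Q ∨ Q' = -Q)) ∨ ((P' = Q ∨ P' = -Q) ∧ (Q' = P ∨ Q' = -P))) := by
  have hQP : Q * P = -(P * Q) := by rw [hPQ, neg_neg]
  -- The product `(1 + Q')(1 + P')` has the signs of `P'` and `Q'` free, but not that of `Q' P'`.
  -- Exchanging the roles of `P` and `Q` provides the opposite sign.
  rcases h₁ with rfl | rfl <;> rcases h₂ with rfl | rfl <;> rcases h₃ with h | h <;> subst h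
  · exact ⟨Q, P, by simp only [add_mul, mul_add, one_mul, mul_one]; module, by simp⟩
  · exact ⟨P, Q, by simp only [add_mul, mul_add, one_mul, mul_one, hQP]; module, by simp⟩
  · exact ⟨P, -Q, by simp only [add_mul, mul_add, one_mul, mul_one, Matrix.neg_mul, hQP]; module, by simp⟩
  · exact ⟨-Q, P, by simp only [add_mul, mul_add, one_mul, mul_one, Matrix.mul_neg]; module, by simp⟩
  · exact ⟨-P, Q, by simp only [add_mul, mul_add, one_mul, mul_one, Matrix.mul_neg, hQP]; module, by simp⟩
  · exact ⟨Q, -P, by simp only [add_mul, mul_add, one_mul, mul_one, Matrix.neg_mul]; module, by simp⟩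
  · exact ⟨-Q, -P, by simp only [add_mul, mul_add, one_mul, mul_one, Matrix.neg_mul, Matrix.mul_neg]; module, by simp⟩
  · exact ⟨-P, -Q, by simp only [add_mul, mul_add, one_mul, mul_one, Matrix.neg_mul, Matrix.mul_neg, hQP]; module, by simp⟩

end Factor

/-! ### Differences of steps of the body-centred cubic lattice -/

section Differences

variable {G : Type*} [AddCommGroup G] {a b c d : G}

/-- The steps of the body-centred cubic lattice. -/
def IsBccStep (a b c d x : G) : Prop :=
  x = 0 ∨ x = a ∨ x = -a ∨ x = b ∨ x = -b ∨ x = c ∨ x = -c ∨ x = d ∨ x = -d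

theorem IsBccStep.coordinates {φ : G ≃+ (Fin 3 → ℤ)} (ha : φ a = Pi.single 0 1)
    (hb : φ b = Pi.single 1 1) (hc : φ c = Pi.single 2 1) (hd : d = -(a + b + c)) {x : G}
    (hx : IsBccStep a b c d x) :
    (x = 0 ∧ φ x 0 = 0 ∧ φ x 1 = 0 ∧ φ x 2 = 0) ∨
    (x = a ∧ φ x 0 = 1 ∧ φ x 1 = 0 ∧ φ x 2 = 0) ∨
    (x = -a ∧ φ x 0 = -1 ∧ φ x 1 = 0 ∧ φ x 2 = 0) ∨
    (x = b ∧ φ x 0 = 0 ∧ φ x 1 = 1 ∧ φ x 2 = 0) ∨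
    (x = -b ∧ φ x 0 = 0 ∧ φ x 1 = -1 ∧ φ x 2 = 0) ∨
    (x = c ∧ φ x 0 = 0 ∧ φ x 1 = 0 ∧ φ x 2 = 1) ∨
    (x = -c ∧ φ x 0 = 0 ∧ φ x 1 = 0 ∧ φ x 2 = -1) ∨
    (x = d ∧ φ x 0 = -1 ∧ φ x 1 = -1 ∧ φ x 2 = -1) ∨
    (x = -d ∧ φ x 0 = 1 ∧ φ x 1 = 1 ∧ φ x 2 = 1) := by
  rcases hx with h | h | h | h | h | h | h | h | h
  · exact Or.inl ⟨h, by simp [h]⟩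
  · exact Or.inr (Or.inl ⟨h, by simp [h, ha]⟩)
  · exact Or.inr (Or.inr (Or.inl ⟨h, by simp [h, ha]⟩))
  · exact Or.inr (Or.inr (Or.inr (Or.inl ⟨h, by simp [h, hb]⟩)))
  · exact Or.inr (Or.inr (Or.inr (Or.inr (Or.inl ⟨h, by simp [h, hb]⟩))))
  · exact Or.inr (Or.inr (Or.inr (Or.inr (Or.inr (Or.inl ⟨h, by simp [h, hc]⟩)))))
  · exact Or.inr (Or.inr (Or.inr (Or.inr (Or.inr (Or.inr (Or.inl ⟨h, by simp [h, hc]⟩))))))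
  · exact Or.inr (Or.inr (Or.inr (Or.inr (Or.inr (Or.inr (Or.inr (Or.inl
      ⟨h, by simp [h, hd, ha, hb, hc]⟩)))))))
  · exact Or.inr (Or.inr (Or.inr (Or.inr (Or.inr (Or.inr (Or.inr (Or.inr
      ⟨h, by simp [h, hd, ha, hb, hc]⟩)))))))

/-- A finite check in the coordinates of the basis `a, b, c`. The sum `a + b` has additional
decompositions, because it equals `-(c + d)`. -/
theorem IsBccStep.difference [Module.Finite ℤ G] (hgen : AddSubgroup.closure {a, b, c} = ⊤)
    (hr : Module.finrank ℤ G = 3) (hd : a + b + c + d = 0) {k k' : G} (hk : IsBccStep a b c d k)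
    (hk' : IsBccStep a b c d k') :
    (k' - k = a - b → (k = b ∧ k' = a) ∨ (k = -a ∧ k' = -b)) ∧
    (k' - k = a - 0 → (k = 0 ∧ k' = a) ∨ (k = -a ∧ k' = -0)) ∧
    (k' - k = a - -b → (k = -b ∧ k' = a) ∨ (k = -a ∧ k' = b) ∨ (k = c ∧ k' = -d) ∨
      (k = d ∧ k' = -c)) := by
  obtain ⟨φ, hφ⟩ := exists_coordinates ![a, b, c] (by
    rw [Matrix.range_cons, Matrix.range_cons, Matrix.range_cons, Matrix.range_empty, Set.union_empty,
      Set.singleton_union, Set.singleton_union]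
    exact hgen) hr
  have ha : φ a = Pi.single 0 1 := hφ 0
  have hb : φ b = Pi.single 1 1 := hφ 1
  have hc : φ c = Pi.single 2 1 := hφ 2
  have hd' : d = -(a + b + c) := (neg_eq_of_add_eq_zero_right hd).symm
  have co : ∀ {x y : G}, k' - k = x → φ k' 0 - φ k 0 = φ x 0 ∧ φ k' 1 - φ k 1 = φ x 1 ∧
      φ k' 2 - φ k 2 = φ x 2 := fun e => by rw [← e]; simp
  refine ⟨fun e => ?_, fun e => ?_, fun e => ?_⟩ <;>
    obtain ⟨e0, e1, e2⟩ := co (y := a) e <;>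
    simp [ha, hb] at e0 e1 e2 <;>
    rcases hk.coordinates ha hb hc hd' with ⟨h, p0, p1, p2⟩ | ⟨h, p0, p1, p2⟩ | ⟨h, p0, p1, p2⟩ |
      ⟨h, p0, p1, p2⟩ | ⟨h, p0, p1, p2⟩ | ⟨h, p0, p1, p2⟩ | ⟨h, p0, p1, p2⟩ | ⟨h, p0, p1, p2⟩ |
      ⟨h, p0, p1, p2⟩ <;>
    rw [p0] at e0 <;> rw [p1] at e1 <;> rw [p2] at e2 <;>
    rcases hk'.coordinates ha hb hc hd' with ⟨h', q0, q1, q2⟩ | ⟨h', q0, q1, q2⟩ |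
      ⟨h', q0, q1, q2⟩ | ⟨h', q0, q1, q2⟩ | ⟨h', q0, q1, q2⟩ | ⟨h', q0, q1, q2⟩ |
      ⟨h', q0, q1, q2⟩ | ⟨h', q0, q1, q2⟩ | ⟨h', q0, q1, q2⟩ <;>
    first
      | (exfalso; omega)
      | simp [h, h']

end Differences

/-! ### Weyl form of a walk -/

namespace IsoWalk

variable {G : Type*} [AddCommGroup G] [DecidableEq G] {L : Type*} [Group L] [DistribMulAction L G]
variable {Sp : Finset G} {A : G → Matrix (Fin 2) (Fin 2) ℂ} {U : L → Matrix (Fin 2) (Fin 2) ℂ}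
variable {B : LinearMap.BilinForm ℤ G}

theorem cov_of_smul (W : IsoWalk Sp A U) {l : L} {P : Matrix (Fin 2) (Fin 2) ℂ} {κ : ℂ}
    (hP : P ∈ Matrix.unitaryGroup (Fin 2) ℂ) (h : U l = κ • P) (x : G) :
    A (l • x) = P * A x * Pᴴ := by
  have h1 := mul_conjTranspose_self_of_mem (W.unitary l)
  have h2 := mul_conjTranspose_self_of_mem hP
  rw [h, Matrix.conjTranspose_smul, Matrix.smul_mul, Matrix.mul_smul, h2, smul_smul] at h1
  have hk : κ * star κ = 1 := by simpa using congrFun (congrFun h1 0) 0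
  rw [W.cov, h, Matrix.conjTranspose_smul, Matrix.smul_mul, Matrix.smul_mul, Matrix.mul_smul,
    smul_smul, hk, one_smul]

theorem steps_of_bcc {a b c d : G} (hSp : Sp = {a, b, c, d}) {x : G} :
    x ∈ steps Sp ↔ IsBccStep a b c d x := by
  rw [mem_steps, mem_neighbours, hSp, IsBccStep]
  simp only [Finset.mem_insert, Finset.mem_singleton, neg_eq_iff_eq_neg]
  tauto

theorem closure_of_bcc (W : IsoWalk Sp A U) {a b c d : G} (hSp : Sp = {a, b, c, d})
    (hd : a + b + c + d = 0) : AddSubgroup.closure {a, b, c} = ⊤ := by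
  have := W.gen
  rw [eq_top_iff, ← this, AddSubgroup.closure_le]
  have ha : a ∈ AddSubgroup.closure {a, b, c} := AddSubgroup.subset_closure (by simp)
  have hb : b ∈ AddSubgroup.closure {a, b, c} := AddSubgroup.subset_closure (by simp)
  have hc : c ∈ AddSubgroup.closure {a, b, c} := AddSubgroup.subset_closure (by simp)
  intro x hx
  rw [hSp] at hx
  simp only [Finset.coe_insert, Finset.coe_singleton, Set.mem_insert_iff,
    Set.mem_singleton_iff] at hx
  rcases hx with rfl | rfl | rfl | rfl
  · exact ha
  · exact hb
  · exact hc
  · rw [(neg_eq_of_add_eq_zero_right hd).symm]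
    exact neg_mem (add_mem (add_mem ha hb) hc)

theorem exists_coordinates_of_bcc [Module.Finite ℤ G] (W : IsoWalk Sp A U)
    (hr : Module.finrank ℤ G = 3) {a b c d : G} (hSp : Sp = {a, b, c, d})
    (hd : a + b + c + d = 0) : ∃ φ : G ≃+ (Fin 3 → ℤ), φ a = Pi.single 0 1 ∧
      φ b = Pi.single 1 1 ∧ φ c = Pi.single 2 1 := by
  obtain ⟨φ, hφ⟩ := exists_coordinates ![a, b, c] (by
    rw [Matrix.range_cons, Matrix.range_cons, Matrix.range_cons, Matrix.range_empty, Set.union_empty,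
      Set.singleton_union, Set.singleton_union]
    exact W.closure_of_bcc hSp hd) hr
  exact ⟨φ, hφ 0, hφ 1, hφ 2⟩

theorem sum_steps_of_bcc [Module.Finite ℤ G] (W : IsoWalk Sp A U)
    (hr : Module.finrank ℤ G = 3) {a b c d : G} (hSp : Sp = {a, b, c, d})
    (hd : a + b + c + d = 0) {M : Type*} [AddCommMonoid M] (f : G → M) :
    ∑ x ∈ steps Sp, f x = f 0 + (f a + (f (-a) + (f b + (f (-b) + (f c + (f (-c) +
      (f d + f (-d)))))))) := by
  obtain ⟨φ, ha, hb, hc⟩ := W.exists_coordinates_of_bcc hr hSp hd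
  have hdv : d = -(a + b + c) := (neg_eq_of_add_eq_zero_right hd).symm
  have nd : ∀ {x y : G}, (φ x 0 ≠ φ y 0 ∨ φ x 1 ≠ φ y 1 ∨ φ x 2 ≠ φ y 2) → x ≠ y := by
    rintro x _ hxy rfl
    simp at hxy
  have hst : steps Sp = {0, a, -a, b, -b, c, -c, d, -d} := by
    ext x
    rw [steps_of_bcc hSp, IsBccStep]
    simp only [Finset.mem_insert, Finset.mem_singleton]
  rw [hst, Finset.sum_insert, Finset.sum_insert, Finset.sum_insert, Finset.sum_insert,
    Finset.sum_insert, Finset.sum_insert, Finset.sum_insert, Finset.sum_pair]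
  all_goals
    try simp only [Finset.mem_insert, Finset.mem_singleton, not_or]
    try refine ⟨?_, ?_⟩
  all_goals
    repeat' refine And.intro ?_ ?_
    all_goals exact nd (by simp [ha, hb, hc, hdv])

theorem trace_difference [Module.Finite ℤ G] (W : IsoWalk Sp A U) (hr : Module.finrank ℤ G = 3)
    {a b c d : G} (hSp : Sp = {a, b, c, d}) (hd : a + b + c + d = 0) :
    ((A b)ᴴ * A a).trace = 0 ∧ ((A 0)ᴴ * A a).trace = 0 ∧
      ((A (-b))ᴴ * A a).trace + ((A c)ᴴ * A (-d)).trace = 0 := by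
  have hgen := W.closure_of_bcc hSp hd
  have diff := fun {k k' : G} (hk : k ∈ steps Sp) (hk' : k' ∈ steps Sp) =>
    ((steps_of_bcc hSp).1 hk).difference hgen hr hd ((steps_of_bcc hSp).1 hk')
  have st : ∀ {x}, IsBccStep a b c d x → x ∈ steps Sp := fun h => (steps_of_bcc hSp).2 h
  obtain ⟨φ, ha, hb, hc⟩ := W.exists_coordinates_of_bcc hr hSp hd
  have nd : ∀ {x y : G}, (φ x 0 ≠ φ y 0 ∨ φ x 1 ≠ φ y 1 ∨ φ x 2 ≠ φ y 2) → x ≠ y := by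
    rintro x _ hxy rfl
    simp at hxy
  have hdv : d = -(a + b + c) := (neg_eq_of_add_eq_zero_right hd).symm
  refine ⟨?_, ?_, ?_⟩
  · exact W.trace_eq_zero_of_unique (st (by simp [IsBccStep])) (st (by simp [IsBccStep]))
      (nd (by simp [ha, hb])) fun k hk k' hk' e => (diff hk hk').1 e
  · exact W.trace_eq_zero_of_unique (st (by simp [IsBccStep])) (st (by simp [IsBccStep]))
      (nd (by simp [ha, hb])) fun k hk k' hk' e => (diff hk hk').2.1 e
  · have key := W.sum_pairs (g := a - -b) (sub_ne_zero.2 (nd (by simp [ha, hb])))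
      {(-b, a), (-a, b), (c, -d), (d, -c)} (by
      rintro ⟨k, k'⟩
      simp only [Finset.mem_insert, Finset.mem_singleton, Prod.mk.injEq]
      constructor
      · rintro (⟨rfl, rfl⟩ | ⟨rfl, rfl⟩ | ⟨rfl, rfl⟩ | ⟨rfl, rfl⟩)
        · exact ⟨st (by simp [IsBccStep]), st (by simp [IsBccStep]), rfl⟩
        · exact ⟨st (by simp [IsBccStep]), st (by simp [IsBccStep]), by abel⟩
        · exact ⟨st (by simp [IsBccStep]), st (by simp [IsBccStep]), by rw [hdv]; abel⟩
        · exact ⟨st (by simp [IsBccStep]), st (by simp [IsBccStep]), by rw [hdv]; abel⟩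
      · rintro ⟨h1, h2, h3⟩
        exact (diff h1 h2).2.2 h3)
    rw [Finset.sum_insert, Finset.sum_insert, Finset.sum_pair] at key
    · have t1 := W.trace_neg (-b) a
      have t2 := W.trace_neg c (-d)
      simp only [neg_neg] at t1 t2
      rw [t1, t2] at key
      linear_combination key / 2
    · rw [Ne, Prod.mk.injEq, not_and_or]
      exact Or.inl (nd (by simp [ha, hb, hc, hdv]))
    · simp only [Finset.mem_insert, Finset.mem_singleton, Prod.mk.injEq, not_or, not_and_or]
      exact ⟨Or.inl (nd (by simp [ha, hb, hc])), Or.inr (nd (by simp [ha, hb, hc]))⟩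
    · simp only [Finset.mem_insert, Finset.mem_singleton, Prod.mk.injEq, not_or, not_and_or]
      exact ⟨Or.inl (nd (by simp [ha, hb, hc])), Or.inl (nd (by simp [ha, hb, hc])),
        Or.inr (nd (by simp [ha, hb, hc]))⟩

/-- The conclusion of the classification in rank three. -/
def IsWeylForm (Sp : Finset G) (A : G → Matrix (Fin 2) (Fin 2) ℂ)
    (U : L → Matrix (Fin 2) (Fin 2) ℂ) : Prop :=
  ∃ (h : Fin 4 → G) (T : Matrix (Fin 2) (Fin 2) ℂ) (η : ℂ), (η = etaPlus ∨ η = etaMinus) ∧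
    T ∈ Matrix.unitaryGroup (Fin 2) ℂ ∧ h 0 + h 1 + h 2 + h 3 = 0 ∧ Sp = Finset.univ.image h ∧
    (∀ i, A (h i) = T * weylPos η i * Tᴴ ∧ A (-h i) = T * weylNeg (star η) i * Tᴴ) ∧
    (∀ g, (∀ i, g ≠ h i ∧ g ≠ -h i) → A g = 0) ∧
    ∀ V, (∀ l, Commute V (U l)) → ∃ c : ℂ, V = c • 1

/-- In a basis where `P` and `Q` are `pauliZ` and `pauliX`, the product `s (1 + Q)(1 + P)` is the
first Weyl matrix with `η = 2 s`. Conjugation by the Pauli matrices gives the other three, and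
adjugation the matrices of the negatives. -/
theorem isWeylForm_of_factor (W : IsoWalk Sp A U) {l₁ l₂ : L} {h : G}
    {P Q : Matrix (Fin 2) (Fin 2) ℂ} {κ₁ κ₂ s : ℂ} (hP : P ∈ Matrix.unitaryGroup (Fin 2) ℂ)
    (hQ : Q ∈ Matrix.unitaryGroup (Fin 2) ℂ) (htr : P.trace = 0) (hPQ : P * Q = -(Q * P))
    (hP1 : P * P = 1) (hQ1 : Q * Q = 1) (h₁ : U l₁ = κ₁ • P) (h₂ : U l₂ = κ₂ • Q)
    (hs : s = (1 + Complex.I) / 8 ∨ s = (1 - Complex.I) / 8)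
    (hA0 : A 0 = 0) (hA : A h = s • ((1 + Q) * (1 + P))) (hSp : Sp = {h, l₂ • h, l₂ • l₁ • h, l₁ • h})
    (hsum : h + l₂ • h + l₂ • l₁ • h + l₁ • h = 0) : IsWeylForm Sp A U := by
  obtain ⟨T, hT, rfl, rfl⟩ := exists_pauli_basis_of_involutive hP hQ htr hPQ hP1 hQ1
  have hT1 := conjTranspose_mul_self_of_mem hT
  have hT2 := mul_conjTranspose_self_of_mem hT
  have hAh : A h = T * weylPos (2 * s) 0 * Tᴴ := by
    have e1 : ∀ X, 1 + T * X * Tᴴ = T * (1 + X) * Tᴴ := fun X => by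
      rw [Matrix.mul_add, Matrix.add_mul, mul_one, hT2]
    rw [hA, e1, e1, conj_mul_conj hT, ← Matrix.smul_mul, ← Matrix.mul_smul]
    congr 2
    ext i j
    fin_cases i <;> fin_cases j <;>
      simp [weylPos, pauliX, pauliZ, Matrix.mul_apply, Fin.sum_univ_two, Matrix.one_apply] <;> ring
  have cc : ∀ X Y, T * X * Tᴴ * (T * Y * Tᴴ) * (T * X * Tᴴ)ᴴ = T * (X * Y * Xᴴ) * Tᴴ := by
    intro X Y
    rw [conjTranspose_conj, conj_mul_conj hT, conj_mul_conj hT]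
  have hA3 : A (l₁ • h) = T * weylPos (2 * s) 3 * Tᴴ := by
    rw [W.cov_of_smul hP h₁, hAh, cc, pauliZ_conjTranspose]
    congr 2
    ext i j
    fin_cases i <;> fin_cases j <;> simp [weylPos, pauliZ]
  have hA1 : A (l₂ • h) = T * weylPos (2 * s) 1 * Tᴴ := by
    rw [W.cov_of_smul hQ h₂, hAh, cc, pauliX_conjTranspose]
    congr 2
    ext i j
    fin_cases i <;> fin_cases j <;> simp [weylPos, pauliX]
  have hA2 : A (l₂ • l₁ • h) = T * weylPos (2 * s) 2 * Tᴴ := by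
    rw [W.cov_of_smul hQ h₂, hA3, cc, pauliX_conjTranspose]
    congr 2
    ext i j
    fin_cases i <;> fin_cases j <;> simp [weylPos, pauliX]
  refine ⟨![h, l₂ • h, l₂ • l₁ • h, l₁ • h], T, 2 * s, ?_, hT, hsum, ?_, ?_, ?_, ?_⟩
  · rcases hs with rfl | rfl
    · left; rw [etaPlus]; ring
    · right; rw [etaMinus]; ring
  · rw [hSp]
    ext x
    simp [Fin.exists_fin_succ, eq_comm]
  · have hpos : ∀ i, A (![h, l₂ • h, l₂ • l₁ • h, l₁ • h] i) = T * weylPos (2 * s) i * Tᴴ := by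
      intro i
      fin_cases i
      exacts [hAh, hA1, hA2, hA3]
    intro i
    refine ⟨hpos i, ?_⟩
    rw [W.neg_conj hT (hpos i)]
    congr 2
    ext j k
    fin_cases i <;> fin_cases j <;> fin_cases k <;>
      simp [weylPos, weylNeg, Matrix.adjugate_fin_two]
  · intro g hg
    by_cases hst : g ∈ steps Sp
    · rcases (steps_of_bcc hSp).1 hst with h | h | h | h | h | h | h | h | h
      · rw [h, hA0]
      exacts [absurd h (hg 0).1, absurd h (hg 0).2, absurd h (hg 1).1, absurd h (hg 1).2,
        absurd h (hg 2).1, absurd h (hg 2).2, absurd h (hg 3).1, absurd h (hg 3).2]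
    · exact W.eq_zero g hst
  · intro V hV
    have hV1 := commute_conj hT (hV l₁)
    have hV2 := commute_conj hT (hV l₂)
    have back : ∀ X, Tᴴ * (T * X * Tᴴ) * T = X := fun X => by
      simp only [Matrix.mul_assoc, hT1, mul_one]
      rw [← Matrix.mul_assoc, hT1, one_mul]
    have z : Commute (Tᴴ * V * T) pauliZ := by
      refine Commute.of_eq_smul hV1 (W.conj_U_ne_zero hT l₁) (c := κ₁) ?_
      rw [h₁, Matrix.mul_smul, Matrix.smul_mul, back]
    have x : Commute (Tᴴ * V * T) pauliX := by
      refine Commute.of_eq_smul hV2 (W.conj_U_ne_zero hT l₂) (c := κ₂) ?_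
      rw [h₂, Matrix.mul_smul, Matrix.smul_mul, back]
    refine ⟨(Tᴴ * V * T) 0 0, ?_⟩
    calc V = T * (Tᴴ * V * T) * Tᴴ := (conj_conjTranspose_conj hT).symm
      _ = T * ((Tᴴ * V * T) 0 0 • 1) * Tᴴ := congrArg (fun M => T * M * Tᴴ)
        (eq_smul_one_of_commute x z)
      _ = (Tᴴ * V * T) 0 0 • 1 := by rw [Matrix.mul_smul, Matrix.smul_mul, mul_one, hT2]

end IsoWalk

/-! ### Pauli coefficients in rank three -/

namespace IsoWalk

variable {G : Type*} [AddCommGroup G] [DecidableEq G] {L : Type*} [Group L] [DistribMulAction L G]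
variable {Sp : Finset G} {A : G → Matrix (Fin 2) (Fin 2) ℂ} {U : L → Matrix (Fin 2) (Fin 2) ℂ}
variable {B : LinearMap.BilinForm ℤ G}

theorem commute_zero (W : IsoWalk Sp A U) (l : L) : Commute (A 0) (U l) := by
  have h := W.cov l 0
  rw [smul_zero] at h
  have h2 := congrArg (fun M => M * U l) h
  simp only [Matrix.mul_assoc, conjTranspose_mul_self_of_mem (W.unitary l), mul_one] at h2
  exact h2

/-- The Pauli coefficients of a transition matrix in rank three. -/
theorem exists_coefficients [Module.Finite ℤ G] (W : IsoWalk Sp A U) (hB : InvForm L B)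
    (hr : Module.finrank ℤ G = 3) {h : G} {m n : L}
    (hSp : Sp = {h, m • h, n • h, m • n • h}) (hsum : h + m • h + n • h + m • n • h = 0)
    {T : Matrix (Fin 2) (Fin 2) ℂ} {κ κ' : ℂ} (hT : T ∈ Matrix.unitaryGroup (Fin 2) ℂ)
    (hm : U m = κ • (T * pauliZ * Tᴴ)) (hn : U n = κ' • (T * pauliX * Tᴴ)) :
    ∃ s w₁ w₂ w₃ : ℂ, (s = (1 + Complex.I) / 8 ∨ s = (1 - Complex.I) / 8) ∧
      (((w₁ = s ∨ w₁ = -s) ∧ (w₂ = s ∨ w₂ = -s) ∧ (w₃ = Complex.I * s ∨ w₃ = -(Complex.I * s))) ∨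
      ((w₁ = s ∨ w₁ = -s) ∧ (w₃ = s ∨ w₃ = -s) ∧ (w₂ = Complex.I * s ∨ w₂ = -(Complex.I * s))) ∨
      ((w₂ = s ∨ w₂ = -s) ∧ (w₃ = s ∨ w₃ = -s) ∧ (w₁ = Complex.I * s ∨ w₁ = -(Complex.I * s)))) ∧
      A h = T * !![s + w₁, w₂ + Complex.I * w₃; w₂ - Complex.I * w₃, s - w₁] * Tᴴ ∧ A 0 = 0 := by
  have hT1 := conjTranspose_mul_self_of_mem hT
  have hT2 := mul_conjTranspose_self_of_mem hT
  obtain ⟨N, hN⟩ : ∃ N, A h = T * N * Tᴴ := ⟨Tᴴ * A h * T, (conj_conjTranspose_conj hT).symm⟩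
  obtain ⟨s, hs⟩ : ∃ s, s = (N 0 0 + N 1 1) / 2 := ⟨_, rfl⟩
  obtain ⟨w₁, hw₁⟩ : ∃ w, w = (N 0 0 - N 1 1) / 2 := ⟨_, rfl⟩
  obtain ⟨w₂, hw₂⟩ : ∃ w, w = (N 0 1 + N 1 0) / 2 := ⟨_, rfl⟩
  obtain ⟨w₃, hw₃⟩ : ∃ w, w = (N 0 1 - N 1 0) / 2 * -Complex.I := ⟨_, rfl⟩
  have hNe : N = !![s + w₁, w₂ + Complex.I * w₃; w₂ - Complex.I * w₃, s - w₁] := by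
    ext i j
    fin_cases i <;> fin_cases j <;> simp [hs, hw₁, hw₂, hw₃]
    · ring
    · linear_combination ((N 0 1 - N 1 0) / 2) * Complex.I_mul_I
    · linear_combination -((N 0 1 - N 1 0) / 2) * Complex.I_mul_I
    · ring
  clear hs hw₁ hw₂ hw₃
  have hP : T * pauliZ * Tᴴ ∈ Matrix.unitaryGroup (Fin 2) ℂ :=
    mul_mem (mul_mem hT pauliZ_mem) (Unitary.star_mem hT)
  have hQ : T * pauliX * Tᴴ ∈ Matrix.unitaryGroup (Fin 2) ℂ :=
    mul_mem (mul_mem hT pauliX_mem) (Unitary.star_mem hT)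
  have cc : ∀ X Y, T * X * Tᴴ * (T * Y * Tᴴ) * (T * X * Tᴴ)ᴴ = T * (X * Y * Xᴴ) * Tᴴ := by
    intro X Y
    rw [conjTranspose_conj, conj_mul_conj hT, conj_mul_conj hT]
  have hNm : A (m • h) = T * !![s + w₁, -(w₂ + Complex.I * w₃); -(w₂ - Complex.I * w₃), s - w₁] * Tᴴ := by
    rw [W.cov_of_smul hP hm, hN, cc, hNe, pauliZ_conjTranspose]
    congr 2
    ext i j
    fin_cases i <;> fin_cases j <;> simp [pauliZ]
  have hNn : A (n • h) = T * !![s - w₁, w₂ - Complex.I * w₃; w₂ + Complex.I * w₃, s + w₁] * Tᴴ := by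
    rw [W.cov_of_smul hQ hn, hN, cc, hNe, pauliX_conjTranspose]
    congr 2
    ext i j
    fin_cases i <;> fin_cases j <;> simp [pauliX]
  have hNmn : A (m • n • h) =
      T * !![s - w₁, -(w₂ - Complex.I * w₃); -(w₂ + Complex.I * w₃), s + w₁] * Tᴴ := by
    rw [W.cov_of_smul hP hm, hNn, cc, pauliZ_conjTranspose]
    congr 2
    ext i j
    fin_cases i <;> fin_cases j <;> simp [pauliZ]
  rw [hNe] at hN
  have hmem : ∀ x ∈ Sp, x ∈ neighbours Sp := fun x hx => mem_neighbours.2 (Or.inl hx)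
  have hdet := W.det_eq_zero hB (hmem h (by rw [hSp]; simp))
  rw [hN, det_unitary_conj hT, Matrix.det_fin_two_of] at hdet
  obtain ⟨p1, p0, p4⟩ := W.trace_difference hr hSp hsum
  obtain ⟨p2, -, p5⟩ := W.trace_difference hr (a := h) (b := n • h) (c := m • h) (d := m • n • h)
    (by rw [hSp]; ext; simp; tauto) (by rw [← hsum]; abel)
  obtain ⟨p3, -, p6⟩ := W.trace_difference hr (a := h) (b := m • n • h) (c := m • h) (d := n • h)
    (by rw [hSp]; ext; simp; tauto) (by rw [← hsum]; abel)
  have hh : h ∈ neighbours Sp := hmem h (by rw [hSp]; simp)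
  have hne : N ≠ 0 := by
    rintro rfl
    apply W.ne_zero h hh
    rw [hN, ← hNe]; simp
  have tr : ∀ X Y, (T * X * Tᴴ * (T * Y * Tᴴ)).trace = (X * Y).trace := fun X Y => by
    rw [conj_mul_conj hT, trace_unitary_conj hT]
  -- In each relation the two traces are complex conjugates of each other. As the determinant
  -- vanishes, they amount to `4 (s² - w_j²)` and its conjugate, so only the real part is
  -- constrained.
  rw [W.conjTranspose_neg_step, W.adj, ← Matrix.conjTranspose_mul, Matrix.trace_conjTranspose]
    at p4 p5 p6
  rw [hN, hNm, hNn, hNmn, adjugate_unitary_conj hT, adjugate_unitary_conj hT, tr, tr] at p4 p5 p6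
  rw [hN] at p1 p2 p3 p0
  rw [hNm, trace_conjTranspose_conj_mul_conj hT] at p1
  rw [hNn, trace_conjTranspose_conj_mul_conj hT] at p2
  rw [hNmn, trace_conjTranspose_conj_mul_conj hT] at p3
  have r4 := congrArg Complex.re p4
  have r5 := congrArg Complex.re p5
  have r6 := congrArg Complex.re p6
  simp only [Complex.add_re, Complex.star_def, Complex.conj_re, Complex.zero_re] at r4 r5 r6
  have d2 := congrArg Complex.re hdet
  have I2 := Complex.I_mul_I
  simp [Matrix.trace_fin_two, Matrix.mul_apply, Fin.sum_univ_two] at p1 p2 p3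
  simp [Matrix.trace_fin_two, Matrix.mul_apply, Fin.sum_univ_two, Matrix.adjugate_fin_two] at r4 r5 r6 d2
  -- `A h` is orthogonal to its three images. In Pauli coefficients each image changes two signs,
  -- and the three relations together equate all four moduli.
  have n1 : Complex.normSq w₁ = Complex.normSq s := by
    apply Complex.ofReal_injective
    rw [Complex.normSq_eq_conj_mul_self, Complex.normSq_eq_conj_mul_self]
    linear_combination -(p2 + p3) / 4
  have n2 : Complex.normSq w₂ = Complex.normSq s := by
    apply Complex.ofReal_injective
    rw [Complex.normSq_eq_conj_mul_self, Complex.normSq_eq_conj_mul_self]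
    linear_combination -(p1 + p3) / 4
  have n3 : Complex.normSq w₃ = Complex.normSq s := by
    apply Complex.ofReal_injective
    rw [Complex.normSq_eq_conj_mul_self, Complex.normSq_eq_conj_mul_self]
    linear_combination -(p1 + p2) / 4 + (starRingEnd ℂ) w₃ * w₃ * I2
  have hs0 : s ≠ 0 := by
    rintro rfl
    rw [map_zero, Complex.normSq_eq_zero] at n1 n2 n3
    apply hne
    rw [hNe, n1, n2, n3]
    ext i j
    fin_cases i <;> fin_cases j <;> simp
  -- `A 0` commutes with both Pauli matrices, hence is scalar, and is orthogonal to `A h`, whose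
  -- trace `2 s` is nonzero.
  have hA0 : A 0 = 0 := by
    have back : ∀ X, Tᴴ * (T * X * Tᴴ) * T = X := fun X => by
      simp only [Matrix.mul_assoc, hT1, mul_one]
      rw [← Matrix.mul_assoc, hT1, one_mul]
    have z : Commute (Tᴴ * A 0 * T) pauliZ := by
      refine Commute.of_eq_smul (commute_conj hT (W.commute_zero m)) (W.conj_U_ne_zero hT m)
        (c := κ) ?_
      rw [hm, Matrix.mul_smul, Matrix.smul_mul, back]
    have x : Commute (Tᴴ * A 0 * T) pauliX := by
      refine Commute.of_eq_smul (commute_conj hT (W.commute_zero n)) (W.conj_U_ne_zero hT n)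
        (c := κ') ?_
      rw [hn, Matrix.mul_smul, Matrix.smul_mul, back]
    have h0 := eq_smul_one_of_commute x z
    generalize (Tᴴ * A 0 * T) 0 0 = c at h0
    have h1 : A 0 = T * (c • 1) * Tᴴ := by rw [← h0, conj_conjTranspose_conj hT]
    rw [h1, trace_conjTranspose_conj_mul_conj hT] at p0
    simp [Matrix.trace_fin_two] at p0
    have hc : c = 0 := by
      have h2 : (starRingEnd ℂ) c * s = 0 := by linear_combination p0 / 2
      simpa [hs0] using h2
    rw [h1, hc]; simp
  -- The trace of `∑ A = 1`: eight steps contribute `2 Re s` each to a total of `2`.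
  have hsre : s.re = 1 / 8 := by
    have h1 := congrArg (fun M => M.trace.re) W.sum
    simp only [Matrix.trace_sum, Complex.re_sum] at h1
    rw [W.sum_steps_of_bcc hr hSp hsum (fun x => (A x).trace.re)] at h1
    have c : ∀ {x}, x ∈ neighbours Sp → (A x).trace.re = 2 * s.re := by
      intro x hx
      rw [W.trace_re_const hh hx, hN, trace_unitary_conj hT, Matrix.trace_fin_two]
      simp; ring
    have hm' := hmem (m • h) (by rw [hSp]; simp)
    have hn' := hmem (n • h) (by rw [hSp]; simp)
    have hmn' := hmem (m • n • h) (by rw [hSp]; simp)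
    rw [hA0, c hh, c hm', c hn', c hmn', c (neg_mem_neighbours hh), c (neg_mem_neighbours hm'),
      c (neg_mem_neighbours hn'), c (neg_mem_neighbours hmn')] at h1
    simp at h1
    linarith
  obtain ⟨hsv, hw⟩ := exists_signs hsre n1 n2 n3 (by linear_combination -hdet + w₃ ^ 2 * I2)
    (by simp [sq]; linarith) (by simp [sq]; linarith) (by simp [sq]; linarith)
  exact ⟨s, w₁, w₂, w₃, hsv, hw, hN, hA0⟩

end IsoWalk

/-! ### Classification in rank three -/

namespace IsoWalk

variable {G : Type*} [AddCommGroup G] [DecidableEq G] {L : Type*} [Group L] [DistribMulAction L G]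
variable {Sp : Finset G} {A : G → Matrix (Fin 2) (Fin 2) ℂ} {U : L → Matrix (Fin 2) (Fin 2) ℂ}
variable {B : LinearMap.BilinForm ℤ G}

theorem add_four_swap {a b c d : G} (h : a + b + c + d = 0) : a + b + d + c = 0 := by
  rw [← h]; abel

theorem add_four_rotate {a b c d : G} (h : a + b + c + d = 0) : a + c + d + b = 0 := by
  rw [← h]; abel

theorem insert_four_swap (a b c d : G) : ({a, b, c, d} : Finset G) = {a, b, d, c} := by
  rw [Finset.pair_comm]

theorem insert_four_rotate (a b c d : G) : ({a, b, c, d} : Finset G) = {a, c, d, b} := by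
  rw [Finset.insert_comm b c, Finset.pair_comm b d]

/-- A unitary involution with vanishing trace that represents `l` up to a phase. -/
structure IsPauliFor (U : L → Matrix (Fin 2) (Fin 2) ℂ) (l : L) (P : Matrix (Fin 2) (Fin 2) ℂ) :
    Prop where
  mem : P ∈ Matrix.unitaryGroup (Fin 2) ℂ
  trace : P.trace = 0
  sq : P * P = 1
  rep : ∃ κ : ℂ, U l = κ • P

theorem IsPauliFor.of_eq_or_neg {l : L} {P P' : Matrix (Fin 2) (Fin 2) ℂ} (h : IsPauliFor U l P)
    (hP : P' = P ∨ P' = -P) : IsPauliFor U l P' := by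
  rcases hP with rfl | rfl
  · exact h
  · obtain ⟨κ, hκ⟩ := h.rep
    refine ⟨?_, by rw [Matrix.trace_neg, h.trace, neg_zero], by rw [neg_mul_neg, h.sq],
      -κ, by rw [hκ, smul_neg, neg_smul, neg_neg]⟩
    rw [Matrix.mem_unitaryGroup_iff, star_neg, neg_mul_neg]
    exact Matrix.mem_unitaryGroup_iff.1 h.mem

/-- The form of a walk one of whose transition matrices is a sign combination of the identity, two
Pauli matrices and their product. -/
theorem isWeylForm_of_signs (W : IsoWalk Sp A U) {l₁ l₂ : L} {h : G}
    {P Q : Matrix (Fin 2) (Fin 2) ℂ} {s w₁ w₂ w₃ : ℂ} (hP : IsPauliFor U l₁ P)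
    (hQ : IsPauliFor U l₂ Q) (hPQ : P * Q = -(Q * P)) (hcomm : l₁ * l₂ = l₂ * l₁)
    (hs : s = (1 + Complex.I) / 8 ∨ s = (1 - Complex.I) / 8)
    (h₁ : w₁ = s ∨ w₁ = -s) (h₂ : w₂ = s ∨ w₂ = -s) (h₃ : w₃ = s ∨ w₃ = -s) (hA0 : A 0 = 0)
    (hA : A h = s • 1 + w₁ • P + w₂ • Q + w₃ • (P * Q))
    (hSp : Sp = {h, l₁ • h, l₂ • h, (l₁ * l₂) • h})
    (hsum : h + l₁ • h + l₂ • h + (l₁ * l₂) • h = 0) : IsWeylForm Sp A U := by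
  obtain ⟨P', Q', hfac, hcase⟩ := exists_factor hPQ h₁ h₂ h₃
  rw [hfac] at hA
  have anti : ∀ {X X' Y Y' : Matrix (Fin 2) (Fin 2) ℂ}, X * Y = -(Y * X) → (X' = X ∨ X' = -X) →
      (Y' = Y ∨ Y' = -Y) → X' * Y' = -(Y' * X') := by
    rintro X X' Y Y' e (rfl | rfl) (rfl | rfl) <;> simp [e]
  rcases hcase with ⟨c1, c2⟩ | ⟨c1, c2⟩
  · have hP' := hP.of_eq_or_neg c1
    have hQ' := hQ.of_eq_or_neg c2
    obtain ⟨κ, hκ⟩ := hP'.rep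
    obtain ⟨κ', hκ'⟩ := hQ'.rep
    refine W.isWeylForm_of_factor hP'.mem hQ'.mem hP'.trace (anti hPQ c1 c2) hP'.sq hQ'.sq hκ hκ'
      hs hA0 hA ?_ ?_
    · rw [hSp, smul_smul, ← hcomm]; exact insert_four_rotate _ _ _ _
    · rw [smul_smul, ← hcomm]; exact add_four_rotate hsum
  · have hP' := hQ.of_eq_or_neg c1
    have hQ' := hP.of_eq_or_neg c2
    obtain ⟨κ, hκ⟩ := hP'.rep
    obtain ⟨κ', hκ'⟩ := hQ'.rep
    refine W.isWeylForm_of_factor hP'.mem hQ'.mem hP'.trace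
      (anti (by rw [hPQ, neg_neg]) c1 c2) hP'.sq hQ'.sq hκ hκ'
      hs hA0 hA ?_ ?_
    · rw [hSp, smul_smul]; exact insert_four_swap _ _ _ _
    · rw [smul_smul]; exact add_four_swap hsum

variable [FaithfulSMul L G]

/-- Classification of normalised isotropic walks in rank three. -/
theorem classification_of_rank_three [TwoUniqueSums G] [IsAddTorsionFree G] [Module.Finite ℤ G]
    [Module.Free ℤ G] [Finite L] (W : IsoWalk Sp A U) (hB : InvForm L B)
    (hr : Module.finrank ℤ G = 3) : IsWeylForm Sp A U := by
  have hinv : ∀ l : L, l * l = 1 := fun l => W.mul_self_eq_one_of_rank_three hB hr l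
  obtain ⟨h, m, n, hm, hn, hmn, hSp, hsum⟩ := W.generators_of_rank_three hB hr hinv
  obtain ⟨T, κ, κ', hT, hUm, hUn⟩ := exists_pauli_basis (W.unitary m) (W.unitary n)
    (W.trace_U_eq_zero hm (hinv m)) (W.anticommute hinv hm hn hmn)
  have hcomm : ∀ l l' : L, l * l' = l' * l := fun l l' => by
    calc l * l' = (l * l')⁻¹ := (inv_eq_of_mul_eq_one_left (hinv _)).symm
      _ = l'⁻¹ * l⁻¹ := mul_inv_rev _ _
      _ = l' * l := by
        rw [inv_eq_of_mul_eq_one_left (hinv l), inv_eq_of_mul_eq_one_left (hinv l')]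
  obtain ⟨s, w₁, w₂, w₃, hs, hw, hA, hA0⟩ := W.exists_coefficients hB hr (h := h)
    (by rw [← mul_smul m n h]; exact hSp) (by rw [← mul_smul m n h]; exact hsum) hT hUm hUn
  have hT2 := mul_conjTranspose_self_of_mem hT
  have hTs : ∀ X Y, T * X * Tᴴ * (T * Y * Tᴴ) = T * (X * Y) * Tᴴ := fun X Y => conj_mul_conj hT
  obtain ⟨P, hP⟩ : ∃ P, P = T * pauliZ * Tᴴ := ⟨_, rfl⟩
  obtain ⟨Q, hQ⟩ : ∃ Q, Q = T * pauliX * Tᴴ := ⟨_, rfl⟩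
  have hPP : P * P = 1 := by rw [hP, hTs, pauliZ_mul_self, mul_one, hT2]
  have hQQ : Q * Q = 1 := by rw [hQ, hTs, pauliX_mul_self, mul_one, hT2]
  have hPQ : P * Q = -(Q * P) := by
    rw [hP, hQ, hTs, hTs, pauliZ_mul_pauliX, Matrix.mul_neg, Matrix.neg_mul]
  have hAe : A h = s • 1 + w₁ • P + w₂ • Q + (Complex.I * w₃) • (P * Q) := by
    rw [hP, hQ, hTs, hA]
    have : !![s + w₁, w₂ + Complex.I * w₃; w₂ - Complex.I * w₃, s - w₁] =
        s • 1 + w₁ • pauliZ + w₂ • pauliX + (Complex.I * w₃) • (pauliZ * pauliX) := by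
      ext i j
      fin_cases i <;> fin_cases j <;> simp [pauliX, pauliZ] <;> ring
    rw [this]
    simp only [Matrix.mul_add, Matrix.add_mul, Matrix.mul_smul, Matrix.smul_mul, mul_one, hT2]
  have fP : IsPauliFor U m P := by
    refine ⟨?_, ?_, hPP, κ, by rw [hUm, hP]⟩
    · rw [hP]; exact mul_mem (mul_mem hT pauliZ_mem) (Unitary.star_mem hT)
    · rw [hP, trace_unitary_conj hT]; simp [pauliZ, Matrix.trace_fin_two]
  have fQ : IsPauliFor U n Q := by
    refine ⟨?_, ?_, hQQ, κ', by rw [hUn, hQ]⟩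
    · rw [hQ]; exact mul_mem (mul_mem hT pauliX_mem) (Unitary.star_mem hT)
    · rw [hQ, trace_unitary_conj hT]; simp [pauliX, Matrix.trace_fin_two]
  -- The third Pauli matrix, up to sign; the factor `i` makes it an involution.
  have fR : IsPauliFor U (m * n) (Complex.I • (P * Q)) := by
    refine ⟨?_, ?_, ?_, ?_⟩
    · have : Complex.I • (P * Q) = (Complex.I • (1 : Matrix (Fin 2) (Fin 2) ℂ)) * (P * Q) := by
        rw [Matrix.smul_mul, one_mul]
      rw [this]
      refine mul_mem ?_ (mul_mem fP.mem fQ.mem)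
      rw [Matrix.mem_unitaryGroup_iff, star_smul, star_one, Matrix.smul_mul, Matrix.mul_smul,
        smul_smul, one_mul]
      simp
    · have := congrArg Matrix.trace hPQ
      rw [Matrix.trace_neg, Matrix.trace_mul_comm Q P] at this
      rw [Matrix.trace_smul, self_eq_neg.1 this, smul_zero]
    · rw [Matrix.smul_mul, Matrix.mul_smul, smul_smul, Complex.I_mul_I]
      calc (-1 : ℂ) • (P * Q * (P * Q)) = -(P * (Q * P) * Q) := by
            rw [neg_smul, one_smul]; simp only [Matrix.mul_assoc]
        _ = P * (P * Q) * Q := by rw [hPQ]; simp [Matrix.mul_assoc]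
        _ = (P * P) * (Q * Q) := by simp only [Matrix.mul_assoc]
        _ = 1 := by rw [hPP, hQQ, one_mul]
    · obtain ⟨c, hc⟩ := W.proj m n
      refine ⟨c * (κ * κ') * -Complex.I, ?_⟩
      rw [hc, hUm, hUn, ← hP, ← hQ, Matrix.smul_mul, Matrix.mul_smul, smul_smul, smul_smul, smul_smul]
      congr 1
      linear_combination (c * (κ * κ')) * Complex.I_mul_I
  have I2 := Complex.I_mul_I
  -- The two Pauli matrices with coefficients `±s` are chosen as the basic pair. Writing the third
  -- as their product costs a factor `±i`, which turns its coefficient `±i s` into `±s`.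
  rcases hw with ⟨c1, c2, c3⟩ | ⟨c1, c3, c2⟩ | ⟨c2, c3, c1⟩
  · refine W.isWeylForm_of_signs (h := h) fP fQ hPQ (hcomm _ _) hs c1 c2 (w₃ := Complex.I * w₃) ?_ hA0 hAe hSp
      hsum
    rcases c3 with rfl | rfl
    · right; linear_combination s * I2
    · left; linear_combination -s * I2
  · refine W.isWeylForm_of_signs (h := h) fP fR ?_ (hcomm _ _) hs c1 c3 (w₃ := -Complex.I * w₂) ?_ hA0 ?_ ?_ ?_
    · rw [Matrix.mul_smul, Matrix.smul_mul, ← smul_neg, Matrix.mul_assoc P Q P, ← Matrix.mul_neg,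
        ← hPQ]
    · rcases c2 with rfl | rfl
      · left; linear_combination -s * I2
      · right; linear_combination s * I2
    · rw [hAe, Matrix.mul_smul, ← Matrix.mul_assoc, hPP, one_mul, smul_smul, smul_smul]
      have : -Complex.I * w₂ * Complex.I = w₂ := by linear_combination -w₂ * I2
      rw [this, mul_comm w₃]
      abel
    · rw [hSp, ← mul_assoc, hinv, one_mul]; exact insert_four_swap _ _ _ _
    · rw [← mul_assoc, hinv, one_mul]; exact add_four_swap hsum
  · refine W.isWeylForm_of_signs (h := h) fQ fR ?_ (hcomm _ _) hs c2 c3 (w₃ := Complex.I * w₁) ?_ hA0 ?_ ?_ ?_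
    · rw [Matrix.mul_smul, Matrix.smul_mul, ← smul_neg, hPQ, Matrix.mul_neg, ← Matrix.mul_assoc,
        Matrix.neg_mul, Matrix.mul_assoc Q P Q, hPQ, Matrix.mul_neg, neg_neg, Matrix.mul_assoc]
    · rcases c1 with rfl | rfl
      · right; linear_combination s * I2
      · left; linear_combination -s * I2
    · have h5 : Q * (P * Q) = -P := by
        rw [hPQ, Matrix.mul_neg, ← Matrix.mul_assoc, hQQ, one_mul]
      rw [hAe, Matrix.mul_smul, h5, smul_neg, smul_neg, smul_smul, smul_smul]
      have : Complex.I * w₁ * Complex.I = -w₁ := by linear_combination w₁ * I2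
      rw [this, mul_comm w₃, neg_smul, neg_neg]
      abel
    · have : n * (m * n) = m := by rw [hcomm m n, ← mul_assoc, hinv, one_mul]
      rw [hSp, this]; exact insert_four_rotate _ _ _ _
    · have : n * (m * n) = m := by rw [hcomm m n, ← mul_assoc, hinv, one_mul]
      rw [this]; exact add_four_rotate hsum

end IsoWalk

/-! ### Auxiliary matrices for rank one -/

section TwoByTwo

variable {X T : Matrix (Fin 2) (Fin 2) ℂ}

/-- A singular matrix in a basis in which its second column vanishes. -/
theorem exists_column_form (hX : X.det = 0) (hX0 : X ≠ 0) :
    ∃ (T : Matrix (Fin 2) (Fin 2) ℂ) (α β : ℂ), T ∈ Matrix.unitaryGroup (Fin 2) ℂ ∧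
      X = T * !![α, 0; β, 0] * Tᴴ := by
  obtain ⟨a, b, ha, hb, rfl⟩ := exists_eq_vecMulVec hX hX0
  have hd : (![-star (b 1), star (b 0)] : Fin 2 → ℂ) ≠ 0 := by
    rw [ne_zero_fin_two] at hb ⊢
    simpa [or_comm] using hb
  -- The auxiliary second matrix has the same column and a row orthogonal to `b` of the same norm.
  obtain ⟨T, α, β, hT, h, -⟩ := exists_common_column hX hX0
    (Y := Matrix.vecMulVec a ![-star (b 1), star (b 0)])
    (by simp [Matrix.det_fin_two, Matrix.vecMulVec_apply]; ring) (vecMulVec_ne_zero_fin_two ha hd)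
    ((adjugate_mul_vecMulVec hb hd).2 (mul_comm _ _))
    (by simp [Matrix.trace_fin_two, Matrix.mul_apply, Fin.sum_univ_two, Matrix.vecMulVec_apply]; ring)
    (by simp [Matrix.trace_fin_two, Matrix.mul_apply, Fin.sum_univ_two, Matrix.vecMulVec_apply]; ring)
  exact ⟨T, α, β, hT, h⟩

/-- The rotation which turns the normal form in rank one into a projection. -/
theorem rotation_mem_unitaryGroup {n m : ℝ} (h : n ^ 2 + m ^ 2 = 1) :
    !![(n : ℂ), -(Complex.I * m); -(Complex.I * m), n] ∈ Matrix.unitaryGroup (Fin 2) ℂ := by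
  have hC : (n : ℂ) ^ 2 + (m : ℂ) ^ 2 = 1 := by exact_mod_cast h
  rw [Matrix.mem_unitaryGroup_iff]
  ext i j
  fin_cases i <;> fin_cases j <;>
    simp [Matrix.star_eq_conjTranspose, Matrix.mul_apply, Fin.sum_univ_two]
  · linear_combination hC - (m : ℂ) ^ 2 * Complex.I_mul_I
  · ring
  · ring
  · linear_combination hC - (m : ℂ) ^ 2 * Complex.I_mul_I

theorem rotation_commute {a b : ℂ} : Commute !![a, b; b, a] pauliX := by
  rw [Commute, SemiconjBy]
  ext i j
  fin_cases i <;> fin_cases j <;> simp [pauliX]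

end TwoByTwo

/-! ### Classification in rank one -/

namespace IsoWalk

variable {G : Type*} [AddCommGroup G] [DecidableEq G] {L : Type*} [Group L] [DistribMulAction L G]
variable {Sp : Finset G} {A : G → Matrix (Fin 2) (Fin 2) ℂ} {U : L → Matrix (Fin 2) (Fin 2) ℂ}
variable {B : LinearMap.BilinForm ℤ G}

/-- On a group isomorphic to `ℤ` the invariant form is a nonzero multiple of the square, so equal
norms mean equality up to sign. -/
theorem eq_or_eq_neg_of_rank_one (W : IsoWalk Sp A U) (hB : InvForm L B)
    (φ : G ≃+ (Fin 1 → ℤ)) {h x : G} (hh : h ∈ neighbours Sp)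
    (hx : x ∈ neighbours Sp) : x = h ∨ x = -h := by
  have e : ∀ y, y = φ y 0 • φ.symm 1 := fun y => by
    apply φ.injective
    rw [map_zsmul, φ.apply_symm_apply]
    ext i
    rw [Subsingleton.elim i 0]
    simp
  have h1 := W.form_const hB hh hx
  have hb : B (φ.symm 1) (φ.symm 1) ≠ 0 := by
    intro h0
    have := hB.pos (φ.symm 1) (by
      intro h2
      have := congrFun ((map_eq_zero_iff _ φ.symm.injective).1 h2) 0
      simp at this)
    omega
  rw [e x, e h] at h1
  simp only [map_smul, LinearMap.smul_apply, smul_eq_mul] at h1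
  have h2 : φ x 0 * φ x 0 = φ h 0 * φ h 0 := by
    apply mul_right_cancel₀ hb
    linear_combination h1
  rcases mul_self_eq_mul_self_iff.1 h2 with h3 | h3
  · left; rw [e x, h3, ← e h]
  · right; rw [e x, h3, neg_smul, ← e h]

theorem generators_of_rank_one [FaithfulSMul L G] (W : IsoWalk Sp A U) (hB : InvForm L B)
    (φ : G ≃+ (Fin 1 → ℤ)) : ∃ h, AddSubgroup.closure {h} = ⊤ ∧
      (Sp = {h} ∨ (Sp = {h, -h} ∧ ∃ l : L, l • h = -h)) := by
  have : Nontrivial G := φ.toEquiv.nontrivial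
  obtain ⟨h, hh⟩ := W.nonempty
  have hhn : h ∈ neighbours Sp := mem_neighbours.2 (Or.inl hh)
  have key : ∀ x ∈ Sp, x = h ∨ x = -h := fun x hx =>
    W.eq_or_eq_neg_of_rank_one hB φ hhn (mem_neighbours.2 (Or.inl hx))
  refine ⟨h, closure_eq_top W.gen fun x hx => ?_, ?_⟩
  · rcases key x hx with rfl | rfl <;> simp
  by_cases hn : -h ∈ Sp
  · refine Or.inr ⟨?_, W.trans h hh _ hn⟩
    ext x
    simp only [Finset.mem_insert, Finset.mem_singleton]
    refine ⟨key x, ?_⟩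
    rintro (rfl | rfl) <;> assumption
  · left
    ext x
    rw [Finset.mem_singleton]
    refine ⟨fun hx => (key x hx).resolve_right ?_, ?_⟩
    · rintro rfl; exact hn hx
    · rintro rfl; exact hh

/-- The form of the transition matrices in rank one, up to a diagonal change of basis. -/
theorem form_of_rank_one (W : IsoWalk Sp A U) (hB : InvForm L B) {h : G} (hh : h ∈ neighbours Sp)
    (hS : ∀ x ∈ neighbours Sp, x = h ∨ x = -h) (φ : G ≃+ (Fin 1 → ℤ)) (h0 : φ h 0 = 1) :
    ∃ (T : Matrix (Fin 2) (Fin 2) ℂ) (x y : ℂ), T ∈ Matrix.unitaryGroup (Fin 2) ℂ ∧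
      A h = T * !![x, 0; y, 0] * Tᴴ ∧ A (-h) = T * !![0, -star y; 0, star x] * Tᴴ ∧
      A 0 = T * !![1 - x, star y; -y, 1 - star x] * Tᴴ ∧ x ≠ 0 ∧ x = star x * x + star y * y := by
  obtain ⟨T, x, y, hT, hA⟩ := exists_column_form (W.det_eq_zero hB hh) (W.ne_zero h hh)
  have hT2 := mul_conjTranspose_self_of_mem hT
  have hAn : A (-h) = T * !![0, -star y; 0, star x] * Tᴴ := by
    rw [W.neg_conj hT hA]
    congr 2
    ext i j
    fin_cases i <;> fin_cases j <;> simp [Matrix.adjugate_fin_two]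
  have hst : ∀ {x}, x ∈ steps Sp ↔ x = 0 ∨ x = h ∨ x = -h := by
    intro x
    rw [mem_steps]
    refine or_congr_right ⟨hS x, ?_⟩
    rintro (rfl | rfl)
    exacts [hh, neg_mem_neighbours hh]
  have nd : ∀ {x y : G}, φ x 0 ≠ φ y 0 → x ≠ y := by
    rintro x _ hxy rfl
    exact hxy rfl
  have hsteps : steps Sp = {0, h, -h} := by
    ext x
    rw [hst]
    simp
  have hsum := W.sum
  rw [hsteps, Finset.sum_insert, Finset.sum_pair] at hsum
  rotate_left
  · exact nd (by simp [h0])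
  · simp only [Finset.mem_insert, Finset.mem_singleton, not_or]
    exact ⟨nd (by simp [h0]), nd (by simp [h0])⟩
  have hA0 : A 0 = T * !![1 - x, star y; -y, 1 - star x] * Tᴴ := by
    rw [eq_sub_of_add_eq hsum, hA, hAn]
    have : !![1 - x, star y; -y, 1 - star x] =
        1 - (!![x, 0; y, 0] + !![0, -star y; 0, star x]) := by
      ext i j
      fin_cases i <;> fin_cases j <;> simp
    rw [this, Matrix.mul_sub, Matrix.sub_mul, mul_one, hT2, Matrix.mul_add, Matrix.add_mul]
  -- The orthogonality of `A 0 = 1 - A h - A (-h)` and `A h`. In particular `x` is real and lies in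
  -- `(0, 1]`.
  have hx : x = star x * x + star y * y := by
    have key : ((A 0)ᴴ * A h).trace = 0 := by
      refine W.trace_eq_zero_of_unique (hst.2 (Or.inl rfl)) (hst.2 (Or.inr (Or.inl rfl)))
        (nd (by simp [h0])) ?_
      intro k hk k' hk' e
      have e' : φ k' 0 - φ k 0 = 1 := by
        rw [← h0, ← sub_zero h, ← e]; simp
      rcases hst.1 hk with rfl | rfl | rfl <;> rcases hst.1 hk' with rfl | rfl | rfl <;>
        simp [h0] at e' <;> simp
    rw [hA, hA0, trace_conjTranspose_conj_mul_conj hT] at key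
    simp [Matrix.trace_fin_two, Matrix.mul_apply, Fin.sum_univ_two] at key
    simp only [← Complex.star_def] at key
    linear_combination key
  refine ⟨T, x, y, hT, hA, hAn, hA0, ?_, hx⟩
  rintro rfl
  have hy : y = 0 := by simpa using hx
  apply W.ne_zero h hh
  have : (!![0, 0; 0, 0] : Matrix (Fin 2) (Fin 2) ℂ) = 0 := by
    ext i j; fin_cases i <;> fin_cases j <;> simp
  rw [hA, hy, this]
  simp

/-- Classification of normalised isotropic walks in rank one. -/
theorem classification_of_rank_one [FaithfulSMul L G] (W : IsoWalk Sp A U) (hB : InvForm L B)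
    (φ : G ≃+ (Fin 1 → ℤ)) :
    ∃ (h : G) (T V : Matrix (Fin 2) (Fin 2) ℂ) (n m : ℝ), T ∈ Matrix.unitaryGroup (Fin 2) ℂ ∧
      V ∈ Matrix.unitaryGroup (Fin 2) ℂ ∧ Commute V pauliX ∧ AddSubgroup.closure {h} = ⊤ ∧
      n ^ 2 + m ^ 2 = 1 ∧ n ≠ 0 ∧ (∀ x ∈ neighbours Sp, x = h ∨ x = -h) ∧
      A h = T * (V * !![(n : ℂ), 0; 0, 0]) * Tᴴ ∧ A (-h) = T * (V * !![0, 0; 0, (n : ℂ)]) * Tᴴ ∧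
      A 0 = T * (V * !![0, Complex.I * m; Complex.I * m, 0]) * Tᴴ ∧
      (Sp = {h} ∨ (Sp = {h, -h} ∧
        ∀ V, (∀ l, Commute V (U l)) → Commute (Tᴴ * V * T) pauliX)) := by
  obtain ⟨h, hcl, hcase⟩ := W.generators_of_rank_one hB φ
  have hhS : h ∈ Sp := by rcases hcase with hS | ⟨hS, -⟩ <;> rw [hS] <;> simp
  have hhn : h ∈ neighbours Sp := mem_neighbours.2 (Or.inl hhS)
  have hS : ∀ x ∈ neighbours Sp, x = h ∨ x = -h := fun x hx =>
    W.eq_or_eq_neg_of_rank_one hB φ hhn hx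
  obtain ⟨ψ, h0⟩ : ∃ ψ : G ≃+ (Fin 1 → ℤ), ψ h 0 = 1 := by
    have : Module.Finite ℤ G := Module.Finite.equiv φ.symm.toIntLinearEquiv
    obtain ⟨ψ, hψ⟩ := exists_coordinates ![h] (by
      rw [Matrix.range_cons, Matrix.range_empty, Set.union_empty]
      exact hcl) (by rw [φ.toIntLinearEquiv.finrank_eq]; simp)
    exact ⟨ψ, by rw [show h = ![h] 0 from rfl, hψ]; simp⟩
  obtain ⟨T, x, y, hT, hA, hAn, hA0, hx0, hx⟩ := W.form_of_rank_one hB hhn hS ψ h0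
  have hT1 := conjTranspose_mul_self_of_mem hT
  obtain ⟨r, hr⟩ : ∃ r : ℝ, r = Complex.normSq x + Complex.normSq y := ⟨_, rfl⟩
  have hxr : x = r := by
    rw [hr, Complex.ofReal_add, Complex.normSq_eq_conj_mul_self, Complex.normSq_eq_conj_mul_self]
    exact hx
  subst hxr
  rw [Complex.normSq_ofReal] at hr
  have hy0 := Complex.normSq_nonneg y
  have hr0 : 0 < r := lt_of_le_of_ne (by nlinarith) (fun e => hx0 (by rw [← e]; simp))
  have hr1 : 0 ≤ 1 - r := by
    by_contra hcon
    push Not at hcon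
    nlinarith
  -- From `r = r² + |y|²` one gets `|y|² = r (1 - r)`, so `|y| = m n`. Only the phase of `y` remains
  -- to be removed by a diagonal change of basis.
  obtain ⟨n, hn⟩ : ∃ n, n = Real.sqrt r := ⟨_, rfl⟩
  obtain ⟨m, hm⟩ : ∃ m, m = Real.sqrt (1 - r) := ⟨_, rfl⟩
  have hn2 : n ^ 2 = r := by rw [hn, Real.sq_sqrt hr0.le]
  have hm2 : m ^ 2 = 1 - r := by rw [hm, Real.sq_sqrt hr1]
  have hn0 : n ≠ 0 := by rintro rfl; rw [← hn2] at hr0; norm_num at hr0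
  have hnC : (n : ℂ) * n = r := by rw [← hn2]; push_cast; ring
  have hmC : (m : ℂ) * m = 1 - r := by rw [← Complex.ofReal_one, ← Complex.ofReal_sub, ← hm2]; push_cast; ring
  have hyn : ‖y‖ = m * n := by
    have : ‖y‖ ^ 2 = (m * n) ^ 2 := by
      rw [← Complex.normSq_eq_norm_sq, mul_pow, hm2, hn2]; linarith
    exact (sq_eq_sq₀ (norm_nonneg _) (by rw [hm, hn]; positivity)).1 this
  -- the phase
  obtain ⟨e, he, hye, hU⟩ : ∃ e : ℂ, ‖e‖ = 1 ∧ y = e * -(Complex.I * m * n) ∧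
      (Sp = {h} ∨ (Sp = {h, -h} ∧ ∃ (l : L) (q r : ℂ), Tᴴ * U l * T = !![0, q; r, 0] ∧
        q * e ^ 2 = r)) := by
    have exY : y ≠ 0 → ∃ e : ℂ, ‖e‖ = 1 ∧ y = e * -(Complex.I * m * n) := by
      intro hy
      have hmn : m * n ≠ 0 := by rw [← hyn]; exact norm_ne_zero_iff.2 hy
      have hmnC : -(Complex.I * m * n) ≠ 0 := by
        rw [neg_ne_zero, mul_assoc, ← Complex.ofReal_mul]
        exact mul_ne_zero Complex.I_ne_zero (Complex.ofReal_ne_zero.2 hmn)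
      refine ⟨y / -(Complex.I * m * n), ?_, (div_mul_cancel₀ _ hmnC).symm⟩
      rw [norm_div, norm_neg, mul_assoc, ← Complex.ofReal_mul, norm_mul, Complex.norm_I, one_mul,
        Complex.norm_real, ← hyn, norm_norm, div_self (norm_ne_zero_iff.2 hy)]
    have ex0 : y = 0 → ∀ e : ℂ, y = e * -(Complex.I * m * n) := by
      intro hy e
      rw [hy, norm_zero] at hyn
      rw [hy, mul_assoc Complex.I, ← Complex.ofReal_mul, ← hyn]
      simp
    rcases hcase with hS | ⟨hS, l, hl⟩
    · rcases eq_or_ne y 0 with hy | hy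
      · exact ⟨1, norm_one, ex0 hy 1, Or.inl hS⟩
      · obtain ⟨e, h1, h2⟩ := exY hy
        exact ⟨e, h1, h2, Or.inl hS⟩
    have hUu : Tᴴ * U l * T ∈ Matrix.unitaryGroup (Fin 2) ℂ :=
      mul_mem (mul_mem (Unitary.star_mem hT) (W.unitary l)) hT
    have f1 := W.conj_U_mul hT hl one_ne_zero (by rw [one_smul]; exact hA) (by rw [one_smul]; exact hAn)
    have f2 := W.conj_U_mul hT (by rw [smul_neg, hl, neg_neg]) one_ne_zero
      (by rw [one_smul]; exact hAn) (by rw [one_smul]; exact hA)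
    obtain ⟨M, hMU⟩ : ∃ M, Tᴴ * U l * T = M := ⟨_, rfl⟩
    rw [hMU] at hUu f1 f2
    have g1 := fun i j => congrFun (congrFun f1 i) j
    have g2 := fun i j => congrFun (congrFun f2 i) j
    have g00 := g1 0 0
    have g11 := g1 1 1
    have k00 := g2 0 0
    simp [Matrix.mul_apply, Fin.sum_univ_two] at g00 g11 k00
    have hr0C : (r : ℂ) ≠ 0 := hx0
    have hM00 : M 0 0 = 0 := k00.resolve_left hr0.ne'
    have hM11 : M 1 1 = 0 := by
      rcases g11 with g | g
      · exact absurd g hr0.ne'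
      · exact g
    rw [hM00] at g00
    have hM : M = !![0, M 0 1; M 1 0, 0] := by
      ext i j
      fin_cases i <;> fin_cases j <;> simp [hM00, hM11]
    obtain ⟨⟨u1, -⟩, -, u2⟩ := unitary_entries hUu
    rw [hM00, mul_zero, zero_add] at u1
    rw [hM11, mul_zero, add_zero] at u2
    have nq : ‖M 0 1‖ = 1 := by
      have := congrArg norm u2
      rw [norm_mul, norm_star, norm_one] at this
      nlinarith [norm_nonneg (M 0 1)]
    have nr : ‖M 1 0‖ = 1 := by
      have := congrArg norm u1
      rw [norm_mul, norm_star, norm_one] at this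
      nlinarith [norm_nonneg (M 1 0)]
    have hq0 : M 0 1 ≠ 0 := by rw [← norm_pos_iff, nq]; exact one_pos
    -- The matrix `M` of a reversal is antidiagonal, and `diag(1, e)` brings it to a multiple of
    -- `pauliX` when `M 0 1 * e ^ 2 = M 1 0`. If `y = 0`, the phase `e` is free and chosen so;
    -- otherwise it is dictated by `y`, and the intertwining relation `g00` yields this equation.
    rcases eq_or_ne y 0 with hy | hy
    · obtain ⟨e, he⟩ := IsAlgClosed.exists_pow_nat_eq (M 1 0 / M 0 1) (n := 2) two_pos
      have he1 : ‖e‖ = 1 := by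
        have := congrArg norm he
        rw [norm_pow, norm_div, nq, nr, div_one] at this
        nlinarith [norm_nonneg e]
      rw [eq_div_iff hq0] at he
      exact ⟨e, he1, ex0 hy e, Or.inr ⟨hS, l, _, _, hMU.trans hM, by rw [mul_comm, he]⟩⟩
    · obtain ⟨e, h1, h2⟩ := exY hy
      refine ⟨e, h1, h2, Or.inr ⟨hS, l, _, _, hMU.trans hM, ?_⟩⟩
      have hee : e * (starRingEnd ℂ) e = 1 := by
        rw [Complex.mul_conj, Complex.normSq_eq_norm_sq, h1]; simp
      have hyc : (starRingEnd ℂ) y = (starRingEnd ℂ) e * (Complex.I * m * n) := by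
        rw [h2]; simp
      apply mul_left_cancel₀ hy
      rw [hyc] at g00
      rw [h2] at g00 ⊢
      linear_combination e ^ 2 * g00 - e * M 1 0 * (Complex.I * m * n) * hee
  have hee : e * (starRingEnd ℂ) e = 1 := by
    rw [Complex.mul_conj, Complex.normSq_eq_norm_sq, he]; simp
  have hDt : (!![1, 0; 0, e])ᴴ = !![1, 0; 0, (starRingEnd ℂ) e] := by
    ext i j; fin_cases i <;> fin_cases j <;> simp
  have hnm : n ^ 2 + m ^ 2 = 1 := by rw [hn2, hm2]; ring
  refine ⟨h, T * !![1, 0; 0, e], !![(n : ℂ), -(Complex.I * m); -(Complex.I * m), n], n, m,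
    mul_mem hT (diagonal_mem_unitaryGroup he), rotation_mem_unitaryGroup hnm, rotation_commute, hcl,
    hnm, hn0, hS, ?_, ?_, ?_, ?_⟩
  · rw [hA, conj_mul_conj_conjTranspose, hDt, hye]
    congr 2
    ext i j
    fin_cases i <;> fin_cases j <;> simp [hnC]
  · rw [hAn, conj_mul_conj_conjTranspose, hDt, hye]
    congr 2
    ext i j
    fin_cases i <;> fin_cases j <;> simp
    · ring
    · linear_combination -(e * (starRingEnd ℂ) e) * hnC - r * hee
  · rw [hA0, conj_mul_conj_conjTranspose, hDt, hye]
    congr 2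
    ext i j
    fin_cases i <;> fin_cases j <;> simp
    · linear_combination (m : ℂ) ^ 2 * Complex.I_mul_I - hmC
    · ring
    · left; ring
    · linear_combination (m : ℂ) ^ 2 * Complex.I_mul_I - hmC + (m : ℂ) ^ 2 * Complex.I ^ 2 * hee
  · rcases hU with hU | ⟨hU, l, q, r, hl, hq⟩
    · exact Or.inl hU
    refine Or.inr ⟨hU, fun V hV => ?_⟩
    have hD := diagonal_mem_unitaryGroup he
    refine Commute.of_eq_smul (commute_conj (mul_mem hT hD) (hV l))
      (W.conj_U_ne_zero (mul_mem hT hD) l) (c := q * e) ?_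
    have : (T * !![1, 0; 0, e])ᴴ * U l * (T * !![1, 0; 0, e]) =
        (!![1, 0; 0, e])ᴴ * (Tᴴ * U l * T) * !![1, 0; 0, e] := by
      simp only [Matrix.conjTranspose_mul, Matrix.mul_assoc]
    rw [this, hl, hDt]
    ext i j
    fin_cases i <;> fin_cases j <;> simp [pauliX]
    linear_combination -(starRingEnd ℂ) e * hq + q * e * hee

end IsoWalk

/-! ### Unitary kernels and unitary operators on the walk space -/

section Kernels

variable {G : Type*} [AddCommGroup G] [DecidableEq G] {n : ℕ}

/-- Only finitely many differences of steps occur, and on them any test function is a combination of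
indicator functions. -/
theorem isConvUnitary_of_single {T : Finset G} {A : G → Matrix (Fin n) (Fin n) ℂ}
    (H : ∀ g, ∑ h ∈ T, ∑ h' ∈ T, (if h' - h = g then (1 : ℂ) else 0) • ((A h)ᴴ * A h') =
      (if (0 : G) = g then (1 : ℂ) else 0) • 1) : IsConvUnitary T A := by
  intro φ
  set D : Finset G := insert 0 ((T ×ˢ T).image fun p => p.2 - p.1)
  have hφ : ∀ x ∈ D, φ x = ∑ g ∈ D, φ g * if x = g then (1 : ℂ) else 0 := by
    intro x hx
    simp [hx]
  calc ∑ h ∈ T, ∑ h' ∈ T, φ (h' - h) • ((A h)ᴴ * A h')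
      = ∑ h ∈ T, ∑ h' ∈ T, ∑ g ∈ D, φ g • ((if h' - h = g then (1 : ℂ) else 0) • ((A h)ᴴ * A h')) := by
        refine Finset.sum_congr rfl fun h hh => Finset.sum_congr rfl fun h' hh' => ?_
        rw [hφ (h' - h) (Finset.mem_insert_of_mem (Finset.mem_image.2 ⟨(h, h'),
          Finset.mem_product.2 ⟨hh, hh'⟩, rfl⟩)), Finset.sum_smul]
        simp only [mul_smul]
    _ = ∑ g ∈ D, φ g • ∑ h ∈ T, ∑ h' ∈ T, (if h' - h = g then (1 : ℂ) else 0) • ((A h)ᴴ * A h') := by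
        simp only [Finset.smul_sum]
        rw [Finset.sum_comm (s := D)]
        exact Finset.sum_congr rfl fun h _ => Finset.sum_comm
    _ = φ 0 • 1 := by
        simp only [H, smul_smul]
        rw [← Finset.sum_smul, ← hφ 0 (Finset.mem_insert_self _ _)]

/-- The adjoint of a unitary kernel is unitary. -/
theorem IsConvUnitary.adjoint {T : Finset G} {A : G → Matrix (Fin n) (Fin n) ℂ}
    (hT : ∀ h ∈ T, -h ∈ T) (hA : IsConvUnitary T A) : IsConvUnitary T fun g => (A (-g))ᴴ := by
  have e : symbol T (fun g => (A (-g))ᴴ) = symbolAdj (symbol T A) := by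
    ext1 i j
    simp only [symbol, symbolAdj, Matrix.transpose_apply, Matrix.map_apply, Matrix.of_apply, map_sum,
      reflect_single]
    refine Finset.sum_nbij' (fun h => -h) (fun h => -h) hT hT (by simp) (by simp) ?_
    intro h _
    simp
  have e' : symbolAdj (symbolAdj (symbol T A)) = symbol T A := by
    ext1 i j
    simp [symbol, symbolAdj, reflect_single]
  rw [isConvUnitary_iff] at hA ⊢
  rw [e, e']
  -- A left inverse of a square matrix over a commutative ring is a right inverse; hence an
  -- isometric walk of this form is automatically surjective.
  exact mul_eq_one_comm.1 hA

/-- A term `T_h ⊗ M` of a walk operator. -/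
noncomputable def walkTerm (h : G) (M : Matrix (Fin n) (Fin n) ℂ) :
    WalkSpace G n →ₗ[ℂ] WalkSpace G n where
  toFun ψ := ⟨fun g => Matrix.toEuclideanLin M (ψ (g - h)), by
    have h1 := (lp.memℓp ψ).summable (by norm_num)
    have h2 := ((Equiv.subRight h).summable_iff.2 h1).mul_left
      (‖(Matrix.toEuclideanLin M).toContinuousLinearMap‖ ^ (2 : ENNReal).toReal)
    refine memℓp_gen (h2.of_nonneg_of_le (fun g => by positivity) fun g => ?_)
    rw [Function.comp_apply, ← Real.mul_rpow (norm_nonneg _) (norm_nonneg _)]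
    exact Real.rpow_le_rpow (norm_nonneg _)
      ((Matrix.toEuclideanLin M).toContinuousLinearMap.le_opNorm _) (by norm_num)⟩
  map_add' ψ χ := by
    ext1; funext g
    exact map_add _ _ _
  map_smul' c ψ := by
    ext1; funext g
    exact (Matrix.toEuclideanLin M).map_smul c _

theorem walkTerm_apply (h : G) (M : Matrix (Fin n) (Fin n) ℂ) (ψ : WalkSpace G n) (g : G) :
    walkTerm h M ψ g = Matrix.toEuclideanLin M (ψ (g - h)) := rfl

theorem inner_walkTerm (h : G) (M : Matrix (Fin n) (Fin n) ℂ) (ψ χ : WalkSpace G n) :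
    inner ℂ (walkTerm h M ψ) χ = inner ℂ ψ (walkTerm (-h) Mᴴ χ) := by
  rw [lp.inner_eq_tsum, lp.inner_eq_tsum, ← (Equiv.addRight h).tsum_eq]
  refine tsum_congr fun g => ?_
  rw [walkTerm_apply, walkTerm_apply, Equiv.coe_addRight, add_sub_cancel_right, sub_neg_eq_add,
    Matrix.toEuclideanLin_conjTranspose_eq_adjoint, LinearMap.adjoint_inner_right]

/-- The operator `∑ T_h ⊗ A_h`. -/
noncomputable def walkOp (T : Finset G) (A : G → Matrix (Fin n) (Fin n) ℂ) :
    WalkSpace G n →ₗ[ℂ] WalkSpace G n := ∑ h ∈ T, walkTerm h (A h)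

theorem walkOp_apply (T : Finset G) (A : G → Matrix (Fin n) (Fin n) ℂ) (ψ : WalkSpace G n) (g : G) :
    walkOp T A ψ g = ∑ h ∈ T, Matrix.toEuclideanLin (A h) (ψ (g - h)) := by
  rw [walkOp, LinearMap.sum_apply, lp.coeFn_sum, Finset.sum_apply]
  rfl

theorem inner_walkOp {T : Finset G} (hT : ∀ h ∈ T, -h ∈ T) (A : G → Matrix (Fin n) (Fin n) ℂ)
    (ψ χ : WalkSpace G n) :
    inner ℂ (walkOp T A ψ) χ = inner ℂ ψ (walkOp T (fun g => (A (-g))ᴴ) χ) := by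
  rw [walkOp, walkOp, LinearMap.sum_apply, LinearMap.sum_apply, sum_inner, inner_sum]
  refine Finset.sum_nbij' (fun h => -h) (fun h => -h) hT hT (by simp) (by simp) ?_
  intro h _
  rw [inner_walkTerm, neg_neg]

theorem walkOp_adjoint_apply {T : Finset G} (hT : ∀ h ∈ T, -h ∈ T)
    (A : G → Matrix (Fin n) (Fin n) ℂ) (ψ : WalkSpace G n) (g : G) (i : Fin n) :
    walkOp T (fun g => (A (-g))ᴴ) (walkOp T A ψ) g i =
      ∑ j, (∑ h ∈ T, ∑ h' ∈ T, ψ (g - (h' - h)) j • ((A h)ᴴ * A h')) i j := by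
  rw [walkOp_apply]
  have : ∑ h ∈ T, Matrix.toEuclideanLin (A (-h))ᴴ (walkOp T A ψ (g - h)) =
      ∑ h ∈ T, Matrix.toEuclideanLin (A h)ᴴ (walkOp T A ψ (g + h)) := by
    refine Finset.sum_nbij' (fun h => -h) (fun h => -h) hT hT (by simp) (by simp) ?_
    intro h _
    rw [← sub_eq_add_neg]
  have comp : ∀ (M N : Matrix (Fin n) (Fin n) ℂ) (v : EuclideanSpace ℂ (Fin n)),
      Matrix.toEuclideanLin M (Matrix.toEuclideanLin N v) = Matrix.toEuclideanLin (M * N) v :=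
    fun M N v => by simp [Matrix.toLpLin_apply, Matrix.mulVec_mulVec]
  have hv : ∀ h h' : G, (Matrix.toEuclideanLin ((A h)ᴴ * A h') (ψ (g + h - h'))) i =
      ∑ j, (ψ (g - (h' - h)) j • ((A h)ᴴ * A h')) i j := fun h h' => by
    rw [show g + h - h' = g - (h' - h) by abel, Matrix.toLpLin_apply]
    simp [Matrix.mulVec, dotProduct, mul_comm]
  rw [this]
  simp only [walkOp_apply, map_sum, comp, WithLp.ofLp_sum, Finset.sum_apply, hv, Matrix.sum_apply]
  rw [Finset.sum_comm (s := Finset.univ)]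
  exact Finset.sum_congr rfl fun h _ => Finset.sum_comm

theorem walkOp_adjoint_walkOp {T : Finset G} (hT : ∀ h ∈ T, -h ∈ T)
    {A : G → Matrix (Fin n) (Fin n) ℂ} (hA : IsConvUnitary T A) (ψ : WalkSpace G n) :
    walkOp T (fun g => (A (-g))ᴴ) (walkOp T A ψ) = ψ := by
  ext1; funext g; ext i
  rw [walkOp_adjoint_apply hT]
  have : ∀ j, (∑ h ∈ T, ∑ h' ∈ T, ψ (g - (h' - h)) j • ((A h)ᴴ * A h')) = ψ g j • 1 := fun j => by
    rw [hA fun x => ψ (g - x) j, sub_zero]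
  simp [this, Matrix.one_apply]

/-- The walk operator of a unitary kernel. -/
noncomputable def walkEquiv {T : Finset G} (hT : ∀ h ∈ T, -h ∈ T)
    {A : G → Matrix (Fin n) (Fin n) ℂ} (hA : IsConvUnitary T A) :
    WalkSpace G n ≃ₗᵢ[ℂ] WalkSpace G n where
  toLinearEquiv := LinearEquiv.ofLinearMap (walkOp T A) (walkOp T fun g => (A (-g))ᴴ)
    (by
      ext1 ψ
      have := walkOp_adjoint_walkOp hT (hA.adjoint hT) ψ
      simpa using this)
    (by ext1 ψ; exact walkOp_adjoint_walkOp hT hA ψ)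
  norm_map' ψ := by
    rw [← sq_eq_sq₀ (norm_nonneg _) (norm_nonneg _), ← inner_self_eq_norm_sq (𝕜 := ℂ),
      ← inner_self_eq_norm_sq (𝕜 := ℂ)]
    change RCLike.re (inner ℂ (walkOp T A ψ) (walkOp T A ψ)) = _
    rw [inner_walkOp hT, walkOp_adjoint_walkOp hT hA]

/-- An isometry satisfies `W† W = 1`; evaluated on vectors concentrated at the origin this gives all
coefficients of the kernel relation. The converse builds the inverse operator from the adjoint
kernel. -/
theorem exists_unitary_iff {T : Finset G} (hT : ∀ h ∈ T, -h ∈ T)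
    {A : G → Matrix (Fin n) (Fin n) ℂ} :
    (∃ W : WalkSpace G n ≃ₗᵢ[ℂ] WalkSpace G n, ∀ (ψ : WalkSpace G n) (g : G),
      W ψ g = ∑ h ∈ T, Matrix.toEuclideanLin (A h) (ψ (g - h))) ↔ IsConvUnitary T A := by
  refine ⟨?_, fun hA => ⟨walkEquiv hT hA, fun ψ g => walkOp_apply T A ψ g⟩⟩
  rintro ⟨W, hW⟩
  have hWe : ∀ ψ, W ψ = walkOp T A ψ := fun ψ => by
    ext1; funext g
    rw [hW, walkOp_apply]
  have hadj : ∀ ψ, walkOp T (fun g => (A (-g))ᴴ) (walkOp T A ψ) = ψ := by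
    intro ψ
    refine ext_inner_left ℂ fun χ => ?_
    rw [← inner_walkOp hT, ← hWe, ← hWe, W.inner_map_map]
  refine isConvUnitary_of_single fun g => ?_
  ext i j
  have := congrArg (fun χ : WalkSpace G n => χ g i)
    (hadj (lp.single 2 (0 : G) (EuclideanSpace.single j (1 : ℂ))))
  have hs : ∀ (x : G) (k : Fin n), (lp.single 2 (0 : G) (EuclideanSpace.single j (1 : ℂ)) :
      WalkSpace G n) x k = (if x = 0 then 1 else 0) * (if k = j then 1 else 0) := by
    intro x k
    rw [lp.single_apply]
    rcases eq_or_ne x 0 with rfl | hx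
    · simp [Pi.single_apply]
    · simp [hx]
  simp only [walkOp_adjoint_apply hT, hs, mul_ite, mul_one, mul_zero, sub_eq_zero] at this
  rw [Finset.sum_eq_single j] at this
  · simp only [if_true, @eq_comm _ g] at this
    rw [this, Matrix.smul_apply, Matrix.one_apply, smul_eq_mul, mul_ite, mul_one, mul_zero]
  · intro k _ hk
    simp [hk]
  · simp

end Kernels

/-! ### Colour automorphisms are group automorphisms -/

section Automorphisms

variable {G : Type*} [AddCommGroup G] [DecidableEq G] {Sp : Finset G} {l : Equiv.Perm G}

theorem IsColourAutomorphism.map_zero (hl : IsColourAutomorphism Sp l)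
    (hgen : AddSubgroup.closure (Sp : Set G) = ⊤) : l 0 = 0 := by
  rcases Sp.eq_empty_or_nonempty with h | ⟨h, hh⟩
  · rw [h, Finset.coe_empty, AddSubgroup.closure_empty] at hgen
    have : l 0 ∈ (⊥ : AddSubgroup G) := hgen ▸ AddSubgroup.mem_top _
    exact AddSubgroup.mem_bot.1 this
  · have := hl.2 0 h hh
    rw [zero_add] at this
    exact right_eq_add.1 this

theorem IsColourAutomorphism.map_add (hl : IsColourAutomorphism Sp l)
    (hgen : AddSubgroup.closure (Sp : Set G) = ⊤) (x y : G) : l (x + y) = l x + l y := by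
  have hy : y ∈ AddSubgroup.closure (Sp : Set G) := by rw [hgen]; trivial
  induction hy using AddSubgroup.closure_induction generalizing x with
  | mem y hy => exact hl.2 x y hy
  | zero => rw [hl.map_zero hgen, add_zero, add_zero]
  | add y z _ _ hy hz => rw [← add_assoc, hz, hy, hz y, add_assoc]
  | neg y _ hy =>
    have h1 := hy (x + -y)
    have h2 := hy (-y)
    rw [neg_add_cancel_right] at h1
    rw [neg_add_cancel, hl.map_zero hgen] at h2
    rw [h1, eq_neg_of_add_eq_zero_left h2.symm, add_neg_cancel_right]

end Automorphisms

/-! ### From an isotropic walk to a normalised one -/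

section Conversion

variable {G : Type*} [AddCommGroup G] [DecidableEq G]

theorem IsQuantumWalk.isConvUnitary {n : ℕ} {Sp : Finset G} {A : G → Matrix (Fin n) (Fin n) ℂ}
    (hQ : IsQuantumWalk Sp A) : IsConvUnitary (steps Sp) A :=
  (exists_unitary_iff fun _ => neg_mem_steps).1 hQ.unitary

/-- An isotropic quantum walk, normalised so that the transition matrices sum to the identity. -/
theorem IsIsotropicQW.exists_isoWalk [TwoUniqueSums G] [IsAddTorsionFree G] {Sp : Finset G}
    {A : G → Matrix (Fin 2) (Fin 2) ℂ} (hQ : IsIsotropicQW Sp A) :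
    ∃ (L : Subgroup (Equiv.Perm G)) (_ : DistribMulAction L G) (_ : FaithfulSMul L G) (_ : Finite L)
      (U : L → Matrix (Fin 2) (Fin 2) ℂ), IsoWalk Sp (fun g => (∑ h ∈ steps Sp, A h)ᴴ * A g) U ∧
        ∀ l, Commute (∑ h ∈ steps Sp, A h) (U l) := by
  obtain ⟨hQ, L, U, hL, hproj, hcov, htrans, hmove⟩ := hQ
  have hgen := hQ.generates
  have hzero := fun l : L => (hL l l.2).map_zero hgen
  have hadd := fun l : L => (hL l l.2).map_add hgen
  let inst : DistribMulAction L G :=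
    { smul := fun l x => (l : Equiv.Perm G) x
      one_smul := fun _ => rfl
      mul_smul := fun _ _ _ => rfl
      smul_zero := hzero
      smul_add := hadd }
  have smul_def : ∀ (l : L) (x : G), l • x = (l : Equiv.Perm G) x := fun _ _ => rfl
  have hfaith : FaithfulSMul L G := ⟨fun h => Subtype.ext (Equiv.ext h)⟩
  have hmem : ∀ (l : L), ∀ h ∈ Sp, l • h ∈ Sp := fun l h hh => (hL l l.2).1 h hh
  have hmems : ∀ (l : L), ∀ h ∈ steps Sp, l • h ∈ steps Sp := by
    intro l h hh
    rw [mem_steps, mem_neighbours] at hh ⊢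
    rcases hh with rfl | hh | hh
    · left; exact smul_zero l
    · exact Or.inr (Or.inl (hmem l h hh))
    · right; right; rw [← smul_neg]; exact hmem l _ hh
  -- An element of `L` is additive, so it is determined by its permutation of the finite generating
  -- set.
  have hfin : Finite L := by
    refine Finite.of_injective (fun (l : L) (x : Sp) => (⟨l • x.1, hmem l x.1 x.2⟩ : Sp)) ?_
    intro l l' e
    refine FaithfulSMul.eq_of_smul_eq_smul (α := G) fun x => ?_
    have hx : x ∈ AddSubgroup.closure (Sp : Set G) := by rw [hgen]; trivial
    induction hx using AddSubgroup.closure_induction with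
    | mem x hx => exact congrArg Subtype.val (congrFun e ⟨x, hx⟩)
    | zero => simp
    | add x y _ _ hx hy => rw [smul_add, smul_add, hx, hy]
    | neg x _ hx => rw [smul_neg, smul_neg, hx]
  have hU := fun l => (U l).2
  have hconv := hQ.isConvUnitary
  have hV := hconv.sum_mem
  have hVh : (∑ h ∈ steps Sp, A h)ᴴ ∈ Matrix.unitaryGroup (Fin 2) ℂ := Unitary.star_mem hV
  have hV2 := mul_conjTranspose_self_of_mem hV
  have hback : ∀ {X Y : Matrix (Fin 2) (Fin 2) ℂ},
      (∑ h ∈ steps Sp, A h)ᴴ * X = (∑ h ∈ steps Sp, A h)ᴴ * Y → X = Y := fun {X Y} e => by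
    rw [← one_mul X, ← hV2, Matrix.mul_assoc, e, ← Matrix.mul_assoc, hV2, one_mul]
  have hcovS : ∀ l : L, ∀ h ∈ steps Sp, A (l • h) =
      (U l : Matrix (Fin 2) (Fin 2) ℂ) * A h * (U l : Matrix (Fin 2) (Fin 2) ℂ)ᴴ := hcov
  have hcov' : ∀ (l : L) (h : G), A (l • h) =
      (U l : Matrix (Fin 2) (Fin 2) ℂ) * A h * (U l : Matrix (Fin 2) (Fin 2) ℂ)ᴴ := by
    intro l h
    by_cases hh : h ∈ steps Sp
    · exact hcovS l h hh
    · rw [hQ.eq_zero h hh, hQ.eq_zero (l • h) fun h1 => hh (by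
        have := hmems l⁻¹ _ h1; rwa [inv_smul_smul] at this)]
      simp
  -- Conjugation by `U l` permutes the summands, so the sum commutes with the representation and may
  -- be divided out without losing covariance.
  have hVU : ∀ l : L, (U l : Matrix (Fin 2) (Fin 2) ℂ) * (∑ h ∈ steps Sp, A h) *
      (U l : Matrix (Fin 2) (Fin 2) ℂ)ᴴ = ∑ h ∈ steps Sp, A h := by
    intro l
    rw [Finset.mul_sum, Finset.sum_mul]
    refine Finset.sum_nbij' (fun h => l • h) (fun h => l⁻¹ • h) (hmems l) (hmems l⁻¹) (by simp)
      (by simp) ?_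
    intro h hh
    rw [hcovS l h hh]
  have hcomm : ∀ l, Commute (∑ h ∈ steps Sp, A h) (U l : Matrix (Fin 2) (Fin 2) ℂ) := by
    intro l
    have := congrArg (fun M => M * (U l : Matrix (Fin 2) (Fin 2) ℂ)) (hVU l)
    simp only [Matrix.mul_assoc, conjTranspose_mul_self_of_mem (hU l), mul_one] at this
    exact this.symm
  have hcommH : ∀ l, (∑ h ∈ steps Sp, A h)ᴴ * (U l : Matrix (Fin 2) (Fin 2) ℂ) =
      (U l : Matrix (Fin 2) (Fin 2) ℂ) * (∑ h ∈ steps Sp, A h)ᴴ := by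
    intro l
    have := congrArg Matrix.conjTranspose (hVU l)
    simp only [Matrix.conjTranspose_mul, Matrix.conjTranspose_conjTranspose] at this
    have h2 := congrArg (fun M => M * (U l : Matrix (Fin 2) (Fin 2) ℂ)) this
    simp only [Matrix.mul_assoc, conjTranspose_mul_self_of_mem (hU l), mul_one] at h2
    exact h2.symm
  have hnz : ∀ h ∈ neighbours Sp, A h ≠ 0 := hQ.ne_zero
  obtain ⟨c, hc1, hadj⟩ := exists_adjugate_eq (steps Sp) A hQ.eq_zero hconv (by
    intro h hh
    by_cases h0 : h ∈ neighbours Sp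
    · exact hnz _ (neg_mem_neighbours h0)
    · have : h ∈ steps Sp := by
        by_contra hcon
        exact hh (hQ.eq_zero h hcon)
      rw [(mem_steps.1 this).resolve_right h0] at hh ⊢
      rwa [neg_zero])
  refine ⟨L, inst, hfaith, hfin, fun l => (U l : Matrix (Fin 2) (Fin 2) ℂ), ?_, hcomm⟩
  exact
    { gen := hgen
      zero_notMem := hQ.zero_notMem
      ne_zero := fun h hh e => hnz h hh (hback (e.trans (Matrix.mul_zero _).symm))
      eq_zero := fun h hh => by rw [hQ.eq_zero h hh, Matrix.mul_zero]
      conv := hconv.mul_left hVh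
      adj := normalised_adjugate (fun _ => neg_mem_steps) hconv hc1 hadj
      sum := by rw [← Finset.mul_sum, conjTranspose_mul_self_of_mem hV]
      mem := hmem
      unitary := hU
      proj := fun l l' => by
        obtain ⟨c, -, hc⟩ := hproj l l'
        exact ⟨c, hc⟩
      cov := fun l h => by
        rw [hcov', ← Matrix.mul_assoc, ← Matrix.mul_assoc, hcommH]
        simp only [Matrix.mul_assoc]
      trans := fun h hh h' hh' => by
        -- The order `0` stands for infinite order, shared by all generators of a torsion-free
        -- group. Transitivity on each order is therefore transitivity on all of `Sp`.
        have ho : ∀ x ∈ Sp, addOrderOf x = 0 := fun x hx => by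
          rw [addOrderOf_eq_zero_iff]
          exact not_isOfFinAddOrder_of_isAddTorsionFree (fun e => hQ.zero_notMem (e ▸ hx))
        obtain ⟨l, hl, e⟩ := htrans h hh h' hh' (by rw [ho h hh, ho h' hh'])
        exact ⟨⟨l, hl⟩, e⟩
      inj := fun h hh h' hh' e => by
        have ho : ∀ x ∈ Sp, addOrderOf x = 0 := fun x hx => by
          rw [addOrderOf_eq_zero_iff]
          exact not_isOfFinAddOrder_of_isAddTorsionFree (fun e => hQ.zero_notMem (e ▸ hx))
        have e' := hback e
        by_contra hne
        obtain ⟨l, hl, el⟩ := htrans h hh h' hh' (by rw [ho h hh, ho h' hh'])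
        refine hmove ⟨l, hl⟩ h hh (by rw [el]; exact Ne.symm hne) ?_
        have h1 := hcov' ⟨l, hl⟩ h
        rw [smul_def, el, ← e'] at h1
        have h2 := congrArg (fun M => M * (U ⟨l, hl⟩ : Matrix (Fin 2) (Fin 2) ℂ)) h1
        simp only [Matrix.mul_assoc, conjTranspose_mul_self_of_mem (hU _), mul_one] at h2
        exact h2.symm }

end Conversion

theorem mul_conj_eq {V T X : Matrix (Fin 2) (Fin 2) ℂ} (hT : T ∈ Matrix.unitaryGroup (Fin 2) ℂ) :
    V * (T * X * Tᴴ) = T * ((Tᴴ * V * T) * X) * Tᴴ := by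
  have hT2 := mul_conjTranspose_self_of_mem hT
  calc V * (T * X * Tᴴ) = (T * Tᴴ) * V * (T * X * Tᴴ) := by rw [hT2, one_mul]
    _ = _ := by simp only [Matrix.mul_assoc]

theorem conj_mem_unitaryGroup {V T : Matrix (Fin 2) (Fin 2) ℂ}
    (hT : T ∈ Matrix.unitaryGroup (Fin 2) ℂ) (hV : V ∈ Matrix.unitaryGroup (Fin 2) ℂ) :
    Tᴴ * V * T ∈ Matrix.unitaryGroup (Fin 2) ℂ :=
  mul_mem (mul_mem (Unitary.star_mem hT) hV) hT

theorem norm_eq_one_of_smul_mem {c : ℂ}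
    (h : c • (1 : Matrix (Fin 2) (Fin 2) ℂ) ∈ Matrix.unitaryGroup (Fin 2) ℂ) : ‖c‖ = 1 := by
  have h1 := congrFun (congrFun (mul_conjTranspose_self_of_mem h) 0) 0
  simp [Matrix.mul_apply, Fin.sum_univ_two] at h1
  rw [Complex.mul_conj, Complex.normSq_eq_norm_sq] at h1
  have : ‖c‖ ^ 2 = 1 := by exact_mod_cast h1
  nlinarith [norm_nonneg c]

/-! ### Necessary form of the transition matrices -/

section Forward

theorem IsIsotropicQW.forms {d : ℕ} {Sp : Finset (Fin d → ℤ)}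
    {A : (Fin d → ℤ) → Matrix (Fin 2) (Fin 2) ℂ} (hQ : IsIsotropicQW Sp A) :
    ∃ (L : Subgroup (Equiv.Perm (Fin d → ℤ))) (_ : DistribMulAction L (Fin d → ℤ))
      (_ : FaithfulSMul L (Fin d → ℤ)) (_ : Finite L) (U : L → Matrix (Fin 2) (Fin 2) ℂ)
      (V : Matrix (Fin 2) (Fin 2) ℂ) (A' : (Fin d → ℤ) → Matrix (Fin 2) (Fin 2) ℂ)
      (B : LinearMap.BilinForm ℤ (Fin d → ℤ)), V ∈ Matrix.unitaryGroup (Fin 2) ℂ ∧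
      (∀ g, A g = V * A' g) ∧ IsoWalk Sp A' U ∧ (∀ l, Commute V (U l)) ∧ InvForm L B := by
  have hV := hQ.1.isConvUnitary.sum_mem
  obtain ⟨L, i1, i2, i3, U, W, hcomm⟩ := hQ.exists_isoWalk
  obtain ⟨B, hB⟩ := exists_invForm (Fin d → ℤ) L
  refine ⟨L, i1, i2, i3, U, _, _, B, hV, fun g => ?_, W, hcomm, hB⟩
  rw [← Matrix.mul_assoc, mul_conjTranspose_self_of_mem hV, one_mul]

theorem IsIsotropicQW.form_one {Sp : Finset (Fin 1 → ℤ)}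
    {A : (Fin 1 → ℤ) → Matrix (Fin 2) (Fin 2) ℂ} (hQ : IsIsotropicQW Sp A) :
    ∃ (h₁ : Fin 1 → ℤ) (n m : ℝ) (V W : Matrix (Fin 2) (Fin 2) ℂ),
      AddSubgroup.closure {h₁} = ⊤ ∧ n ^ 2 + m ^ 2 = 1 ∧ n ≠ 0 ∧
      V ∈ Matrix.unitaryGroup (Fin 2) ℂ ∧ W ∈ Matrix.unitaryGroup (Fin 2) ℂ ∧
      (Sp = {h₁} ∨ (Sp = {h₁, -h₁} ∧ Commute V pauliX)) ∧
      A h₁ = W * (V * !![(n : ℂ), 0; 0, 0]) * Wᴴ ∧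
      A (-h₁) = W * (V * !![0, 0; 0, (n : ℂ)]) * Wᴴ ∧
      A 0 = W * (V * !![0, Complex.I * m; Complex.I * m, 0]) * Wᴴ ∧
      ∀ g, g ≠ h₁ → g ≠ -h₁ → g ≠ 0 → A g = 0 := by
  have heq := hQ.1.eq_zero
  obtain ⟨L, i1, i2, i3, U, V, A', B, hV, hA, W, hcomm, hB⟩ := hQ.forms
  obtain ⟨h, T, V', n, m, hT, hV', hX, hcl, hnm, hn, hS, e1, e2, e3, hcase⟩ :=
    W.classification_of_rank_one hB (AddEquiv.refl _)
  refine ⟨h, n, m, (Tᴴ * V * T) * V', T, hcl, hnm, hn, mul_mem (conj_mem_unitaryGroup hT hV) hV', hT,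
    ?_, ?_, ?_, ?_, ?_⟩
  · rcases hcase with h1 | ⟨h1, h2⟩
    · exact Or.inl h1
    · exact Or.inr ⟨h1, (h2 V hcomm).mul_left hX⟩
  · rw [hA, e1, mul_conj_eq hT, ← Matrix.mul_assoc (Tᴴ * V * T)]
  · rw [hA, e2, mul_conj_eq hT, ← Matrix.mul_assoc (Tᴴ * V * T)]
  · rw [hA, e3, mul_conj_eq hT, ← Matrix.mul_assoc (Tᴴ * V * T)]
  · intro g h1 h2 h3
    refine heq g fun hg => ?_
    rcases hS g ((mem_steps.1 hg).resolve_left h3) with h | h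
    exacts [h1 h, h2 h]

theorem IsIsotropicQW.form_two {Sp : Finset (Fin 2 → ℤ)}
    {A : (Fin 2 → ℤ) → Matrix (Fin 2) (Fin 2) ℂ} (hQ : IsIsotropicQW Sp A) :
    ∃ (h₁ h₂ : Fin 2 → ℤ) (V W : Matrix (Fin 2) (Fin 2) ℂ),
      AddSubgroup.closure {h₁, h₂} = ⊤ ∧
      V ∈ Matrix.unitaryGroup (Fin 2) ℂ ∧ W ∈ Matrix.unitaryGroup (Fin 2) ℂ ∧
      ((Sp = {h₁, h₂} ∧ Commute V pauliX) ∨ (Sp = {h₁, -h₂} ∧ Commute V pauliZ) ∨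
        (Sp = {h₁, h₂, -h₁, -h₂} ∧ ∃ c : ℂ, ‖c‖ = 1 ∧ V = c • 1)) ∧
      A h₁ = W * ((1 / 2 : ℂ) • (V * !![1, 0; 1, 0])) * Wᴴ ∧
      A (-h₁) = W * ((1 / 2 : ℂ) • (V * !![0, -1; 0, 1])) * Wᴴ ∧
      A h₂ = W * ((1 / 2 : ℂ) • (V * !![0, 1; 0, 1])) * Wᴴ ∧
      A (-h₂) = W * ((1 / 2 : ℂ) • (V * !![1, 0; -1, 0])) * Wᴴ ∧
      A 0 = 0 ∧ ∀ g, g ≠ h₁ → g ≠ -h₁ → g ≠ h₂ → g ≠ -h₂ → A g = 0 := by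
  have heq := hQ.1.eq_zero
  obtain ⟨L, i1, i2, i3, U, V, A', B, hV, hA, W, hcomm, hB⟩ := hQ.forms
  obtain ⟨h₁, h₂, T, hT, hcl, ⟨e1, e2, e3, e4, e0⟩, hS, hcase⟩ :=
    W.classification_of_rank_two hB (by simp)
  have hVT := conj_mem_unitaryGroup hT hV
  refine ⟨h₁, h₂, Tᴴ * V * T, T, hcl, hVT, hT, ?_, ?_, ?_, ?_, ?_, ?_, ?_⟩
  · rcases hcase with ⟨h1, h2⟩ | ⟨h1, h2⟩ | ⟨h1, h2⟩
    · exact Or.inl ⟨h1, h2 V hcomm⟩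
    · exact Or.inr (Or.inl ⟨h1, h2 V hcomm⟩)
    · obtain ⟨c, hc⟩ := h2 V hcomm
      exact Or.inr (Or.inr ⟨h1, c, norm_eq_one_of_smul_mem (hc ▸ hVT), hc⟩)
  · rw [hA, e1, mul_conj_eq hT, Matrix.mul_smul]
  · rw [hA, e2, mul_conj_eq hT, Matrix.mul_smul]
  · rw [hA, e3, mul_conj_eq hT, Matrix.mul_smul]
  · rw [hA, e4, mul_conj_eq hT, Matrix.mul_smul]
  · rw [hA, e0, Matrix.mul_zero]
  · intro g h1 h2 h3 h4
    by_cases h0 : g = 0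
    · rw [h0, hA, e0, Matrix.mul_zero]
    refine heq g fun hg => ?_
    rcases hS g ((mem_steps.1 hg).resolve_left h0) with h | h | h | h
    exacts [h1 h, h2 h, h3 h, h4 h]

theorem IsIsotropicQW.form_three {Sp : Finset (Fin 3 → ℤ)}
    {A : (Fin 3 → ℤ) → Matrix (Fin 2) (Fin 2) ℂ} (hQ : IsIsotropicQW Sp A) :
    ∃ (h : Fin 4 → Fin 3 → ℤ) (B : (Fin 3 → ℤ) → Matrix (Fin 2) (Fin 2) ℂ)
      (W : Matrix (Fin 2) (Fin 2) ℂ) (c : ℂ), IsBccLabelling Sp h ∧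
      (IsWeylWalk etaPlus etaMinus h B ∨ IsWeylWalk etaMinus etaPlus h B) ∧
      W ∈ Matrix.unitaryGroup (Fin 2) ℂ ∧ ‖c‖ = 1 ∧ ∀ g, A g = c • (W * B g * Wᴴ) := by
  have hgen := hQ.1.generates
  obtain ⟨L, i1, i2, i3, U, V, A', B, hV, hA, W, hcomm, hB⟩ := hQ.forms
  obtain ⟨h, T, η, hη, hT, hsum, hSp, hpn, hz, hV'⟩ := W.classification_of_rank_three hB (by simp)
  obtain ⟨c, rfl⟩ := hV' V hcomm
  have hT1 := conjTranspose_mul_self_of_mem hT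
  have back : ∀ X, Tᴴ * (T * X * Tᴴ) * T = X := fun X => by
    simp only [Matrix.mul_assoc, hT1, mul_one]
    rw [← Matrix.mul_assoc, hT1, one_mul]
  have hstar : star etaPlus = etaMinus ∧ star etaMinus = etaPlus := by
    constructor <;> apply Complex.ext <;> simp [etaPlus, etaMinus]
  have hWeyl : IsWeylWalk η (star η) h fun g => Tᴴ * A' g * T := by
    refine ⟨fun i => ⟨?_, ?_⟩, fun g hg => ?_⟩
    · simp only [(hpn i).1, back]
    · simp only [(hpn i).2, back]
    · simp [hz g hg]
  refine ⟨h, fun g => Tᴴ * A' g * T, T, c, ⟨?_, hsum, hSp⟩, ?_, hT, norm_eq_one_of_smul_mem hV, ?_⟩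
  · rw [← hgen, hSp]; simp
  · rcases hη with rfl | rfl
    · left; rwa [hstar.1] at hWeyl
    · right; rwa [hstar.2] at hWeyl
  · intro g
    rw [hA, conj_conjTranspose_conj hT, Matrix.smul_mul, one_mul]

end Forward

/-! ### Criteria for isotropy -/

section Sufficient

variable {G : Type*} [AddCommGroup G] [DecidableEq G] {n : ℕ} {Sp : Finset G}
  {A : G → Matrix (Fin n) (Fin n) ℂ}

theorem IsConvUnitary.conj {T : Finset G} {W : Matrix (Fin n) (Fin n) ℂ}
    (hW : W ∈ Matrix.unitaryGroup (Fin n) ℂ) (hA : IsConvUnitary T A) :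
    IsConvUnitary T fun g => W * A g * Wᴴ := by
  intro φ
  have hW1 := conjTranspose_mul_self_of_mem hW
  have e : ∀ h h', φ (h' - h) • ((W * A h * Wᴴ)ᴴ * (W * A h' * Wᴴ)) =
      W * (φ (h' - h) • ((A h)ᴴ * A h')) * Wᴴ := by
    intro h h'
    simp only [Matrix.conjTranspose_mul, Matrix.conjTranspose_conjTranspose, Matrix.mul_smul,
      Matrix.smul_mul, Matrix.mul_assoc]
    rw [← Matrix.mul_assoc Wᴴ W, hW1, Matrix.one_mul]
  calc _ = W * (∑ h ∈ T, ∑ h' ∈ T, φ (h' - h) • ((A h)ᴴ * A h')) * Wᴴ := by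
        simp only [e, Matrix.mul_sum, Matrix.sum_mul]
    _ = _ := by
        rw [hA, Matrix.mul_smul, Matrix.smul_mul, Matrix.mul_one, mul_conjTranspose_self_of_mem hW]

theorem IsIsotropicQW.conj {W : Matrix (Fin n) (Fin n) ℂ}
    (hW : W ∈ Matrix.unitaryGroup (Fin n) ℂ) (hA : IsIsotropicQW Sp A) :
    IsIsotropicQW Sp fun g => W * A g * Wᴴ := by
  have hW1 := conjTranspose_mul_self_of_mem hW
  have back : ∀ X, Wᴴ * (W * X * Wᴴ) * W = X := fun X => by
    simp only [Matrix.mul_assoc, hW1, Matrix.mul_one]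
    rw [← Matrix.mul_assoc, hW1, Matrix.one_mul]
  have hmul : ∀ X Y : Matrix (Fin n) (Fin n) ℂ, W * X * Wᴴ * (W * Y * Wᴴ) = W * (X * Y) * Wᴴ := by
    intro X Y
    simp only [Matrix.mul_assoc]
    rw [← Matrix.mul_assoc Wᴴ W, hW1, Matrix.one_mul]
  obtain ⟨hQ, L, U, hL, hproj, hcov, htrans, hmove⟩ := hA
  refine ⟨⟨hQ.generates, hQ.zero_notMem, fun h hh h0 => hQ.ne_zero h hh ?_, fun h hh => ?_,
    (exists_unitary_iff fun _ => neg_mem_steps).2 (hQ.isConvUnitary.conj hW)⟩,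
    L, fun l => ⟨W * U l * Wᴴ, mul_mem (mul_mem hW (U l).2) (Unitary.star_mem hW)⟩, hL,
    fun l l' => ?_, fun l h hh => ?_, htrans, fun l h hh hne hc => hmove l h hh hne ?_⟩
  · rw [← back (A h), h0, Matrix.mul_zero, Matrix.zero_mul]
  · rw [hQ.eq_zero h hh, Matrix.mul_zero, Matrix.zero_mul]
  · obtain ⟨c, hc, e⟩ := hproj l l'
    exact ⟨c, hc, by simp only [hmul, e, Matrix.mul_smul, Matrix.smul_mul]⟩
  · simp only [hcov l h hh, Matrix.conjTranspose_mul, Matrix.conjTranspose_conjTranspose]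
    simp only [Matrix.mul_assoc]
    rw [← Matrix.mul_assoc Wᴴ W, hW1, Matrix.one_mul, ← Matrix.mul_assoc Wᴴ W, hW1, Matrix.one_mul]
  · have := hc.eq
    simp only [hmul] at this
    rw [commute_iff_eq, ← back (_ * A h), this, back]

theorem map_neg_of_map_add {l : Equiv.Perm G} (h : ∀ x y, l (x + y) = l x + l y) (x : G) :
    l (-x) = -l x :=
  map_neg (AddMonoidHom.mk' l h) x

/-- The pairs of an automorphism of the group that permutes the colours and a change of basis of the
coin that together leave a walk invariant. -/
def covarianceGroup (Sp : Finset G) (A : G → Matrix (Fin n) (Fin n) ℂ) :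
    Subgroup (Equiv.Perm G × Matrix.unitaryGroup (Fin n) ℂ) where
  carrier := {x | (∀ g h, x.1 (g + h) = x.1 g + x.1 h) ∧ (∀ h, x.1 h ∈ Sp ↔ h ∈ Sp) ∧
    ∀ h ∈ steps Sp,
      A (x.1 h) = (x.2 : Matrix (Fin n) (Fin n) ℂ) * A h * (x.2 : Matrix (Fin n) (Fin n) ℂ)ᴴ}
  one_mem' := ⟨fun _ _ => rfl, fun _ => Iff.rfl, fun h _ => by simp⟩
  mul_mem' := by
    rintro ⟨a, P⟩ ⟨b, Q⟩ ⟨h0, h1, h2⟩ ⟨h0', h3, h4⟩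
    refine ⟨fun g h => ?_, fun h => (h1 _).trans (h3 h), fun h hh => ?_⟩
    · exact (congrArg a (h0' g h)).trans (h0 _ _)
    have hb : b h ∈ steps Sp := by
      rw [mem_steps, mem_neighbours] at hh ⊢
      rcases hh with rfl | hh | hh
      · exact Or.inl (map_zero (AddMonoidHom.mk' b h0'))
      · exact Or.inr (Or.inl ((h3 h).2 hh))
      · exact Or.inr (Or.inr (by rw [← map_neg_of_map_add h0']; exact (h3 _).2 hh))
    simp only [Prod.mk_mul_mk, Equiv.Perm.mul_apply, Submonoid.coe_mul, Matrix.conjTranspose_mul] at *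
    rw [h2 _ hb, h4 h hh]
    simp only [Matrix.mul_assoc]
  inv_mem' := by
    rintro ⟨a, P⟩ ⟨h0, h1, h2⟩
    have h0' : ∀ x y, a⁻¹ (x + y) = a⁻¹ x + a⁻¹ y := fun x y => by
      apply a.injective
      change a _ = a _
      rw [h0]
      simp
    have h3 : ∀ h, a⁻¹ h ∈ Sp ↔ h ∈ Sp := fun h => by
      rw [← h1]; simp
    refine ⟨h0', h3, fun h hh => ?_⟩
    have hb : a⁻¹ h ∈ steps Sp := by
      rw [mem_steps, mem_neighbours] at hh ⊢
      rcases hh with rfl | hh | hh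
      · exact Or.inl (map_zero (AddMonoidHom.mk' _ h0'))
      · exact Or.inr (Or.inl ((h3 h).2 hh))
      · exact Or.inr (Or.inr (by rw [← map_neg_of_map_add h0']; exact (h3 _).2 hh))
    have := h2 _ hb
    have hP1 := conjTranspose_mul_self_of_mem P.2
    change A (a (a.symm h)) = _ at this
    rw [Equiv.apply_symm_apply] at this
    rw [this]
    change A (a.symm h) = (P : Matrix (Fin n) (Fin n) ℂ)ᴴ * (P * A (a.symm h) * (P : Matrix (Fin n) (Fin n) ℂ)ᴴ) *
      ((P : Matrix (Fin n) (Fin n) ℂ)ᴴ)ᴴ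
    simp only [Matrix.conjTranspose_conjTranspose, Matrix.mul_assoc, hP1, Matrix.mul_one]
    rw [← Matrix.mul_assoc, hP1, Matrix.one_mul]

theorem mem_covarianceGroup {a : G ≃+ G} {P : Matrix.unitaryGroup (Fin n) ℂ}
    (hcol : ∀ h ∈ Sp, a h ∈ Sp)
    (h0 : A 0 = (P : Matrix (Fin n) (Fin n) ℂ) * A 0 * (P : Matrix (Fin n) (Fin n) ℂ)ᴴ)
    (hA : ∀ h ∈ Sp, A (a h) = (P : Matrix (Fin n) (Fin n) ℂ) * A h * (P : Matrix (Fin n) (Fin n) ℂ)ᴴ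
      ∧ A (-a h) = (P : Matrix (Fin n) (Fin n) ℂ) * A (-h) * (P : Matrix (Fin n) (Fin n) ℂ)ᴴ) :
    (a.toEquiv, P) ∈ covarianceGroup Sp A := by
  refine ⟨map_add a, fun h => ⟨fun hh => ?_, hcol h⟩, fun h hh => ?_⟩
  · have e : Sp.image a = Sp := Finset.eq_of_subset_of_card_le
      (Finset.image_subset_iff.2 hcol) (Finset.card_image_of_injective _ a.injective).ge
    change a h ∈ Sp at hh
    rw [← e, Finset.mem_image] at hh
    obtain ⟨x, hx, hxh⟩ := hh
    exact a.injective hxh ▸ hx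
  · change A (a h) = _
    rcases mem_steps.1 hh with rfl | hh
    · rw [map_zero]; exact h0
    · rcases mem_neighbours.1 hh with hh | hh
      · exact (hA h hh).1
      · simpa using (hA _ hh).2

/-- A walk is isotropic if enough changes of basis cover automorphisms of its Cayley graph. -/
theorem isIsotropic_of_subgroup {K : Subgroup (Equiv.Perm G × Matrix.unitaryGroup (Fin n) ℂ)}
    (hK : K ≤ covarianceGroup Sp A)
    (hone : ∀ x ∈ K, x.1 = 1 → ∃ c : ℂ, ‖c‖ = 1 ∧ (x.2 : Matrix (Fin n) (Fin n) ℂ) = c • 1)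
    (htrans : ∀ h ∈ Sp, ∀ h' ∈ Sp, ∃ x ∈ K, x.1 h = h') (hinj : Set.InjOn A Sp) :
    IsIsotropic Sp A := by
  let f : Equiv.Perm G × Matrix.unitaryGroup (Fin n) ℂ →* Equiv.Perm G :=
    MonoidHom.fst _ _
  have hf : ∀ x h, f x h = x.1 h := fun _ _ => rfl
  have hex : ∀ l : K.map f, ∃ x ∈ K, f x = l := fun l => Subgroup.mem_map.1 l.2
  -- A set-theoretic section of the projection to permutations. It is multiplicative up to elements
  -- of `K` over the identity, which are phases by `hone`.
  choose s hs hsl using hex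
  have hsl' : ∀ (l : K.map f) h, (l : Equiv.Perm G) h = (s l).1 h := fun l h => by rw [← hsl, hf]
  have hmem : ∀ (l : K.map f) {h}, h ∈ Sp → h ∈ steps Sp := fun l h hh =>
    mem_steps.2 (Or.inr (mem_neighbours.2 (Or.inl hh)))
  refine ⟨K.map f, fun l => (s l).2, fun l hl => ⟨fun h hh => ?_, fun g h _ => ?_⟩, fun l l' => ?_,
    fun l h hh => ?_, fun h hh h' hh' _ => ?_, fun l h hh hne hc => hne ?_⟩
  · obtain ⟨x, hx, rfl⟩ := hl
    exact ((hK hx).2.1 h).2 hh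
  · obtain ⟨x, hx, rfl⟩ := hl
    exact (hK hx).1 g h
  · obtain ⟨c, hc, e⟩ := hone (s (l * l') * (s l * s l')⁻¹)
      (mul_mem (hs _) (inv_mem (mul_mem (hs _) (hs _)))) (by
        rw [Prod.fst_mul, Prod.fst_inv, mul_inv_eq_one]
        ext h
        rw [← hsl', Prod.fst_mul, Equiv.Perm.mul_apply, ← hsl', ← hsl']
        rfl)
    refine ⟨c, hc, ?_⟩
    have : (s (l * l')).2 = (s (l * l') * (s l * s l')⁻¹).2 * ((s l).2 * (s l').2) := by
      simp [mul_assoc]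
    change ((s (l * l')).2 : Matrix (Fin n) (Fin n) ℂ) = _
    rw [this, Submonoid.coe_mul, e, Matrix.smul_mul, Matrix.one_mul, Submonoid.coe_mul]
  · rw [hsl']
    exact (hK (hs l)).2.2 h hh
  · obtain ⟨x, hx, e⟩ := htrans h hh h' hh'
    exact ⟨f x, Subgroup.mem_map_of_mem _ hx, e⟩
  -- If the change of basis commuted with `A h`, covariance would give `A (l h) = A h`, and
  -- injectivity would leave `h` unmoved.
  · have h1 := (hK (hs l)).2.2 h (hmem l hh)
    rw [hc.eq, Matrix.mul_assoc, mul_conjTranspose_self_of_mem (s l).2.2, Matrix.mul_one] at h1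
    rw [hsl']
    exact hinj (((hK (hs l)).2.1 h).2 hh) hh h1

end Sufficient

/-! ### Walks given by explicit families of steps -/

section Families

variable {G : Type*} [AddCommGroup G] [DecidableEq G] {n : ℕ} {Sp : Finset G}
  {A : G → Matrix (Fin n) (Fin n) ℂ}

theorem symbol_image {k : ℕ} {h : Fin k → G} (hinj : Function.Injective h) (i j : Fin n) :
    symbol (Finset.univ.image h) A i j = ∑ q, A (h q) i j • AddMonoidAlgebra.single (h q) (1 : ℂ) := by
  simp only [symbol, Matrix.of_apply]
  rw [Finset.sum_image fun _ _ _ _ e => hinj e]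
  simp

theorem symbolAdj_image {k : ℕ} {h : Fin k → G} (hinj : Function.Injective h) (i j : Fin n) :
    symbolAdj (symbol (Finset.univ.image h) A) i j =
      ∑ q, star (A (h q) j i) • AddMonoidAlgebra.single (-h q) (1 : ℂ) := by
  rw [symbolAdj, Matrix.transpose_apply, Matrix.map_apply]
  simp only [symbol, Matrix.of_apply]
  rw [Finset.sum_image fun _ _ _ _ e => hinj e, map_sum]
  simp only [reflect_single]
  simp

theorem isQuantumWalk_of_family {k : ℕ} {h : Fin (k + 1) → G} (hinj : Function.Injective h)
    (h0 : h 0 = 0) (hgen : AddSubgroup.closure (Sp : Set G) = ⊤)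
    (hnb : ∀ x, x ∈ neighbours Sp ↔ ∃ i : Fin k, x = h i.succ) (hne : ∀ i : Fin k, A (h i.succ) ≠ 0)
    (hz : ∀ g, (∀ i, g ≠ h i) → A g = 0) (hU : IsConvUnitary (Finset.univ.image h) A) :
    IsQuantumWalk Sp A := by
  have hst : Finset.univ.image h = steps Sp := by
    ext x
    rw [mem_steps, hnb, Finset.mem_image]
    constructor
    · rintro ⟨i, -, rfl⟩
      rcases Fin.eq_zero_or_eq_succ i with rfl | ⟨j, rfl⟩
      exacts [Or.inl h0, Or.inr ⟨j, rfl⟩]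
    · rintro (rfl | ⟨i, rfl⟩)
      exacts [⟨0, Finset.mem_univ _, h0⟩, ⟨_, Finset.mem_univ _, rfl⟩]
  refine ⟨hgen, fun hmem => ?_, fun x hx => ?_, fun x hx => hz x fun i hi => hx ?_,
    (exists_unitary_iff fun _ => neg_mem_steps).2 (hst ▸ hU)⟩
  · obtain ⟨i, hi⟩ := (hnb 0).1 (mem_neighbours.2 (Or.inl hmem))
    exact (Fin.succ_ne_zero i) (hinj (hi.symm.trans h0.symm))
  · obtain ⟨i, rfl⟩ := (hnb x).1 hx
    exact hne i
  · rw [← hst, hi]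
    exact Finset.mem_image_of_mem _ (Finset.mem_univ _)

theorem mem_covarianceGroup_of_commute {V P : Matrix (Fin n) (Fin n) ℂ}
    (hP : P ∈ Matrix.unitaryGroup (Fin n) ℂ) (hV : Commute V P) {a : G ≃+ G}
    (hcol : ∀ h ∈ Sp, a h ∈ Sp) (h0 : A 0 = P * A 0 * Pᴴ)
    (hA : ∀ h ∈ Sp, A (a h) = P * A h * Pᴴ ∧ A (-a h) = P * A (-h) * Pᴴ) :
    ((a.toEquiv, ⟨P, hP⟩) : Equiv.Perm G × _) ∈ covarianceGroup Sp fun g => V * A g := by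
  have key : ∀ X, P * (V * X) * Pᴴ = V * (P * X * Pᴴ) := fun X => by
    rw [← Matrix.mul_assoc P, ← hV.eq]
    simp only [Matrix.mul_assoc]
  refine mem_covarianceGroup hcol ?_ fun h hh => ⟨?_, ?_⟩
  · change V * A 0 = P * (V * A 0) * Pᴴ
    rw [key, ← h0]
  · change V * A (a h) = P * (V * A h) * Pᴴ
    rw [key, (hA h hh).1]
  · change V * A (-a h) = P * (V * A (-h)) * Pᴴ
    rw [key, (hA h hh).2]

/-- `P` commutes with the matrix unit `Xᴴ * Y` and its adjoint, which generate all `2 × 2` matrices.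
-/
theorem eq_smul_one_of_conj {P X Y : Matrix (Fin 2) (Fin 2) ℂ}
    (hP : P ∈ Matrix.unitaryGroup (Fin 2) ℂ) (hX : X = P * X * Pᴴ) (hY : Y = P * Y * Pᴴ) {k : ℂ}
    (hk : k ≠ 0) (hXY : Xᴴ * Y = !![0, k; 0, 0]) : ∃ c : ℂ, ‖c‖ = 1 ∧ P = c • 1 := by
  have hP1 := conjTranspose_mul_self_of_mem hP
  have comm : ∀ Z, Z = P * Z * Pᴴ → P * Z = Z * P := fun Z hZ => by
    conv_rhs => rw [hZ]
    rw [Matrix.mul_assoc, hP1, Matrix.mul_one]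
  have h1 : Xᴴ * Y = P * (Xᴴ * Y) * Pᴴ := by
    conv_lhs => rw [hX, hY]
    simp only [Matrix.conjTranspose_mul, Matrix.conjTranspose_conjTranspose, Matrix.mul_assoc]
    rw [← Matrix.mul_assoc Pᴴ P, hP1, Matrix.one_mul]
  have h2 : (Xᴴ * Y)ᴴ = P * (Xᴴ * Y)ᴴ * Pᴴ := by
    conv_lhs => rw [h1]
    simp only [Matrix.conjTranspose_mul, Matrix.conjTranspose_conjTranspose, Matrix.mul_assoc]
  replace h1 := comm _ h1
  replace h2 := comm _ h2
  rw [hXY] at h1 h2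
  have e1 := congrFun (congrFun h1 0) 1
  have e2 := congrFun (congrFun h1 1) 1
  have e3 := congrFun (congrFun h2 0) 0
  simp [Matrix.mul_apply, Fin.sum_univ_two, hk, Matrix.conjTranspose_apply] at e1 e2 e3
  have e : P = P 0 0 • 1 := by
    ext i j
    fin_cases i <;> fin_cases j <;> simp [e2, e3]
    exact mul_right_cancel₀ hk (by rw [e1, mul_comm])
  refine ⟨P 0 0, norm_eq_one_of_smul_mem (e ▸ hP), e⟩

/-- The full covariance group serves as `K`: a matrix unit among the products of transition matrices
forces every change of basis over the identity to be a phase. Transitivity need only be known from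
one base generator. -/
theorem isIsotropic_of_irreducible {A : G → Matrix (Fin 2) (Fin 2) ℂ} {p q h₀ : G} {k : ℂ}
    (hp : p ∈ steps Sp) (hq : q ∈ steps Sp) (hk : k ≠ 0) (hpq : (A p)ᴴ * A q = !![0, k; 0, 0])
    (htrans : ∀ h ∈ Sp, ∃ x ∈ covarianceGroup Sp A, x.1 h₀ = h) (hinj : Set.InjOn A Sp) :
    IsIsotropic Sp A := by
  refine isIsotropic_of_subgroup le_rfl (fun x hx h1 => ?_) (fun h hh h' hh' => ?_) hinj
  · have e := hx.2.2
    simp only [h1, Equiv.Perm.one_apply] at e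
    exact eq_smul_one_of_conj x.2.2 (e p hp) (e q hq) hk hpq
  · obtain ⟨x, hx, rfl⟩ := htrans h hh
    obtain ⟨y, hy, rfl⟩ := htrans h' hh'
    exact ⟨y * x⁻¹, mul_mem hy (inv_mem hx), by simp⟩

theorem exists_addEquiv_of_bases [Module.Finite ℤ G] {d : ℕ} {h k : Fin d → G}
    (hh : AddSubgroup.closure (Set.range h) = ⊤) (hk : AddSubgroup.closure (Set.range k) = ⊤)
    (hr : Module.finrank ℤ G = d) : ∃ a : G ≃+ G, ∀ i, a (h i) = k i := by
  obtain ⟨φ, hφ⟩ := exists_coordinates h hh hr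
  obtain ⟨ψ, hψ⟩ := exists_coordinates k hk hr
  exact ⟨φ.trans ψ.symm, fun i => by simp [hφ, ← hψ]⟩

theorem conj_mul_cancel {V W X Y : Matrix (Fin n) (Fin n) ℂ}
    (hV : V ∈ Matrix.unitaryGroup (Fin n) ℂ) (hW : W ∈ Matrix.unitaryGroup (Fin n) ℂ)
    (h : W * (V * X) * Wᴴ = W * (V * Y) * Wᴴ) : X = Y := by
  have key : ∀ X, Vᴴ * (Wᴴ * (W * (V * X) * Wᴴ) * W) = X := fun X => by
    simp only [Matrix.mul_assoc, conjTranspose_mul_self_of_mem hW, Matrix.mul_one]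
    rw [← Matrix.mul_assoc Wᴴ, conjTranspose_mul_self_of_mem hW, Matrix.one_mul,
      ← Matrix.mul_assoc, conjTranspose_mul_self_of_mem hV, Matrix.one_mul]
  rw [← key X, h, key]

/-- Undoing a change of basis and a left multiplication in a family of transition matrices. -/
theorem exists_eq_conj_mul {V W : Matrix (Fin n) (Fin n) ℂ}
    (hV : V ∈ Matrix.unitaryGroup (Fin n) ℂ) (hW : W ∈ Matrix.unitaryGroup (Fin n) ℂ)
    (A : G → Matrix (Fin n) (Fin n) ℂ) :
    ∃ M : G → Matrix (Fin n) (Fin n) ℂ, A = fun g => W * (V * M g) * Wᴴ := by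
  refine ⟨fun g => Vᴴ * (Wᴴ * A g * W), funext fun g => ?_⟩
  rw [← Matrix.mul_assoc V, mul_conjTranspose_self_of_mem hV, Matrix.one_mul]
  simp only [Matrix.mul_assoc, mul_conjTranspose_self_of_mem hW, Matrix.mul_one]
  rw [← Matrix.mul_assoc, mul_conjTranspose_self_of_mem hW, Matrix.one_mul]

end Families

/-! ### Sufficiency in rank one -/

section RankOne

theorem isConvUnitary_of_rank_one {G : Type*} [AddCommGroup G] [DecidableEq G]
    {M : G → Matrix (Fin 2) (Fin 2) ℂ} {h₁ : G} {n m : ℝ}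
    (hinj : Function.Injective ![0, h₁, -h₁]) (hnm : n ^ 2 + m ^ 2 = 1)
    (e1 : M h₁ = !![(n : ℂ), 0; 0, 0]) (e2 : M (-h₁) = !![0, 0; 0, (n : ℂ)])
    (e3 : M 0 = !![0, Complex.I * m; Complex.I * m, 0]) :
    IsConvUnitary (Finset.univ.image ![0, h₁, -h₁]) M := by
  rw [isConvUnitary_iff]
  have hnm' : (n : ℂ) ^ 2 + (m : ℂ) ^ 2 = 1 := by exact_mod_cast hnm
  ext1 i j
  rw [Matrix.mul_apply]
  simp only [symbol_image hinj, symbolAdj_image hinj, Fin.sum_univ_succ, Fin.sum_univ_zero]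
  fin_cases i <;> fin_cases j <;> simp [e1, e2, e3, AddMonoidAlgebra.single_mul_single]
  · rw [← sub_eq_add_neg, ← AddMonoidAlgebra.single_sub, AddMonoidAlgebra.one_def]
    congr 1
    linear_combination hnm' - (m : ℂ) ^ 2 * Complex.I_sq
  · rw [mul_comm, add_neg_cancel]
  · rw [mul_comm, neg_add_cancel]
  · rw [add_comm, ← sub_eq_add_neg, ← AddMonoidAlgebra.single_sub, AddMonoidAlgebra.one_def]
    congr 1
    linear_combination hnm' - (m : ℂ) ^ 2 * Complex.I_sq

theorem isIsotropicQW_of_rank_one {Sp : Finset (Fin 1 → ℤ)}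
    {M : (Fin 1 → ℤ) → Matrix (Fin 2) (Fin 2) ℂ} {V : Matrix (Fin 2) (Fin 2) ℂ}
    {h₁ : Fin 1 → ℤ} {n m : ℝ} (hV : V ∈ Matrix.unitaryGroup (Fin 2) ℂ)
    (hcl : AddSubgroup.closure {h₁} = ⊤) (hnm : n ^ 2 + m ^ 2 = 1) (hn : n ≠ 0)
    (hSp : Sp = {h₁} ∨ (Sp = {h₁, -h₁} ∧ Commute V pauliX))
    (e1 : M h₁ = !![(n : ℂ), 0; 0, 0]) (e2 : M (-h₁) = !![0, 0; 0, (n : ℂ)])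
    (e3 : M 0 = !![0, Complex.I * m; Complex.I * m, 0])
    (hz : ∀ g, g ≠ h₁ → g ≠ -h₁ → g ≠ 0 → M g = 0) :
    IsIsotropicQW Sp fun g => V * M g := by
  have hV1 := conjTranspose_mul_self_of_mem hV
  have hA0 : ∀ X Y, V * X = V * Y → X = Y := fun X Y h => by
    rw [← Matrix.one_mul X, ← hV1, Matrix.mul_assoc, h, ← Matrix.mul_assoc, hV1, Matrix.one_mul]
  obtain ⟨φ, hφ⟩ := exists_coordinates ![h₁] (by simpa using hcl) (by simp)
  replace hφ := hφ 0
  simp only [Matrix.cons_val_zero] at hφ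
  have hinj : Function.Injective ![0, h₁, -h₁] := by
    refine Function.Injective.of_comp (f := φ) ?_
    have : φ ∘ ![0, h₁, -h₁] = ![0, Pi.single 0 1, -Pi.single 0 1] := by
      ext1 i; fin_cases i <;> simp [hφ]
    rw [this]
    decide
  have hnb : ∀ x, x ∈ neighbours Sp ↔ x = h₁ ∨ x = -h₁ := by
    intro x
    rw [mem_neighbours]
    rcases hSp with rfl | ⟨rfl, -⟩
    · simp only [Finset.mem_singleton, neg_eq_iff_eq_neg]
    · simp only [Finset.mem_insert, Finset.mem_singleton, neg_eq_iff_eq_neg, neg_neg]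
      tauto
  have hgen : AddSubgroup.closure (Sp : Set (Fin 1 → ℤ)) = ⊤ := by
    rw [eq_top_iff, ← hcl]
    refine AddSubgroup.closure_mono ?_
    rcases hSp with rfl | ⟨rfl, -⟩ <;> simp
  have hne : M h₁ ≠ M (-h₁) := fun h => by
    have := congrFun (congrFun h 0) 0
    simp [e1, e2, hn] at this
  refine ⟨isQuantumWalk_of_family hinj rfl hgen (fun x => ?_) (fun i h0 => ?_) (fun g hg => ?_)
    ((isConvUnitary_of_rank_one hinj hnm e1 e2 e3).mul_left hV), ?_⟩
  · rw [hnb]; simp [Fin.exists_fin_succ]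
  · replace h0 := hA0 _ 0 (h0.trans (Matrix.mul_zero V).symm)
    have h1 := congrFun (congrFun h0 0) 0
    have h2 := congrFun (congrFun h0 1) 1
    fin_cases i <;> simp [e1, e2, hn] at h1 h2
  · rw [hz g (hg 1) (hg 2) (hg 0), Matrix.mul_zero]
  -- The full covariance group may contain nonscalar matrices over the identity, so a small subgroup
  -- is used: the trivial one for a single generator, and the one generated by inversion with
  -- `pauliX` for two.
  · rcases hSp with rfl | ⟨rfl, hX⟩
    · refine isIsotropic_of_subgroup (K := ⊥) bot_le (fun x hx _ => ⟨1, by simp, ?_⟩)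
        (fun h hh h' hh' => ⟨1, one_mem _, ?_⟩) ?_
      · rw [Subgroup.mem_bot.1 hx]; simp
      · rw [Finset.mem_singleton.1 hh, Finset.mem_singleton.1 hh']; rfl
      · simp
    · set x : Equiv.Perm (Fin 1 → ℤ) × Matrix.unitaryGroup (Fin 2) ℂ :=
        ((AddEquiv.neg (Fin 1 → ℤ)).toEquiv, ⟨pauliX, pauliX_mem⟩) with hx
      have hmem : x ∈ covarianceGroup {h₁, -h₁} fun g => V * M g := by
        refine mem_covarianceGroup_of_commute pauliX_mem hX (by simp) ?_ ?_
        · rw [e3, pauliX_conjTranspose]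
          ext i j
          fin_cases i <;> fin_cases j <;> simp [pauliX, Matrix.mul_apply, Fin.sum_univ_two]
        · intro h hh
          simp only [Finset.mem_insert, Finset.mem_singleton] at hh
          rcases hh with rfl | rfl <;>
          · simp only [AddEquiv.neg_apply, neg_neg, e1, e2, pauliX_conjTranspose]
            constructor <;> ext i j <;> fin_cases i <;> fin_cases j <;>
              simp [pauliX, Matrix.mul_apply, Fin.sum_univ_two]
      have hxx : x ^ 2 = 1 := by
        rw [pow_two]
        refine Prod.ext (Equiv.ext fun y => neg_neg y) (Subtype.ext pauliX_mul_self)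
      refine isIsotropic_of_subgroup (K := Subgroup.zpowers x) (by simpa using hmem)
        (fun y hy h1 => ?_) (fun h hh h' hh' => ?_) ?_
      · have : y = 1 ∨ y = x := by
          obtain ⟨k, rfl⟩ := Subgroup.mem_zpowers_iff.1 hy
          rcases Int.even_or_odd' k with ⟨r, rfl | rfl⟩
          · left; rw [zpow_mul]; simp [hxx]
          · right; rw [zpow_add, zpow_mul]; simp [hxx]
        rcases this with rfl | rfl
        · exact ⟨1, by simp, by simp⟩
        · have h2 : -h₁ = h₁ := congrArg (fun l : Equiv.Perm (Fin 1 → ℤ) => l h₁) h1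
          exact absurd (congrArg M h2).symm hne
      · simp only [Finset.mem_insert, Finset.mem_singleton] at hh hh'
        have hx1 := Subgroup.mem_zpowers x
        rcases hh with rfl | rfl <;> rcases hh' with rfl | rfl
        · exact ⟨1, one_mem _, rfl⟩
        · exact ⟨x, hx1, rfl⟩
        · exact ⟨x, hx1, neg_neg _⟩
        · exact ⟨1, one_mem _, rfl⟩
      · intro p hp q hq hpq
        replace hpq := hA0 _ _ hpq
        simp only [Finset.coe_insert, Finset.coe_singleton, Set.mem_insert_iff,
          Set.mem_singleton_iff] at hp hq
        rcases hp with rfl | rfl <;> rcases hq with rfl | rfl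
        exacts [rfl, absurd hpq hne, absurd hpq.symm hne, rfl]

end RankOne

/-! ### Sufficiency in rank two -/

section RankTwo

theorem single_mul_single_neg {G : Type*} [AddCommGroup G] (h : G) (c c' : ℂ) :
    AddMonoidAlgebra.single h c * AddMonoidAlgebra.single (-h) c' =
      algebraMap ℂ (AddMonoidAlgebra ℂ G) (c * c') := by
  rw [AddMonoidAlgebra.single_mul_single, add_neg_cancel, Algebra.algebraMap_eq_smul_one,
    AddMonoidAlgebra.one_def, AddMonoidAlgebra.smul_single, smul_eq_mul, mul_one]

theorem isConvUnitary_of_rank_two {G : Type*} [AddCommGroup G] [DecidableEq G]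
    {M : G → Matrix (Fin 2) (Fin 2) ℂ} {h₁ h₂ : G}
    (hinj : Function.Injective ![0, h₁, -h₁, h₂, -h₂])
    (e1 : M h₁ = (1 / 2 : ℂ) • !![1, 0; 1, 0]) (e2 : M (-h₁) = (1 / 2 : ℂ) • !![0, -1; 0, 1])
    (e3 : M h₂ = (1 / 2 : ℂ) • !![0, 1; 0, 1]) (e4 : M (-h₂) = (1 / 2 : ℂ) • !![1, 0; -1, 0])
    (e0 : M 0 = 0) :
    IsConvUnitary (Finset.univ.image ![0, h₁, -h₁, h₂, -h₂]) M := by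
  rw [isConvUnitary_iff]
  ext1 i j
  rw [Matrix.mul_apply]
  simp only [symbol_image hinj, symbolAdj_image hinj, Fin.sum_univ_succ, Fin.sum_univ_zero]
  fin_cases i <;> fin_cases j <;> simp [e1, e2, e3, e4, e0, AddMonoidAlgebra.single_mul_single]
  all_goals
    have k1 := single_mul_single_neg h₁ (2⁻¹ : ℂ) 2⁻¹
    have k2 := single_mul_single_neg h₂ (2⁻¹ : ℂ) 2⁻¹
    have k : algebraMap ℂ (AddMonoidAlgebra ℂ G) (2⁻¹ * 2⁻¹) * 4 = 1 := by
      rw [← map_ofNat (algebraMap ℂ (AddMonoidAlgebra ℂ G)), ← map_mul,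
        show (2⁻¹ * 2⁻¹ * 4 : ℂ) = 1 by norm_num, map_one]
    generalize AddMonoidAlgebra.single h₁ (2⁻¹ : ℂ) = a at *
    generalize AddMonoidAlgebra.single h₂ (2⁻¹ : ℂ) = b at *
    generalize AddMonoidAlgebra.single (-h₁) (2⁻¹ : ℂ) = c at *
    generalize AddMonoidAlgebra.single (-h₂) (2⁻¹ : ℂ) = d at *
  · linear_combination 2 * k1 + 2 * k2 + k
  · ring
  · ring
  · linear_combination 2 * k1 + 2 * k2 + k

theorem isIsotropicQW_of_rank_two {Sp : Finset (Fin 2 → ℤ)}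
    {M : (Fin 2 → ℤ) → Matrix (Fin 2) (Fin 2) ℂ} {V : Matrix (Fin 2) (Fin 2) ℂ}
    {h₁ h₂ : Fin 2 → ℤ} (hV : V ∈ Matrix.unitaryGroup (Fin 2) ℂ)
    (hcl : AddSubgroup.closure {h₁, h₂} = ⊤)
    (hSp : (Sp = {h₁, h₂} ∧ Commute V pauliX) ∨ (Sp = {h₁, -h₂} ∧ Commute V pauliZ) ∨
        (Sp = {h₁, h₂, -h₁, -h₂} ∧ ∃ c : ℂ, ‖c‖ = 1 ∧ V = c • 1))
    (e1 : M h₁ = (1 / 2 : ℂ) • !![1, 0; 1, 0]) (e2 : M (-h₁) = (1 / 2 : ℂ) • !![0, -1; 0, 1])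
    (e3 : M h₂ = (1 / 2 : ℂ) • !![0, 1; 0, 1]) (e4 : M (-h₂) = (1 / 2 : ℂ) • !![1, 0; -1, 0])
    (e0 : M 0 = 0) (hz : ∀ g, g ≠ h₁ → g ≠ -h₁ → g ≠ h₂ → g ≠ -h₂ → M g = 0) :
    IsIsotropicQW Sp fun g => V * M g := by
  have hV1 := conjTranspose_mul_self_of_mem hV
  have hr : ∀ x y : Fin 2 → ℤ, Set.range ![x, y] = {x, y} := fun x y => by
    simp [Set.pair_comm]
  have hcl1 : AddSubgroup.closure {h₂, h₁} = ⊤ := by rw [Set.pair_comm, hcl]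
  have hcl2 : AddSubgroup.closure {-h₂, -h₁} = ⊤ := by
    rw [← hcl1, ← AddSubgroup.closure_neg]; simp [Set.pair_comm]
  obtain ⟨φ, hφ⟩ := exists_coordinates ![h₁, h₂] (by rw [hr, hcl]) (by simp)
  obtain ⟨a, ha⟩ := exists_addEquiv_of_bases (h := ![h₁, h₂]) (k := ![h₂, h₁]) (by rw [hr, hcl])
    (by rw [hr, hcl1]) (by simp)
  obtain ⟨b, hb⟩ := exists_addEquiv_of_bases (h := ![h₁, h₂]) (k := ![-h₂, -h₁]) (by rw [hr, hcl])
    (by rw [hr, hcl2]) (by simp)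
  simp only [Fin.forall_fin_two, Matrix.cons_val_zero, Matrix.cons_val_one] at ha hb hφ
  have hinj : Function.Injective ![0, h₁, -h₁, h₂, -h₂] := by
    refine Function.Injective.of_comp (f := φ) ?_
    have : φ ∘ ![0, h₁, -h₁, h₂, -h₂] = ![0, Pi.single 0 1, -Pi.single 0 1, Pi.single 1 1,
        -Pi.single 1 1] := by
      ext1 i; fin_cases i <;> simp [hφ]
    rw [this]
    decide
  have hnb : ∀ x, x ∈ neighbours Sp ↔ x = h₁ ∨ x = -h₁ ∨ x = h₂ ∨ x = -h₂ := by
    intro x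
    rw [mem_neighbours]
    rcases hSp with ⟨rfl, -⟩ | ⟨rfl, -⟩ | ⟨rfl, -⟩ <;>
    · simp only [Finset.mem_insert, Finset.mem_singleton, neg_eq_iff_eq_neg, neg_neg]
      tauto
  have hsub : ∀ h ∈ Sp, h = h₁ ∨ h = -h₁ ∨ h = h₂ ∨ h = -h₂ := fun h hh =>
    (hnb h).1 (mem_neighbours.2 (Or.inl hh))
  have hgen : AddSubgroup.closure (Sp : Set (Fin 2 → ℤ)) = ⊤ := by
    rw [eq_top_iff, ← hcl, AddSubgroup.closure_le, Set.insert_subset_iff, Set.singleton_subset_iff]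
    have key : ∀ x ∈ neighbours Sp, x ∈ AddSubgroup.closure (Sp : Set (Fin 2 → ℤ)) := fun x hx => by
      rcases mem_neighbours.1 hx with hx | hx
      · exact AddSubgroup.subset_closure hx
      · exact neg_mem_iff.1 (AddSubgroup.subset_closure hx)
    exact ⟨key _ ((hnb _).2 (by simp)), key _ ((hnb _).2 (by simp))⟩
  have mA : (∀ h ∈ Sp, a h ∈ Sp) → Commute V pauliX →
      ((a.toEquiv, ⟨pauliX, pauliX_mem⟩) : Equiv.Perm _ × _) ∈ covarianceGroup Sp fun g => V * M g := by
    refine fun hcol hVX => mem_covarianceGroup_of_commute pauliX_mem hVX hcol (by simp [e0]) ?_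
    intro h hh
    rcases hsub h hh with rfl | rfl | rfl | rfl <;>
    · simp only [map_neg, ha, neg_neg, e1, e2, e3, e4, pauliX_conjTranspose, Matrix.mul_smul,
        Matrix.smul_mul]
      constructor <;> congr 1 <;> ext i j <;> fin_cases i <;> fin_cases j <;>
        simp [pauliX, Matrix.mul_apply, Fin.sum_univ_two]
  have mB : (∀ h ∈ Sp, b h ∈ Sp) → Commute V pauliZ →
      ((b.toEquiv, ⟨pauliZ, pauliZ_mem⟩) : Equiv.Perm _ × _) ∈ covarianceGroup Sp fun g => V * M g := by
    refine fun hcol hVX => mem_covarianceGroup_of_commute pauliZ_mem hVX hcol (by simp [e0]) ?_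
    intro h hh
    rcases hsub h hh with rfl | rfl | rfl | rfl <;>
    · simp only [map_neg, hb, neg_neg, e1, e2, e3, e4, pauliZ_conjTranspose, Matrix.mul_smul,
        Matrix.smul_mul]
      constructor <;> congr 1 <;> ext i j <;> fin_cases i <;> fin_cases j <;>
        simp [pauliZ, Matrix.mul_apply, Fin.sum_univ_two]
  have hA0 : ∀ X Y, V * X = V * Y → X = Y := fun X Y h => by
    rw [← Matrix.one_mul X, ← hV1, Matrix.mul_assoc, h, ← Matrix.mul_assoc, hV1, Matrix.one_mul]
  refine ⟨isQuantumWalk_of_family hinj rfl hgen (fun x => ?_) (fun i h0 => ?_) (fun g hg => ?_)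
    ((isConvUnitary_of_rank_two hinj e1 e2 e3 e4 e0).mul_left hV),
    isIsotropic_of_irreducible (p := h₁) (q := h₂) (h₀ := h₁) (k := 1 / 2)
      (mem_steps.2 (Or.inr ((hnb _).2 (by simp)))) (mem_steps.2 (Or.inr ((hnb _).2 (by simp))))
      (by norm_num) ?_ ?_ ?_⟩
  · rw [hnb]; simp [Fin.exists_fin_succ]
  · replace h0 := hA0 _ 0 (h0.trans (Matrix.mul_zero V).symm)
    have h1 := congrFun (congrFun h0 1) 
    have h2 := h1 0
    have h3 := h1 1
    fin_cases i <;> simp [e1, e2, e3, e4] at h2 h3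
  · rw [hz g (hg 1) (hg 2) (hg 3) (hg 4), Matrix.mul_zero]
  · rw [Matrix.conjTranspose_mul, Matrix.mul_assoc, ← Matrix.mul_assoc Vᴴ, hV1, Matrix.one_mul, e1, e3]
    ext i j
    fin_cases i <;> fin_cases j <;> simp [Matrix.mul_apply, Fin.sum_univ_two]
    rw [map_ofNat]; norm_num
  · rcases hSp with ⟨rfl, hX⟩ | ⟨rfl, hZ⟩ | ⟨rfl, c, -, rfl⟩
    · intro h hh
      simp only [Finset.mem_insert, Finset.mem_singleton] at hh
      rcases hh with rfl | rfl
      · exact ⟨1, one_mem _, rfl⟩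
      · exact ⟨_, mA (by simp [ha]) hX, ha.1⟩
    · intro h hh
      simp only [Finset.mem_insert, Finset.mem_singleton] at hh
      rcases hh with rfl | rfl
      · exact ⟨1, one_mem _, rfl⟩
      · exact ⟨_, mB (by simp [hb]) hZ, hb.1⟩
    · have hA' := mA (by simp [ha]) ((Commute.one_left _).smul_left c)
      have hB' := mB (by simp [hb]) ((Commute.one_left _).smul_left c)
      intro h hh
      simp only [Finset.mem_insert, Finset.mem_singleton] at hh
      rcases hh with rfl | rfl | rfl | rfl
      · exact ⟨1, one_mem _, rfl⟩
      · exact ⟨_, hA', ha.1⟩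
      · exact ⟨_, mul_mem hA' hB', (congrArg a hb.1).trans (by rw [map_neg, ha.2])⟩
      · exact ⟨_, hB', hb.1⟩
  · intro x hx y hy hxy
    have h1 := congrFun (hA0 _ _ hxy)
    have h2 := congrFun (h1 0)
    have h3 := h2 0
    have h4 := h2 1
    have h5 := congrFun (h1 1) 0
    rcases hsub x hx with rfl | rfl | rfl | rfl <;> rcases hsub y hy with rfl | rfl | rfl | rfl <;>
      first
        | rfl
        | (exfalso; norm_num [e1, e2, e3, e4] at h3; done)
        | (exfalso; norm_num [e1, e2, e3, e4] at h4; done)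
        | (exfalso; norm_num [e1, e2, e3, e4] at h5)

end RankTwo

/-! ### Sufficiency in rank three -/

section RankThree

theorem isConvUnitary_of_weyl {G : Type*} [AddCommGroup G] [DecidableEq G]
    {M : G → Matrix (Fin 2) (Fin 2) ℂ} {h : Fin 4 → G} {η : ℂ}
    (hsum : h 0 + h 1 + h 2 + h 3 = 0)
    (hinj : Function.Injective ![0, h 0, -h 0, h 1, -h 1, h 2, -h 2, h 3, -h 3])
    (hη : 8 * (η * star η) = 1) (hη2 : η * η + star η * star η = 0)
    (e : ∀ i, M (h i) = weylPos η i ∧ M (-h i) = weylNeg (star η) i) (e0 : M 0 = 0) :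
    IsConvUnitary (Finset.univ.image ![0, h 0, -h 0, h 1, -h 1, h 2, -h 2, h 3, -h 3]) M := by
  rw [isConvUnitary_iff]
  have hs : star (star η) = η := star_star η
  have k0 := single_mul_single_neg (h 0) η (star η)
  have k1 := single_mul_single_neg (h 1) η (star η)
  have k2 := single_mul_single_neg (h 2) η (star η)
  have k3 := single_mul_single_neg (h 3) η (star η)
  have k : algebraMap ℂ (AddMonoidAlgebra ℂ G) (η * star η) * 8 = 1 := by
    rw [← map_ofNat (algebraMap ℂ (AddMonoidAlgebra ℂ G)), ← map_mul, mul_comm, hη, map_one]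
  -- The element `a + b = -c - d` receives contributions from both pairs, and these cancel because
  -- `η² + conj η² = 0`.
  have cross : ∀ a b c d : G, a + b + c + d = 0 →
      AddMonoidAlgebra.single a η * AddMonoidAlgebra.single b η +
        AddMonoidAlgebra.single (-c) (star η) * AddMonoidAlgebra.single (-d) (star η) = 0 := by
    intro a b c d hd
    rw [AddMonoidAlgebra.single_mul_single, AddMonoidAlgebra.single_mul_single,
      show -c + -d = a + b by rw [← neg_add, neg_eq_iff_add_eq_zero, ← hd]; abel,
      ← AddMonoidAlgebra.single_add, hη2, AddMonoidAlgebra.single_zero]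
  have c2 := cross (h 0) (h 2) (h 1) (h 3) (by rw [← hsum]; abel)
  have c5 := cross (h 1) (h 3) (h 0) (h 2) (by rw [← hsum]; abel)
  have hsη : starRingEnd ℂ η = star η := rfl
  generalize star η = η' at *
  ext1 i j
  rw [Matrix.mul_apply]
  simp only [symbol_image hinj, symbolAdj_image hinj, Fin.sum_univ_succ, Fin.sum_univ_zero]
  fin_cases i <;> fin_cases j <;> simp [(e 0).1, (e 0).2, (e 1).1, (e 1).2, (e 2).1, (e 2).2,
    (e 3).1, (e 3).2, e0, weylPos, weylNeg, hs, hsη]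
  · linear_combination 2 * (k0 + k1 + k2 + k3) + 2 * c2 + 2 * c5 + k
  · ring
  · ring
  · linear_combination 2 * (k0 + k1 + k2 + k3) + 2 * c2 + 2 * c5 + k

theorem closure_range_of_add_eq_zero {G : Type*} [AddCommGroup G] {h : Fin 4 → G}
    (hcl : AddSubgroup.closure (Set.range h) = ⊤) (p q r s : Fin 4)
    (hs : h p + h q + h r + h s = 0) (hi : ∀ i, i = p ∨ i = q ∨ i = r ∨ i = s) :
    AddSubgroup.closure (Set.range ![h p, h q, h r]) = ⊤ := by
  rw [eq_top_iff, ← hcl, AddSubgroup.closure_le]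
  have hm : ∀ i, ![h p, h q, h r] i ∈ AddSubgroup.closure (Set.range ![h p, h q, h r]) :=
    fun i => AddSubgroup.subset_closure (Set.mem_range_self i)
  rintro _ ⟨i, rfl⟩
  rcases hi i with rfl | rfl | rfl | rfl
  · exact hm 0
  · exact hm 1
  · exact hm 2
  · rw [← neg_eq_of_add_eq_zero_right hs]
    exact neg_mem (add_mem (add_mem (hm 0) (hm 1)) (hm 2))

theorem isIsotropicQW_of_weyl {Sp : Finset (Fin 3 → ℤ)}
    {M : (Fin 3 → ℤ) → Matrix (Fin 2) (Fin 2) ℂ} {c η : ℂ} {h : Fin 4 → Fin 3 → ℤ} (hc : ‖c‖ = 1)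
    (hL : IsBccLabelling Sp h) (hη : 8 * (η * star η) = 1) (hη2 : η * η + star η * star η = 0)
    (hM : IsWeylWalk η (star η) h M) :
    IsIsotropicQW Sp fun g => (c • (1 : Matrix (Fin 2) (Fin 2) ℂ)) * M g := by
  obtain ⟨hcl, hsum, hSp⟩ := hL
  obtain ⟨e, hz⟩ := hM
  have h3 : h 3 = -(h 0 + h 1 + h 2) := (neg_eq_of_add_eq_zero_right hsum).symm
  have hη0 : η ≠ 0 := by rintro rfl; simp at hη
  have hV : c • (1 : Matrix (Fin 2) (Fin 2) ℂ) ∈ Matrix.unitaryGroup (Fin 2) ℂ := by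
    rw [Matrix.mem_unitaryGroup_iff, star_smul, star_one, Matrix.smul_mul, Matrix.one_mul, smul_smul]
    have : c * star c = 1 := by
      rw [Complex.star_def, Complex.mul_conj, Complex.normSq_eq_norm_sq, hc]; simp
    rw [this, one_smul]
  have hVc : ∀ P, Commute (c • (1 : Matrix (Fin 2) (Fin 2) ℂ)) P := fun P =>
    (Commute.one_left _).smul_left c
  have hV1 := conjTranspose_mul_self_of_mem hV
  have hA0 : ∀ X Y, c • (1 : Matrix (Fin 2) (Fin 2) ℂ) * X = c • (1 : Matrix (Fin 2) (Fin 2) ℂ) * Y →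
      X = Y := fun X Y h => by
    rw [← Matrix.one_mul X, ← hV1, Matrix.mul_assoc, h, ← Matrix.mul_assoc, hV1, Matrix.one_mul]
  have hcl' := closure_range_of_add_eq_zero hcl
  obtain ⟨φ, hφ⟩ := exists_coordinates _ (hcl' 0 1 2 3 hsum (by decide)) (by simp)
  -- The automorphisms `a` and `b` are the double transpositions `(0 1)(2 3)` and `(0 3)(1 2)` of
  -- the labels, covered by `pauliX` and `pauliZ`.
  obtain ⟨a, ha⟩ := exists_addEquiv_of_bases (hcl' 0 1 2 3 hsum (by decide))
    (hcl' 1 0 3 2 (by rw [← hsum]; abel) (by decide)) (by simp)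
  obtain ⟨b, hb⟩ := exists_addEquiv_of_bases (hcl' 0 1 2 3 hsum (by decide))
    (hcl' 3 2 1 0 (by rw [← hsum]; abel) (by decide)) (by simp)
  simp only [Fin.forall_fin_succ, Matrix.cons_val_zero, Matrix.cons_val_succ, Fin.succ_zero_eq_one,
    Fin.succ_one_eq_two, IsEmpty.forall_iff, and_true] at ha hb hφ
  have ha3 : a (h 3) = h 2 := by
    rw [h3, map_neg, map_add, map_add, ha.1, ha.2.1, ha.2.2, neg_eq_iff_add_eq_zero, ← hsum]; abel
  have hb3 : b (h 3) = h 0 := by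
    rw [h3, map_neg, map_add, map_add, hb.1, hb.2.1, hb.2.2, neg_eq_iff_add_eq_zero, ← hsum]; abel
  have hinj : Function.Injective ![0, h 0, -h 0, h 1, -h 1, h 2, -h 2, h 3, -h 3] := by
    refine Function.Injective.of_comp (f := φ) ?_
    have : φ ∘ ![0, h 0, -h 0, h 1, -h 1, h 2, -h 2, h 3, -h 3] = ![0, ![1, 0, 0], ![-1, 0, 0],
        ![0, 1, 0], ![0, -1, 0], ![0, 0, 1], ![0, 0, -1], ![-1, -1, -1], ![1, 1, 1]] := by
      ext i j; fin_cases i <;> fin_cases j <;> simp [hφ, h3]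
    rw [this]
    decide
  have hmem : ∀ i, h i ∈ Sp := fun i => hSp ▸ Finset.mem_image_of_mem _ (Finset.mem_univ i)
  have hsub : ∀ x ∈ Sp, ∃ i, h i = x := fun x hx => by
    rw [hSp, Finset.mem_image] at hx
    obtain ⟨i, -, hi⟩ := hx
    exact ⟨i, hi⟩
  have hst : ∀ i, h i ∈ steps Sp := fun i => mem_steps.2 (Or.inr (mem_neighbours.2 (Or.inl (hmem i))))
  have hnb : ∀ x, x ∈ neighbours Sp ↔ ∃ i, x = h i ∨ x = -h i := by
    intro x
    rw [mem_neighbours]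
    constructor
    · rintro (hx | hx) <;> obtain ⟨i, hi⟩ := hsub _ hx
      exacts [⟨i, Or.inl hi.symm⟩, ⟨i, Or.inr (by rw [hi, neg_neg])⟩]
    · rintro ⟨i, rfl | rfl⟩
      exacts [Or.inl (hmem i), Or.inr (by rw [neg_neg]; exact hmem i)]
  have hgen : AddSubgroup.closure (Sp : Set (Fin 3 → ℤ)) = ⊤ := by rw [← hcl, hSp]; simp
  have e0 : M 0 = 0 := hz 0 fun i => by
    fin_cases i
    exacts [⟨hinj.ne (show (0 : Fin 9) ≠ 1 by decide), hinj.ne (show (0 : Fin 9) ≠ 2 by decide)⟩,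
      ⟨hinj.ne (show (0 : Fin 9) ≠ 3 by decide), hinj.ne (show (0 : Fin 9) ≠ 4 by decide)⟩,
      ⟨hinj.ne (show (0 : Fin 9) ≠ 5 by decide), hinj.ne (show (0 : Fin 9) ≠ 6 by decide)⟩,
      ⟨hinj.ne (show (0 : Fin 9) ≠ 7 by decide), hinj.ne (show (0 : Fin 9) ≠ 8 by decide)⟩]
  have mA : ((a.toEquiv, ⟨pauliX, pauliX_mem⟩) : Equiv.Perm _ × _) ∈
      covarianceGroup Sp fun g => c • (1 : Matrix (Fin 2) (Fin 2) ℂ) * M g := by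
    refine mem_covarianceGroup_of_commute pauliX_mem (hVc _) (fun x hx => ?_) (by simp [e0]) ?_
    · obtain ⟨i, rfl⟩ := hsub x hx
      fin_cases i <;> simp [ha, ha3, hmem]
    · intro x hx
      obtain ⟨i, rfl⟩ := hsub x hx
      fin_cases i <;> simp only [Fin.zero_eta, Fin.mk_one, Fin.reduceFinMk, ha, ha3, (e _).1, (e _).2,
        pauliX_conjTranspose] <;>
      constructor <;> ext i j <;> fin_cases i <;> fin_cases j <;>
        simp [pauliX, weylPos, weylNeg, Matrix.mul_apply, Fin.sum_univ_two]
  have mB : ((b.toEquiv, ⟨pauliZ, pauliZ_mem⟩) : Equiv.Perm _ × _) ∈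
      covarianceGroup Sp fun g => c • (1 : Matrix (Fin 2) (Fin 2) ℂ) * M g := by
    refine mem_covarianceGroup_of_commute pauliZ_mem (hVc _) (fun x hx => ?_) (by simp [e0]) ?_
    · obtain ⟨i, rfl⟩ := hsub x hx
      fin_cases i <;> simp [hb, hb3, hmem]
    · intro x hx
      obtain ⟨i, rfl⟩ := hsub x hx
      fin_cases i <;> simp only [Fin.zero_eta, Fin.mk_one, Fin.reduceFinMk, hb, hb3, (e _).1, (e _).2,
        pauliZ_conjTranspose] <;>
      constructor <;> ext i j <;> fin_cases i <;> fin_cases j <;>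
        simp [pauliZ, weylPos, weylNeg, Matrix.mul_apply, Fin.sum_univ_two]
  refine ⟨isQuantumWalk_of_family hinj rfl hgen (fun x => ?_) (fun i h0 => ?_) (fun g hg => ?_)
    ((isConvUnitary_of_weyl hsum hinj hη hη2 e e0).mul_left hV),
    isIsotropic_of_irreducible (h₀ := h 0) (k := 2 * (η * star η)) (hst 0) (hst 1) ?_ ?_ ?_ ?_⟩
  · rw [hnb]; simp [Fin.exists_fin_succ, or_assoc]
  · replace h0 := hA0 _ 0 (h0.trans (Matrix.mul_zero _).symm)
    have h2 := congrFun (congrFun h0 1) 0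
    have h3 := congrFun (congrFun h0 1) 1
    fin_cases i <;> simp [(e _).1, (e _).2, weylPos, weylNeg, hη0] at h2 h3
  · rw [hz g fun i => ?_, Matrix.mul_zero]
    fin_cases i
    exacts [⟨hg 1, hg 2⟩, ⟨hg 3, hg 4⟩, ⟨hg 5, hg 6⟩, ⟨hg 7, hg 8⟩]
  · simp [hη0]
  · rw [Matrix.conjTranspose_mul, Matrix.mul_assoc, ← Matrix.mul_assoc _ _ (M (h 1)), hV1,
      Matrix.one_mul, (e 0).1, (e 1).1]
    ext i j
    fin_cases i <;> fin_cases j <;> simp [weylPos, Matrix.mul_apply, Fin.sum_univ_two]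
    ring
  · intro x hx
    obtain ⟨i, rfl⟩ := hsub x hx
    fin_cases i
    · exact ⟨1, one_mem _, rfl⟩
    · exact ⟨_, mA, ha.1⟩
    · exact ⟨_, mul_mem mA mB, (congrArg a hb.1).trans ha3⟩
    · exact ⟨_, mB, hb.1⟩
  · intro x hx y hy hxy
    obtain ⟨i, rfl⟩ := hsub x hx
    obtain ⟨j, rfl⟩ := hsub y hy
    have h1 := congrFun (hA0 _ _ hxy)
    rw [(e i).1, (e j).1] at h1
    have h2 := congrFun (h1 0) 0
    have h3 := congrFun (h1 0) 1
    have h4 := congrFun (h1 1) 0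
    fin_cases i <;> fin_cases j <;>
      first
        | rfl
        | (exfalso; simp [weylPos, hη0, self_eq_neg, neg_eq_self] at h2 h3 h4)

end RankThree

/-! ### Identification of the Cayley graphs -/

section Lattices

theorem cayleyGraph_adj {G : Type*} [AddCommGroup G] [DecidableEq G] {Sp : Finset G}
    (h0 : (0 : G) ∉ Sp) {x y : G} : (cayleyGraph Sp).Adj x y ↔ y - x ∈ neighbours Sp := by
  rw [mem_neighbours, neg_sub]
  refine ⟨fun h => h.2, fun h => ⟨?_, h⟩⟩
  rintro rfl
  simp [h0] at h

theorem sameLattice_of_rank_one {Sp : Finset (Fin 1 → ℤ)} {h₁ : Fin 1 → ℤ} (h0 : 0 ∉ Sp)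
    (hcl : AddSubgroup.closure {h₁} = ⊤) (hSp : Sp = {h₁} ∨ Sp = {h₁, -h₁}) :
    SameLattice (cayleyGraph Sp) (hypercubicGraph 1) := by
  obtain ⟨φ, hφ⟩ := exists_coordinates ![h₁] (by simpa using hcl) (by simp)
  replace hφ := hφ 0
  simp only [Matrix.cons_val_zero] at hφ
  refine ⟨φ, fun x y => ?_⟩
  have hnb : y - x ∈ neighbours Sp ↔ y - x = h₁ ∨ y - x = -h₁ := by
    rw [mem_neighbours]
    rcases hSp with rfl | rfl
    · simp only [Finset.mem_singleton, neg_eq_iff_eq_neg]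
    · simp only [Finset.mem_insert, Finset.mem_singleton, neg_eq_iff_eq_neg, neg_neg]
      tauto
  rw [cayleyGraph_adj h0, hnb, ← φ.injective.eq_iff, ← φ.injective.eq_iff (b := -h₁), map_sub,
    map_neg, hφ]
  simp only [hypercubicGraph, funext_iff, Fin.forall_fin_one, Fin.sum_univ_one, Pi.sub_apply,
    Pi.neg_apply, Pi.single_apply]
  simp
  rcases abs_cases (φ x 0 - φ y 0) with h | h <;> omega

theorem sameLattice_of_rank_two {Sp : Finset (Fin 2 → ℤ)} {h₁ h₂ : Fin 2 → ℤ} (h0 : 0 ∉ Sp)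
    (hcl : AddSubgroup.closure {h₁, h₂} = ⊤)
    (hSp : Sp = {h₁, h₂} ∨ Sp = {h₁, -h₂} ∨ Sp = {h₁, h₂, -h₁, -h₂}) :
    SameLattice (cayleyGraph Sp) (hypercubicGraph 2) := by
  obtain ⟨φ, hφ⟩ := exists_coordinates ![h₁, h₂] (by
    rw [← hcl]; congr 1; simp [Set.pair_comm]) (by simp)
  simp only [Fin.forall_fin_two, Matrix.cons_val_zero, Matrix.cons_val_one] at hφ
  refine ⟨φ, fun x y => ?_⟩
  have hnb : y - x ∈ neighbours Sp ↔ y - x = h₁ ∨ y - x = -h₁ ∨ y - x = h₂ ∨ y - x = -h₂ := by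
    rw [mem_neighbours]
    rcases hSp with rfl | rfl | rfl <;>
    · simp only [Finset.mem_insert, Finset.mem_singleton, neg_eq_iff_eq_neg, neg_neg]
      tauto
  rw [cayleyGraph_adj h0, hnb]
  simp only [← φ.injective.eq_iff (a := y - x), map_sub, map_neg, hφ]
  simp only [hypercubicGraph, funext_iff, Fin.forall_fin_two, Fin.sum_univ_two, Pi.sub_apply,
    Pi.neg_apply, Pi.single_apply]
  simp
  rcases abs_cases (φ x 0 - φ y 0) with h | h <;> rcases abs_cases (φ x 1 - φ y 1) with h' | h' <;>
    omega

/-- Coordinates on the body-centred cubic lattice. -/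
def bccEquiv : (Fin 3 → ℤ) ≃+ bcc where
  toFun x := ⟨![x 0 + x 1 - x 2, x 0 - x 1 + x 2, x 0 - x 1 - x 2], fun i j => by
    fin_cases i <;> fin_cases j <;> simp [Int.ModEq] <;> omega⟩
  invFun x := ![(x.1 0 + x.1 1) / 2, (x.1 0 - x.1 2) / 2, (x.1 1 - x.1 2) / 2]
  left_inv x := by
    ext i
    fin_cases i <;> simp <;> omega
  right_inv x := by
    have h1 := x.2 0 1
    have h2 := x.2 0 2
    simp only [Int.ModEq] at h1 h2
    ext i
    fin_cases i <;> simp <;> omega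
  map_add' x y := by
    ext i
    fin_cases i <;> simp <;> ring

theorem sameLattice_of_bcc {Sp : Finset (Fin 3 → ℤ)} {h : Fin 4 → Fin 3 → ℤ} (h0 : 0 ∉ Sp)
    (hL : IsBccLabelling Sp h) : SameLattice (cayleyGraph Sp) bccGraph := by
  obtain ⟨hcl, hsum, hSp⟩ := hL
  have h3 : h 3 = -(h 0 + h 1 + h 2) := (neg_eq_of_add_eq_zero_right hsum).symm
  obtain ⟨φ, hφ⟩ := exists_coordinates ![h 0, h 1, h 2]
    (closure_range_of_add_eq_zero hcl 0 1 2 3 hsum (by decide)) (by simp)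
  simp only [Fin.forall_fin_succ, Matrix.cons_val_zero, Matrix.cons_val_succ, Fin.succ_zero_eq_one,
    Fin.succ_one_eq_two, IsEmpty.forall_iff, and_true] at hφ
  -- The generators go to `(1,1,1)`, `(1,-1,-1)`, `(-1,1,-1)`, `(-1,-1,1)`: alternate vertices of
  -- the cube, whose negatives are the other four.
  refine ⟨φ.trans bccEquiv, fun x y => ?_⟩
  have hnb : y - x ∈ neighbours Sp ↔ ∃ i, y - x = h i ∨ y - x = -h i := by
    rw [mem_neighbours, hSp]
    simp only [Finset.mem_image, Finset.mem_univ, true_and, ← exists_or]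
    refine exists_congr fun i => or_congr eq_comm ?_
    rw [eq_comm, neg_eq_iff_eq_neg]
  rw [cayleyGraph_adj h0, hnb]
  simp only [← φ.injective.eq_iff (a := y - x), map_sub, map_neg, map_add, Fin.exists_fin_succ,
    Fin.succ_zero_eq_one, Fin.succ_one_eq_two, Fin.reduceSucc, IsEmpty.exists_iff, hφ, h3]
  simp only [bccGraph, bccEquiv, funext_iff, Fin.forall_fin_succ]
  simp [abs_eq zero_le_one]
  constructor
  · rintro ⟨h1 | h1, h2 | h2, h3 | h3⟩
    · exact Or.inl (Or.inr (by omega))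
    · exact Or.inr (Or.inr (Or.inr (Or.inl (by omega))))
    · exact Or.inr (Or.inr (Or.inl (Or.inl (by omega))))
    · exact Or.inr (Or.inl (Or.inr (by omega)))
    · exact Or.inr (Or.inl (Or.inl (by omega)))
    · exact Or.inr (Or.inr (Or.inl (Or.inr (by omega))))
    · exact Or.inr (Or.inr (Or.inr (Or.inr (by omega))))
    · exact Or.inl (Or.inl (by omega))
  · rintro ((h | h) | (h | h) | (h | h) | h | h) <;> omega

end Lattices

/-! ### Inequivalence of the two Weyl walks -/

section Inequivalence

/-- The trace is `η` on generators and `conj η` on their negatives. An equivalence with phase `c`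
would give `η⁻ = c η⁺` and `η⁺ = c η⁻`, hence equal squares, but these are opposite and nonzero. -/
theorem IsWeylWalk.not_equivalent {Sp : Finset (Fin 3 → ℤ)} {h h' : Fin 4 → Fin 3 → ℤ}
    {B B' : (Fin 3 → ℤ) → Matrix (Fin 2) (Fin 2) ℂ} (hL : IsBccLabelling Sp h)
    (hL' : IsBccLabelling Sp h') (hB : IsWeylWalk etaPlus etaMinus h B)
    (hB' : IsWeylWalk etaMinus etaPlus h' B') : ¬ Equivalent Sp B B' := by
  rintro ⟨φ, W, c, hφ, -, hW⟩
  obtain ⟨j, hj⟩ : ∃ j, h' j = φ (h 0) := by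
    have : φ (h 0) ∈ Sp := by
      rw [← hφ, hL.2.2]
      exact Finset.mem_image_of_mem _ (Finset.mem_image_of_mem _ (Finset.mem_univ 0))
    rw [hL'.2.2, Finset.mem_image] at this
    obtain ⟨j, -, hj⟩ := this
    exact ⟨j, hj⟩
  have key : ∀ g, (B' (φ g)).trace = c * (B g).trace := fun g => by
    rw [hW, Matrix.trace_smul, trace_unitary_conj W.2, smul_eq_mul]
  have h1 := key (h 0)
  have h2 := key (-h 0)
  rw [← hj, (hB'.1 j).1, (hB.1 0).1] at h1
  rw [map_neg, ← hj, (hB'.1 j).2, (hB.1 0).2] at h2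
  have t1 : ∀ η i, (weylPos η i).trace = η := fun η i => by
    fin_cases i <;> simp [weylPos, Matrix.trace_fin_two]
  have t2 : ∀ η i, (weylNeg η i).trace = η := fun η i => by
    fin_cases i <;> simp [weylNeg, Matrix.trace_fin_two]
  rw [t1, t1] at h1
  rw [t2, t2] at h2
  have : etaMinus * etaMinus = etaPlus * etaPlus := by
    linear_combination etaMinus * h1 - etaPlus * h2
  have := congrArg Complex.im this
  norm_num [etaMinus, etaPlus] at this

end Inequivalence

end IsoQW

/-! ### The classification theorem -/

theorem mainTheorem1 :
    -- dimension one
    ((∀ (Sp : Finset (Fin 1 → ℤ)) (A : (Fin 1 → ℤ) → Matrix (Fin 2) (Fin 2) ℂ),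
        IsoQW.IsIsotropicQW Sp A →
          IsoQW.SameLattice (IsoQW.cayleyGraph Sp) (IsoQW.hypercubicGraph 1)) ∧
      ∀ (Sp : Finset (Fin 1 → ℤ)) (A : (Fin 1 → ℤ) → Matrix (Fin 2) (Fin 2) ℂ),
        IsoQW.IsIsotropicQW Sp A ↔
          ∃ (h₁ : Fin 1 → ℤ) (n m : ℝ) (V W : Matrix (Fin 2) (Fin 2) ℂ),
            AddSubgroup.closure {h₁} = ⊤ ∧ n ^ 2 + m ^ 2 = 1 ∧ n ≠ 0 ∧
            V ∈ Matrix.unitaryGroup (Fin 2) ℂ ∧ W ∈ Matrix.unitaryGroup (Fin 2) ℂ ∧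
            (Sp = {h₁} ∨ (Sp = {h₁, -h₁} ∧ Commute V IsoQW.pauliX)) ∧
            A h₁ = W * (V * !![(n : ℂ), 0; 0, 0]) * Wᴴ ∧
            A (-h₁) = W * (V * !![0, 0; 0, (n : ℂ)]) * Wᴴ ∧
            A 0 = W * (V * !![0, Complex.I * m; Complex.I * m, 0]) * Wᴴ ∧
            ∀ g, g ≠ h₁ → g ≠ -h₁ → g ≠ 0 → A g = 0) ∧
    -- dimension two
    ((∀ (Sp : Finset (Fin 2 → ℤ)) (A : (Fin 2 → ℤ) → Matrix (Fin 2) (Fin 2) ℂ),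
        IsoQW.IsIsotropicQW Sp A →
          IsoQW.SameLattice (IsoQW.cayleyGraph Sp) (IsoQW.hypercubicGraph 2)) ∧
      ∀ (Sp : Finset (Fin 2 → ℤ)) (A : (Fin 2 → ℤ) → Matrix (Fin 2) (Fin 2) ℂ),
        IsoQW.IsIsotropicQW Sp A ↔
          ∃ (h₁ h₂ : Fin 2 → ℤ) (V W : Matrix (Fin 2) (Fin 2) ℂ),
            AddSubgroup.closure {h₁, h₂} = ⊤ ∧
            V ∈ Matrix.unitaryGroup (Fin 2) ℂ ∧ W ∈ Matrix.unitaryGroup (Fin 2) ℂ ∧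
            ((Sp = {h₁, h₂} ∧ Commute V IsoQW.pauliX) ∨
              (Sp = {h₁, -h₂} ∧ Commute V IsoQW.pauliZ) ∨
              (Sp = {h₁, h₂, -h₁, -h₂} ∧ ∃ c : ℂ, ‖c‖ = 1 ∧ V = c • 1)) ∧
            A h₁ = W * ((1 / 2 : ℂ) • (V * !![1, 0; 1, 0])) * Wᴴ ∧
            A (-h₁) = W * ((1 / 2 : ℂ) • (V * !![0, -1; 0, 1])) * Wᴴ ∧
            A h₂ = W * ((1 / 2 : ℂ) • (V * !![0, 1; 0, 1])) * Wᴴ ∧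
            A (-h₂) = W * ((1 / 2 : ℂ) • (V * !![1, 0; -1, 0])) * Wᴴ ∧
            A 0 = 0 ∧
            ∀ g, g ≠ h₁ → g ≠ -h₁ → g ≠ h₂ → g ≠ -h₂ → A g = 0) ∧
    -- dimension three
    ((∀ (Sp : Finset (Fin 3 → ℤ)) (A : (Fin 3 → ℤ) → Matrix (Fin 2) (Fin 2) ℂ),
        IsoQW.IsIsotropicQW Sp A →
          IsoQW.SameLattice (IsoQW.cayleyGraph Sp) IsoQW.bccGraph) ∧
      (∀ (Sp : Finset (Fin 3 → ℤ)) (A : (Fin 3 → ℤ) → Matrix (Fin 2) (Fin 2) ℂ),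
        IsoQW.IsIsotropicQW Sp A ↔
          ∃ (h : Fin 4 → Fin 3 → ℤ) (B : (Fin 3 → ℤ) → Matrix (Fin 2) (Fin 2) ℂ)
            (W : Matrix (Fin 2) (Fin 2) ℂ) (c : ℂ),
            IsoQW.IsBccLabelling Sp h ∧
            (IsoQW.IsWeylWalk IsoQW.etaPlus IsoQW.etaMinus h B ∨
              IsoQW.IsWeylWalk IsoQW.etaMinus IsoQW.etaPlus h B) ∧
            W ∈ Matrix.unitaryGroup (Fin 2) ℂ ∧ ‖c‖ = 1 ∧
            ∀ g, A g = c • (W * B g * Wᴴ)) ∧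
      ∀ (Sp : Finset (Fin 3 → ℤ)) (h h' : Fin 4 → Fin 3 → ℤ)
        (B B' : (Fin 3 → ℤ) → Matrix (Fin 2) (Fin 2) ℂ),
        IsoQW.IsBccLabelling Sp h → IsoQW.IsBccLabelling Sp h' →
        IsoQW.IsWeylWalk IsoQW.etaPlus IsoQW.etaMinus h B →
        IsoQW.IsWeylWalk IsoQW.etaMinus IsoQW.etaPlus h' B' →
        ¬ IsoQW.Equivalent Sp B B') := by 
  refine ⟨⟨fun Sp A hQ => ?_, fun Sp A => ⟨fun hQ => hQ.form_one, ?_⟩⟩,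
    ⟨fun Sp A hQ => ?_, fun Sp A => ⟨fun hQ => hQ.form_two, ?_⟩⟩,
    ⟨fun Sp A hQ => ?_, fun Sp A => ⟨fun hQ => hQ.form_three, ?_⟩,
      fun Sp h h' B B' hL hL' hB hB' => hB.not_equivalent hL hL' hB'⟩⟩
  · obtain ⟨h, _, _, _, _, hcl, -, -, -, -, hSp, -⟩ := hQ.form_one
    exact IsoQW.sameLattice_of_rank_one hQ.1.zero_notMem hcl (hSp.imp_right And.left)
  · rintro ⟨h, n, m, V, W, hcl, hnm, hn, hV, hW, hSp, e1, e2, e3, hz⟩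
    obtain ⟨M, rfl⟩ := IsoQW.exists_eq_conj_mul hV hW A
    refine (IsoQW.isIsotropicQW_of_rank_one hV hcl hnm hn hSp (IsoQW.conj_mul_cancel hV hW e1)
      (IsoQW.conj_mul_cancel hV hW e2) (IsoQW.conj_mul_cancel hV hW e3) fun g h1 h2 h3 =>
        IsoQW.conj_mul_cancel hV hW ((hz g h1 h2 h3).trans ?_)).conj hW
    rw [Matrix.mul_zero, Matrix.mul_zero, Matrix.zero_mul]
  · obtain ⟨h₁, h₂, _, _, hcl, -, -, hSp, -⟩ := hQ.form_two
    exact IsoQW.sameLattice_of_rank_two hQ.1.zero_notMem hcl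
      (hSp.imp And.left (Or.imp And.left And.left))
  · rintro ⟨h₁, h₂, V, W, hcl, hV, hW, hSp, e1, e2, e3, e4, e0, hz⟩
    obtain ⟨M, rfl⟩ := IsoQW.exists_eq_conj_mul hV hW A
    have cancel : ∀ {X Y}, W * (V * X) * Wᴴ = W * ((1 / 2 : ℂ) • (V * Y)) * Wᴴ →
        X = (1 / 2 : ℂ) • Y := fun h => by
      rw [← Matrix.mul_smul V] at h
      exact IsoQW.conj_mul_cancel hV hW h
    have cancel0 : ∀ {X}, W * (V * X) * Wᴴ = 0 → X = 0 := fun h =>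
      IsoQW.conj_mul_cancel hV hW (by rw [h, Matrix.mul_zero, Matrix.mul_zero, Matrix.zero_mul])
    exact (IsoQW.isIsotropicQW_of_rank_two hV hcl hSp (cancel e1) (cancel e2) (cancel e3) (cancel e4)
      (cancel0 e0) fun g h1 h2 h3 h4 => cancel0 (hz g h1 h2 h3 h4)).conj hW
  · obtain ⟨h, _, _, _, hL, -⟩ := hQ.form_three
    exact IsoQW.sameLattice_of_bcc hQ.1.zero_notMem hL
  · rintro ⟨h, B, W, c, hL, hB, hW, hc, hA⟩
    have e : A = fun g => W * (c • (1 : Matrix (Fin 2) (Fin 2) ℂ) * B g) * Wᴴ := by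
      funext g
      rw [hA, Matrix.smul_mul, Matrix.one_mul, Matrix.mul_smul, Matrix.smul_mul]
    have s1 : star IsoQW.etaPlus = IsoQW.etaMinus ∧ star IsoQW.etaMinus = IsoQW.etaPlus := by
      constructor <;> apply Complex.ext <;> simp [IsoQW.etaPlus, IsoQW.etaMinus]
    have s2 : 8 * (IsoQW.etaPlus * IsoQW.etaMinus) = 1 := by
      rw [IsoQW.etaPlus, IsoQW.etaMinus]
      linear_combination (-1 / 2 : ℂ) * Complex.I_sq
    have s3 : IsoQW.etaPlus * IsoQW.etaPlus + IsoQW.etaMinus * IsoQW.etaMinus = 0 := by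
      rw [IsoQW.etaPlus, IsoQW.etaMinus]
      linear_combination (1 / 8 : ℂ) * Complex.I_sq
    rw [e]
    rcases hB with hB | hB
    · refine (IsoQW.isIsotropicQW_of_weyl hc hL ?_ ?_ (s1.1.symm ▸ hB)).conj hW
      · rw [s1.1, s2]
      · rw [s1.1, s3]
    · refine (IsoQW.isIsotropicQW_of_weyl hc hL ?_ ?_ (s1.2.symm ▸ hB)).conj hW
      · rw [s1.2, mul_comm IsoQW.etaMinus, s2]
      · rw [s1.2, add_comm, s3]
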